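/- **Conventions.** Let $g$ be a smooth Riemannian metric on an open subset $U$ of $\mathbb R^n$, let $R_{ijkl}$ be its curvature tensor, $Ric_{ik}=R_{ijkl}g^{jl}$, $R=g^{ik}Ric_{ik}$, and let $\psi_1,\dots,\psi_s,\Omega,\upsilon$ be smooth functions on $U$. A *contraction* is a formal tensor product of factors $\nabla^{(m)}R_{ijkl}$, $\nabla^{(m)}Ric_{ij}$, $\nabla^{(p)}\psi_h$, $\nabla^{(p)}\Omega$, $\nabla^{(p)}\upsilon$ with a pattern that contracts its indices in pairs by means of $g^{-1}$; it is complete if no index is free, and a vector field if exactly one is. Its length is its number of factors, and an internal contraction is a pair of contracted indices of the same factor. The weight is minus the sum of $m+2$ over the curvature and Ricci factors and of $p$ over the other factors. An equation *holds modulo length $\ge N$* if its two sides differ by a fixed finite linear combination of complete contractions with at least $N$ factors, which contain the same functions the same number of times as the equation does (with derivatives of any order), and this is so at every point, for all $U$ and $g$ in dimension $n$ and all functions. Fix $n,s,\tau,q,a\ge 0$. Call a complete contraction or vector field *admissible* if it is of the form $$contr(\nabla^{(m_1)}R_{ijkl}\otimes\dots\otimes\nabla^{(m_t)}R_{ijkl}\otimes\nabla^{(a_1)}\psi_1\otimes\dots\otimes\nabla^{(a_s)}\psi_s\otimes\nabla^{(p_1)}\Omega\otimes\dots\otimes\nabla^{(p_q)}\Omega\otimes\nabla\upsilon\otimes\dots\otimes\nabla\upsilon)$$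 with $a$ factors $\nabla\upsilon$, length $\tau+a$, no internal contractions, no two factors $\nabla\upsilon$ contracted against each other, no free index on a factor $\nabla\upsilon$, and $p\ge2$ for each factor $\nabla^{(p)}\psi_h$ or $\nabla^{(p)}\Omega$ that is not contracted against a factor $\nabla\upsilon$. For an admissible vector field $C^i$, $Xdiv_iC^i$ is the sum of those terms of $div_iC^i$ in which $\nabla_i$ hits neither the factor with the free index nor a factor $\nabla\upsilon$. For an admissible contraction $C$, $Riccify[C]$ is obtained as follows. If the indices $r_{a_1},\dots,r_{a_d}$ of a factor are those contracted against factors $\nabla\upsilon$, then $\nabla^{(m)}R_{ijkl}$ is replaced by $\nabla^{r_{a_1}\dots r_{a_d}}\nabla^{(m)}R_{ijkl}$, $\nabla^{(b)}\psi_h$ by $\nabla^{r_{a_1}\dots r_{a_d}}\nabla^{(b)}\psi_h$, and $\nabla^{(p)}_{r_1\dots r_p}\Omega$ with $p\ge2$ by $\nabla^{r_{a_1}\dots r_{a_d}}\nabla^{(p-2)}_{r_1\dots r_{p-2}}Ric_{r_{p-1}r_p}$; each expression $\nabla_i\Omega\nabla^i\upsilon$ is replaced by $\frac12R$; and the factors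 $\nabla\upsilon$ are erased. Call a complete contraction *normal* if it has length $\tau$ and its factors are of the forms $\nabla^{f_1\dots f_y}\nabla^{(m)}R_{ijkl}$, $\nabla^{f_1\dots f_y}\nabla^{(p)}Ric_{ij}$, $R$ and $\nabla^{f_1\dots f_y}\nabla^{(b)}\psi_h$ (exactly one for each $h=1,\dots,s$), where in each factor every index $f_1,\dots,f_y$ is contracted against one of the other indices of that factor and no two of these other indices are contracted against each other. The factors $R$ count as Ricci factors. Let $\delta=\delta_R+\delta_{Ric}+\delta_\psi$ be the total number of internal contractions, including the one in each $Ric_{ik}=R_{ijkl}g^{jl}$ itself (so a factor $R$ contributes $2$). **Lemma.** Let $C^l$, $l\in L$, be finitely many admissible complete contractions, of weight $\ge -n$, and let $C^{r,i}$, $r\in R$, be finitely many admissible vector fields, of weight $\ge -n+1$; let $a_l,a_r\in\mathbb R$. Assume that $$\sum_{l\in L}a_lC^l_g(\Omega^q,\psi^s,\upsilon^a)-Xdiv_i\sum_{r\in R}a_rC^{r,i}_g(\Omega^q,\psi^s,\upsilon^a)=0$$ modulo length $\ge\tau+a+1$. Then there are finite linear combinations of normal complete contractions such that, modulo length $\ge\tau+1$,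 $$\sum_{l\in L}a_lRiccify[C^l_g]-div_i\sum_{r\in R}a_rRiccify[C^{r,i}_g]=\sum_{d\in D^1}a_dC^d_g(\psi^s)+\sum_{d\in D^2}a_dC^d_g(\psi^s),$$ where each $C^d$ with $d\in D^1$ has fewer than $q$ Ricci factors and $\delta\ge a+q$, and each $C^d$ with $d\in D^2$ has exactly $q$ Ricci factors and $\delta\ge a+q+1$. -/

import Mathlib

open scoped ContDiff

namespace RicciInvariants

/-! Riemannian geometry in a coordinate domain `U ⊆ ℝⁿ`. -/

/-- Components of a covariant tensor field in coordinates, indexed by the list of its (lower)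
indices; the rank of a tensor is the length of the lists at which it is evaluated. -/
abbrev Tens (n : ℕ) : Type := (Fin n → ℝ) → List (Fin n) → ℝ

/-- The partial derivative `∂_i f`. -/
noncomputable def pd {n : ℕ} (i : Fin n) (f : (Fin n → ℝ) → ℝ) (x : Fin n → ℝ) : ℝ :=
  fderiv ℝ f x (Pi.single i 1)

/-- The Christoffel symbol `Γ^k_{ij}` of the metric `g`. -/
noncomputable def christoffel {n : ℕ} (g : (Fin n → ℝ) → Matrix (Fin n) (Fin n) ℝ)
    (x : Fin n → ℝ) (k i j : Fin n) : ℝ :=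
  (1 / 2) * ∑ l, (g x)⁻¹ k l *
    (pd i (fun y => g y j l) x + pd j (fun y => g y i l) x - pd l (fun y => g y i j) x)

/-- The Levi-Civita covariant derivative; the new index comes first:
`(∇T)_{i l₁ … l_r} = ∇_i T_{l₁ … l_r}`. -/
noncomputable def cov {n : ℕ} (g : (Fin n → ℝ) → Matrix (Fin n) (Fin n) ℝ) (T : Tens n) : Tens n
  | _, [] => 0
  | x, i :: l => pd i (fun y => T y l) x -
      ∑ p : Fin l.length, ∑ k, christoffel g x k i (l.get p) * T x (l.set p k)

/-- `∇^{(m)} T`. -/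
noncomputable def iterCov {n : ℕ} (g : (Fin n → ℝ) → Matrix (Fin n) (Fin n) ℝ) (m : ℕ)
    (T : Tens n) : Tens n :=
  (cov g)^[m] T

/-- The curvature tensor `R_{ijkl}`, with the convention
`(∇_i ∇_j - ∇_j ∇_i) X_l = R_{ijkl} X^k` for one-forms `X`. -/
noncomputable def riem {n : ℕ} (g : (Fin n → ℝ) → Matrix (Fin n) (Fin n) ℝ) : Tens n
  | x, [i, j, k, l] => - ∑ p, g x k p *
      (pd i (fun y => christoffel g y p j l) x - pd j (fun y => christoffel g y p i l) x
        + ∑ m, (christoffel g x p i m * christoffel g x m j l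
              - christoffel g x p j m * christoffel g x m i l))
  | _, _ => 0

/-- The Ricci tensor `Ric_{ik} = g^{jl} R_{ijkl}`. -/
noncomputable def ricci {n : ℕ} (g : (Fin n → ℝ) → Matrix (Fin n) (Fin n) ℝ) : Tens n
  | x, [i, k] => ∑ j, ∑ l, (g x)⁻¹ j l * riem g x [i, j, k, l]
  | _, _ => 0

/-- A function regarded as a tensor of rank zero. -/
def scalar {n : ℕ} (f : (Fin n → ℝ) → ℝ) : Tens n
  | x, [] => f x
  | _, _ => 0

/-- The divergence `∇^i X_i = g^{ij} ∇_i X_j` of a vector field given by its lowered components. -/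
noncomputable def divergence {n : ℕ} (g : (Fin n → ℝ) → Matrix (Fin n) (Fin n) ℝ)
    (X : (Fin n → ℝ) → Fin n → ℝ) (x : Fin n → ℝ) : ℝ :=
  ∑ i, ∑ j, (g x)⁻¹ i j * (pd i (fun y => X y j) x - ∑ k, christoffel g x k i j * X x k)

/-- A Riemannian metric on an open subset `U` of `ℝⁿ`, with smooth functions
`ψ_1, …, ψ_s, Ω, υ` on it. -/
structure Background (n s : ℕ) where
  U : Set (Fin n → ℝ)
  isOpen : IsOpen U
  g : (Fin n → ℝ) → Matrix (Fin n) (Fin n) ℝ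
  smooth_g : ∀ i j, ContDiffOn ℝ ∞ (fun x => g x i j) U
  posDef_g : ∀ x ∈ U, (g x).PosDef
  ψ : Fin s → (Fin n → ℝ) → ℝ
  smooth_ψ : ∀ h, ContDiffOn ℝ ∞ (ψ h) U
  Ω : (Fin n → ℝ) → ℝ
  smooth_Ω : ContDiffOn ℝ ∞ Ω U
  υ : (Fin n → ℝ) → ℝ
  smooth_υ : ContDiffOn ℝ ∞ υ U

/-! Formal contractions. -/

/-- The tensors whose iterated covariant derivatives are the factors of a contraction. -/
inductive Kind (s : ℕ) : Type
  | curv : Kind s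
  | ric : Kind s
  | psi (h : Fin s) : Kind s
  | omega : Kind s
  | ups : Kind s
  deriving DecidableEq

/-- The rank of the undifferentiated tensor. -/
def Kind.rank {s : ℕ} : Kind s → ℕ
  | .curv => 4
  | .ric => 2
  | .psi _ => 0
  | .omega => 0
  | .ups => 0

/-- Minus the weight of the undifferentiated tensor, after all its indices are contracted. -/
def Kind.weight {s : ℕ} : Kind s → ℕ
  | .curv => 2
  | .ric => 2
  | .psi _ => 0
  | .omega => 0
  | .ups => 0

/-- The undifferentiated tensor. -/
noncomputable def Background.base {n s : ℕ} (B : Background n s) : Kind s → Tens n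
  | .curv => riem B.g
  | .ric => ricci B.g
  | .psi h => scalar (B.ψ h)
  | .omega => scalar B.Ω
  | .ups => scalar B.υ

/-- The factor `∇^{(m)} T`, where `T` is the tensor of the given kind. -/
noncomputable def Background.factor {n s : ℕ} (B : Background n s) (κ : Kind s) (m : ℕ) : Tens n :=
  iterCov B.g m (B.base κ)

/-- A (formal) partial contraction with `f` free indices: factors `∇^{(ord i)} T_i`, `i ∈ ι`, and
a pattern that matches the index slots of the factors into `pairs` pairs of contracted slots and
`f` free ones. The slots of a factor are numbered from the left: first the `ord i` derivative
indices (the outermost derivative first), then the internal indices of `T_i`. -/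
structure Contraction (s f : ℕ) where
  ι : Type
  [fintype : Fintype ι]
  [decEq : DecidableEq ι]
  kind : ι → Kind s
  ord : ι → ℕ
  pairs : ℕ
  slot : (Fin pairs × Bool) ⊕ Fin f ≃ (Σ i : ι, Fin ((kind i).rank + ord i))

attribute [instance] Contraction.fintype Contraction.decEq

namespace Contraction

variable {s f n : ℕ}

/-- The number of factors. -/
def length (C : Contraction s f) : ℕ := Fintype.card C.ι

/-- The number of factors of a given kind. -/
def count (C : Contraction s f) (κ : Kind s) : ℕ := Fintype.card {i : C.ι // C.kind i = κ}

/-- Minus the weight: the number of derivatives, plus two for each curvature or Ricci factor. -/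
def weight (C : Contraction s f) : ℕ := ∑ i, (C.ord i + (C.kind i).weight)

/-- The factor to which one end of a contracted pair belongs. -/
def owner (C : Contraction s f) (j : Fin C.pairs) (b : Bool) : C.ι := (C.slot (.inl (j, b))).1

/-- The `j`-th pair is an internal contraction: both of its slots belong to the same factor. -/
def IsInternal (C : Contraction s f) (j : Fin C.pairs) : Prop := C.owner j false = C.owner j true

instance (C : Contraction s f) : DecidablePred C.IsInternal := fun j =>
  inferInstanceAs (Decidable (C.owner j false = C.owner j true))

/-- Two slots are contracted against each other. -/
def Paired (C : Contraction s f) (x y : Σ i : C.ι, Fin ((C.kind i).rank + C.ord i)) : Prop :=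
  ∃ (j : Fin C.pairs) (b : Bool), C.slot (.inl (j, b)) = x ∧ C.slot (.inl (j, !b)) = y

/-- The factor `i` is contracted against some factor `∇υ`. -/
def MeetsUps (C : Contraction s f) (i : C.ι) : Prop :=
  ∃ (j : Fin C.pairs) (b : Bool), C.owner j b = i ∧ C.kind (C.owner j (!b)) = .ups

/-- The list of the labels of the slots of the factor `i`, for a labelling of all slots. -/
def labels (C : Contraction s f) (lab : (Fin C.pairs × Bool) ⊕ Fin f → Fin n) (i : C.ι) :
    List (Fin n) :=
  List.ofFn fun k : Fin ((C.kind i).rank + C.ord i) => lab (C.slot.symm ⟨i, k⟩)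

/-- The list of the labels of those slots of factors `υ` which are contracted against slots of the
factor `i`, in the order of the latter. -/
def upsLabels (C : Contraction s f) (lab : (Fin C.pairs × Bool) ⊕ Fin f → Fin n) (i : C.ι) :
    List (Fin n) :=
  (List.finRange ((C.kind i).rank + C.ord i)).filterMap fun k =>
    match C.slot.symm ⟨i, k⟩ with
    | .inl (j, b) => if C.kind (C.owner j (!b)) = .ups then some (lab (.inl (j, !b))) else none
    | .inr _ => none

/-- Contraction of the product of the `T lab i`, `i ∈ ι`, according to the pattern of `C`:
the labels of the two slots of each contracted pair are summed against the inverse metric, and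
`β` labels the free slots. -/
noncomputable def contract (C : Contraction s f) (B : Background n s) (x : Fin n → ℝ)
    (β : Fin f → Fin n) (T : ((Fin C.pairs × Bool) ⊕ Fin f → Fin n) → C.ι → ℝ) : ℝ :=
  ∑ α : Fin C.pairs × Bool → Fin n,
    (∏ j, (B.g x)⁻¹ (α (j, false)) (α (j, true))) * ∏ i, T (Sum.elim α β) i

/-- The value of the contraction at `x`; `β` gives the values of the free (lower) indices. -/
noncomputable def value (C : Contraction s f) (B : Background n s) (x : Fin n → ℝ)
    (β : Fin f → Fin n) : ℝ :=
  C.contract B x β fun lab i => B.factor (C.kind i) (C.ord i) x (C.labels lab i)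

/-- `Xdiv_i C^i` for a vector field `C^i`: the sum of the terms of
`div_i C^i = g^{βγ} ∇_β C_γ` in which the derivative hits a factor that is neither the one with
the free index nor a factor `∇υ`. -/
noncomputable def xdiv (C : Contraction s 1) (B : Background n s) (x : Fin n → ℝ) : ℝ :=
  ∑ i₀ : {i : C.ι // i ≠ (C.slot (.inr 0)).1 ∧ C.kind i ≠ .ups},
    ∑ β, ∑ γ, (B.g x)⁻¹ β γ * C.contract B x (fun _ => γ) fun lab i =>
      if i = i₀ then B.factor (C.kind i) (C.ord i + 1) x (β :: C.labels lab i)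
      else B.factor (C.kind i) (C.ord i) x (C.labels lab i)

end Contraction

/-- The factor that replaces `∇^{(p)}_{l} T` in `Riccify`. Here `l` lists the indices of the factor
and `u` the indices of the factors `∇υ` contracted against it; the pairs (index of `∇υ`, index of
the factor) stay contracted, so that the indices `u` become derivative indices placed in front and
contracted against the same indices of `l`. In `∇^{(p)}Ω`, `p ≥ 2`, the last two derivatives turn
into a Ricci tensor. The expression `∇_iΩ ∇^iυ` becomes `g^{ab}·½Ric_{ab} = ½R`. Factors `∇υ` are
erased. (`Ω` is never undifferentiated.) -/
noncomputable def Background.riccFactor {n s : ℕ} (B : Background n s) (κ : Kind s) (p : ℕ)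
    (x : Fin n → ℝ) (u l : List (Fin n)) : ℝ :=
  match κ, p with
  | .ups, _ => 1
  | .omega, 0 => 0
  | .omega, 1 => (1 / 2) * ricci B.g x (u ++ l)
  | .omega, p + 2 => iterCov B.g (u.length + p) (ricci B.g) x (u ++ l)
  | .curv, p => iterCov B.g (u.length + p) (riem B.g) x (u ++ l)
  | .ric, p => iterCov B.g (u.length + p) (ricci B.g) x (u ++ l)
  | .psi h, p => iterCov B.g (u.length + p) (scalar (B.ψ h)) x (u ++ l)

namespace Contraction

variable {s f n : ℕ}

/-- `Riccify[C]`, evaluated at `x`; `β` gives the values of the free (lower) indices. -/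
noncomputable def riccify (C : Contraction s f) (B : Background n s) (x : Fin n → ℝ)
    (β : Fin f → Fin n) : ℝ :=
  C.contract B x β fun lab i =>
    B.riccFactor (C.kind i) (C.ord i) x (C.upsLabels lab i) (C.labels lab i)

/-- Each `ψ_h` occurs in exactly one factor, `Ω` in `q` factors and `υ` in `a` factors. -/
structure HasCounts (C : Contraction s f) (q a : ℕ) : Prop where
  psi : ∀ h, C.count (.psi h) = 1
  omega : C.count .omega = q
  ups : C.count .ups = a

/-- Contractions of
`∇^{(m_1)}R_{ijkl} ⊗ ⋯ ⊗ ∇^{(a_1)}ψ_1 ⊗ ⋯ ⊗ ∇^{(a_s)}ψ_s ⊗ ∇^{(p_1)}Ω ⊗ ⋯ ⊗ ∇^{(p_q)}Ω ⊗ ∇υ ⊗ ⋯ ⊗ ∇υ`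
of length `τ + a` on which `Riccify` acts. -/
structure IsAdmissible (C : Contraction s f) (τ q a : ℕ) : Prop where
  counts : C.HasCounts q a
  length_eq : C.length = τ + a
  no_ric : ∀ i, C.kind i ≠ .ric
  ups_ord : ∀ i, C.kind i = .ups → C.ord i = 1
  no_internal : ∀ j, ¬ C.IsInternal j
  ups_not_ups : ∀ j, ¬ (C.kind (C.owner j false) = .ups ∧ C.kind (C.owner j true) = .ups)
  ups_not_free : ∀ k, C.kind (C.slot (.inr k)).1 ≠ .ups
  psi_ord : ∀ i h, C.kind i = .psi h → ¬ C.MeetsUps i → 2 ≤ C.ord i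
  omega_ord : ∀ i, C.kind i = .omega → ¬ C.MeetsUps i → 2 ≤ C.ord i

/-- Either the factor has the form `∇^{f_1 … f_u} ∇^{(m)}_{r_1 … r_m} T`, where each of the
indices `f_1, …, f_u` is contracted against one of the remaining indices of the factor, and no two
of the remaining ones are contracted against each other; or it is the scalar curvature
`R = g^{ij} Ric_{ij}`. -/
def IsNormalFactor (C : Contraction s f) (i : C.ι) : Prop :=
  (∃ u ≤ C.ord i,
    (∀ k : Fin ((C.kind i).rank + C.ord i), k.val < u →
      ∃ l : Fin ((C.kind i).rank + C.ord i), u ≤ l.val ∧ C.Paired ⟨i, k⟩ ⟨i, l⟩) ∧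
    (∀ k l : Fin ((C.kind i).rank + C.ord i), u ≤ k.val → u ≤ l.val →
      ¬ C.Paired ⟨i, k⟩ ⟨i, l⟩)) ∨
  (C.kind i = .ric ∧ C.ord i = 0 ∧
    ∃ k l : Fin ((C.kind i).rank + C.ord i), C.Paired ⟨i, k⟩ ⟨i, l⟩)

/-- Contractions in `∇^{f_1 … f_y}∇^{(m)}R_{ijkl}`, `∇^{f_1 … f_y}∇^{(p)}Ric_{ij}`, `R` and
`∇^{f_1 … f_y}∇^{(b)}ψ_1, …, ∇^{f_1 … f_y}∇^{(b')}ψ_s` of length `τ`. -/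
structure IsNormal (C : Contraction s f) (τ : ℕ) : Prop where
  counts : C.HasCounts 0 0
  length_eq : C.length = τ
  normal : ∀ i, C.IsNormalFactor i

/-- `δ_R + δ_Ric + δ_ψ`: the number of internal contractions, including the one in each
`Ric_{ik} = R_{ijkl} g^{jl}` itself (so that a scalar curvature factor counts twice). -/
def delta (C : Contraction s f) : ℕ :=
  Fintype.card {j : Fin C.pairs // C.IsInternal j} + C.count .ric

end Contraction

/-- `F = 0` modulo complete contractions of length at least `N`: there is a linear combination of
complete contractions with at least `N` factors, in the curvature and its derivatives, the
derivatives of `ψ_1, …, ψ_s` (one factor each), `q` derivatives of `Ω` and `a` derivatives of `υ`,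
that equals `F` for all metrics and all functions. -/
def VanishesMod (n s q a N : ℕ) (F : Background n s → (Fin n → ℝ) → ℝ) : Prop :=
  ∃ (K : ℕ) (e : Fin K → ℝ) (E : Fin K → Contraction s 0),
    (∀ k, (E k).HasCounts q a ∧ N ≤ (E k).length) ∧
    ∀ (B : Background n s), ∀ x ∈ B.U, F B x = ∑ k, e k * (E k).value B x Fin.elim0

end RicciInvariants

open RicciInvariants

/-!
The replacement of `∇υ` and `Ω` by derivatives of curvature is justified by reading the assumed
identity as a purely formal one, in which other tensors may be inserted.

*The identity is formal.* Apply the identity at the origin to the metrics `1 + t h`, where `h` and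
the functions `ψ`, `Ω`, `υ` have prescribed derivatives at the origin. Each curvature factor
contributes one power of `t`. The longer contractions have the same factors `ψ`, `Ω`, `υ`, hence
more curvature factors, so they do not enter in the lowest order in `t`, and what remains is an
identity among contractions of arbitrary symmetric arrays (`sum_linVal_one_eq_zero`). The
contractions have at most `n` pairs of indices, because their weight is at most `n`. Expanding a
matrix in rank-one matrices, a term then involves at most `n` of these, and so is covered by the
identity in dimension `n`; hence the contraction may use any symmetric matrix on any finite index
set (`sum_linVal_eq_zero`).

*Specialization.* Besides the ordinary indices, contracted by `g⁻¹`, there are indices reserved for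
the factors `∇υ` and partners of these (`ExtIndex`). An index contracted against `∇υ` is turned into
an index of the factor together with an additional derivative contracted against it. Symmetrized
covariant derivatives of `R_{ijkl}`, of `Ric` and of `ψ` define arrays on these indices
(`specialJets`), for which the formal contraction is `Riccify` with symmetrized factors
(`linVal_specialJets`).

*Symmetrization.* Modulo longer contractions, covariant derivatives commute, and the curvature is
recovered from its symmetrized part (`curv_sub_linPattern_mem`). For `Ric` the symmetrization also
exchanges derivative indices with Ricci indices. By the contracted second Bianchi identity this
costs curvature terms, which have one Ricci factor less and the same number of internal contractions
(`fac_ricci_sub_ricciJet_mem`). So `Riccify` differs from its symmetrized form by admissible errors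
only (`Scheme.combination_riccify_sub`).

*Divergence.* In the divergence of a Riccified vector field the derivative hits each factor once. If
this factor is not the one with the free index, then the result is the Riccification of a term of
`Xdiv`, which for `½ R` uses `∇_i R = 2 ∇^j Ric_{ij}` (`cov_scalar_curvature`). If it is, there is
one more internal contraction, and the term is an admissible error
(`Contraction.IsAdmissible.combination_divergence`).
-/

namespace RicciInvariants

/-! ### Partial derivatives, Christoffel symbols and the metric -/

section PartialDerivatives

variable {n : ℕ} {U : Set (Fin n → ℝ)} {f h : (Fin n → ℝ) → ℝ} {x : Fin n → ℝ}

theorem differentiableAt_of_smooth (hU : IsOpen U) (hf : ContDiffOn ℝ ∞ f U) (hx : x ∈ U) :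
    DifferentiableAt ℝ f x :=
  (hf.contDiffAt (hU.mem_nhds hx)).differentiableAt (by simp)

theorem pd_add (i : Fin n) (hf : DifferentiableAt ℝ f x) (hh : DifferentiableAt ℝ h x) :
    pd i (fun y => f y + h y) x = pd i f x + pd i h x := by
  simp [pd, fderiv_fun_add hf hh]

theorem pd_sub (i : Fin n) (hf : DifferentiableAt ℝ f x) (hh : DifferentiableAt ℝ h x) :
    pd i (fun y => f y - h y) x = pd i f x - pd i h x := by
  simp [pd, fderiv_fun_sub hf hh]

theorem pd_neg (i : Fin n) : pd i (fun y => - f y) x = - pd i f x := by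
  simp [pd, fderiv_fun_neg]

theorem pd_mul (i : Fin n) (hf : DifferentiableAt ℝ f x) (hh : DifferentiableAt ℝ h x) :
    pd i (fun y => f y * h y) x = pd i f x * h x + f x * pd i h x := by
  simp [pd, fderiv_fun_mul hf hh]; ring

theorem pd_const (i : Fin n) (c : ℝ) : pd i (fun _ => c) x = 0 := by
  simp [pd]

theorem pd_const_mul (i : Fin n) (c : ℝ) (hf : DifferentiableAt ℝ f x) :
    pd i (fun y => c * f y) x = c * pd i f x := by
  rw [pd_mul i (differentiableAt_const c) hf, pd_const]; ring

theorem pd_sum {ι : Type*} (i : Fin n) (s : Finset ι) {F : ι → (Fin n → ℝ) → ℝ}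
    (hF : ∀ k ∈ s, DifferentiableAt ℝ (F k) x) :
    pd i (fun y => ∑ k ∈ s, F k y) x = ∑ k ∈ s, pd i (F k) x := by
  simp [pd, fderiv_fun_sum hF]

theorem pd_prod {ι : Type*} [DecidableEq ι] (i : Fin n) (s : Finset ι) {F : ι → (Fin n → ℝ) → ℝ}
    (hF : ∀ k ∈ s, DifferentiableAt ℝ (F k) x) :
    pd i (fun y => ∏ k ∈ s, F k y) x = ∑ k ∈ s, (∏ j ∈ s.erase k, F j x) * pd i (F k) x := by
  have := HasFDerivAt.finsetProd (fun k hk => (hF k hk).hasFDerivAt)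
  rw [pd, this.fderiv]
  simp [pd]

theorem pd_congr (hU : IsOpen U) (hx : x ∈ U) (i : Fin n) (hfh : ∀ y ∈ U, f y = h y) :
    pd i f x = pd i h x := by
  rw [pd, pd, Filter.EventuallyEq.fderiv_eq]
  filter_upwards [hU.mem_nhds hx] with y hy using hfh y hy

theorem pd_smooth (hU : IsOpen U) (i : Fin n) (hf : ContDiffOn ℝ ∞ f U) :
    ContDiffOn ℝ ∞ (pd i f) U :=
  (hf.fderiv_of_isOpen hU (m := ∞) (by simp)).clm_apply contDiffOn_const

theorem pd_comm (hU : IsOpen U) (hx : x ∈ U) (i j : Fin n) (hf : ContDiffOn ℝ ∞ f U) :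
    pd i (pd j f) x = pd j (pd i f) x := by
  have h1 : DifferentiableAt ℝ (fderiv ℝ f) x :=
    ((hf.fderiv_of_isOpen hU (m := ∞) (by simp)).contDiffAt (hU.mem_nhds hx)).differentiableAt
      (by simp)
  have h2 : ∀ i j : Fin n, pd i (pd j f) x
      = fderiv ℝ (fderiv ℝ f) x (Pi.single i 1) (Pi.single j 1) := by
    intro i j
    unfold pd
    rw [fderiv_clm_apply h1 (differentiableAt_const _)]
    simp
  rw [h2, h2]
  exact (hf.contDiffAt (hU.mem_nhds hx)).isSymmSndFDerivAt
    (by simp only [minSmoothness_of_isRCLikeNormedField]; exact WithTop.coe_le_coe.2 (le_top (a := 2))) _ _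

end PartialDerivatives

section MatrixSmooth

variable {X : Type*} [NormedAddCommGroup X] [NormedSpace ℝ X] {n : ℕ} {W : Set X}

theorem contDiffOn_det {ι : Type*} [Fintype ι] [DecidableEq ι] {A : X → Matrix ι ι ℝ}
    (hA : ∀ i j, ContDiffOn ℝ ∞ (fun x => A x i j) W) : ContDiffOn ℝ ∞ (fun x => (A x).det) W := by
  simp only [Matrix.det_apply]
  exact ContDiffOn.sum fun σ _ => (contDiffOn_prod fun i _ => hA _ _).const_smul _

theorem contDiffOn_matrix_inv {A : X → Matrix (Fin n) (Fin n) ℝ}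
    (hA : ∀ i j, ContDiffOn ℝ ∞ (fun x => A x i j) W) (hdet : ∀ x ∈ W, (A x).det ≠ 0)
    (i j : Fin n) : ContDiffOn ℝ ∞ (fun x => (A x)⁻¹ i j) W := by
  have hadj : ContDiffOn ℝ ∞ (fun x => (A x).adjugate i j) W := by
    simp only [Matrix.adjugate_apply]
    refine contDiffOn_det fun k l => ?_
    by_cases hk : k = j
    · subst hk
      simp only [Matrix.updateRow_self]
      exact contDiffOn_const
    · simpa only [Matrix.updateRow_ne hk] using hA k l
  have : ∀ x, (A x)⁻¹ i j = ((A x).det)⁻¹ * (A x).adjugate i j := by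
    intro x
    rw [Matrix.inv_def, Ring.inverse_eq_inv', Matrix.smul_apply, smul_eq_mul]
  simp only [this]
  exact ((contDiffOn_det hA).inv hdet).mul hadj

end MatrixSmooth

namespace Background

variable {n s : ℕ} (B : Background n s) {x : Fin n → ℝ}

theorem det_ne_zero (hx : x ∈ B.U) : (B.g x).det ≠ 0 := (B.posDef_g x hx).det_pos.ne'

theorem g_symm (hx : x ∈ B.U) (i j : Fin n) : B.g x i j = B.g x j i := by
  have := (B.posDef_g x hx).isHermitian.apply i j
  simpa using this.symm

theorem ginv_symm (hx : x ∈ B.U) (i j : Fin n) : (B.g x)⁻¹ i j = (B.g x)⁻¹ j i := by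
  have := (B.posDef_g x hx).isHermitian.inv.apply i j
  simpa using this.symm

theorem sum_g_ginv (hx : x ∈ B.U) (i j : Fin n) :
    ∑ k, B.g x i k * (B.g x)⁻¹ k j = if i = j then 1 else 0 := by
  rw [← Matrix.mul_apply, Matrix.mul_nonsing_inv _ (B.det_ne_zero hx).isUnit, Matrix.one_apply]

theorem sum_ginv_g (hx : x ∈ B.U) (i j : Fin n) :
    ∑ k, (B.g x)⁻¹ i k * B.g x k j = if i = j then 1 else 0 := by
  rw [← Matrix.mul_apply, Matrix.nonsing_inv_mul _ (B.det_ne_zero hx).isUnit, Matrix.one_apply]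

theorem smooth_ginv (i j : Fin n) : ContDiffOn ℝ ∞ (fun x => (B.g x)⁻¹ i j) B.U :=
  contDiffOn_matrix_inv B.smooth_g (fun _ hx => B.det_ne_zero hx) i j

theorem smooth_christoffel (k i j : Fin n) :
    ContDiffOn ℝ ∞ (fun x => christoffel B.g x k i j) B.U := by
  unfold christoffel
  refine contDiffOn_const.mul (ContDiffOn.sum fun l _ => (B.smooth_ginv k l).mul ?_)
  exact ((pd_smooth B.isOpen _ (B.smooth_g _ _)).add (pd_smooth B.isOpen _ (B.smooth_g _ _))).sub
    (pd_smooth B.isOpen _ (B.smooth_g _ _))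

theorem christoffel_symm (hx : x ∈ B.U) (k i j : Fin n) :
    christoffel B.g x k i j = christoffel B.g x k j i := by
  unfold christoffel
  congr 1
  refine Finset.sum_congr rfl fun l _ => ?_
  rw [pd_congr B.isOpen hx l fun y hy => B.g_symm hy i j]
  ring

theorem sum_g_christoffel (hx : x ∈ B.U) (l i j : Fin n) :
    ∑ k, B.g x l k * christoffel B.g x k i j = (1 / 2) *
      (pd i (fun y => B.g y j l) x + pd j (fun y => B.g y i l) x - pd l (fun y => B.g y i j) x) := by
  unfold christoffel
  simp only [Finset.mul_sum]
  rw [Finset.sum_comm]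
  have : ∀ m, ∑ k, B.g x l k * (1 / 2 * ((B.g x)⁻¹ k m * (pd i (fun y => B.g y j m) x
      + pd j (fun y => B.g y i m) x - pd m (fun y => B.g y i j) x)))
      = (if l = m then 1 else 0) * (1 / 2 * (pd i (fun y => B.g y j m) x
      + pd j (fun y => B.g y i m) x - pd m (fun y => B.g y i j) x)) := by
    intro m
    rw [← B.sum_g_ginv hx l m, Finset.sum_mul]
    exact Finset.sum_congr rfl fun k _ => by ring
  simp only [this, ite_mul, one_mul, zero_mul, Finset.sum_ite_eq, Finset.mem_univ, if_true]

/-- Metric compatibility of the Levi-Civita connection. -/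
theorem pd_g (hx : x ∈ B.U) (i j l : Fin n) :
    pd i (fun y => B.g y j l) x = (∑ k, christoffel B.g x k i j * B.g x k l)
      + ∑ k, christoffel B.g x k i l * B.g x j k := by
  have h1 := B.sum_g_christoffel hx l i j
  have h2 := B.sum_g_christoffel hx j i l
  rw [show ∑ k, christoffel B.g x k i j * B.g x k l = ∑ k, B.g x l k * christoffel B.g x k i j from
    Finset.sum_congr rfl fun k _ => by rw [B.g_symm hx k l, mul_comm],
    show ∑ k, christoffel B.g x k i l * B.g x j k = ∑ k, B.g x j k * christoffel B.g x k i l from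
    Finset.sum_congr rfl fun k _ => by rw [mul_comm], h1, h2,
    pd_congr B.isOpen hx i fun y hy => B.g_symm hy l j]
  ring

theorem pd_ginv (hx : x ∈ B.U) (i a b : Fin n) :
    pd i (fun y => (B.g y)⁻¹ a b) x = - ((∑ k, christoffel B.g x a i k * (B.g x)⁻¹ k b)
      + ∑ k, christoffel B.g x b i k * (B.g x)⁻¹ a k) := by
  have dg : ∀ i j, DifferentiableAt ℝ (fun y => B.g y i j) x :=
    fun i j => differentiableAt_of_smooth B.isOpen (B.smooth_g i j) hx
  have dgi : ∀ i j, DifferentiableAt ℝ (fun y => (B.g y)⁻¹ i j) x :=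
    fun i j => differentiableAt_of_smooth B.isOpen (B.smooth_ginv i j) hx
  -- differentiate `g⁻¹ g = 1`
  have key : ∀ c, ∑ k, (pd i (fun y => (B.g y)⁻¹ a k) x * B.g x k c
      + (B.g x)⁻¹ a k * pd i (fun y => B.g y k c) x) = 0 := by
    intro c
    have h0 : pd i (fun y => ∑ k, (B.g y)⁻¹ a k * B.g y k c) x = 0 := by
      rw [pd_congr B.isOpen hx i fun y hy => B.sum_ginv_g hy a c, pd_const]
    rw [pd_sum i _ fun k _ => (dgi a k).fun_mul (dg k c)] at h0
    rw [← h0]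
    exact Finset.sum_congr rfl fun k _ => (pd_mul i (dgi a k) (dg k c)).symm
  have h1 : pd i (fun y => (B.g y)⁻¹ a b) x
      = ∑ c, (∑ k, pd i (fun y => (B.g y)⁻¹ a k) x * B.g x k c) * (B.g x)⁻¹ c b := by
    simp only [Finset.sum_mul]
    rw [Finset.sum_comm]
    have : ∀ k, ∑ c, pd i (fun y => (B.g y)⁻¹ a k) x * B.g x k c * (B.g x)⁻¹ c b
        = pd i (fun y => (B.g y)⁻¹ a k) x * if k = b then 1 else 0 := by
      intro k
      rw [← B.sum_g_ginv hx k b, Finset.mul_sum]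
      exact Finset.sum_congr rfl fun c _ => by ring
    simp [this]
  have h2 : ∀ c, ∑ k, pd i (fun y => (B.g y)⁻¹ a k) x * B.g x k c
      = - (christoffel B.g x a i c + ∑ k, ∑ m, (B.g x)⁻¹ a k * (christoffel B.g x m i k * B.g x m c)) := by
    intro c
    have := key c
    rw [Finset.sum_add_distrib, ← eq_neg_iff_add_eq_zero] at this
    rw [this]
    congr 1
    simp only [B.pd_g hx, mul_add, Finset.sum_add_distrib, Finset.mul_sum]
    rw [add_comm]
    congr 1
    rw [Finset.sum_comm]
    have : ∀ m, ∑ k, (B.g x)⁻¹ a k * (christoffel B.g x m i c * B.g x k m)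
        = christoffel B.g x m i c * if a = m then 1 else 0 := by
      intro m
      rw [← B.sum_ginv_g hx a m, Finset.mul_sum]
      exact Finset.sum_congr rfl fun k _ => by ring
    simp [this]
  rw [h1]
  simp only [h2]
  simp only [neg_mul, Finset.sum_neg_distrib, add_mul, Finset.sum_add_distrib, Finset.sum_mul]
  congr 2
  rw [Finset.sum_comm]
  refine (Finset.sum_congr rfl fun k _ => ?_)
  rw [Finset.sum_comm]
  have : ∀ m, ∑ c, (B.g x)⁻¹ a k * (christoffel B.g x m i k * B.g x m c) * (B.g x)⁻¹ c b
      = (B.g x)⁻¹ a k * christoffel B.g x m i k * if m = b then 1 else 0 := by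
    intro m
    rw [← B.sum_g_ginv hx m b, Finset.mul_sum]
    exact Finset.sum_congr rfl fun c _ => by ring
  rw [Finset.sum_congr rfl fun m _ => this m]
  simp [mul_comm]

/-! Smoothness of the factors. -/

theorem smooth_cov {T : Tens n} (hT : ∀ l, ContDiffOn ℝ ∞ (fun y => T y l) B.U)
    (l : List (Fin n)) : ContDiffOn ℝ ∞ (fun y => cov B.g T y l) B.U := by
  cases l with
  | nil => exact contDiffOn_const
  | cons i l =>
    simp only [cov]
    exact (pd_smooth B.isOpen _ (hT _)).sub (ContDiffOn.sum fun p _ => ContDiffOn.sum fun k _ =>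
      (B.smooth_christoffel _ _ _).mul (hT _))

theorem smooth_iterCov {T : Tens n} (hT : ∀ l, ContDiffOn ℝ ∞ (fun y => T y l) B.U) (m : ℕ) :
    ∀ l : List (Fin n), ContDiffOn ℝ ∞ (fun y => iterCov B.g m T y l) B.U := by
  induction m with
  | zero => exact hT
  | succ m ih =>
    intro l
    have : iterCov B.g (m + 1) T = cov B.g (iterCov B.g m T) :=
      Function.iterate_succ_apply' _ _ _
    rw [this]
    exact B.smooth_cov ih l

theorem smooth_riem : ∀ l : List (Fin n), ContDiffOn ℝ ∞ (fun y => riem B.g y l) B.U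
  | [] => contDiffOn_const
  | [_] => contDiffOn_const
  | [_, _] => contDiffOn_const
  | [_, _, _] => contDiffOn_const
  | _ :: _ :: _ :: _ :: _ :: _ => contDiffOn_const
  | [i, j, k, l] => by
    simp only [riem]
    refine (ContDiffOn.sum fun p _ => (B.smooth_g _ _).mul ?_).neg
    refine ((pd_smooth B.isOpen _ (B.smooth_christoffel _ _ _)).sub
      (pd_smooth B.isOpen _ (B.smooth_christoffel _ _ _))).add (ContDiffOn.sum fun m _ => ?_)
    exact ((B.smooth_christoffel _ _ _).mul (B.smooth_christoffel _ _ _)).sub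
      ((B.smooth_christoffel _ _ _).mul (B.smooth_christoffel _ _ _))

theorem smooth_ricci : ∀ l : List (Fin n), ContDiffOn ℝ ∞ (fun y => ricci B.g y l) B.U
  | [] => contDiffOn_const
  | [_] => contDiffOn_const
  | _ :: _ :: _ :: _ => contDiffOn_const
  | [i, k] => by
    simp only [ricci]
    exact ContDiffOn.sum fun j _ => ContDiffOn.sum fun l _ =>
      (B.smooth_ginv _ _).mul (B.smooth_riem _)

theorem smooth_scalar {f : (Fin n → ℝ) → ℝ} (hf : ContDiffOn ℝ ∞ f B.U) :
    ∀ l : List (Fin n), ContDiffOn ℝ ∞ (fun y => scalar f y l) B.U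
  | [] => hf
  | _ :: _ => contDiffOn_const

theorem smooth_base (κ : Kind s) : ∀ l : List (Fin n), ContDiffOn ℝ ∞ (fun y => B.base κ y l) B.U := by
  cases κ with
  | curv => exact B.smooth_riem
  | ric => exact B.smooth_ricci
  | psi h => exact B.smooth_scalar (B.smooth_ψ h)
  | omega => exact B.smooth_scalar B.smooth_Ω
  | ups => exact B.smooth_scalar B.smooth_υ

theorem smooth_factor (κ : Kind s) (m : ℕ) (l : List (Fin n)) :
    ContDiffOn ℝ ∞ (fun y => B.factor κ m y l) B.U :=
  B.smooth_iterCov (B.smooth_base κ) m l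

end Background

/-! ### Covariant derivatives of labelled tensors and the curvature identities -/

/-- The covariant derivative `∇_i W` of a tensor whose index slots are the labels in `S`; the
component with indices `lab e`, `e ∈ S`, is `W x lab`. -/
noncomputable def labelCov {n : ℕ} {E : Type} [DecidableEq E]
    (g : (Fin n → ℝ) → Matrix (Fin n) (Fin n) ℝ) (S : Finset E) (i : Fin n)
    (W : (Fin n → ℝ) → (E → Fin n) → ℝ) (x : Fin n → ℝ) (lab : E → Fin n) : ℝ :=
  pd i (fun y => W y lab) x -
    ∑ e ∈ S, ∑ k, christoffel g x k i (lab e) * W x (Function.update lab e k)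

section LabelCov

variable {n s : ℕ} {E : Type} [DecidableEq E] (B : Background n s) {x : Fin n → ℝ}

theorem map_update_of_notMem {a : E} {e : List E} (ha : a ∉ e) (lab : E → Fin n) (k : Fin n) :
    e.map (Function.update lab a k) = e.map lab :=
  List.map_congr_left fun b hb => Function.update_of_ne (fun h => ha (by rwa [← h])) _ _

theorem sum_get_set {e : List E} (he : e.Nodup) (lab : E → Fin n) (k : Fin n)
    (G : Fin n → List (Fin n) → ℝ) :
    ∑ p : Fin (e.map lab).length, G ((e.map lab).get p) ((e.map lab).set p k)
      = ∑ a ∈ e.toFinset, G (lab a) (e.map (Function.update lab a k)) := by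
  induction e generalizing G with
  | nil => exact Fin.sum_univ_zero _
  | cons a e ih =>
    obtain ⟨ha, he⟩ := List.nodup_cons.1 he
    rw [List.toFinset_cons, Finset.sum_insert (by simpa using ha)]
    have h0 : ∑ p : Fin ((a :: e).map lab).length,
        G (((a :: e).map lab).get p) (((a :: e).map lab).set p k)
        = G (lab a) (k :: e.map lab) + ∑ p : Fin (e.map lab).length,
          G ((e.map lab).get p) (lab a :: (e.map lab).set p k) :=
      Fin.sum_univ_succ (n := (e.map lab).length)
        fun p => G (((a :: e).map lab).get p) (((a :: e).map lab).set p k)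
    rw [h0, ih he fun i l => G i (lab a :: l)]
    congr 1
    · simp [map_update_of_notMem ha]
    · refine Finset.sum_congr rfl fun b hb => ?_
      have hab : a ≠ b := by rintro rfl; exact ha (by simpa using hb)
      simp [Function.update_of_ne hab]

theorem sum_get_set_finRange (l : List (Fin n)) (k : Fin n) (G : Fin n → List (Fin n) → ℝ) :
    ∑ p : Fin l.length, G (l.get p) (l.set p k)
      = ∑ e : Fin l.length,
        G (l.get e) ((List.finRange l.length).map (Function.update l.get e k)) := by
  have h := sum_get_set (List.nodup_finRange l.length) l.get k G
  have key : ∀ l', l' = l → ∑ p : Fin l.length, G (l.get p) (l.set p k)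
      = ∑ p : Fin l'.length, G (l'.get p) (l'.set p k) := by rintro _ rfl; rfl
  rw [key _ (List.map_get_finRange l), h, List.toFinset_finRange]

theorem labelCov_list (T : Tens n) {e : List E} (he : e.Nodup) (i : Fin n) (lab : E → Fin n) :
    labelCov B.g e.toFinset i (fun y lab => T y (e.map lab)) x lab
      = cov B.g T x (i :: e.map lab) := by
  simp only [labelCov, cov]
  congr 1
  rw [Finset.sum_comm, Finset.sum_comm (s := (Finset.univ : Finset (Fin (e.map lab).length)))]
  refine Finset.sum_congr rfl fun k _ => ?_
  exact (sum_get_set he lab k fun j l => christoffel B.g x k i j * T x l).symm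

theorem labelCov_congr (hx : x ∈ B.U) (S : Finset E) (i : Fin n)
    {V W : (Fin n → ℝ) → (E → Fin n) → ℝ} (h : ∀ y ∈ B.U, ∀ lab, V y lab = W y lab)
    (lab : E → Fin n) : labelCov B.g S i V x lab = labelCov B.g S i W x lab := by
  unfold labelCov
  rw [pd_congr B.isOpen hx i fun y hy => h y hy lab]
  simp only [h x hx]

theorem labelCov_sum (hx : x ∈ B.U) (S : Finset E) (i : Fin n) {ι : Type*} (I : Finset ι)
    (c : ι → ℝ) {W : ι → (Fin n → ℝ) → (E → Fin n) → ℝ}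
    (hW : ∀ k lab, ContDiffOn ℝ ∞ (fun y => W k y lab) B.U) (lab : E → Fin n) :
    labelCov B.g S i (fun y lab => ∑ k ∈ I, c k * W k y lab) x lab
      = ∑ k ∈ I, c k * labelCov B.g S i (W k) x lab := by
  unfold labelCov
  have hd : ∀ k lab, DifferentiableAt ℝ (fun y => W k y lab) x :=
    fun k lab => differentiableAt_of_smooth B.isOpen (hW k lab) hx
  rw [pd_sum i _ fun k _ => (hd k lab).const_mul (c k)]
  simp only [pd_const_mul i _ (hd _ lab), mul_sub, Finset.sum_sub_distrib]
  congr 1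
  simp only [Finset.mul_sum]
  rw [Finset.sum_comm (s := I)]
  refine Finset.sum_congr rfl fun e _ => ?_
  rw [Finset.sum_comm]
  refine Finset.sum_congr rfl fun k _ => Finset.sum_congr rfl fun j _ => by ring

/-- The Leibniz rule for a product of tensors with disjoint sets of labels. -/
theorem labelCov_prod (hx : x ∈ B.U) (i : Fin n) {ι : Type*} [DecidableEq ι] (I : Finset ι)
    (S : ι → Finset E) (hS : (I : Set ι).PairwiseDisjoint S)
    {W : ι → (Fin n → ℝ) → (E → Fin n) → ℝ}
    (hW : ∀ k lab, ContDiffOn ℝ ∞ (fun y => W k y lab) B.U)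
    (hdep : ∀ k y lab, ∀ e ∉ S k, ∀ j, W k y (Function.update lab e j) = W k y lab)
    (lab : E → Fin n) :
    labelCov B.g (I.biUnion S) i (fun y lab => ∏ k ∈ I, W k y lab) x lab
      = ∑ k ∈ I, (∏ j ∈ I.erase k, W j x lab) * labelCov B.g (S k) i (W k) x lab := by
  unfold labelCov
  have hd : ∀ k lab, DifferentiableAt ℝ (fun y => W k y lab) x :=
    fun k lab => differentiableAt_of_smooth B.isOpen (hW k lab) hx
  rw [pd_prod i _ fun k _ => hd k lab, Finset.sum_biUnion hS]
  simp only [mul_sub, Finset.sum_sub_distrib]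
  congr 1
  refine Finset.sum_congr rfl fun k hk => ?_
  rw [Finset.mul_sum]
  refine Finset.sum_congr rfl fun e he => ?_
  rw [Finset.mul_sum]
  refine Finset.sum_congr rfl fun j _ => ?_
  rw [← Finset.mul_prod_erase I _ hk, Finset.prod_congr rfl fun k' hk' => ?_]
  · ring
  · refine hdep k' x lab e (fun he' => ?_) j
    obtain ⟨hne, hk'⟩ := Finset.mem_erase.1 hk'
    exact Finset.disjoint_left.1 (hS hk' hk hne) he' he

theorem update_pair_apply {P : Type} [DecidableEq P] (α : P × Bool → Fin n) (j : P) (b : Bool)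
    (k : Fin n) (G : Fin n → Fin n → ℝ) (j' : P) (h : j' ≠ j) :
    G (Function.update α (j, b) k (j', false)) (Function.update α (j, b) k (j', true))
      = G (α (j', false)) (α (j', true)) := by
  rw [Function.update_of_ne (by simp [h]), Function.update_of_ne (by simp [h])]

theorem pd_prod_ginv (hx : x ∈ B.U) {P : Type} [Fintype P] [DecidableEq P] (i : Fin n)
    (α : P × Bool → Fin n) :
    pd i (fun y => ∏ j, (B.g y)⁻¹ (α (j, false)) (α (j, true))) x
      = - ∑ p, ∑ k, christoffel B.g x (α p) i k *
          ∏ j, (B.g x)⁻¹ (Function.update α p k (j, false)) (Function.update α p k (j, true)) := by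
  rw [pd_prod i _ fun k _ => differentiableAt_of_smooth B.isOpen (B.smooth_ginv _ _) hx,
    Fintype.sum_prod_type, ← Finset.sum_neg_distrib]
  refine Finset.sum_congr rfl fun j _ => ?_
  rw [B.pd_ginv hx, Fintype.sum_bool]
  have h : ∀ (b : Bool) (k : Fin n), ∏ j', (B.g x)⁻¹ (Function.update α (j, b) k (j', false))
      (Function.update α (j, b) k (j', true)) = (B.g x)⁻¹ (Function.update α (j, b) k (j, false))
      (Function.update α (j, b) k (j, true)) * ∏ j' ∈ Finset.univ.erase j,
        (B.g x)⁻¹ (α (j', false)) (α (j', true)) := by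
    intro b k
    rw [← Finset.mul_prod_erase _ _ (Finset.mem_univ j)]
    congr 1
    exact Finset.prod_congr rfl fun j' hj' =>
      update_pair_apply α j b k (fun c d => (B.g x)⁻¹ c d) j' (Finset.ne_of_mem_erase hj')
  simp only [h]
  simp only [Function.update_self, ne_eq, Prod.mk.injEq, true_and, Bool.true_eq_false,
    Bool.false_eq_true, not_false_eq_true, Function.update_of_ne, neg_add, mul_neg, mul_add,
    Finset.mul_sum]
  rw [add_comm]
  congr 1 <;> refine congrArg _ (Finset.sum_congr rfl fun k _ => by ring)

/-- The covariant derivative commutes with contractions against the inverse metric. -/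
theorem labelCov_contract (hx : x ∈ B.U) {P : Type} [Fintype P] [DecidableEq P] (S : Finset E)
    (i : Fin n) {W : (Fin n → ℝ) → (E ⊕ P × Bool → Fin n) → ℝ}
    (hW : ∀ lab, ContDiffOn ℝ ∞ (fun y => W y lab) B.U) (lab : E → Fin n) :
    labelCov B.g S i (fun y lab => ∑ α : P × Bool → Fin n,
        (∏ j, (B.g y)⁻¹ (α (j, false)) (α (j, true))) * W y (Sum.elim lab α)) x lab
      = ∑ α : P × Bool → Fin n, (∏ j, (B.g x)⁻¹ (α (j, false)) (α (j, true))) *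
          labelCov B.g (S.disjSum Finset.univ) i W x (Sum.elim lab α) := by
  have hd : ∀ lab, DifferentiableAt ℝ (fun y => W y lab) x :=
    fun lab => differentiableAt_of_smooth B.isOpen (hW lab) hx
  have hg : ∀ α : P × Bool → Fin n,
      DifferentiableAt ℝ (fun y => ∏ j, (B.g y)⁻¹ (α (j, false)) (α (j, true))) x := fun α =>
    differentiableAt_of_smooth B.isOpen (contDiffOn_prod fun j _ => B.smooth_ginv _ _) hx
  unfold labelCov
  rw [pd_sum i _ fun α _ => (hg α).fun_mul (hd _)]
  simp only [pd_mul i (hg _) (hd _), Finset.sum_add_distrib, mul_sub, Finset.sum_sub_distrib,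
    Finset.sum_disjSum, Sum.elim_inl, Sum.elim_inr, Sum.update_elim_inl, Sum.update_elim_inr,
    mul_add]
  have h1 : ∑ α : P × Bool → Fin n,
      pd i (fun y => ∏ j, (B.g y)⁻¹ (α (j, false)) (α (j, true))) x * W x (Sum.elim lab α)
      = - ∑ α : P × Bool → Fin n, (∏ j, (B.g x)⁻¹ (α (j, false)) (α (j, true))) *
          ∑ p, ∑ k, christoffel B.g x k i (α p) *
            W x (Sum.elim lab (Function.update α p k)) := by
    simp only [pd_prod_ginv B hx, neg_mul, Finset.sum_neg_distrib, Finset.mul_sum, Finset.sum_mul]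
    congr 1
    rw [Finset.sum_comm, Finset.sum_comm (s := (Finset.univ : Finset (P × Bool → Fin n)))]
    refine Finset.sum_congr rfl fun p _ => ?_
    rw [← Fintype.sum_prod_type', ← Fintype.sum_prod_type']
    -- exchange the value `α p` with the summation index `k`
    refine Fintype.sum_bijective
      (fun z : (P × Bool → Fin n) × Fin n => (Function.update z.1 p z.2, z.1 p)) ?_ _ _ ?_
    · refine Function.Involutive.bijective fun z => ?_
      simp
    · rintro ⟨α, k⟩
      simp
      ring
  have h2 : ∑ e ∈ S, ∑ k, christoffel B.g x k i (lab e) * ∑ α : P × Bool → Fin n,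
      (∏ j, (B.g x)⁻¹ (α (j, false)) (α (j, true))) * W x (Sum.elim (Function.update lab e k) α)
      = ∑ α : P × Bool → Fin n, (∏ j, (B.g x)⁻¹ (α (j, false)) (α (j, true))) *
        ∑ e ∈ S, ∑ k, christoffel B.g x k i (lab e) *
          W x (Sum.elim (Function.update lab e k) α) := by
    simp only [Finset.mul_sum]
    rw [Finset.sum_comm (s := (Finset.univ : Finset (P × Bool → Fin n)))]
    refine Finset.sum_congr rfl fun e _ => ?_
    rw [Finset.sum_comm]
    exact Finset.sum_congr rfl fun k _ => Finset.sum_congr rfl fun α _ => by ring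
  rw [h1, h2]
  ring

end LabelCov

/-- The curvature tensor with its third index raised. -/
noncomputable def riemUp {n : ℕ} (g : (Fin n → ℝ) → Matrix (Fin n) (Fin n) ℝ)
    (x : Fin n → ℝ) (a b k l : Fin n) : ℝ :=
  - (pd a (fun y => christoffel g y k b l) x - pd b (fun y => christoffel g y k a l) x
      + ∑ m, (christoffel g x k a m * christoffel g x m b l
              - christoffel g x k b m * christoffel g x m a l))

theorem riem_eq {n : ℕ} (g : (Fin n → ℝ) → Matrix (Fin n) (Fin n) ℝ) (x : Fin n → ℝ)
    (i j k l : Fin n) : riem g x [i, j, k, l] = ∑ p, g x k p * riemUp g x i j p l := by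
  simp only [riem, riemUp, mul_neg, Finset.sum_neg_distrib]

section Commutator

variable {n s : ℕ} {E : Type} [DecidableEq E] (B : Background n s) {x : Fin n → ℝ}

theorem riemUp_eq (hx : x ∈ B.U) (i j p l : Fin n) :
    riemUp B.g x i j p l = ∑ k, (B.g x)⁻¹ p k * riem B.g x [i, j, k, l] := by
  simp only [riem_eq, Finset.mul_sum]
  rw [Finset.sum_comm]
  have : ∀ q, ∑ k, (B.g x)⁻¹ p k * (B.g x k q * riemUp B.g x i j q l)
      = (if p = q then 1 else 0) * riemUp B.g x i j q l := by
    intro q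
    rw [← B.sum_ginv_g hx p q, Finset.sum_mul]
    exact Finset.sum_congr rfl fun _ _ => by ring
  simp [this]

theorem labelCov_labelCov (hx : x ∈ B.U) (S : Finset E) (a b : Fin n)
    {W : (Fin n → ℝ) → (E → Fin n) → ℝ} (hW : ∀ lab, ContDiffOn ℝ ∞ (fun y => W y lab) B.U)
    (lab : E → Fin n) :
    labelCov B.g S a (labelCov B.g S b W) x lab - labelCov B.g S b (labelCov B.g S a W) x lab
      = ∑ e ∈ S, ∑ k, riemUp B.g x a b k (lab e) * W x (Function.update lab e k) := by
  have hd : ∀ lab, DifferentiableAt ℝ (fun y => W y lab) x :=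
    fun lab => differentiableAt_of_smooth B.isOpen (hW lab) hx
  have hpd : ∀ i lab, DifferentiableAt ℝ (pd i fun y => W y lab) x :=
    fun i lab => differentiableAt_of_smooth B.isOpen (pd_smooth B.isOpen i (hW lab)) hx
  have hΓ : ∀ k i j, DifferentiableAt ℝ (fun y => christoffel B.g y k i j) x :=
    fun k i j => differentiableAt_of_smooth B.isOpen (B.smooth_christoffel k i j) hx
  have h1 : ∀ a b, pd a (fun y => labelCov B.g S b W y lab) x
      = pd a (pd b fun y => W y lab) x - ∑ e ∈ S, ∑ k,
        (pd a (fun y => christoffel B.g y k b (lab e)) x * W x (Function.update lab e k)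
          + christoffel B.g x k b (lab e) * pd a (fun y => W y (Function.update lab e k)) x) := by
    intro a b
    unfold labelCov
    have hds : ∀ e, DifferentiableAt ℝ (fun y => ∑ k, christoffel B.g y k b (lab e) *
        W y (Function.update lab e k)) x := fun e =>
      DifferentiableAt.fun_sum fun k _ => (hΓ _ _ _).fun_mul (hd _)
    rw [pd_sub a (hpd _ _) (DifferentiableAt.fun_sum fun e _ => hds e), pd_sum a _ fun e _ => hds e]
    congr 1
    refine Finset.sum_congr rfl fun e _ => ?_
    rw [pd_sum a _ fun k _ => (hΓ _ _ _).fun_mul (hd _)]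
    exact Finset.sum_congr rfl fun k _ => pd_mul a (hΓ _ _ _) (hd _)
  -- the terms with two distinct slots are symmetric in `a`, `b`
  have hoff : ∀ a b : Fin n, ∑ e ∈ S, ∑ k, christoffel B.g x k a (lab e) *
      ∑ e' ∈ S, ∑ k', christoffel B.g x k' b (Function.update lab e k e') *
        W x (Function.update (Function.update lab e k) e' k')
      = (∑ e ∈ S, ∑ e' ∈ S, ∑ k, ∑ k', if e = e' then 0 else
          christoffel B.g x k a (lab e) * christoffel B.g x k' b (lab e') *
            W x (Function.update (Function.update lab e k) e' k'))
        + ∑ e ∈ S, ∑ k', (∑ k, christoffel B.g x k' b k * christoffel B.g x k a (lab e)) *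
            W x (Function.update lab e k') := by
    intro a b
    rw [← Finset.sum_add_distrib]
    refine Finset.sum_congr rfl fun e he => ?_
    simp only [Finset.mul_sum]
    conv_lhs => rw [Finset.sum_comm]
    rw [← Finset.add_sum_erase _ _ he, ← Finset.add_sum_erase (a := e) S (fun e' => ∑ k, ∑ k', _) he]
    simp only [if_true, Finset.sum_const_zero, zero_add]
    rw [add_comm]
    congr 1
    · refine Finset.sum_congr rfl fun e' he' => ?_
      have hne : e ≠ e' := (Finset.ne_of_mem_erase he').symm
      refine Finset.sum_congr rfl fun k _ => Finset.sum_congr rfl fun k' _ => ?_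
      rw [if_neg hne, Function.update_of_ne hne.symm]
      ring
    · rw [Finset.sum_comm]
      refine Finset.sum_congr rfl fun k' _ => ?_
      rw [Finset.sum_mul]
      refine Finset.sum_congr rfl fun k _ => ?_
      rw [Function.update_self, Function.update_idem]
      ring
  have hsymm : ∀ a b : Fin n, (∑ e ∈ S, ∑ e' ∈ S, ∑ k, ∑ k', if e = e' then 0 else
          christoffel B.g x k a (lab e) * christoffel B.g x k' b (lab e') *
            W x (Function.update (Function.update lab e k) e' k'))
      = ∑ e ∈ S, ∑ e' ∈ S, ∑ k, ∑ k', if e = e' then 0 else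
          christoffel B.g x k b (lab e) * christoffel B.g x k' a (lab e') *
            W x (Function.update (Function.update lab e k) e' k') := by
    intro a b
    rw [Finset.sum_comm]
    refine Finset.sum_congr rfl fun e _ => Finset.sum_congr rfl fun e' _ => ?_
    rw [Finset.sum_comm]
    refine Finset.sum_congr rfl fun k _ => Finset.sum_congr rfl fun k' _ => ?_
    by_cases h : e = e'
    · simp [h]
    · rw [if_neg h, if_neg (Ne.symm h), Function.update_comm h]
      ring
  have h2 : ∀ a b, labelCov B.g S a (labelCov B.g S b W) x lab
      = pd a (pd b fun y => W y lab) x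
        - (∑ e ∈ S, ∑ k, (pd a (fun y => christoffel B.g y k b (lab e)) x *
            W x (Function.update lab e k)))
        - (∑ e ∈ S, ∑ k, christoffel B.g x k b (lab e) *
            pd a (fun y => W y (Function.update lab e k)) x)
        - (∑ e ∈ S, ∑ k, christoffel B.g x k a (lab e) *
            pd b (fun y => W y (Function.update lab e k)) x)
        + ((∑ e ∈ S, ∑ e' ∈ S, ∑ k, ∑ k', if e = e' then 0 else
          christoffel B.g x k a (lab e) * christoffel B.g x k' b (lab e') *
            W x (Function.update (Function.update lab e k) e' k'))
        + ∑ e ∈ S, ∑ k', (∑ k, christoffel B.g x k' b k * christoffel B.g x k a (lab e)) *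
            W x (Function.update lab e k')) := by
    intro a b
    rw [← hoff, labelCov, h1]
    simp only [labelCov, mul_sub, Finset.sum_sub_distrib, Finset.sum_add_distrib]
    ring
  rw [h2 a b, h2 b a, hsymm b a, pd_comm B.isOpen hx a b (hW lab)]
  have h3 : ∑ e ∈ S, ∑ k, riemUp B.g x a b k (lab e) * W x (Function.update lab e k)
      = - (∑ e ∈ S, ∑ k, (pd a (fun y => christoffel B.g y k b (lab e)) x *
            W x (Function.update lab e k)))
        + (∑ e ∈ S, ∑ k, (pd b (fun y => christoffel B.g y k a (lab e)) x *
            W x (Function.update lab e k)))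
        + (∑ e ∈ S, ∑ k', (∑ k, christoffel B.g x k' b k * christoffel B.g x k a (lab e)) *
            W x (Function.update lab e k'))
        - (∑ e ∈ S, ∑ k', (∑ k, christoffel B.g x k' a k * christoffel B.g x k b (lab e)) *
            W x (Function.update lab e k')) := by
    rw [← Finset.sum_neg_distrib, ← Finset.sum_add_distrib, ← Finset.sum_add_distrib,
      ← Finset.sum_sub_distrib]
    refine Finset.sum_congr rfl fun e _ => ?_
    rw [← Finset.sum_neg_distrib, ← Finset.sum_add_distrib, ← Finset.sum_add_distrib,
      ← Finset.sum_sub_distrib]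
    refine Finset.sum_congr rfl fun k _ => ?_
    rw [riemUp, Finset.sum_sub_distrib]
    ring
  rw [h3]
  ring

/-- The Ricci identity. -/
theorem cov_cov_sub (hx : x ∈ B.U) {T : Tens n} (hT : ∀ l, ContDiffOn ℝ ∞ (fun y => T y l) B.U)
    (a b : Fin n) (l : List (Fin n)) :
    cov B.g (cov B.g T) x (a :: b :: l) - cov B.g (cov B.g T) x (b :: a :: l)
      = ∑ p : Fin l.length, ∑ k, riemUp B.g x a b k (l.get p) * T x (l.set p k) := by
  set W : (Fin n → ℝ) → (Fin l.length → Fin n) → ℝ :=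
    fun y lab => T y ((List.finRange l.length).map lab) with hWdef
  have hcov : ∀ y i lab, cov B.g T y (i :: (List.finRange l.length).map lab)
      = labelCov B.g Finset.univ i W y lab := by
    intro y i lab
    have := labelCov_list B (x := y) T (List.nodup_finRange l.length) i lab
    rw [List.toFinset_finRange] at this
    exact this.symm
  have h : ∀ a b, cov B.g (cov B.g T) x (a :: b :: l)
      = labelCov B.g Finset.univ a (labelCov B.g Finset.univ b W) x l.get
        - ∑ k, christoffel B.g x k a b * cov B.g T x (k :: l) := by
    intro a b
    have e1 : cov B.g (cov B.g T) x (a :: b :: l) = pd a (fun y => cov B.g T y (b :: l)) x -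
        ((∑ k, christoffel B.g x k a b * cov B.g T x (k :: l)) + ∑ p : Fin l.length, ∑ k,
          christoffel B.g x k a (l.get p) * cov B.g T x (b :: l.set p k)) := by
      conv_lhs => rw [cov]
      congr 1
      exact Fin.sum_univ_succ (n := l.length) fun p => ∑ k,
        christoffel B.g x k a ((b :: l).get p) * cov B.g T x ((b :: l).set p k)
    have e2 : labelCov B.g Finset.univ a (labelCov B.g Finset.univ b W) x l.get
        = pd a (fun y => cov B.g T y (b :: l)) x - ∑ p : Fin l.length, ∑ k,
          christoffel B.g x k a (l.get p) * cov B.g T x (b :: l.set p k) := by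
      have e3 : labelCov B.g Finset.univ b W
          = fun y lab => cov B.g T y (b :: (List.finRange l.length).map lab) := by
        funext y lab; exact (hcov y b lab).symm
      rw [e3]
      unfold labelCov
      simp only [List.map_get_finRange]
      congr 1
      rw [Finset.sum_comm, Finset.sum_comm (s := (Finset.univ : Finset (Fin l.length)))]
      refine Finset.sum_congr rfl fun k _ => ?_
      exact (sum_get_set_finRange l k
        fun j l' => christoffel B.g x k a j * cov B.g T x (b :: l')).symm
    rw [e1, e2]
    ring
  rw [h a b, h b a]
  have h4 := labelCov_labelCov B hx Finset.univ a b (W := W) (fun lab => hT _) l.get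
  have h5 : ∑ p : Fin l.length, ∑ k, riemUp B.g x a b k (l.get p) * T x (l.set p k)
      = ∑ e : Fin l.length, ∑ k, riemUp B.g x a b k (l.get e) *
          W x (Function.update l.get e k) := by
    rw [Finset.sum_comm, Finset.sum_comm (s := (Finset.univ : Finset (Fin l.length)))]
    refine Finset.sum_congr rfl fun k _ => ?_
    exact sum_get_set_finRange l k fun j l' => riemUp B.g x a b k j * T x l'
  rw [h5, ← h4]
  simp only [B.christoffel_symm hx _ a b]
  ring

end Commutator

section CurvatureIdentities

variable {n s : ℕ} (B : Background n s) {x : Fin n → ℝ}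

/-- The metric as a tensor. -/
def metricTensor {n : ℕ} (g : (Fin n → ℝ) → Matrix (Fin n) (Fin n) ℝ) : Tens n
  | x, [i, j] => g x i j
  | _, _ => 0

theorem smooth_metricTensor :
    ∀ l : List (Fin n), ContDiffOn ℝ ∞ (fun y => metricTensor B.g y l) B.U
  | [] => contDiffOn_const
  | [_] => contDiffOn_const
  | _ :: _ :: _ :: _ => contDiffOn_const
  | [_, _] => B.smooth_g _ _

theorem cov_metricTensor (hx : x ∈ B.U) (i j k : Fin n) :
    cov B.g (metricTensor B.g) x [i, j, k] = 0 := by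
  simp [cov, metricTensor, Fin.sum_univ_succ, B.pd_g hx]

theorem riem_antisymm_left (i j k l : Fin n) :
    riem B.g x [i, j, k, l] = - riem B.g x [j, i, k, l] := by
  rw [riem_eq, riem_eq, ← Finset.sum_neg_distrib]
  refine Finset.sum_congr rfl fun p _ => ?_
  simp only [riemUp, Finset.sum_sub_distrib]
  ring

theorem riem_bianchi (hx : x ∈ B.U) (i j k l : Fin n) :
    riem B.g x [i, j, k, l] + riem B.g x [j, l, k, i] + riem B.g x [l, i, k, j] = 0 := by
  simp only [riem_eq, ← Finset.sum_add_distrib, ← mul_add]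
  refine Finset.sum_eq_zero fun p _ => ?_
  have h : ∀ a b c : Fin n, pd a (fun y => christoffel B.g y p b c) x
      = pd a (fun y => christoffel B.g y p c b) x := fun a b c =>
    pd_congr B.isOpen hx a fun y hy => B.christoffel_symm hy p b c
  simp only [riemUp, Finset.sum_sub_distrib]
  rw [h i l j, h j i l, h l j i]
  simp only [B.christoffel_symm hx _ l j, B.christoffel_symm hx _ i l, B.christoffel_symm hx _ j i]
  ring

theorem riem_antisymm_right (hx : x ∈ B.U) (i j k l : Fin n) :
    riem B.g x [i, j, k, l] = - riem B.g x [i, j, l, k] := by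
  have h0 : ∀ a b : Fin n, cov B.g (cov B.g (metricTensor B.g)) x [a, b, k, l] = 0 := by
    intro a b
    rw [cov, pd_congr B.isOpen hx a fun y hy => cov_metricTensor B hy b k l, pd_const]
    simp [Fin.sum_univ_succ, cov_metricTensor B hx]
  have h := cov_cov_sub B hx (smooth_metricTensor B) i j [k, l]
  rw [h0, h0] at h
  simp [Fin.sum_univ_succ, metricTensor] at h
  rw [riem_eq, riem_eq]
  have e1 : ∑ p, B.g x k p * riemUp B.g x i j p l = ∑ p, riemUp B.g x i j p l * B.g x k p :=
    Finset.sum_congr rfl fun _ _ => mul_comm _ _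
  have e2 : ∑ p, B.g x l p * riemUp B.g x i j p k = ∑ p, riemUp B.g x i j p k * B.g x p l :=
    Finset.sum_congr rfl fun p _ => by rw [B.g_symm hx l p, mul_comm]
  rw [e1, e2]
  linarith

theorem riem_pair_symm (hx : x ∈ B.U) (i j k l : Fin n) :
    riem B.g x [i, j, k, l] = riem B.g x [k, l, i, j] := by
  have b := riem_bianchi B hx
  have r := riem_antisymm_right B hx
  have m := riem_antisymm_left B (x := x)
  linarith [b i j k l, b i j l k, b i k j l, b j k i l, r j l k i, m l i k j, r i l k j,
    r i j l k, r j k l i, m k i l j, r i k l j, r k l j i, m l i j k, m l j i k]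

/-- The second Bianchi identity. -/
theorem cov_riem_bianchi (hx : x ∈ B.U) (a b c k l : Fin n) :
    cov B.g (riem B.g) x [a, b, c, k, l] + cov B.g (riem B.g) x [b, c, a, k, l]
      + cov B.g (riem B.g) x [c, a, b, k, l] = 0 := by
  -- connection matrices, and their first and second derivatives
  let A : Fin n → Matrix (Fin n) (Fin n) ℝ := fun i => Matrix.of fun p q => christoffel B.g x p i q
  let D : Fin n → Fin n → Matrix (Fin n) (Fin n) ℝ := fun i j =>
    Matrix.of fun p q => pd i (fun y => christoffel B.g y p j q) x
  let DD : Fin n → Fin n → Fin n → Matrix (Fin n) (Fin n) ℝ := fun i j k =>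
    Matrix.of fun p q => pd i (pd j fun y => christoffel B.g y p k q) x
  have hDD : ∀ i j k, DD i j k = DD j i k := fun i j k => by
    ext p q; exact pd_comm B.isOpen hx i j (B.smooth_christoffel p k q)
  let F : Fin n → Fin n → Matrix (Fin n) (Fin n) ℝ := fun i j =>
    -(D i j - D j i + A i * A j - A j * A i)
  let F' : Fin n → Fin n → Fin n → Matrix (Fin n) (Fin n) ℝ := fun i b c =>
    -(DD i b c - DD i c b + (D i b * A c + A b * D i c) - (D i c * A b + A c * D i b))
  have hF : ∀ i j p q, riemUp B.g x i j p q = F i j p q := by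
    intro i j p q
    simp [riemUp, F, A, D, Matrix.mul_apply, Finset.sum_sub_distrib]
    ring
  have dΓ : ∀ k i j, DifferentiableAt ℝ (fun y => christoffel B.g y k i j) x :=
    fun k i j => differentiableAt_of_smooth B.isOpen (B.smooth_christoffel k i j) hx
  have dpΓ : ∀ a k i j, DifferentiableAt ℝ (pd a fun y => christoffel B.g y k i j) x :=
    fun a k i j => differentiableAt_of_smooth B.isOpen
      (pd_smooth B.isOpen a (B.smooth_christoffel k i j)) hx
  have dg : ∀ i j, DifferentiableAt ℝ (fun y => B.g y i j) x :=
    fun i j => differentiableAt_of_smooth B.isOpen (B.smooth_g i j) hx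
  have dS : ∀ b c p q, DifferentiableAt ℝ
      (fun y => ∑ m, christoffel B.g y p b m * christoffel B.g y m c q) x := fun b c p q =>
    DifferentiableAt.fun_sum fun m _ => (dΓ _ _ _).fun_mul (dΓ _ _ _)
  have eS : ∀ b c p q y, riemUp B.g y b c p q = -(pd b (fun y => christoffel B.g y p c q) y -
      pd c (fun y => christoffel B.g y p b q) y +
      ((∑ m, christoffel B.g y p b m * christoffel B.g y m c q)
        - ∑ m, christoffel B.g y p c m * christoffel B.g y m b q)) := by
    intro b c p q y
    rw [riemUp, Finset.sum_sub_distrib]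
  have dR : ∀ b c p q, DifferentiableAt ℝ (fun y => riemUp B.g y b c p q) x := by
    intro b c p q
    simp only [eS]
    exact (((dpΓ _ _ _ _).fun_sub (dpΓ _ _ _ _)).fun_add ((dS _ _ _ _).fun_sub (dS _ _ _ _))).fun_neg
  have hF' : ∀ i b c p q, pd i (fun y => riemUp B.g y b c p q) x = F' i b c p q := by
    intro i b c p q
    have pS : ∀ b c, pd i (fun y => ∑ m, christoffel B.g y p b m * christoffel B.g y m c q) x
        = (D i b * A c + A b * D i c) p q := by
      intro b c
      rw [pd_sum i _ fun m _ => (dΓ _ _ _).fun_mul (dΓ _ _ _)]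
      simp only [pd_mul i (dΓ _ _ _) (dΓ _ _ _), Finset.sum_add_distrib, Matrix.add_apply,
        Matrix.mul_apply]
      rfl
    simp only [eS]
    rw [pd_neg, pd_add i ((dpΓ _ _ _ _).fun_sub (dpΓ _ _ _ _)) ((dS _ _ _ _).fun_sub (dS _ _ _ _)),
      pd_sub i (dpΓ _ _ _ _) (dpΓ _ _ _ _), pd_sub i (dS _ _ _ _) (dS _ _ _ _), pS, pS]
    simp only [F', Matrix.neg_apply, Matrix.add_apply, Matrix.sub_apply]
    simp only [DD, Matrix.of_apply]
    ring
  have key : ∀ a b c, cov B.g (riem B.g) x [a, b, c, k, l]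
      = (∑ p, B.g x k p * (F' a b c + (A a * F b c - F b c * A a)) p l)
        - (∑ m, christoffel B.g x m a b * riem B.g x [m, c, k, l])
        - ∑ m, christoffel B.g x m a c * riem B.g x [b, m, k, l] := by
    intro a b c
    have h1 : pd a (fun y => riem B.g y [b, c, k, l]) x
        = (∑ p, B.g x k p * F' a b c p l) + (∑ m, christoffel B.g x m a k * riem B.g x [b, c, m, l])
          + ∑ p, B.g x k p * (A a * F b c) p l := by
      simp only [riem_eq]
      rw [pd_sum a _ fun p _ => (dg k p).fun_mul (dR _ _ _ _)]
      simp only [pd_mul a (dg _ _) (dR _ _ _ _), B.pd_g hx, hF, hF', Finset.sum_add_distrib,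
        add_mul, Finset.mul_sum, Finset.sum_mul, Matrix.mul_apply]
      rw [add_comm, add_assoc]
      congr 2
      · rw [Finset.sum_comm]
        exact Finset.sum_congr rfl fun _ _ => Finset.sum_congr rfl fun _ _ => by ring
      · rw [Finset.sum_comm]
        refine Finset.sum_congr rfl fun _ _ => Finset.sum_congr rfl fun _ _ => ?_
        simp only [A, Matrix.of_apply]
        ring
    have h2 : ∑ m, christoffel B.g x m a l * riem B.g x [b, c, k, m]
        = ∑ p, B.g x k p * (F b c * A a) p l := by
      simp only [riem_eq, hF, Finset.mul_sum, Matrix.mul_apply]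
      rw [Finset.sum_comm]
      refine Finset.sum_congr rfl fun _ _ => Finset.sum_congr rfl fun _ _ => ?_
      simp only [A, Matrix.of_apply]
      ring
    have h3 : cov B.g (riem B.g) x [a, b, c, k, l] = pd a (fun y => riem B.g y [b, c, k, l]) x
        - ((∑ m, christoffel B.g x m a b * riem B.g x [m, c, k, l])
        + ((∑ m, christoffel B.g x m a c * riem B.g x [b, m, k, l])
        + ((∑ m, christoffel B.g x m a k * riem B.g x [b, c, m, l])
        + ∑ m, christoffel B.g x m a l * riem B.g x [b, c, k, m]))) := by
      simp [cov, Fin.sum_univ_succ]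
    rw [h3, h1, h2]
    simp only [Matrix.add_apply, Matrix.sub_apply, mul_add, mul_sub, Finset.sum_add_distrib,
      Finset.sum_sub_distrib]
    ring
  have hcyc : (F' a b c + (A a * F b c - F b c * A a)) + (F' b c a + (A b * F c a - F c a * A b))
      + (F' c a b + (A c * F a b - F a b * A c)) = 0 := by
    simp only [F, F', hDD b a c, hDD c a b, hDD c b a]
    noncomm_ring
  have hs := fun m i => B.christoffel_symm hx m i
  have h0 : ∑ p, B.g x k p * ((F' a b c + (A a * F b c - F b c * A a))
      + (F' b c a + (A b * F c a - F c a * A b)) + (F' c a b + (A c * F a b - F a b * A c))) p l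
      = 0 := by
    rw [hcyc]; simp
  have hm : ∀ i j p q, ∑ m, christoffel B.g x m i j * riem B.g x [p, m, k, q]
      = - ∑ m, christoffel B.g x m j i * riem B.g x [m, p, k, q] := by
    intro i j p q
    rw [← Finset.sum_neg_distrib]
    refine Finset.sum_congr rfl fun m _ => ?_
    rw [riem_antisymm_left B p m, B.christoffel_symm hx m i j]
    ring
  rw [key, key, key, hm a c, hm b a, hm c b]
  simp only [Matrix.add_apply _ (F' c a b + _), Matrix.add_apply (F' a b c + _), mul_add,
    Finset.sum_add_distrib] at h0 ⊢
  linarith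

theorem ricci_symm (hx : x ∈ B.U) (i k : Fin n) : ricci B.g x [i, k] = ricci B.g x [k, i] := by
  simp only [ricci]
  rw [Finset.sum_comm]
  refine Finset.sum_congr rfl fun l _ => Finset.sum_congr rfl fun j _ => ?_
  rw [B.ginv_symm hx j l, riem_pair_symm B hx i j k l]

theorem iterCov_succ (m : ℕ) (T : Tens n) :
    iterCov B.g (m + 1) T = cov B.g (iterCov B.g m T) :=
  Function.iterate_succ_apply' _ _ _

/-- A linear relation between the components of `T` with permuted indices persists for the
components of its iterated covariant derivatives. -/
theorem iterCov_relation {E : Type} [DecidableEq E] {ι : Type*} (I : Finset ι) (c : ι → ℝ)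
    {T : Tens n} (hT : ∀ l, ContDiffOn ℝ ∞ (fun y => T y l) B.U) (S : Finset E) (e : ι → List E)
    (he : ∀ k ∈ I, (e k).Nodup ∧ (e k).toFinset = S)
    (h : ∀ y ∈ B.U, ∀ lab : E → Fin n, ∑ k ∈ I, c k * T y ((e k).map lab) = 0) (m : ℕ) :
    ∀ y ∈ B.U, ∀ (pre : List (Fin n)), pre.length = m → ∀ lab : E → Fin n,
      ∑ k ∈ I, c k * iterCov B.g m T y (pre ++ (e k).map lab) = 0 := by
  induction m with
  | zero =>
    intro y hy pre hpre lab
    rw [List.length_eq_zero_iff.1 hpre]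
    exact h y hy lab
  | succ m ih =>
    intro y hy pre hpre lab
    match pre, hpre with
    | i :: pre, hpre =>
      have hpre : pre.length = m := by simpa using hpre
      subst hpre
      -- label the first indices as well
      let e' : ι → List (Fin pre.length ⊕ E) := fun k =>
        (List.finRange pre.length).map Sum.inl ++ (e k).map Sum.inr
      let lab' : Fin pre.length ⊕ E → Fin n := Sum.elim pre.get lab
      have hl : ∀ k, pre ++ (e k).map lab = (e' k).map lab' := by
        intro k
        simp only [e', List.map_append, List.map_map]
        congr 1
        exact (List.map_get_finRange pre).symm
      have hnd : ∀ k ∈ I, (e' k).Nodup := by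
        intro k hk
        refine List.Nodup.append ((List.nodup_finRange _).map Sum.inl_injective)
          ((he k hk).1.map Sum.inr_injective) ?_
        simp [List.Disjoint]
      have hS : ∀ k ∈ I, (e' k).toFinset = Finset.univ.disjSum S := by
        intro k hk
        ext z
        rw [← (he k hk).2]
        rcases z with z | z <;> simp [e']
      have h1 : ∀ k ∈ I, cov B.g (iterCov B.g pre.length T) y (i :: (e' k).map lab')
          = labelCov B.g (Finset.univ.disjSum S) i
            (fun z lab => iterCov B.g pre.length T z ((e' k).map lab)) y lab' := by
        intro k hk
        rw [← hS k hk, labelCov_list B _ (hnd k hk)]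
      simp only [List.cons_append, iterCov_succ, hl]
      rw [Finset.sum_congr rfl fun k hk => by rw [h1 k hk]]
      rw [← labelCov_sum B hy _ i I c (fun k lab => B.smooth_iterCov hT _ _),
        labelCov_congr B hy _ i (W := fun _ _ => 0)]
      · simp [labelCov, pd_const]
      · intro z hz lab
        have := ih z hz ((List.finRange pre.length).map (lab ∘ Sum.inl)) (by simp) (lab ∘ Sum.inr)
        simpa [e', List.map_append, List.map_map, Function.comp_def] using this

/-! Symmetries of the derivatives of the curvature. -/

theorem iterCov_riem_antisymm_left (hx : x ∈ B.U) (pre : List (Fin n)) (i j k l : Fin n) :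
    iterCov B.g pre.length (riem B.g) x (pre ++ [i, j, k, l])
      = - iterCov B.g pre.length (riem B.g) x (pre ++ [j, i, k, l]) := by
  have := iterCov_relation B Finset.univ (fun _ : Fin 2 => 1) B.smooth_riem Finset.univ
    ![[(0 : Fin 4), 1, 2, 3], [1, 0, 2, 3]] (by decide)
    (fun y hy lab => by simp [riem_antisymm_left B (lab 0)]) _ x hx pre rfl ![i, j, k, l]
  simp at this
  linarith

theorem iterCov_riem_antisymm_right (hx : x ∈ B.U) (pre : List (Fin n)) (i j k l : Fin n) :
    iterCov B.g pre.length (riem B.g) x (pre ++ [i, j, k, l])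
      = - iterCov B.g pre.length (riem B.g) x (pre ++ [i, j, l, k]) := by
  have := iterCov_relation B Finset.univ (fun _ : Fin 2 => 1) B.smooth_riem Finset.univ
    ![[(0 : Fin 4), 1, 2, 3], [0, 1, 3, 2]] (by decide)
    (fun y hy lab => by simp [riem_antisymm_right B hy _ _ (lab 2)]) _ x hx pre rfl ![i, j, k, l]
  simp at this
  linarith

theorem iterCov_riem_pair_symm (hx : x ∈ B.U) (pre : List (Fin n)) (i j k l : Fin n) :
    iterCov B.g pre.length (riem B.g) x (pre ++ [i, j, k, l])
      = iterCov B.g pre.length (riem B.g) x (pre ++ [k, l, i, j]) := by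
  have := iterCov_relation B Finset.univ ![1, -1] B.smooth_riem Finset.univ
    ![[(0 : Fin 4), 1, 2, 3], [2, 3, 0, 1]] (by decide)
    (fun y hy lab => by simp [riem_pair_symm B hy (lab 0)]) _ x hx pre rfl ![i, j, k, l]
  simp at this
  linarith

theorem iterCov_riem_bianchi (hx : x ∈ B.U) (pre : List (Fin n)) (i j k l : Fin n) :
    iterCov B.g pre.length (riem B.g) x (pre ++ [i, j, k, l])
      + iterCov B.g pre.length (riem B.g) x (pre ++ [j, l, k, i])
      + iterCov B.g pre.length (riem B.g) x (pre ++ [l, i, k, j]) = 0 := by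
  have := iterCov_relation B Finset.univ (fun _ : Fin 3 => 1) B.smooth_riem Finset.univ
    ![[(0 : Fin 4), 1, 2, 3], [1, 3, 2, 0], [3, 0, 2, 1]] (by decide)
    (fun y hy lab => by
      have := riem_bianchi B hy (lab 0) (lab 1) (lab 2) (lab 3)
      simp [Fin.sum_univ_succ]; linarith) _ x hx pre rfl ![i, j, k, l]
  simp [Fin.sum_univ_succ] at this
  linarith

theorem iterCov_iterCov (k m : ℕ) (T : Tens n) :
    iterCov B.g k (iterCov B.g m T) = iterCov B.g (k + m) T :=
  (Function.iterate_add_apply _ _ _ _).symm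

theorem iterCov_riem_bianchi_second (hx : x ∈ B.U) (pre : List (Fin n)) (a b c k l : Fin n) :
    iterCov B.g (pre.length + 1) (riem B.g) x (pre ++ [a, b, c, k, l])
      + iterCov B.g (pre.length + 1) (riem B.g) x (pre ++ [b, c, a, k, l])
      + iterCov B.g (pre.length + 1) (riem B.g) x (pre ++ [c, a, b, k, l]) = 0 := by
  have := iterCov_relation B Finset.univ (fun _ : Fin 3 => 1)
    (B.smooth_iterCov B.smooth_riem 1) Finset.univ
    ![[(0 : Fin 5), 1, 2, 3, 4], [1, 2, 0, 3, 4], [2, 0, 1, 3, 4]] (by decide)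
    (fun y hy lab => by
      have := cov_riem_bianchi B hy (lab 0) (lab 1) (lab 2) (lab 3) (lab 4)
      simp [Fin.sum_univ_succ, iterCov]; linarith) _ x hx pre rfl ![a, b, c, k, l]
  simp [Fin.sum_univ_succ, iterCov_iterCov] at this
  linarith

theorem iterCov_ricci_symm (hx : x ∈ B.U) (pre : List (Fin n)) (i k : Fin n) :
    iterCov B.g pre.length (ricci B.g) x (pre ++ [i, k])
      = iterCov B.g pre.length (ricci B.g) x (pre ++ [k, i]) := by
  have := iterCov_relation B Finset.univ ![1, -1] B.smooth_ricci Finset.univ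
    ![[(0 : Fin 2), 1], [1, 0]] (by decide)
    (fun y hy lab => by simp [ricci_symm B hy (lab 0)]) _ x hx pre rfl ![i, k]
  simp at this
  linarith

theorem sum_pairs_unit (F : (Unit × Bool → Fin n) → ℝ) :
    ∑ α : Unit × Bool → Fin n, F α
      = ∑ j, ∑ l, F (fun p => if p.2 then l else j) := by
  rw [← Fintype.sum_prod_type']
  refine Fintype.sum_equiv
    ⟨fun α => (α ((), false), α ((), true)), fun z p => if p.2 then z.2 else z.1, ?_, ?_⟩ _ _ ?_
  · intro α
    funext p
    rcases p with ⟨⟨⟩, _ | _⟩ <;> rfl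
  · rintro ⟨j, l⟩; rfl
  · intro α
    congr 1
    funext p
    rcases p with ⟨⟨⟩, _ | _⟩ <;> rfl

theorem iterCov_ricci (m : ℕ) : ∀ x ∈ B.U, ∀ (pre : List (Fin n)), pre.length = m → ∀ b c : Fin n,
    iterCov B.g m (ricci B.g) x (pre ++ [b, c])
      = ∑ j, ∑ l, (B.g x)⁻¹ j l * iterCov B.g m (riem B.g) x (pre ++ [b, j, c, l]) := by
  induction m with
  | zero =>
    intro x hx pre hpre b c
    rw [List.length_eq_zero_iff.1 hpre]
    rfl
  | succ m ih =>
    intro x hx pre hpre b c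
    match pre, hpre with
    | i :: pre, hpre =>
      have hpre : pre.length = m := by simpa using hpre
      subst hpre
      let e : List (Fin pre.length ⊕ Bool) :=
        (List.finRange pre.length).map Sum.inl ++ [Sum.inr false, Sum.inr true]
      let e' : List ((Fin pre.length ⊕ Bool) ⊕ Unit × Bool) :=
        (List.finRange pre.length).map (fun k => Sum.inl (Sum.inl k)) ++
          [Sum.inl (Sum.inr false), Sum.inr ((), false), Sum.inl (Sum.inr true), Sum.inr ((), true)]
      let lab : Fin pre.length ⊕ Bool → Fin n := Sum.elim pre.get fun z => if z then c else b
      have hnd : e.Nodup := by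
        refine List.Nodup.append ((List.nodup_finRange _).map Sum.inl_injective) (by simp) ?_
        simp [List.Disjoint]
      have hnd' : e'.Nodup := by
        refine List.Nodup.append ((List.nodup_finRange _).map
          (Sum.inl_injective.comp Sum.inl_injective)) (by simp) ?_
        simp [List.Disjoint]
      have hS : e.toFinset = Finset.univ := by
        ext z; rcases z with z | z <;> simp [e]
      have hS' : e'.toFinset = (Finset.univ : Finset (Fin pre.length ⊕ Bool)).disjSum Finset.univ := by
        ext z
        rcases z with (z | z) | ⟨⟨⟩, z⟩ <;> simp [e']
      have hl : pre ++ [b, c] = e.map lab := by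
        simp only [e, List.map_append, List.map_map, lab]
        congr 1
        exact (List.map_get_finRange pre).symm
      simp only [List.cons_append, iterCov_succ]
      rw [hl, ← labelCov_list B _ hnd, hS, labelCov_congr B hx _ i
        (W := fun y lab => ∑ α : Unit × Bool → Fin n,
          (∏ j, (B.g y)⁻¹ (α (j, false)) (α (j, true))) *
            iterCov B.g pre.length (riem B.g) y (e'.map (Sum.elim lab α))),
        labelCov_contract B hx _ i (W := fun y lab => iterCov B.g pre.length (riem B.g) y (e'.map lab))
          (fun lab => B.smooth_iterCov B.smooth_riem _ _), ← hS', sum_pairs_unit]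
      · refine Finset.sum_congr rfl fun j _ => Finset.sum_congr rfl fun l _ => ?_
        rw [labelCov_list B _ hnd']
        simp only [e', List.map_append, List.map_map, lab, Function.comp_def]
        simp
      · intro y hy lab
        have := ih y hy ((List.finRange pre.length).map (lab ∘ Sum.inl)) (by simp)
          (lab (Sum.inr false)) (lab (Sum.inr true))
        rw [sum_pairs_unit]
        simpa [e, e', Function.comp_def] using this

/-- The contracted second Bianchi identity, before the last contraction. -/
theorem iterCov_ricci_sub (hx : x ∈ B.U) (pre : List (Fin n)) (a b c : Fin n) :
    iterCov B.g (pre.length + 1) (ricci B.g) x (pre ++ [a, b, c])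
      - iterCov B.g (pre.length + 1) (ricci B.g) x (pre ++ [b, a, c])
      = - ∑ j, ∑ l, (B.g x)⁻¹ j l *
          iterCov B.g (pre.length + 1) (riem B.g) x (pre ++ [j, a, b, c, l]) := by
  have h1 := fun a b => iterCov_ricci B (pre.length + 1) x hx (pre ++ [a]) (by simp) b c
  simp only [List.append_assoc, List.cons_append, List.nil_append] at h1
  rw [h1 a b, h1 b a, ← Finset.sum_sub_distrib, ← Finset.sum_neg_distrib]
  refine Finset.sum_congr rfl fun j _ => ?_
  rw [← Finset.sum_sub_distrib, ← Finset.sum_neg_distrib]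
  refine Finset.sum_congr rfl fun l _ => ?_
  have h2 := iterCov_riem_bianchi_second B hx pre a b j c l
  have h3 := iterCov_riem_antisymm_left B hx (pre ++ [b]) a j c l
  simp only [List.append_assoc, List.cons_append, List.nil_append, List.length_append,
    List.length_cons, List.length_nil, zero_add] at h3
  rw [h3]
  linear_combination ((B.g x)⁻¹ j l) * h2

theorem sum_comm_four (F : Fin n → Fin n → Fin n → Fin n → ℝ) :
    ∑ a, ∑ b, ∑ j, ∑ l, F a b j l = ∑ j, ∑ l, ∑ a, ∑ b, F a b j l := by
  calc _ = ∑ a, ∑ j, ∑ b, ∑ l, F a b j l := Finset.sum_congr rfl fun a _ => Finset.sum_comm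
    _ = ∑ j, ∑ a, ∑ l, ∑ b, F a b j l := by
      rw [Finset.sum_comm]
      exact Finset.sum_congr rfl fun j _ => Finset.sum_congr rfl fun a _ => Finset.sum_comm
    _ = _ := Finset.sum_congr rfl fun j _ => Finset.sum_comm

/-- The contracted second Bianchi identity `∇_i R = 2 ∇^a Ric_{ia}`. -/
theorem cov_scalar_curvature (hx : x ∈ B.U) (i : Fin n) :
    ∑ a, ∑ b, (B.g x)⁻¹ a b * cov B.g (ricci B.g) x [i, a, b]
      = 2 * ∑ a, ∑ b, (B.g x)⁻¹ a b * cov B.g (ricci B.g) x [a, i, b] := by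
  have h1 := fun a b => iterCov_ricci_sub B hx [] i a b
  simp only [List.length_nil, zero_add, List.nil_append, iterCov_succ] at h1
  simp only [iterCov, Function.iterate_zero, id_eq] at h1
  have h2 : (∑ a, ∑ b, (B.g x)⁻¹ a b * cov B.g (ricci B.g) x [i, a, b])
      - ∑ a, ∑ b, (B.g x)⁻¹ a b * cov B.g (ricci B.g) x [a, i, b]
      = - ∑ a, ∑ b, ∑ j, ∑ l, (B.g x)⁻¹ a b * ((B.g x)⁻¹ j l *
          cov B.g (riem B.g) x [j, i, a, b, l]) := by
    simp only [← Finset.sum_sub_distrib, ← Finset.sum_neg_distrib, ← mul_sub, h1, mul_neg,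
      Finset.mul_sum]
  have h3 : ∀ j l, ∑ a, ∑ b, (B.g x)⁻¹ a b * cov B.g (riem B.g) x [j, i, a, b, l]
      = - cov B.g (ricci B.g) x [j, i, l] := by
    intro j l
    have h4 := iterCov_ricci B 1 x hx [j] rfl i l
    have h5 := fun a b => iterCov_riem_antisymm_right B hx [j] i a b l
    simp only [iterCov, List.length_singleton, Function.iterate_succ, Function.iterate_zero,
      Function.comp_def, id_eq, List.cons_append, List.nil_append] at h4 h5
    rw [h4, ← Finset.sum_neg_distrib]
    refine Finset.sum_congr rfl fun a _ => ?_
    rw [← Finset.sum_neg_distrib]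
    exact Finset.sum_congr rfl fun b _ => by rw [h5]; ring
  have h6 : ∑ a, ∑ b, ∑ j, ∑ l, (B.g x)⁻¹ a b * ((B.g x)⁻¹ j l *
          cov B.g (riem B.g) x [j, i, a, b, l])
      = - ∑ j, ∑ l, (B.g x)⁻¹ j l * cov B.g (ricci B.g) x [j, i, l] := by
    have : ∀ j l, (B.g x)⁻¹ j l * cov B.g (ricci B.g) x [j, i, l]
        = - ∑ a, ∑ b, (B.g x)⁻¹ a b * ((B.g x)⁻¹ j l * cov B.g (riem B.g) x [j, i, a, b, l]) := by
      intro j l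
      rw [← neg_eq_iff_eq_neg.2 (h3 j l), mul_neg, Finset.mul_sum]
      congr 1
      refine Finset.sum_congr rfl fun a _ => ?_
      rw [Finset.mul_sum]
      exact Finset.sum_congr rfl fun b _ => by ring
    simp only [this, Finset.sum_neg_distrib, neg_neg]
    exact sum_comm_four _
  rw [h6] at h2
  linarith

end CurvatureIdentities

/-! ### Partial contractions with labelled free indices -/

/-- Scalar-valued expressions in the metric and the functions of a background, a point, and the
values of indices labelled by `E`. -/
abbrev LFun (n s : ℕ) (E : Type) : Type :=
  Background n s → (Fin n → ℝ) → (E → Fin n) → ℝ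

/-- A partial contraction whose free indices are the labels in `S`. Each factor comes with the list
of its indices, an index being either a label or one of the two ends of a contracted pair
`p : P`. -/
structure Net (s : ℕ) (E : Type) (S : Finset E) where
  ι : Type
  [fintypeι : Fintype ι]
  [decEqι : DecidableEq ι]
  P : Type
  [fintypeP : Fintype P]
  [decEqP : DecidableEq P]
  kind : ι → Kind s
  ord : ι → ℕ
  lbl : ι → List (E ⊕ P × Bool)
  len : ∀ i, (lbl i).length = (kind i).rank + ord i
  nodup : ∀ i, (lbl i).Nodup
  disj : ∀ i j z, z ∈ lbl i → z ∈ lbl j → i = j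
  cover : ∀ z, (∃ i, z ∈ lbl i) ↔ z ∈ S.disjSum Finset.univ

attribute [instance] Net.fintypeι Net.decEqι Net.fintypeP Net.decEqP

namespace Net

variable {n s : ℕ} {E : Type} {S : Finset E}

/-- The value of a partial contraction. -/
noncomputable def val (n : ℕ) (N : Net s E S) : LFun n s E := fun B x lab =>
  ∑ α : N.P × Bool → Fin n, (∏ j, (B.g x)⁻¹ (α (j, false)) (α (j, true))) *
    ∏ i, B.factor (N.kind i) (N.ord i) x ((N.lbl i).map (Sum.elim lab α))

/-- The number of factors. -/
def length (N : Net s E S) : ℕ := Fintype.card N.ι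

/-- The number of factors of a given kind. -/
def count (N : Net s E S) (κ : Kind s) : ℕ := (Finset.univ.filter fun i => N.kind i = κ).card

end Net

section Value

variable {n s : ℕ} {E : Type} {S : Finset E}

theorem factor_succ (B : Background n s) (κ : Kind s) (m : ℕ) :
    B.factor κ (m + 1) = cov B.g (B.factor κ m) :=
  iterCov_succ B m _

theorem smooth_contract_term (B : Background n s) {P : Type} [Fintype P] (α : P × Bool → Fin n) :
    ContDiffOn ℝ ∞ (fun y => ∏ j, (B.g y)⁻¹ (α (j, false)) (α (j, true))) B.U :=
  contDiffOn_prod fun _ _ => B.smooth_ginv _ _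

theorem Net.smooth_val (N : Net s E S) (B : Background n s) (lab : E → Fin n) :
    ContDiffOn ℝ ∞ (fun y => N.val n B y lab) B.U :=
  ContDiffOn.sum fun _ _ => (smooth_contract_term B _).mul
    (contDiffOn_prod fun _ _ => B.smooth_factor _ _ _)

/-- The terms of the covariant derivative of a contraction: the factor `i₀` is differentiated, and
the new index gets the label `c`. -/
def Net.bump (N : Net s E S) [DecidableEq E] (c : E) (hc : c ∉ S) (i₀ : N.ι) :
    Net s E (insert c S) where
  ι := N.ι
  P := N.P
  kind := N.kind
  ord := fun i => if i = i₀ then N.ord i + 1 else N.ord i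
  lbl := fun i => if i = i₀ then Sum.inl c :: N.lbl i else N.lbl i
  len := by
    intro i
    split_ifs <;> simp [N.len i, add_assoc]
  nodup := by
    intro i
    split_ifs
    · refine List.nodup_cons.2 ⟨fun h => hc ?_, N.nodup i⟩
      simpa using (N.cover _).1 ⟨i, h⟩
    · exact N.nodup i
  disj := by
    intro i j z hi hj
    have hz : ∀ i, Sum.inl c ∉ N.lbl i := fun i h => hc (by simpa using (N.cover _).1 ⟨i, h⟩)
    split_ifs at hi hj with h1 h2 h2
    · exact h1.trans h2.symm
    · rcases List.mem_cons.1 hi with rfl | hi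
      · exact absurd hj (hz _)
      · exact N.disj i j z hi hj
    · rcases List.mem_cons.1 hj with rfl | hj
      · exact absurd hi (hz _)
      · exact N.disj i j z hi hj
    · exact N.disj i j z hi hj
  cover := by
    intro z
    have h := N.cover z
    constructor
    · rintro ⟨i, hi⟩
      split_ifs at hi
      · rcases List.mem_cons.1 hi with rfl | hi
        · simp
        · have := h.1 ⟨i, hi⟩
          rcases z with z | z <;> simp_all
      · have := h.1 ⟨i, hi⟩
        rcases z with z | z <;> simp_all
    · intro hz
      by_cases hzc : z = Sum.inl c
      · exact ⟨i₀, by simp [hzc]⟩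
      · have : z ∈ S.disjSum Finset.univ := by
          rcases z with z | z
          · simp only [Finset.inl_mem_disjSum, Finset.mem_insert] at hz ⊢
            exact hz.resolve_left fun h => hzc (by rw [h])
          · simp
        obtain ⟨i, hi⟩ := h.2 this
        refine ⟨i, ?_⟩
        split_ifs
        · exact List.mem_cons_of_mem _ hi
        · exact hi

theorem Net.labelCov_val [DecidableEq E] (N : Net s E S) {c : E} (hc : c ∉ S) (B : Background n s)
    {x : Fin n → ℝ} (hx : x ∈ B.U) (lab : E → Fin n) :
    labelCov B.g S (lab c) (N.val n B) x lab = ∑ i₀, (N.bump c hc i₀).val n B x lab := by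
  have h1 := labelCov_contract B hx S (lab c) (P := N.P) (W := fun y lab =>
    ∏ i, B.factor (N.kind i) (N.ord i) y ((N.lbl i).map lab))
    (fun lab => contDiffOn_prod fun _ _ => B.smooth_factor _ _ _) lab
  have hS : Finset.univ.biUnion (fun i => (N.lbl i).toFinset) = S.disjSum Finset.univ := by
    ext z
    rw [← N.cover z]
    simp
  unfold Net.val
  rw [h1]
  change _ = ∑ i₀ : N.ι, ∑ α : N.P × Bool → Fin n,
    (∏ j, (B.g x)⁻¹ (α (j, false)) (α (j, true))) *
      ∏ i : N.ι, B.factor (N.kind i) (if i = i₀ then N.ord i + 1 else N.ord i) x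
        ((if i = i₀ then Sum.inl c :: N.lbl i else N.lbl i).map (Sum.elim lab α))
  rw [Finset.sum_comm]
  refine Finset.sum_congr rfl fun α _ => ?_
  rw [← hS, labelCov_prod B hx (lab c) Finset.univ (fun i => (N.lbl i).toFinset) ?_
    (fun i lab => B.smooth_factor _ _ _) ?_, Finset.mul_sum]
  · refine Finset.sum_congr rfl fun i₀ _ => ?_
    congr 1
    rw [labelCov_list B _ (N.nodup i₀), ← Finset.mul_prod_erase _ _ (Finset.mem_univ i₀), mul_comm]
    congr 1
    · simp [factor_succ]
    · refine Finset.prod_congr rfl fun j hj => ?_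
      simp [Finset.ne_of_mem_erase hj]
  · intro i _ j _ hij
    refine Finset.disjoint_left.2 fun z hi hj => hij ?_
    exact N.disj i j z (by simpa using hi) (by simpa using hj)
  · intro i y lab e he j
    rw [map_update_of_notMem (by simpa using he)]

/-- The product of two partial contractions. -/
def Net.mul [DecidableEq E] {S₁ S₂ : Finset E} (N₁ : Net s E S₁) (N₂ : Net s E S₂)
    (h : Disjoint S₁ S₂) : Net s E (S₁ ∪ S₂) where
  ι := N₁.ι ⊕ N₂.ι
  P := N₁.P ⊕ N₂.P
  kind := Sum.elim N₁.kind N₂.kind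
  ord := Sum.elim N₁.ord N₂.ord
  lbl := Sum.elim (fun i => (N₁.lbl i).map (Sum.map id (Prod.map Sum.inl id)))
    (fun i => (N₂.lbl i).map (Sum.map id (Prod.map Sum.inr id)))
  len := by rintro (i | i) <;> simp [Net.len]
  nodup := by
    rintro (i | i)
    · exact (N₁.nodup i).map (Function.injective_id.sumMap
        (Sum.inl_injective.prodMap Function.injective_id))
    · exact (N₂.nodup i).map (Function.injective_id.sumMap
        (Sum.inr_injective.prodMap Function.injective_id))
  disj := by
    have hd : ∀ i j z, z ∈ N₁.lbl i → ∀ w, w ∈ N₂.lbl j →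
        Sum.map id (Prod.map Sum.inl id) z
          = (Sum.map id (Prod.map Sum.inr id) w : E ⊕ (N₁.P ⊕ N₂.P) × Bool) → False := by
      intro i j z hz w hw hzw
      have h1 := (N₁.cover z).1 ⟨i, hz⟩
      have h2 := (N₂.cover w).1 ⟨j, hw⟩
      rcases z with z | ⟨z, b⟩ <;> rcases w with w | ⟨w, b'⟩ <;> simp at h1 h2 hzw
      subst hzw
      exact Finset.disjoint_left.1 h h1 h2
    rintro (i | i) (j | j) z hi hj <;> simp only [Sum.elim_inl, Sum.elim_inr, List.mem_map] at hi hj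
    · obtain ⟨a, ha, rfl⟩ := hi
      obtain ⟨b, hb, hab⟩ := hj
      rw [(Function.injective_id.sumMap (Sum.inl_injective.prodMap Function.injective_id)) hab] at hb
      exact congrArg _ (N₁.disj i j a ha hb)
    · obtain ⟨a, ha, rfl⟩ := hi
      obtain ⟨b, hb, hab⟩ := hj
      exact (hd i j a ha b hb hab.symm).elim
    · obtain ⟨a, ha, rfl⟩ := hi
      obtain ⟨b, hb, hab⟩ := hj
      exact (hd j i b hb a ha hab).elim
    · obtain ⟨a, ha, rfl⟩ := hi
      obtain ⟨b, hb, hab⟩ := hj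
      rw [(Function.injective_id.sumMap (Sum.inr_injective.prodMap Function.injective_id)) hab] at hb
      exact congrArg _ (N₂.disj i j a ha hb)
  cover := by
    intro z
    constructor
    · rintro ⟨i | i, hi⟩ <;> simp only [Sum.elim_inl, Sum.elim_inr, List.mem_map] at hi <;>
        obtain ⟨a, ha, rfl⟩ := hi
      · have := (N₁.cover a).1 ⟨i, ha⟩
        rcases a with a | a <;> simp_all
      · have := (N₂.cover a).1 ⟨i, ha⟩
        rcases a with a | a <;> simp_all
    · intro hz
      rcases z with z | ⟨z | z, b⟩
      · simp only [Finset.inl_mem_disjSum, Finset.mem_union] at hz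
        rcases hz with hz | hz
        · obtain ⟨i, hi⟩ := (N₁.cover (Sum.inl z)).2 (by simpa using hz)
          exact ⟨Sum.inl i, List.mem_map.2 ⟨_, hi, rfl⟩⟩
        · obtain ⟨i, hi⟩ := (N₂.cover (Sum.inl z)).2 (by simpa using hz)
          exact ⟨Sum.inr i, List.mem_map.2 ⟨_, hi, rfl⟩⟩
      · obtain ⟨i, hi⟩ := (N₁.cover (Sum.inr (z, b))).2 (by simp)
        exact ⟨Sum.inl i, List.mem_map.2 ⟨_, hi, rfl⟩⟩
      · obtain ⟨i, hi⟩ := (N₂.cover (Sum.inr (z, b))).2 (by simp)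
        exact ⟨Sum.inr i, List.mem_map.2 ⟨_, hi, rfl⟩⟩

/-- Index assignments for a disjoint union of sets of pairs. -/
def pairsSumEquiv (P Q : Type) (n : ℕ) :
    ((P ⊕ Q) × Bool → Fin n) ≃ (P × Bool → Fin n) × (Q × Bool → Fin n) where
  toFun α := (fun p => α (Sum.inl p.1, p.2), fun p => α (Sum.inr p.1, p.2))
  invFun z p := Sum.elim (fun j => z.1 (j, p.2)) (fun j => z.2 (j, p.2)) p.1
  left_inv α := by
    funext p
    rcases p with ⟨p | p, b⟩ <;> rfl
  right_inv z := rfl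

@[simp] theorem pairsSumEquiv_fst {P Q : Type} (α : (P ⊕ Q) × Bool → Fin n) (p : P × Bool) :
    (pairsSumEquiv P Q n α).1 p = α (Sum.inl p.1, p.2) := rfl

@[simp] theorem pairsSumEquiv_snd {P Q : Type} (α : (P ⊕ Q) × Bool → Fin n) (p : Q × Bool) :
    (pairsSumEquiv P Q n α).2 p = α (Sum.inr p.1, p.2) := rfl

theorem Net.val_mul [DecidableEq E] {S₁ S₂ : Finset E} (N₁ : Net s E S₁) (N₂ : Net s E S₂)
    (h : Disjoint S₁ S₂) : (N₁.mul N₂ h).val n = N₁.val n * N₂.val n := by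
  funext B x lab
  simp only [Net.val, Pi.mul_apply]
  rw [Finset.sum_mul_sum, ← Fintype.sum_prod_type']
  refine Fintype.sum_equiv (pairsSumEquiv N₁.P N₂.P n) _ _ fun α => ?_
  have h1 : ∀ l : List (E ⊕ N₁.P × Bool), (l.map (Sum.map id (Prod.map Sum.inl id))).map
      (Sum.elim lab α) = l.map (Sum.elim lab (pairsSumEquiv N₁.P N₂.P n α).1) := by
    intro l
    rw [List.map_map]
    refine List.map_congr_left fun z _ => ?_
    rcases z with z | z <;> rfl
  have h2 : ∀ l : List (E ⊕ N₂.P × Bool), (l.map (Sum.map id (Prod.map Sum.inr id))).map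
      (Sum.elim lab α) = l.map (Sum.elim lab (pairsSumEquiv N₁.P N₂.P n α).2) := by
    intro l
    rw [List.map_map]
    refine List.map_congr_left fun z _ => ?_
    rcases z with z | z <;> rfl
  change (∏ j : N₁.P ⊕ N₂.P, (B.g x)⁻¹ (α (j, false)) (α (j, true))) *
    ∏ i : N₁.ι ⊕ N₂.ι, B.factor (Sum.elim N₁.kind N₂.kind i) (Sum.elim N₁.ord N₂.ord i) x
      ((Sum.elim (fun i => (N₁.lbl i).map (Sum.map id (Prod.map Sum.inl id)))
      (fun i => (N₂.lbl i).map (Sum.map id (Prod.map Sum.inr id))) i).map (Sum.elim lab α)) = _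
  rw [Fintype.prod_sum_type, Fintype.prod_sum_type]
  simp only [Sum.elim_inl, Sum.elim_inr, h1, h2, pairsSumEquiv_fst, pairsSumEquiv_snd]
  ring

/-- The relabelling of indices used when further pairs are contracted. -/
def closeLabel {E P Q : Type} : (E ⊕ P × Bool) ⊕ Q × Bool → E ⊕ (P ⊕ Q) × Bool
  | .inl (.inl e) => .inl e
  | .inl (.inr p) => .inr (.inl p.1, p.2)
  | .inr q => .inr (.inr q.1, q.2)

theorem closeLabel_injective {E P Q : Type} :
    Function.Injective (closeLabel : (E ⊕ P × Bool) ⊕ Q × Bool → E ⊕ (P ⊕ Q) × Bool) := by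
  rintro ((a | ⟨a, a'⟩) | ⟨a, a'⟩) ((b | ⟨b, b'⟩) | ⟨b, b'⟩) h <;> simp_all [closeLabel]

/-- Contraction of some of the labels of a partial contraction in pairs. -/
def Net.close {P : Type} [Fintype P] [DecidableEq P]
    (N : Net s (E ⊕ P × Bool) (S.disjSum Finset.univ)) : Net s E S where
  ι := N.ι
  P := P ⊕ N.P
  kind := N.kind
  ord := N.ord
  lbl := fun i => (N.lbl i).map closeLabel
  len := fun i => by simp [N.len]
  nodup := fun i => (N.nodup i).map closeLabel_injective
  disj := by
    intro i j z hi hj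
    obtain ⟨a, ha, rfl⟩ := List.mem_map.1 hi
    obtain ⟨b, hb, hab⟩ := List.mem_map.1 hj
    rw [closeLabel_injective hab] at hb
    exact N.disj i j a ha hb
  cover := by
    intro z
    constructor
    · rintro ⟨i, hi⟩
      obtain ⟨a, ha, rfl⟩ := List.mem_map.1 hi
      have := (N.cover a).1 ⟨i, ha⟩
      rcases a with (a | a) | a <;> simp_all [closeLabel]
    · intro hz
      have : ∃ a : (E ⊕ P × Bool) ⊕ N.P × Bool, closeLabel a = z ∧
          a ∈ (S.disjSum Finset.univ : Finset (E ⊕ P × Bool)).disjSum Finset.univ := by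
        rcases z with z | ⟨z | z, b⟩
        · exact ⟨.inl (.inl z), rfl, by simpa using hz⟩
        · exact ⟨.inl (.inr (z, b)), rfl, by simp⟩
        · exact ⟨.inr (z, b), rfl, by simp⟩
      obtain ⟨a, rfl, ha⟩ := this
      obtain ⟨i, hi⟩ := (N.cover a).2 ha
      exact ⟨i, List.mem_map.2 ⟨a, hi, rfl⟩⟩

theorem Net.val_close {P : Type} [Fintype P] [DecidableEq P]
    (N : Net s (E ⊕ P × Bool) (S.disjSum Finset.univ)) (B : Background n s) (x : Fin n → ℝ)
    (lab : E → Fin n) :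
    N.close.val n B x lab = ∑ α : P × Bool → Fin n,
      (∏ j, (B.g x)⁻¹ (α (j, false)) (α (j, true))) * N.val n B x (Sum.elim lab α) := by
  simp only [Net.val, Finset.mul_sum]
  rw [← Fintype.sum_prod_type']
  refine Fintype.sum_equiv (pairsSumEquiv P N.P n) _ _ fun α => ?_
  have h1 : ∀ l : List ((E ⊕ P × Bool) ⊕ N.P × Bool), (l.map closeLabel).map (Sum.elim lab α)
      = l.map (Sum.elim (Sum.elim lab (pairsSumEquiv P N.P n α).1)
          (pairsSumEquiv P N.P n α).2) := by
    intro l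
    rw [List.map_map]
    refine List.map_congr_left fun z _ => ?_
    rcases z with (z | z) | z <;> rfl
  change (∏ j : P ⊕ N.P, (B.g x)⁻¹ (α (j, false)) (α (j, true))) *
    ∏ i, B.factor (N.kind i) (N.ord i) x (((N.lbl i).map closeLabel).map (Sum.elim lab α)) = _
  rw [Fintype.prod_sum_type]
  simp only [h1, pairsSumEquiv_fst, pairsSumEquiv_snd]
  ring

end Value

section Classes

variable {n s : ℕ} {E : Type} {S : Finset E}

/-- Restriction of an expression to the points of the domain of the background. -/
def onDomain (n s : ℕ) (E : Type) : LFun n s E →ₗ[ℝ]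
    ({z : Background n s × (Fin n → ℝ) // z.2 ∈ z.1.U} → (E → Fin n) → ℝ) where
  toFun W z lab := W z.1.1 z.1.2 lab
  map_add' _ _ := rfl
  map_smul' _ _ := rfl

/-- The expressions that agree, on the domain of every background, with a linear combination of
partial contractions satisfying `p`. -/
noncomputable def cls (n : ℕ) (p : Net s E S → Prop) : Submodule ℝ (LFun n s E) :=
  (Submodule.span ℝ {F | ∃ N, p N ∧ F = onDomain n s E (N.val n)}).comap (onDomain n s E)

theorem mem_cls_congr {p : Net s E S → Prop} {V W : LFun n s E}
    (h : ∀ B, ∀ x ∈ B.U, ∀ lab, V B x lab = W B x lab) (hW : W ∈ cls n p) : V ∈ cls n p := by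
  have : onDomain n s E V = onDomain n s E W := by
    funext z lab
    exact h _ _ z.2 _
  rw [cls, Submodule.mem_comap, this]
  exact hW

theorem mem_cls_of_net {p : Net s E S → Prop} (N : Net s E S) (h : p N) {W : LFun n s E}
    (hW : ∀ B, ∀ x ∈ B.U, ∀ lab, W B x lab = N.val n B x lab) : W ∈ cls n p :=
  mem_cls_congr hW (Submodule.subset_span ⟨N, h, rfl⟩)

theorem mem_cls_of_zero {p : Net s E S → Prop} {W : LFun n s E}
    (hW : ∀ B, ∀ x ∈ B.U, ∀ lab, W B x lab = 0) : W ∈ cls n p :=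
  mem_cls_congr (W := 0) hW (Submodule.zero_mem _)

theorem cls_mono {p q : Net s E S → Prop} (h : ∀ N, p N → q N) : cls n p ≤ cls n q := by
  refine Submodule.comap_mono (Submodule.span_mono ?_)
  rintro _ ⟨N, hN, rfl⟩
  exact ⟨N, h N hN, rfl⟩

theorem mem_cls_iff {p : Net s E S → Prop} {W : LFun n s E} :
    W ∈ cls n p ↔ ∃ (K : ℕ) (c : Fin K → ℝ) (N : Fin K → Net s E S), (∀ k, p (N k)) ∧
      ∀ B, ∀ x ∈ B.U, ∀ lab, W B x lab = ∑ k, c k * (N k).val n B x lab := by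
  constructor
  · intro h
    obtain ⟨K, c, G, hG⟩ := Submodule.mem_span_set'.1 h
    choose N hp hN using fun k => (G k).2
    refine ⟨K, c, N, hp, fun B x hx lab => ?_⟩
    have := congrFun (congrFun hG ⟨(B, x), hx⟩) lab
    simp only [Finset.sum_apply, Pi.smul_apply, smul_eq_mul, hN] at this
    exact this.symm
  · rintro ⟨K, c, N, hp, hN⟩
    refine mem_cls_congr (W := ∑ k, c k • (N k).val n) ?_ (Submodule.sum_mem _ fun k _ =>
      Submodule.smul_mem _ _ (mem_cls_of_net (N k) (hp k) fun _ _ _ _ => rfl))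
    intro B x hx lab
    simpa [Finset.sum_apply] using hN B x hx lab

theorem mul_mem_cls [DecidableEq E] {S₁ S₂ : Finset E} (h : Disjoint S₁ S₂)
    {p₁ : Net s E S₁ → Prop} {p₂ : Net s E S₂ → Prop} {p : Net s E (S₁ ∪ S₂) → Prop}
    (hp : ∀ N₁ N₂, p₁ N₁ → p₂ N₂ → p (N₁.mul N₂ h)) {W₁ W₂ : LFun n s E} (h₁ : W₁ ∈ cls n p₁)
    (h₂ : W₂ ∈ cls n p₂) : W₁ * W₂ ∈ cls n p := by
  obtain ⟨K₁, c₁, N₁, hN₁, e₁⟩ := mem_cls_iff.1 h₁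
  obtain ⟨K₂, c₂, N₂, hN₂, e₂⟩ := mem_cls_iff.1 h₂
  refine mem_cls_congr (W := ∑ k₁, ∑ k₂, (c₁ k₁ * c₂ k₂) • ((N₁ k₁).mul (N₂ k₂) h).val n) ?_
    (Submodule.sum_mem _ fun k₁ _ => Submodule.sum_mem _ fun k₂ _ => Submodule.smul_mem _ _
      (mem_cls_of_net _ (hp _ _ (hN₁ k₁) (hN₂ k₂)) fun _ _ _ _ => rfl))
  intro B x hx lab
  simp only [Pi.mul_apply, e₁ B x hx, e₂ B x hx, Finset.sum_apply, Pi.smul_apply, smul_eq_mul,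
    Net.val_mul, Finset.sum_mul_sum]
  exact Finset.sum_congr rfl fun _ _ => Finset.sum_congr rfl fun _ _ => by ring

/-- The covariant derivative of an expression with free indices in `S`; the new index is labelled
by `c`. -/
noncomputable def LFun.der [DecidableEq E] (S : Finset E) (c : E) (W : LFun n s E) : LFun n s E :=
  fun B x lab => labelCov B.g S (lab c) (W B) x lab

theorem der_mem_cls [DecidableEq E] {c : E} (hc : c ∉ S) {p : Net s E S → Prop}
    {q : Net s E (insert c S) → Prop} (hpq : ∀ N, p N → ∀ i₀, q (N.bump c hc i₀))
    {W : LFun n s E} (h : W ∈ cls n p) : W.der S c ∈ cls n q := by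
  obtain ⟨K, a, N, hN, e⟩ := mem_cls_iff.1 h
  refine mem_cls_congr (W := ∑ k, a k • ∑ i₀, ((N k).bump c hc i₀).val n) ?_
    (Submodule.sum_mem _ fun k _ => Submodule.smul_mem _ _ (Submodule.sum_mem _ fun i₀ _ =>
      mem_cls_of_net _ (hpq _ (hN k) i₀) fun _ _ _ _ => rfl))
  intro B x hx lab
  rw [LFun.der, labelCov_congr B hx S (lab c) (e B),
    labelCov_sum B hx S (lab c) Finset.univ a fun k lab => (N k).smooth_val B lab]
  simp only [Finset.sum_apply, Pi.smul_apply, smul_eq_mul, (N _).labelCov_val hc B hx]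

theorem close_mem_cls {P : Type} [Fintype P] [DecidableEq P]
    {p : Net s (E ⊕ P × Bool) (S.disjSum Finset.univ) → Prop} {q : Net s E S → Prop}
    (hpq : ∀ N, p N → q N.close) {W : LFun n s (E ⊕ P × Bool)} (h : W ∈ cls n p) :
    (fun B x lab => ∑ α : P × Bool → Fin n, (∏ j, (B.g x)⁻¹ (α (j, false)) (α (j, true))) *
      W B x (Sum.elim lab α)) ∈ cls n q := by
  obtain ⟨K, a, N, hN, e⟩ := mem_cls_iff.1 h
  refine mem_cls_iff.2 ⟨K, a, fun k => (N k).close, fun k => hpq _ (hN k), fun B x hx lab => ?_⟩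
  simp only [e B x hx, Net.val_close, Finset.mul_sum]
  rw [Finset.sum_comm]
  exact Finset.sum_congr rfl fun _ _ => Finset.sum_congr rfl fun _ _ => by ring

end Classes

/-! ### Identities modulo longer contractions -/

section Long

variable {n s : ℕ} {E : Type} {S : Finset E}

/-- The kinds `ψ_h`, `Ω` and `υ`. -/
def Kind.IsFun (κ : Kind s) : Prop := κ ≠ .curv ∧ κ ≠ .ric

/-- `χ` counts the factors `∇^{(p)}ψ_h`, `∇^{(p)}Ω` and `∇^{(p)}υ` of a partial contraction. -/
def Net.HasCharge (N : Net s E S) (χ : Kind s → ℕ) : Prop := ∀ κ : Kind s, κ.IsFun → N.count κ = χ κ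

/-- Partial contractions with at least `ℓ` factors and a given number of factors of each kind of
function. -/
def Net.Long (χ : Kind s → ℕ) (ℓ : ℕ) (N : Net s E S) : Prop := N.HasCharge χ ∧ ℓ ≤ N.length

/-- The number of factors of each kind in a single factor of kind `κ`. -/
def unitCharge (κ : Kind s) : Kind s → ℕ := fun κ' => if κ = κ' then 1 else 0

theorem Net.count_mul [DecidableEq E] {S₁ S₂ : Finset E} (N₁ : Net s E S₁) (N₂ : Net s E S₂)
    (h : Disjoint S₁ S₂) (κ : Kind s) : (N₁.mul N₂ h).count κ = N₁.count κ + N₂.count κ := by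
  have : ∀ {ι₁ ι₂ : Type} [Fintype ι₁] [Fintype ι₂] (f : ι₁ → Kind s) (g : ι₂ → Kind s),
      (Finset.univ.filter fun i : ι₁ ⊕ ι₂ => Sum.elim f g i = κ).card
      = (Finset.univ.filter fun i => f i = κ).card + (Finset.univ.filter fun i => g i = κ).card := by
    intro ι₁ ι₂ _ _ f g
    simp only [Finset.card_filter, Fintype.sum_sum_type, Sum.elim_inl, Sum.elim_inr]
    rfl
  exact this _ _

theorem Net.length_mul [DecidableEq E] {S₁ S₂ : Finset E} (N₁ : Net s E S₁) (N₂ : Net s E S₂)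
    (h : Disjoint S₁ S₂) : (N₁.mul N₂ h).length = N₁.length + N₂.length :=
  Fintype.card_sum

theorem Net.HasCharge.mul [DecidableEq E] {S₁ S₂ : Finset E} {N₁ : Net s E S₁} {N₂ : Net s E S₂}
    {χ₁ χ₂ : Kind s → ℕ} (h₁ : N₁.HasCharge χ₁) (h₂ : N₂.HasCharge χ₂) (h : Disjoint S₁ S₂) :
    (N₁.mul N₂ h).HasCharge (χ₁ + χ₂) := by
  intro κ hκ
  rw [Net.count_mul, h₁ κ hκ, h₂ κ hκ, Pi.add_apply]

theorem der_mem_long [DecidableEq E] {c : E} (hc : c ∉ S) {χ : Kind s → ℕ} {ℓ : ℕ}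
    {W : LFun n s E} (h : W ∈ cls n (Net.Long χ ℓ : Net s E S → Prop)) :
    W.der S c ∈ cls n (Net.Long χ ℓ : Net s E (insert c S) → Prop) :=
  der_mem_cls hc (fun _ hN _ => hN) h

theorem close_mem_long {P : Type} [Fintype P] [DecidableEq P] {χ : Kind s → ℕ} {ℓ : ℕ}
    {W : LFun n s (E ⊕ P × Bool)}
    (h : W ∈ cls n (Net.Long χ ℓ : Net s (E ⊕ P × Bool) (S.disjSum Finset.univ) → Prop)) :
    (fun B x lab => ∑ α : P × Bool → Fin n, (∏ j, (B.g x)⁻¹ (α (j, false)) (α (j, true))) *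
      W B x (Sum.elim lab α)) ∈ cls n (Net.Long χ ℓ : Net s E S → Prop) :=
  close_mem_cls (fun _ hN => hN) h

/-- A single factor, with its indices given by a list of labels. -/
noncomputable def fac (n : ℕ) (κ : Kind s) (m : ℕ) (e : List E) : LFun n s E :=
  fun B x lab => B.factor κ m x (e.map lab)

/-- The list `e` enumerates `S` without repetitions. -/
def Enum (S : Finset E) (e : List E) : Prop := e.Nodup ∧ ∀ z, z ∈ e ↔ z ∈ S

theorem Enum.perm {e e' : List E} (h : Enum S e) (hp : e.Perm e') : Enum S e' :=
  ⟨hp.nodup_iff.1 h.1, fun z => hp.mem_iff.symm.trans (h.2 z)⟩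

/-- A partial contraction with one factor and pairs `P` of internal contractions. -/
def Net.one (P : Type) [Fintype P] [DecidableEq P] (κ : Kind s) (m : ℕ) (e : List (E ⊕ P × Bool))
    (hlen : e.length = κ.rank + m) (he : Enum (S.disjSum Finset.univ) e) : Net s E S where
  ι := Unit
  P := P
  kind := fun _ => κ
  ord := fun _ => m
  lbl := fun _ => e
  len := fun _ => hlen
  nodup := fun _ => he.1
  disj := fun _ _ _ _ _ => rfl
  cover := fun z => by simpa using he.2 z

theorem Net.val_one (P : Type) [Fintype P] [DecidableEq P] (κ : Kind s) (m : ℕ)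
    (e : List (E ⊕ P × Bool)) (hlen : e.length = κ.rank + m)
    (he : Enum (S.disjSum Finset.univ) e) (B : Background n s) (x : Fin n → ℝ) (lab : E → Fin n) :
    (Net.one P κ m e hlen he).val n B x lab = ∑ α : P × Bool → Fin n,
      (∏ j, (B.g x)⁻¹ (α (j, false)) (α (j, true))) * fac n κ m e B x (Sum.elim lab α) := by
  unfold Net.val
  refine Finset.sum_congr rfl fun α _ => ?_
  congr 1
  exact Fintype.prod_unique (ι := Unit) _

theorem Net.hasCharge_one (P : Type) [Fintype P] [DecidableEq P] (κ : Kind s) (m : ℕ)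
    (e : List (E ⊕ P × Bool)) (hlen : e.length = κ.rank + m)
    (he : Enum (S.disjSum Finset.univ) e) :
    (Net.one P κ m e hlen he).HasCharge (unitCharge κ) := by
  intro κ' _
  change (Finset.univ.filter fun _ : Unit => κ = κ').card = _
  unfold unitCharge
  split_ifs with h <;> simp [h]

theorem Enum.map_inl {e : List E} (he : Enum S e) :
    Enum (S.disjSum (Finset.univ : Finset (Empty × Bool))) (e.map Sum.inl) := by
  refine ⟨he.1.map Sum.inl_injective, fun z => ?_⟩
  rcases z with z | z
  · simp [he.2]
  · exact z.1.elim

theorem fac_eq_val (κ : Kind s) (m : ℕ) (e : List E) (hlen : e.length = κ.rank + m)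
    (he : Enum S e) (B : Background n s) (x : Fin n → ℝ) (lab : E → Fin n) :
    fac n κ m e B x lab
      = (Net.one Empty κ m (e.map Sum.inl) (by simpa using hlen) he.map_inl).val n B x lab := by
  rw [Net.val_one, Fintype.sum_unique]
  simp [fac, Function.comp_def]

theorem smooth_fac (B : Background n s) (κ : Kind s) (m : ℕ) (e : List E) (lab : E → Fin n) :
    ContDiffOn ℝ ∞ (fun y => fac n κ m e B y lab) B.U :=
  B.smooth_factor _ _ _

variable [DecidableEq E]

theorem fac_cons (B : Background n s) (x : Fin n → ℝ) (κ : Kind s) (m : ℕ) (c : E) {e : List E}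
    (he : e.Nodup) (lab : E → Fin n) :
    fac n κ (m + 1) (c :: e) B x lab
      = labelCov B.g e.toFinset (lab c) (fac n κ m e B) x lab := by
  unfold fac
  rw [labelCov_list B _ he, factor_succ]
  rfl

/-- If reordering the indices of a factor changes it by long contractions, then so it does for the
covariant derivative of this factor. -/
theorem fac_cons_sub_mem {κ : Kind s} {m : ℕ} {c : E} {e e' : List E} (he : e.Nodup)
    (hee' : e.Perm e') (hc : c ∉ e) {χ : Kind s → ℕ} {ℓ : ℕ}
    (h : fac n κ m e - fac n κ m e' ∈ cls n (Net.Long χ ℓ : Net s E e.toFinset → Prop))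
    (hS : Enum S (c :: e)) :
    fac n κ (m + 1) (c :: e) - fac n κ (m + 1) (c :: e')
      ∈ cls n (Net.Long χ ℓ : Net s E S → Prop) := by
  obtain rfl : S = insert c e.toFinset := by
    ext z
    rw [← hS.2 z]
    simp
  refine mem_cls_congr ?_ (der_mem_long (by simpa using hc) h)
  intro B x hx lab
  have h1 := labelCov_sum B hx e.toFinset (lab c) Finset.univ ![1, -1]
    (W := ![fac n κ m e B, fac n κ m e' B]) (by
      intro k lab
      fin_cases k
      · exact smooth_fac B κ m e lab
      · exact smooth_fac B κ m e' lab) lab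
  simp only [Fin.sum_univ_two, Matrix.cons_val_zero, Matrix.cons_val_one, one_mul, neg_one_mul,
    ← sub_eq_add_neg] at h1
  rw [LFun.der, Pi.sub_apply, Pi.sub_apply, Pi.sub_apply, fac_cons B x κ m c he,
    fac_cons B x κ m c (hee'.nodup_iff.1 he), ← List.toFinset_eq_of_perm _ _ hee', ← h1]
  rfl

/-- The terms of the commutator of two covariant derivatives of a tensor with indices `post`:
the curvature tensor is contracted against the index `e` of the tensor. -/
def commutatorNet (κ : Kind s) (m : ℕ) (a b e : E) (post : List E)
    (hlen : post.length = κ.rank + m) (hS : Enum S (a :: b :: post)) (he : e ∈ post) :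
    Net s E S where
  ι := Bool
  P := Unit
  kind := fun t => if t then .curv else κ
  ord := fun t => if t then 0 else m
  lbl := fun t => if t then [.inl a, .inl b, .inr ((), true), .inl e]
    else post.map fun z => if z = e then .inr ((), false) else .inl z
  len := by
    rintro (_ | _)
    · simpa using hlen
    · rfl
  nodup := by
    have h := hS.1
    simp only [List.nodup_cons, List.mem_cons, not_or] at h
    rintro (_ | _)
    · refine h.2.2.map fun z w hzw => ?_
      split_ifs at hzw with h1 h2 h2
      · rw [h1, h2]
      · exact Sum.inl_injective hzw
    · have hae : a ≠ e := fun h' => h.1.2 (h' ▸ he)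
      have hbe : b ≠ e := fun h' => h.2.1 (h' ▸ he)
      simp [h.1.1, hae, hbe]
  disj := by
    have h := hS.1
    simp only [List.nodup_cons, List.mem_cons, not_or] at h
    have key : ∀ z, z ∈ ([.inl a, .inl b, .inr ((), true), .inl e] : List (E ⊕ Unit × Bool)) →
        z ∈ post.map (fun z => if z = e then (.inr ((), false) : E ⊕ Unit × Bool) else .inl z) →
        False := by
      intro z hz hz'
      obtain ⟨w, hw, rfl⟩ := List.mem_map.1 hz'
      split_ifs at hz with hwe
      · simp at hz
      · simp at hz
        rcases hz with rfl | rfl | rfl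
        · exact h.1.2 hw
        · exact h.2.1 hw
        · exact hwe rfl
    rintro (_ | _) (_ | _) z hi hj
    · rfl
    · exact (key z hj hi).elim
    · exact (key z hi hj).elim
    · rfl
  cover := by
    intro z
    constructor
    · rintro ⟨_ | _, hi⟩
      · obtain ⟨w, hw, rfl⟩ := List.mem_map.1 (by simpa using hi)
        split_ifs
        · simp
        · simpa using (hS.2 w).1 (by simp [hw])
      · simp at hi
        rcases hi with rfl | rfl | rfl | rfl
        · simpa using (hS.2 a).1 (by simp)
        · simpa using (hS.2 b).1 (by simp)
        · simp
        · simpa using (hS.2 e).1 (by simp [he])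
    · intro hz
      rcases z with z | ⟨⟨⟩, _ | _⟩
      · have := (hS.2 z).2 (by simpa using hz)
        simp only [List.mem_cons] at this
        rcases this with rfl | rfl | hzp
        · exact ⟨true, by simp⟩
        · exact ⟨true, by simp⟩
        · by_cases hze : z = e
          · exact ⟨true, by simp [hze]⟩
          · exact ⟨false, List.mem_map.2 ⟨z, hzp, by simp [hze]⟩⟩
      · exact ⟨false, List.mem_map.2 ⟨e, he, by simp⟩⟩
      · exact ⟨true, by simp⟩

theorem commutator_mem_long (κ : Kind s) (m : ℕ) (a b : E) (post : List E)
    (hlen : post.length = κ.rank + m) (hS : Enum S (a :: b :: post)) :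
    fac n κ (m + 2) (a :: b :: post) - fac n κ (m + 2) (b :: a :: post)
      ∈ cls n (Net.Long (unitCharge κ) 2 : Net s E S → Prop) := by
  have hnd : post.Nodup := by
    have := hS.1
    simp only [List.nodup_cons] at this
    exact this.2.2
  refine mem_cls_congr (W := ∑ e ∈ post.toFinset.attach, (commutatorNet κ m a b e.1 post hlen hS
    (List.mem_toFinset.1 e.2)).val n) ?_ (Submodule.sum_mem _ fun e _ => mem_cls_of_net _ ?_
      fun _ _ _ _ => rfl)
  · intro B x hx lab
    have h1 := cov_cov_sub B hx (B.smooth_factor κ m) (lab a) (lab b) (post.map lab)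
    have h2 : (fac n κ (m + 2) (a :: b :: post) - fac n κ (m + 2) (b :: a :: post)) B x lab
      = ∑ e ∈ post.toFinset, ∑ k, riemUp B.g x (lab a) (lab b) k (lab e) *
          B.factor κ m x (post.map (Function.update lab e k)) := by
      simp only [Pi.sub_apply, fac, factor_succ, List.map_cons]
      rw [h1, Finset.sum_comm, Finset.sum_comm (s := post.toFinset)]
      exact Finset.sum_congr rfl fun k _ => sum_get_set hnd lab k
        fun j l => riemUp B.g x (lab a) (lab b) k j * B.factor κ m x l
    rw [h2, ← Finset.sum_attach]
    simp only [Finset.sum_apply]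
    refine Finset.sum_congr rfl fun e _ => ?_
    simp only [Net.val]
    refine Eq.trans ?_ (sum_pairs_unit _).symm
    refine Finset.sum_congr rfl fun k _ => ?_
    rw [riemUp_eq B hx, Finset.sum_mul]
    refine Finset.sum_congr rfl fun k' _ => ?_
    change _ = (∏ _j : Unit, (B.g x)⁻¹ k k') * ∏ i : Bool, _
    rw [Fintype.prod_bool, Finset.univ_unique, Finset.prod_singleton, mul_assoc]
    congr 2
    change B.factor κ m x _ = B.factor κ m x _
    congr 1
    change _ = (post.map fun z => if z = e.1 then (.inr ((), false) : E ⊕ Unit × Bool)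
      else .inl z).map (Sum.elim lab fun p : Unit × Bool => if p.2 then k' else k)
    rw [List.map_map]
    refine List.map_congr_left fun z _ => ?_
    by_cases hz : z = e.1
    · simp [hz]
    · simp [hz]
  · refine ⟨fun κ' hκ' => ?_, le_refl 2⟩
    change (Finset.univ.filter fun t : Bool => (if t then Kind.curv else κ) = κ').card = _
    unfold unitCharge
    rw [Finset.card_filter, Fintype.sum_bool]
    simp [hκ'.1.symm]

/-- Adjacent derivative indices commute modulo longer contractions. -/
theorem swap_mem_long (κ : Kind s) (pre : List E) : ∀ {S : Finset E} (m : ℕ) (a b : E)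
    (post : List E), post.length = κ.rank + m → Enum S (pre ++ a :: b :: post) →
    fac n κ (pre.length + (m + 2)) (pre ++ a :: b :: post)
      - fac n κ (pre.length + (m + 2)) (pre ++ b :: a :: post)
      ∈ cls n (Net.Long (unitCharge κ) 2 : Net s E S → Prop) := by
  induction pre with
  | nil =>
    intro S m a b post hlen hS
    simpa using commutator_mem_long κ m a b post hlen hS
  | cons c pre ih =>
    intro S m a b post hlen hS
    have hnd := List.nodup_cons.1 hS.1
    have := fac_cons_sub_mem hnd.2 ((List.Perm.swap b a post).append_left pre) hnd.1
      (ih m a b post hlen ⟨hnd.2, fun _ => List.mem_toFinset.symm⟩) hS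
    simpa [add_right_comm] using this

theorem perm_mem_long (κ : Kind s) (post : List E) (hpost : post.length = κ.rank) {r r' : List E}
    (h : r.Perm r') : ∀ (front back : List E), Enum S (front ++ r ++ back ++ post) →
    ∀ M, M = front.length + r.length + back.length →
    fac n κ M (front ++ r ++ back ++ post) - fac n κ M (front ++ r' ++ back ++ post)
      ∈ cls n (Net.Long (unitCharge κ) 2 : Net s E S → Prop) := by
  induction h with
  | nil => intro front back _ M _; simp
  | cons c _ ih =>
    intro front back hS M hM
    simpa using ih (front ++ [c]) back (by simpa using hS) M (by simp [hM]; ring)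
  | swap a b l =>
    intro front back hS M hM
    have := swap_mem_long (n := n) κ front (l.length + back.length) b a (l ++ back ++ post)
      (by simp [hpost]; ring) (by simpa using hS)
    have hM' : M = front.length + (l.length + back.length + 2) := by simp [hM]; ring
    rw [hM']
    simpa using this
  | trans h₁ h₂ ih₁ ih₂ =>
    intro front back hS M hM
    have := Submodule.add_mem _ (ih₁ front back hS M hM) (ih₂ front back
      (hS.perm (((h₁.append_left front).append_right back).append_right post)) M
      (by rw [hM, h₁.length_eq]))
    simpa using this

end Long

/-! ### Reconstruction of the curvature from its symmetrized part -/

section Insertion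

variable {A : Type*}

/-- The sum of `f` over all ways of inserting `a` into the list `t`. -/
def insertSum {V : Type*} [AddCommMonoid V] (a : A) (t : List A) (f : List A → V) : V :=
  ((List.permutations'Aux a t).map f).sum

theorem insertSum_nil (a : A) (f : List A → ℝ) : insertSum a [] f = f [a] := by
  simp [insertSum]

theorem insertSum_cons (a b : A) (t : List A) (f : List A → ℝ) :
    insertSum a (b :: t) f = f (a :: b :: t) + insertSum a t fun l => f (b :: l) := by
  simp [insertSum, Function.comp_def]

theorem insertSum_of_perm (a : A) (t : List A) {f : List A → ℝ}
    (hf : ∀ l l', l.Perm l' → f l = f l') : insertSum a t f = (t.length + 1) * f (a :: t) := by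
  induction t generalizing f with
  | nil => simp [insertSum_nil]
  | cons b t ih =>
    rw [insertSum_cons, ih fun l l' h => hf _ _ (h.cons b), hf (b :: a :: t) _ (List.Perm.swap a b t)]
    push_cast [List.length_cons]
    ring

theorem sum_flatMap {V : Type*} [AddCommMonoid V] {A B : Type*} (l : List A) (F : A → List B)
    (f : B → V) : ((l.flatMap F).map f).sum = (l.map fun t => ((F t).map f).sum).sum := by
  induction l with
  | nil => simp
  | cons a l ih => simp [ih]

theorem sum_permutations_cons_cons (a b : A) (r : List A) (f : List A → ℝ) :
    (((a :: b :: r).permutations).map f).sum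
      = ((List.permutations' r).map fun r' => insertSum b r' fun t => insertSum a t f).sum := by
  rw [((List.permutations_perm_permutations' (a :: b :: r)).map f).sum_eq, List.permutations',
    sum_flatMap, List.permutations', sum_flatMap]
  rfl

end Insertion

section Reconstruction

variable {A : Type*} {V : Type*}

/-- `T` with two of the entries of a list, one index `c` and one index `d` in the places of the
curvature indices: `T_{L₃ L₄ ⋯; L₁ c L₂ d}`. -/
def selectTwo [Zero V] (T : List A → A → A → A → A → V) (c d : A) : List A → V
  | a :: b :: rest => T rest a c b d
  | _ => 0

/-- The algebraic identities, for `T_{r; ijkl} = ∇_r R_{ijkl}`, of a tensor that is symmetric in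
its derivative indices `r`. -/
structure IsCurvatureLike [AddCommGroup V] (T : List A → A → A → A → A → V) : Prop where
  perm : ∀ r r' i j k l, r.Perm r' → T r i j k l = T r' i j k l
  anti : ∀ r i j k l, T r i j k l = - T r j i k l
  pair : ∀ r i j k l, T r i j k l = T r k l i j
  bianchi : ∀ r i j k l, T r i j k l + T r j l k i + T r l i k j = 0
  bianchi₂ : ∀ r a i j k l, T (a :: r) i j k l + T (i :: r) j a k l + T (j :: r) a i k l = 0

namespace IsCurvatureLike

variable {T : List A → A → A → A → A → ℝ}


theorem anti_right (hT : IsCurvatureLike T) (r : List A) (i j k l : A) : T r i j k l = - T r i j l k := by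
  rw [hT.pair, hT.anti, hT.pair]

theorem bianchi_left (hT : IsCurvatureLike T) (r : List A) (a i j l : A) : T r a j i l - T r a i j l = T r i j a l := by
  linarith [hT.bianchi r a j l i, hT.anti_right r a j i l, hT.anti r j i l a,
    hT.anti_right r i j l a, hT.anti r i a l j, hT.anti_right r a i l j]

theorem bianchi_right (hT : IsCurvatureLike T) (r : List A) (a j k l : A) : T r k j a l - T r l j a k = T r a j k l := by
  linarith [hT.bianchi_left r a k l j, hT.pair r k j a l, hT.pair r l j a k, hT.pair r k l a j]

theorem bianchi₂_left (hT : IsCurvatureLike T) (r : List A) (a i j k l : A) :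
    T (i :: r) a j k l - T (j :: r) a i k l = T (a :: r) i j k l := by
  linarith [hT.bianchi₂ r a i j k l, hT.anti (i :: r) j a k l]

theorem bianchi₂_right (hT : IsCurvatureLike T) (r : List A) (a i j k l : A) :
    T (k :: r) i j a l - T (l :: r) i j a k = T (a :: r) i j k l := by
  linarith [hT.bianchi₂_left r a k l i j, hT.pair (k :: r) i j a l, hT.pair (l :: r) i j a k,
    hT.pair (a :: r) i j k l]

theorem antisymmetrize_zero (hT : IsCurvatureLike T) (r : List A) (i j k l : A) :
    (T r i j k l + T r k j i l) - (T r j i k l + T r k i j l) - (T r i j l k + T r l j i k)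
      + (T r j i l k + T r l i j k) = 6 * T r i j k l := by
  linarith [hT.bianchi_left r k i j l, hT.bianchi_left r l i j k, hT.anti r i j k l,
    hT.anti r i j l k, hT.anti_right r i j k l]

theorem antisymmetrize_one (hT : IsCurvatureLike T) (r : List A) (a i j k l : A) :
    (T (i :: r) k j a l + T (i :: r) a j k l + T (k :: r) i j a l + T (k :: r) a j i l)
      - (T (j :: r) k i a l + T (j :: r) a i k l + T (k :: r) j i a l + T (k :: r) a i j l)
      - (T (i :: r) l j a k + T (i :: r) a j l k + T (l :: r) i j a k + T (l :: r) a j i k)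
      + (T (j :: r) l i a k + T (j :: r) a i l k + T (l :: r) j i a k + T (l :: r) a i j k)
      = 6 * T (a :: r) i j k l := by
  linarith [hT.bianchi_left (k :: r) a i j l, hT.bianchi_left (l :: r) a i j k,
    hT.bianchi_right (i :: r) a j k l, hT.bianchi_right (j :: r) a i k l,
    hT.bianchi₂_left r a i j k l, hT.bianchi₂_right r a i j k l,
    hT.anti (k :: r) j i a l, hT.anti (l :: r) j i a k,
    hT.anti_right (i :: r) a j k l, hT.anti_right (j :: r) a i k l]

theorem antisymmetrize_two (hT : IsCurvatureLike T) (r : List A) (a b i j k l : A) :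
    T (i :: k :: r) a j b l - T (j :: k :: r) a i b l - T (i :: l :: r) a j b k
      + T (j :: l :: r) a i b k = T (a :: b :: r) i j k l := by
  linarith [hT.bianchi₂_left (k :: r) a i j b l, hT.bianchi₂_left (l :: r) a i j b k,
    hT.bianchi₂_right (a :: r) b i j k l, hT.perm _ _ i j b l (List.Perm.swap k a r),
    hT.perm _ _ i j b k (List.Perm.swap l a r), hT.perm _ _ i j k l (List.Perm.swap b a r)]

theorem insertSum_insertSum (hT : IsCurvatureLike T) (a b i k c d : A) (r : List A) :
    (insertSum k (a :: b :: r) fun t => insertSum i t (selectTwo T c d))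
      = (T (a :: b :: r) i c k d + T (a :: b :: r) k c i d)
        + (r.length + 2) * (T (i :: b :: r) k c a d + T (i :: b :: r) a c k d
          + T (k :: b :: r) i c a d + T (k :: b :: r) a c i d)
        + (r.length + 1) * (r.length + 2) * T (i :: k :: r) a c b d := by
  have h1 : ∀ (t₁ t₂ : A) (t : List A), insertSum i (t₁ :: t₂ :: t) (selectTwo T c d)
      = T (t₂ :: t) i c t₁ d + T (t₂ :: t) t₁ c i d + (t.length + 1) * T (i :: t) t₁ c t₂ d := by
    intro t₁ t₂ t
    rw [insertSum_cons, insertSum_cons]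
    simp only [selectTwo]
    rw [insertSum_of_perm i t fun l l' h => hT.perm _ _ _ _ _ _ h]
    ring
  rw [insertSum_cons k a, insertSum_cons k b, h1, h1,
    insertSum_of_perm k r (f := fun l => insertSum i (a :: b :: l) (selectTwo T c d))]
  · rw [h1]
    simp only [List.length_cons]
    rw [hT.perm (b :: k :: r) (k :: b :: r) i c a d (List.Perm.swap _ _ _),
      hT.perm (b :: k :: r) (k :: b :: r) a c i d (List.Perm.swap _ _ _)]
    push_cast
    ring
  · intro l l' h
    simp only [h1, h.length_eq]
    rw [hT.perm _ _ i c a d (h.cons b), hT.perm _ _ a c i d (h.cons b),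
      hT.perm _ _ a c b d (h.cons i)]

theorem antisymmetrize_insertSum (hT : IsCurvatureLike T) (i j k l : A) : ∀ r : List A,
    (insertSum k r fun t => insertSum i t (selectTwo T j l))
      - (insertSum k r fun t => insertSum j t (selectTwo T i l))
      - (insertSum l r fun t => insertSum i t (selectTwo T j k))
      + (insertSum l r fun t => insertSum j t (selectTwo T i k))
      = (r.length + 2) * (r.length + 3) * T r i j k l
  | [] => by
    simp only [insertSum_nil, insertSum_cons, selectTwo, List.length_nil]
    have := hT.antisymmetrize_zero [] i j k l
    push_cast
    linarith
  | [a] => by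
    simp only [insertSum_nil, insertSum_cons, selectTwo, List.length_singleton]
    have h0 := hT.antisymmetrize_zero [a] i j k l
    have h1 := hT.antisymmetrize_one [] a i j k l
    push_cast
    linarith
  | a :: b :: r => by
    simp only [hT.insertSum_insertSum, List.length_cons]
    have h0 := hT.antisymmetrize_zero (a :: b :: r) i j k l
    have h1 := hT.antisymmetrize_one (b :: r) a i j k l
    have h2 := hT.antisymmetrize_two r a b i j k l
    push_cast
    linear_combination h0 + ((r.length : ℝ) + 2) * h1
      + ((r.length : ℝ) + 1) * ((r.length : ℝ) + 2) * h2

/-- Antisymmetrization, as in the linearized curvature, of the symmetrization of a curvature-like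
tensor returns a multiple of the tensor. -/
theorem antisymmetrize_permutations (hT : IsCurvatureLike T) (r : List A) (i j k l : A) :
    (((i :: k :: r).permutations).map (selectTwo T j l)).sum
      - (((j :: k :: r).permutations).map (selectTwo T i l)).sum
      - (((i :: l :: r).permutations).map (selectTwo T j k)).sum
      + (((j :: l :: r).permutations).map (selectTwo T i k)).sum
      = (r.length + 2) * (r.length + 3) * r.length.factorial * T r i j k l := by
  simp only [sum_permutations_cons_cons]
  have h : ∀ L : List (List A), (∀ r' ∈ L, r'.Perm r) →
      (L.map fun r => insertSum k r fun t => insertSum i t (selectTwo T j l)).sum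
      - (L.map fun r => insertSum k r fun t => insertSum j t (selectTwo T i l)).sum
      - (L.map fun r => insertSum l r fun t => insertSum i t (selectTwo T j k)).sum
      + (L.map fun r => insertSum l r fun t => insertSum j t (selectTwo T i k)).sum
      = L.length * ((r.length + 2) * (r.length + 3) * T r i j k l) := by
    intro L hL
    induction L with
    | nil => simp
    | cons r' L ih =>
      have h1 := hT.antisymmetrize_insertSum i j k l r'
      have h2 := ih fun x hx => hL x (List.mem_cons_of_mem _ hx)
      have h3 := hL r' List.mem_cons_self
      rw [h3.length_eq, hT.perm _ _ i j k l h3] at h1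
      simp only [List.map_cons, List.sum_cons, List.length_cons]
      push_cast
      linarith
  rw [h _ fun r' hr' => List.mem_permutations'.1 hr',
    (List.permutations_perm_permutations' r).symm.length_eq, List.length_permutations]
  ring

end IsCurvatureLike

theorem selectTwo_map [AddCommGroup V] [Module ℝ V] (φ : V →ₗ[ℝ] ℝ)
    (T : List A → A → A → A → A → V) (c d : A) (L : List A) :
    φ (selectTwo T c d L) = selectTwo (fun r i j k l => φ (T r i j k l)) c d L := by
  match L with
  | [] => exact map_zero φ
  | [_] => exact map_zero φ
  | _ :: _ :: _ => rfl

/-- Reconstruction of a curvature-like tensor from its symmetrization. -/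
theorem IsCurvatureLike.reconstruct [AddCommGroup V] [Module ℝ V]
    {T : List A → A → A → A → A → V} (hT : IsCurvatureLike T) (r : List A) (i j k l : A) :
    (((i :: k :: r).permutations).map fun L => selectTwo T j l L + selectTwo T l j L).sum
      - (((j :: k :: r).permutations).map fun L => selectTwo T i l L + selectTwo T l i L).sum
      - (((i :: l :: r).permutations).map fun L => selectTwo T j k L + selectTwo T k j L).sum
      + (((j :: l :: r).permutations).map fun L => selectTwo T i k L + selectTwo T k i L).sum
      = (2 * ((r.length + 2) * (r.length + 3) * r.length.factorial : ℝ)) • T r i j k l := by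
  rw [← sub_eq_zero, ← Module.forall_dual_apply_eq_zero_iff ℝ]
  intro φ
  have hφ : IsCurvatureLike fun r i j k l => φ (T r i j k l) :=
    ⟨fun r r' i j k l h => by rw [hT.perm r r' i j k l h],
      fun r i j k l => by rw [hT.anti, map_neg],
      fun r i j k l => by rw [hT.pair],
      fun r i j k l => by rw [← map_add, ← map_add, hT.bianchi, map_zero],
      fun r a i j k l => by rw [← map_add, ← map_add, hT.bianchi₂, map_zero]⟩
  have h1 := hφ.antisymmetrize_permutations r i j k l
  have h2 := hφ.antisymmetrize_permutations r k l i j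
  have hsw : ∀ a b c d, (((a :: b :: r).permutations).map
      (selectTwo (fun r i j k l => φ (T r i j k l)) c d)).sum = (((b :: a :: r).permutations).map
      (selectTwo (fun r i j k l => φ (T r i j k l)) c d)).sum := fun a b c d =>
    (((List.Perm.swap b a r).permutations).map _).sum_eq
  rw [hsw k i, hsw l i, hsw k j, hsw l j, ← hφ.pair r i j k l] at h2
  simp only [map_sub, map_add, map_smul, map_list_sum, List.map_map, smul_eq_mul,
    Function.comp_def, selectTwo_map, List.sum_map_add]
  linarith

end Reconstruction

section Jets

variable {n s : ℕ}

/-- The components `∇_r R_{ijkl}` of the derivatives of the curvature. -/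
noncomputable def curvComp (B : Background n s) (x : Fin n → ℝ) (r : List (Fin n))
    (i j k l : Fin n) : ℝ :=
  iterCov B.g r.length (riem B.g) x (r ++ [i, j, k, l])

/-- Symmetrized derivatives of the curvature, normalized so that, up to quadratic terms, they are
the derivatives `∂_L h_{cd}` of a metric perturbation with the given curvature. -/
noncomputable def metricJet (B : Background n s) (x : Fin n → ℝ) (L : List (Fin n)) (c d : Fin n) :
    ℝ :=
  (L.permutations.map fun L' => selectTwo (curvComp B x) c d L' + selectTwo (curvComp B x) d c L').sum
    / (L.length * (L.length + 1) * (L.length - 2).factorial)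

theorem metricJet_perm (B : Background n s) (x : Fin n → ℝ) {L L' : List (Fin n)} (h : L.Perm L')
    (c d : Fin n) : metricJet B x L c d = metricJet B x L' c d := by
  rw [metricJet, metricJet, (h.permutations.map _).sum_eq, h.length_eq]

theorem metricJet_symm (B : Background n s) (x : Fin n → ℝ) (L : List (Fin n)) (c d : Fin n) :
    metricJet B x L c d = metricJet B x L d c := by
  simp only [metricJet, add_comm]

/-- The symmetrized derivatives of a tensor. -/
noncomputable def symJet (B : Background n s) (T : Tens n) (x : Fin n → ℝ) (L : List (Fin n)) : ℝ :=
  (L.permutations.map fun L' => iterCov B.g L.length T x L').sum / L.length.factorial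

theorem symJet_perm (B : Background n s) (T : Tens n) (x : Fin n → ℝ) {L L' : List (Fin n)}
    (h : L.Perm L') : symJet B T x L = symJet B T x L' := by
  rw [symJet, symJet, (h.permutations.map _).sum_eq, h.length_eq]

/-- The derivatives of the Ricci tensor, symmetrized separately in `u` and `l`. -/
noncomputable def ricciJet (B : Background n s) (x : Fin n → ℝ) (u l : List (Fin n)) : ℝ :=
  (u.permutations.map fun u' => (l.permutations.map fun l' =>
    iterCov B.g (u.length + (l.length - 2)) (ricci B.g) x (u' ++ l')).sum).sum
      / (u.length.factorial * l.length.factorial)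

theorem ricciJet_perm (B : Background n s) (x : Fin n → ℝ) {u u' l l' : List (Fin n)}
    (hu : u.Perm u') (hl : l.Perm l') : ricciJet B x u l = ricciJet B x u' l' := by
  unfold ricciJet
  rw [(hu.permutations.map _).sum_eq, hu.length_eq, hl.length_eq]
  congr 3
  funext v
  exact (hl.permutations.map _).sum_eq

/-- The linearized curvature `½(h_{jl,ik} + h_{ik,jl} - h_{jk,il} - h_{il,jk})`, differentiated in
the directions `r`, for `h L c d = ∂_L h_{cd}`. -/
noncomputable def linPattern {A : Type*} (h : List A → A → A → ℝ) (r : List A) (i j k l : A) : ℝ :=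
  1 / 2 * (h (r ++ [i, k]) j l + h (r ++ [j, l]) i k - h (r ++ [j, k]) i l - h (r ++ [i, l]) j k)

/-- The linearized curvature as a function of the list of all indices. -/
noncomputable def linCurv {A : Type*} : ℕ → (List A → A → A → ℝ) → List A → ℝ
  | 0, h, [i, j, k, l] => linPattern h [] i j k l
  | m + 1, h, a :: L => linCurv m (fun r => h (a :: r)) L
  | _, _, _ => 0

theorem linCurv_append {A : Type*} (r : List A) (h : List A → A → A → ℝ) (i j k l : A) :
    linCurv r.length h (r ++ [i, j, k, l]) = linPattern h r i j k l := by
  induction r generalizing h with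
  | nil => rfl
  | cons a r ih => exact ih _

/-- The factors that result from `Background.riccFactor` by symmetrization. -/
noncomputable def Background.symFactor (B : Background n s) (κ : Kind s) (m : ℕ)
    (x : Fin n → ℝ) (u l : List (Fin n)) : ℝ :=
  match κ with
  | .curv => linCurv m (fun L => metricJet B x (u ++ L)) l
  | .ric => 0
  | .psi h => symJet B (scalar (B.ψ h)) x (u ++ l)
  | .omega => if l.length = 0 then 0 else if l.length = 1 then 1 / 2 * ricci B.g x (u ++ l)
      else ricciJet B x u l
  | .ups => 1

end Jets

section Symmetrization

variable {n s : ℕ} {E : Type} {S : Finset E}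

theorem list_sum_apply {ι : Type*} (L : List ι) (F : ι → LFun n s E) (B : Background n s)
    (x : Fin n → ℝ) (lab : E → Fin n) :
    (L.map F).sum B x lab = (L.map fun i => F i B x lab).sum := by
  induction L with
  | nil => rfl
  | cons a L ih => simp [ih]

theorem mkQ_sub_eq {V : Type*} [AddCommGroup V] [Module ℝ V] (K : Submodule ℝ V) (a b : V) :
    K.mkQ a = K.mkQ b ↔ a - b ∈ K := by
  simp [Submodule.Quotient.eq]

open Classical in
/-- The classes, modulo longer contractions, of the derivatives of the curvature. -/
noncomputable def curvClass (n : ℕ) (S : Finset E) (r : List E) (i j k l : E) :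
    LFun n s E ⧸ cls n (Net.Long (unitCharge .curv) 2 : Net s E S → Prop) :=
  if Enum S (r ++ [i, j, k, l]) then Submodule.mkQ _ (fac n .curv r.length (r ++ [i, j, k, l])) else 0

theorem curvClass_of_enum {r : List E} {i j k l : E} (h : Enum S (r ++ [i, j, k, l])) :
    curvClass (s := s) n S r i j k l
      = Submodule.mkQ _ (fac n .curv r.length (r ++ [i, j, k, l])) := if_pos h

theorem curvClass_of_not_enum {r : List E} {i j k l : E} (h : ¬ Enum S (r ++ [i, j, k, l])) :
    curvClass (s := s) n S r i j k l = 0 := if_neg h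

theorem curvClass_eq_neg {r : List E} {i j k l i' j' k' l' : E}
    (hp : (r ++ [i, j, k, l]).Perm (r ++ [i', j', k', l']))
    (h : ∀ (B : Background n s), ∀ x ∈ B.U, ∀ lab : E → Fin n,
      iterCov B.g (r.map lab).length (riem B.g) x (r.map lab ++ [lab i, lab j, lab k, lab l])
        = - iterCov B.g (r.map lab).length (riem B.g) x
          (r.map lab ++ [lab i', lab j', lab k', lab l'])) :
    curvClass (s := s) n S r i j k l = - curvClass n S r i' j' k' l' := by
  by_cases he : Enum S (r ++ [i, j, k, l])
  · rw [curvClass_of_enum he, curvClass_of_enum (he.perm hp), ← map_neg, mkQ_sub_eq, sub_neg_eq_add]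
    refine mem_cls_of_zero fun B x hx lab => ?_
    have := h B x hx lab
    rw [List.length_map] at this
    simp only [Pi.add_apply, fac, List.map_append, List.map_cons, List.map_nil]
    exact add_eq_zero_iff_eq_neg.2 this
  · rw [curvClass_of_not_enum he, curvClass_of_not_enum fun h' => he (h'.perm hp.symm), neg_zero]

theorem curvClass_add_add {r r' r'' : List E} {i j k l i' j' k' l' i'' j'' k'' l'' : E}
    (hp : (r ++ [i, j, k, l]).Perm (r' ++ [i', j', k', l']))
    (hp' : (r ++ [i, j, k, l]).Perm (r'' ++ [i'', j'', k'', l''])) (hr : r.length = r'.length)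
    (hr' : r.length = r''.length)
    (h : ∀ (B : Background n s), ∀ x ∈ B.U, ∀ lab : E → Fin n,
      iterCov B.g r.length (riem B.g) x ((r ++ [i, j, k, l]).map lab)
      + iterCov B.g r.length (riem B.g) x ((r' ++ [i', j', k', l']).map lab)
      + iterCov B.g r.length (riem B.g) x ((r'' ++ [i'', j'', k'', l'']).map lab) = 0) :
    curvClass (s := s) n S r i j k l + curvClass n S r' i' j' k' l'
      + curvClass n S r'' i'' j'' k'' l'' = 0 := by
  by_cases he : Enum S (r ++ [i, j, k, l])
  · rw [curvClass_of_enum he, curvClass_of_enum (he.perm hp), curvClass_of_enum (he.perm hp'),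
      ← map_add, ← map_add, ← map_zero (Submodule.mkQ _), mkQ_sub_eq, sub_zero]
    refine mem_cls_of_zero fun B x hx lab => ?_
    have := h B x hx lab
    simp only [Pi.add_apply, fac, ← hr, ← hr']
    exact this
  · rw [curvClass_of_not_enum he, curvClass_of_not_enum fun h' => he (h'.perm hp.symm),
      curvClass_of_not_enum fun h' => he (h'.perm hp'.symm)]
    simp

variable [DecidableEq E]

theorem isCurvatureLike_curvClass :
    IsCurvatureLike (curvClass (s := s) n S) where
  perm r r' i j k l h := by
    by_cases he : Enum S (r ++ [i, j, k, l])
    · rw [curvClass_of_enum he, curvClass_of_enum (he.perm (h.append_right _)), mkQ_sub_eq,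
        ← h.length_eq]
      have := perm_mem_long (n := n) (S := S) (Kind.curv : Kind s) [i, j, k, l] rfl h [] []
        (by simpa using he) _ rfl
      simpa using this
    · rw [curvClass_of_not_enum he,
        curvClass_of_not_enum fun h' => he (h'.perm (h.append_right _).symm)]
  anti r i j k l := curvClass_eq_neg ((List.Perm.swap j i _).append_left r)
    fun B x hx lab => iterCov_riem_antisymm_left B hx _ _ _ _ _
  pair r i j k l := by
    have hp : (r ++ [i, j, k, l]).Perm (r ++ [k, l, i, j]) :=
      (List.perm_append_comm (l₁ := [i, j]) (l₂ := [k, l])).append_left r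
    by_cases he : Enum S (r ++ [i, j, k, l])
    · rw [curvClass_of_enum he, curvClass_of_enum (he.perm hp), mkQ_sub_eq]
      refine mem_cls_of_zero fun B x hx lab => ?_
      have := iterCov_riem_pair_symm B hx (r.map lab) (lab i) (lab j) (lab k) (lab l)
      rw [List.length_map] at this
      simp only [Pi.sub_apply, fac, List.map_append, List.map_cons, List.map_nil]
      exact sub_eq_zero.2 this
    · rw [curvClass_of_not_enum he, curvClass_of_not_enum fun h' => he (h'.perm hp.symm)]
  bianchi r i j k l := by
    refine curvClass_add_add ?_ ?_ rfl rfl fun B x hx lab => ?_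
    · refine List.Perm.append_left r ?_
      exact (List.perm_append_comm (l₁ := [i]) (l₂ := [j, k, l])).trans
        ((List.Perm.swap l k [i]).cons j)
    · refine List.Perm.append_left r ?_
      exact ((List.perm_append_comm (l₁ := [i, j, k]) (l₂ := [l]))).trans
        (((List.Perm.swap k j []).cons i).cons l)
    · have := iterCov_riem_bianchi B hx (r.map lab) (lab i) (lab j) (lab k) (lab l)
      rw [List.length_map] at this
      simpa only [List.map_append, List.map_cons, List.map_nil] using this
  bianchi₂ r a i j k l := by
    have key : ∀ r' : List E, curvClass (s := s) n S (r' ++ [a]) i j k l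
        + curvClass n S (r' ++ [i]) j a k l + curvClass n S (r' ++ [j]) a i k l = 0 := by
      intro r'
      refine curvClass_add_add ?_ ?_ (by simp) (by simp) fun B x hx lab => ?_
      · simp only [List.append_assoc]
        refine List.Perm.append_left r' ?_
        exact (List.perm_append_comm (l₁ := [a]) (l₂ := [i, j])).append_right [k, l]
      · simp only [List.append_assoc]
        refine List.Perm.append_left r' ?_
        exact (List.perm_append_comm (l₁ := [a, i]) (l₂ := [j])).append_right [k, l]
      · have := iterCov_riem_bianchi_second B hx (r'.map lab) (lab a) (lab i) (lab j) (lab k) (lab l)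
        simpa using this
    have hperm : ∀ (b : E) (i j k l : E), curvClass (s := s) n S (b :: r) i j k l
        = curvClass n S (r ++ [b]) i j k l := by
      intro b i j k l
      have h : (b :: r).Perm (r ++ [b]) := (List.perm_append_singleton b r).symm
      by_cases he : Enum S (b :: r ++ [i, j, k, l])
      · rw [curvClass_of_enum he, curvClass_of_enum (he.perm (h.append_right _)), mkQ_sub_eq,
          ← h.length_eq]
        have := perm_mem_long (n := n) (S := S) (Kind.curv : Kind s) [i, j, k, l] rfl h [] []
          (by simpa using he) _ rfl
        simpa using this
      · rw [curvClass_of_not_enum he,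
          curvClass_of_not_enum fun h' => he (h'.perm (h.append_right _).symm)]
    rw [hperm, hperm, hperm]
    exact key r

/-- Modulo longer contractions, the derivatives of the curvature are the linearized curvature of
`metricJet`. -/
theorem curv_sub_linPattern_mem (r : List E) (i j k l : E) (he : Enum S (r ++ [i, j, k, l])) :
    (fac n .curv r.length (r ++ [i, j, k, l]) - fun B x lab =>
      linPattern (metricJet B x) (r.map lab) (lab i) (lab j) (lab k) (lab l))
      ∈ cls n (Net.Long (unitCharge .curv) 2 : Net s E S → Prop) := by
  set K := cls n (Net.Long (unitCharge .curv) 2 : Net s E S → Prop)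
  let f : List E → E → E → E → E → LFun n s E := fun r a b c d =>
    fac n .curv r.length (r ++ [a, b, c, d])
  let H : List E → E → E → LFun n s E := fun L c d =>
    (L.permutations.map fun L' => selectTwo f c d L' + selectTwo f d c L').sum
  have hsel : ∀ (c d : E) (L : List E) (B : Background n s) (x) (lab : E → Fin n),
      selectTwo f c d L B x lab = selectTwo (curvComp B x) (lab c) (lab d) (L.map lab) := by
    intro c d L B x lab
    match L with
    | [] => rfl
    | [_] => rfl
    | a :: b :: L =>
      simp only [selectTwo, f, fac, List.map_cons, curvComp, List.length_map, List.map_append,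
        List.map_nil]
      rfl
  have hH : ∀ (L : List E) (c d : E) (B : Background n s) (x) (lab : E → Fin n),
      metricJet B x (L.map lab) (lab c) (lab d)
        = H L c d B x lab / (L.length * (L.length + 1) * (L.length - 2).factorial) := by
    intro L c d B x lab
    simp only [H]
    rw [metricJet, List.length_map, ← List.map_permutations, List.map_map, list_sum_apply]
    congr 3
    funext L'
    simp only [Function.comp_apply, Pi.add_apply, hsel]
  have hq : ∀ a b c d, (r ++ [i, j, k, l]).Perm (r ++ [a, c, b, d]) →
      K.mkQ (H (a :: b :: r) c d) = (((a :: b :: r).permutations).map fun L =>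
        selectTwo (curvClass (s := s) n S) c d L + selectTwo (curvClass (s := s) n S) d c L).sum := by
    intro a b c d hp
    rw [map_list_sum, List.map_map]
    congr 1
    refine List.map_congr_left fun L hL => ?_
    have hL' := List.mem_permutations.1 hL
    match L, hL' with
    | p :: q :: t, hL' =>
      have h1 : (r ++ [a, c, b, d]).Perm (t ++ [p, c, q, d]) := by
        have e1 : (r ++ [a, c, b, d]).Perm ((a :: b :: r) ++ [c, d]) := by
          refine List.perm_append_comm.trans ?_
          exact ((List.Perm.swap b c (d :: r)).cons a).trans
            ((List.perm_append_comm (l₁ := [c, d]) (l₂ := r)).cons b |>.cons a)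
        have e2 : (t ++ [p, c, q, d]).Perm ((p :: q :: t) ++ [c, d]) := by
          refine List.perm_append_comm.trans ?_
          exact ((List.Perm.swap q c (d :: t)).cons p).trans
            ((List.perm_append_comm (l₁ := [c, d]) (l₂ := t)).cons q |>.cons p)
        exact e1.trans ((hL'.symm.append_right _).trans e2.symm)
      have h2 : (t ++ [p, c, q, d]).Perm (t ++ [p, d, q, c]) := by
        refine List.Perm.append_left t (List.Perm.cons p ?_)
        exact (List.perm_append_comm (l₁ := [c, q]) (l₂ := [d])).trans
          ((List.Perm.swap q c []).cons d)
      have he' := he.perm (hp.trans h1)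
      simp only [Function.comp_apply, selectTwo, map_add]
      rw [curvClass_of_enum he', curvClass_of_enum (he'.perm h2)]
    | [_], hL' => simp at hL'
    | [], hL' => simp at hL'
  have h1 := isCurvatureLike_curvClass (n := n) (s := s) (S := S) |>.reconstruct r i j k l
  rw [← hq, ← hq, ← hq, ← hq, curvClass_of_enum he] at h1
  · have hc : (0 : ℝ) < 2 * ((r.length + 2) * (r.length + 3) * r.length.factorial) := by
      have := r.length.factorial_pos
      positivity
    rw [← map_sub, ← map_sub, ← map_add, ← map_smul, mkQ_sub_eq] at h1
    have h2 := Submodule.smul_mem K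
      (-(2 * ((r.length + 2) * (r.length + 3) * r.length.factorial) : ℝ)⁻¹) h1
    refine mem_cls_congr ?_ h2
    intro B x _ lab
    simp only [Pi.sub_apply, Pi.add_apply, Pi.smul_apply, smul_eq_mul, linPattern]
    have hm : ∀ a b c d, metricJet B x (r.map lab ++ [lab a, lab b]) (lab c) (lab d)
        = H (a :: b :: r) c d B x lab / ((r.length + 2) * (r.length + 3) * r.length.factorial) := by
      intro a b c d
      rw [metricJet_perm B x (L' := (a :: b :: r).map lab)
        (List.perm_append_comm (l₁ := r.map lab) (l₂ := [lab a, lab b])), hH]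
      simp only [List.length_cons]
      push_cast
      ring
    rw [hm, hm, hm, hm]
    field_simp
    ring
  all_goals refine List.Perm.append_left r ?_
  · exact ((List.Perm.swap j i [k, l])).trans (((List.Perm.swap l k []).cons i).cons j)
  · exact ((List.Perm.swap l k []).cons j).cons i
  · exact List.Perm.swap j i _
  · exact List.Perm.refl _

end Symmetrization

/-! ### Normal contractions -/

section Normal

variable {n s : ℕ}

/-- The list form of `Contraction.IsNormalFactor`, for a factor with indices `l`; the index `z` is
contracted against `pt z`. -/
def IsNormalList {A : Type} (pt : A → A) (κ : Kind s) (m : ℕ) (l : List A) : Prop :=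
  (∃ u ≤ m, (∀ z ∈ l.take u, pt z ∈ l.drop u) ∧ ∀ z ∈ l.drop u, pt z ∉ l.drop u) ∨
  (κ = .ric ∧ m = 0 ∧ ∃ z ∈ l, pt z ∈ l)

theorem IsNormalList.map {A A' : Type} {pt : A → A} {pt' : A' → A'} {κ : Kind s} {m : ℕ}
    {l : List A} (h : IsNormalList pt κ m l) (φ : A → A') (hφ : Function.Injective φ)
    (hpt : ∀ z, φ (pt z) = pt' (φ z)) : IsNormalList pt' κ m (l.map φ) := by
  rcases h with ⟨u, hu, h1, h2⟩ | ⟨hκ, hm, z, hz, hz'⟩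
  · refine Or.inl ⟨u, hu, ?_, ?_⟩
    · intro z hz
      rw [← List.map_take] at hz
      obtain ⟨w, hw, rfl⟩ := List.mem_map.1 hz
      rw [← hpt, ← List.map_drop]
      exact List.mem_map_of_mem (h1 w hw)
    · intro z hz
      rw [← List.map_drop] at hz ⊢
      obtain ⟨w, hw, rfl⟩ := List.mem_map.1 hz
      rw [← hpt, List.mem_map_of_injective hφ]
      exact h2 w hw
  · refine Or.inr ⟨hκ, hm, φ z, List.mem_map_of_mem hz, ?_⟩
    rw [← hpt]
    exact List.mem_map_of_mem hz'

/-- The number of the indices in the list `l` that are contracted against an index in `l`. -/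
def doubleCount {A : Type} [DecidableEq A] (pt : A → A) (l : List A) : ℕ :=
  l.countP fun z => decide (pt z ∈ l)

theorem doubleCount_map {A A' : Type} [DecidableEq A] [DecidableEq A'] {pt : A → A} {pt' : A' → A'}
    (l : List A) (φ : A → A') (hφ : Function.Injective φ) (hpt : ∀ z, φ (pt z) = pt' (φ z)) :
    doubleCount pt' (l.map φ) = doubleCount pt l := by
  unfold doubleCount
  rw [List.countP_map]
  refine List.countP_congr fun z _ => ?_
  simp only [Function.comp_apply, ← hpt, List.mem_map_of_injective hφ]

theorem two_mul_length_le_doubleCount {A : Type} [DecidableEq A] {pt : A → A}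
    (hpt : Function.Involutive pt) {u l : List A} (h : (u ++ l).Nodup) (hu : ∀ z ∈ u, pt z ∈ l) :
    2 * u.length ≤ doubleCount pt (u ++ l) := by
  have h1 : u.countP (fun z => decide (pt z ∈ u ++ l)) = u.length := by
    rw [List.countP_eq_length]
    intro z hz
    simp [hu z hz]
  have h2 : u.length ≤ l.countP (fun z => decide (pt z ∈ u ++ l)) := by
    rw [List.countP_eq_length_filter, ← List.length_map pt]
    refine List.Subperm.length_le (List.subperm_of_subset ?_ ?_)
    · exact (h.of_append_left).map hpt.injective
    · intro z hz
      obtain ⟨w, hw, rfl⟩ := List.mem_map.1 hz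
      simp [hu w hw, hpt w, hw]
  rw [doubleCount, List.countP_append, h1]
  omega

variable {E : Type} {S : Finset E}

/-- The partner of an index, if the labels `e` and `par e` are going to be contracted. -/
def partner (par : E → E) {P : Type} : E ⊕ P × Bool → E ⊕ P × Bool :=
  Sum.map par fun p => (p.1, !p.2)

theorem partner_involutive {par : E → E} (h : Function.Involutive par) {P : Type} :
    Function.Involutive (partner par : E ⊕ P × Bool → E ⊕ P × Bool) := by
  rintro (z | ⟨p, b⟩) <;> simp [partner, h _]

variable [DecidableEq E]

/-- Twice the number of internal contractions, including those in the Ricci factors. -/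
def Net.double (par : E → E) (N : Net s E S) : ℕ :=
  ∑ i, doubleCount (partner par) (N.lbl i) + 2 * N.count .ric

/-- Partial contractions with more than `ℓ` factors, or with `ℓ` normal factors of which at most
`r - z` are Ricci factors and which have at least `d / 2` internal contractions. -/
def Net.Good (par : E → E) (χ : Kind s → ℕ) (ℓ r d z : ℕ) (N : Net s E S) : Prop :=
  N.HasCharge χ ∧ (ℓ < N.length ∨ (N.length = ℓ ∧
    (∀ i, IsNormalList (partner par) (N.kind i) (N.ord i) (N.lbl i)) ∧
      N.count .ric + z ≤ r ∧ d ≤ N.double par))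

theorem Net.Good.mono {par : E → E} {χ : Kind s → ℕ} {ℓ r d d' z z' : ℕ} {N : Net s E S}
    (h : N.Good par χ ℓ r d z) (hd : d' ≤ d) (hz : z' ≤ z) : N.Good par χ ℓ r d' z' :=
  ⟨h.1, h.2.imp id fun h => ⟨h.1, h.2.1, by have := h.2.2.1; omega, hd.trans h.2.2.2⟩⟩

theorem cls_long_le_good (par : E → E) (χ : Kind s → ℕ) (ℓ r d z : ℕ) :
    cls n (Net.Long χ (ℓ + 1) : Net s E S → Prop) ≤ cls n (Net.Good par χ ℓ r d z : Net s E S → Prop) :=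
  cls_mono fun _ h => ⟨h.1, Or.inl h.2⟩

theorem Net.Good.mul {par : E → E} {S₁ S₂ : Finset E} (h : Disjoint S₁ S₂)
    {χ₁ χ₂ : Kind s → ℕ} {ℓ₁ ℓ₂ r₁ r₂ d₁ d₂ z₁ z₂ : ℕ} {N₁ : Net s E S₁} {N₂ : Net s E S₂}
    (h₁ : N₁.Good par χ₁ ℓ₁ r₁ d₁ z₁) (h₂ : N₂.Good par χ₂ ℓ₂ r₂ d₂ z₂) :
    (N₁.mul N₂ h).Good par (χ₁ + χ₂) (ℓ₁ + ℓ₂) (r₁ + r₂) (d₁ + d₂) (z₁ + z₂) := by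
  refine ⟨h₁.1.mul h₂.1 h, ?_⟩
  rw [Net.length_mul, Net.count_mul]
  rcases h₁.2 with h₁ | ⟨h₁, n₁, r₁, d₁⟩
  · exact Or.inl (by rcases h₂.2 with h₂ | ⟨h₂, -⟩ <;> omega)
  rcases h₂.2 with h₂ | ⟨h₂, n₂, r₂, d₂⟩
  · exact Or.inl (by omega)
  refine Or.inr ⟨by omega, ?_, by omega, ?_⟩
  · rintro (i | i)
    · refine (n₁ i).map _ (Function.injective_id.sumMap
        (Sum.inl_injective.prodMap Function.injective_id)) ?_
      rintro (z | z) <;> rfl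
    · refine (n₂ i).map _ (Function.injective_id.sumMap
        (Sum.inr_injective.prodMap Function.injective_id)) ?_
      rintro (z | z) <;> rfl
  · have key : (N₁.mul N₂ h).double par = N₁.double par + N₂.double par := by
      unfold Net.double
      rw [Net.count_mul]
      have e1 : ∀ i, doubleCount (partner par)
          ((N₁.lbl i).map (Sum.map id (Prod.map Sum.inl id)) : List (E ⊕ (N₁.P ⊕ N₂.P) × Bool))
          = doubleCount (partner par) (N₁.lbl i) := fun i =>
        doubleCount_map _ _ (Function.injective_id.sumMap
          (Sum.inl_injective.prodMap Function.injective_id)) (by rintro (z | z) <;> rfl)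
      have e2 : ∀ i, doubleCount (partner par)
          ((N₂.lbl i).map (Sum.map id (Prod.map Sum.inr id)) : List (E ⊕ (N₁.P ⊕ N₂.P) × Bool))
          = doubleCount (partner par) (N₂.lbl i) := fun i =>
        doubleCount_map _ _ (Function.injective_id.sumMap
          (Sum.inr_injective.prodMap Function.injective_id)) (by rintro (z | z) <;> rfl)
      have e3 : ∑ i, doubleCount (partner par) ((N₁.mul N₂ h).lbl i)
          = ∑ i, doubleCount (partner par) (N₁.lbl i)
            + ∑ i, doubleCount (partner par) (N₂.lbl i) := by
        refine (Fintype.sum_sum_type (α₁ := N₁.ι) (α₂ := N₂.ι)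
          fun i => doubleCount (partner par) ((N₁.mul N₂ h).lbl i)).trans ?_
        congr 1
        · exact Finset.sum_congr rfl fun i _ => e1 i
        · exact Finset.sum_congr rfl fun i _ => e2 i
      rw [e3]
      ring
    rw [key]
    omega

theorem Net.good_one {par : E → E} (P : Type) [Fintype P] [DecidableEq P] {κ : Kind s} {m : ℕ}
    {e : List (E ⊕ P × Bool)} (hlen : e.length = κ.rank + m)
    (he : Enum (S.disjSum Finset.univ) e) {χ : Kind s → ℕ} (hχ : ∀ κ', κ'.IsFun → unitCharge κ κ' = χ κ')
    {r d z : ℕ}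
    (hn : IsNormalList (partner par) κ m e) (hr : (if κ = .ric then 1 else 0) + z ≤ r)
    (hd : d ≤ doubleCount (partner par) e + 2 * if κ = .ric then 1 else 0) :
    (Net.one P κ m e hlen he).Good par χ 1 r d z := by
  have hc : (Net.one P κ m e hlen he).count .ric = if κ = .ric then 1 else 0 := by
    change (Finset.univ.filter fun _ : Unit => κ = .ric).card = _
    split_ifs with h <;> simp [h]
  refine ⟨fun κ' hκ' => (Net.hasCharge_one P κ m e hlen he κ' hκ').trans (hχ κ' hκ'),
    Or.inr ⟨rfl, fun _ => hn, by rw [hc]; exact hr, ?_⟩⟩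
  unfold Net.double
  rw [hc]
  refine hd.trans (le_of_eq ?_)
  congr 1

/-- The contraction without factors. -/
def Net.empty (s : ℕ) (E : Type) : Net s E ∅ where
  ι := Empty
  P := Empty
  kind := Empty.elim
  ord := Empty.elim
  lbl := Empty.rec
  len := fun i => i.elim
  nodup := fun i => i.elim
  disj := fun i => i.elim
  cover := by
    rintro (z | z)
    · simp
    · exact z.1.elim

theorem one_mem_good (par : E → E) :
    (1 : LFun n s E) ∈ cls n (Net.Good par 0 0 0 0 0 : Net s E ∅ → Prop) := by
  refine mem_cls_of_net (Net.empty s E) ⟨fun κ _ => rfl, Or.inr ⟨rfl, fun i => i.elim, le_refl 0,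
    Nat.zero_le _⟩⟩ fun B x _ lab => ?_
  refine Eq.trans ?_ (Fintype.sum_unique (ι := Empty × Bool → Fin n) _).symm
  exact ((mul_one (1 : ℝ)).symm : (1 : ℝ) = 1 * 1)

theorem mul_mem_good {par : E → E} {S₁ S₂ : Finset E} (h : Disjoint S₁ S₂)
    {χ₁ χ₂ : Kind s → ℕ} {ℓ₁ ℓ₂ r₁ r₂ d₁ d₂ z₁ z₂ : ℕ} {W₁ W₂ : LFun n s E}
    (h₁ : W₁ ∈ cls n (Net.Good par χ₁ ℓ₁ r₁ d₁ z₁ : Net s E S₁ → Prop))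
    (h₂ : W₂ ∈ cls n (Net.Good par χ₂ ℓ₂ r₂ d₂ z₂ : Net s E S₂ → Prop)) :
    W₁ * W₂ ∈ cls n (Net.Good par (χ₁ + χ₂) (ℓ₁ + ℓ₂) (r₁ + r₂) (d₁ + d₂) (z₁ + z₂) :
      Net s E (S₁ ∪ S₂) → Prop) :=
  mul_mem_cls h (fun _ _ => Net.Good.mul h) h₁ h₂

theorem good_le_good (par : E → E) (χ : Kind s → ℕ) (ℓ r : ℕ) {d d' z z' : ℕ} (hd : d' ≤ d)
    (hz : z' ≤ z) : cls n (Net.Good par χ ℓ r d z : Net s E S → Prop)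
      ≤ cls n (Net.Good par χ ℓ r d' z' : Net s E S → Prop) :=
  cls_mono fun _ h => h.mono hd hz

/-- Products of good expressions are good, and changing the factors by good defects changes the
product by a good defect. -/
theorem prod_mem_good {par : E → E} {ι : Type} [DecidableEq ι] (S : ι → Finset E) (χ : ι → Kind s → ℕ)
    (ℓ r d : ι → ℕ) (V W : ι → LFun n s E) (I : Finset ι)
    (hS : ∀ i ∈ I, ∀ j ∈ I, i ≠ j → Disjoint (S i) (S j))
    (hV : ∀ i ∈ I, V i ∈ cls n (Net.Good par (χ i) (ℓ i) (r i) (d i) 0 : Net s E (S i) → Prop))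
    (hVW : ∀ i ∈ I, V i - W i
      ∈ cls n (Net.Good par (χ i) (ℓ i) (r i) (d i) 1 : Net s E (S i) → Prop)) :
    ∏ i ∈ I, V i ∈ cls n (Net.Good par (∑ i ∈ I, χ i) (∑ i ∈ I, ℓ i) (∑ i ∈ I, r i)
      (∑ i ∈ I, d i) 0 : Net s E (I.biUnion S) → Prop) ∧
    ∏ i ∈ I, V i - ∏ i ∈ I, W i ∈ cls n (Net.Good par (∑ i ∈ I, χ i) (∑ i ∈ I, ℓ i)
      (∑ i ∈ I, r i) (∑ i ∈ I, d i) 1 : Net s E (I.biUnion S) → Prop) := by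
  induction I using Finset.induction_on with
  | empty => simpa using one_mem_good (n := n) (s := s) par
  | insert i I hi ih =>
    obtain ⟨ih₁, ih₂⟩ := ih (fun a ha b hb => hS a (Finset.mem_insert_of_mem ha) b
      (Finset.mem_insert_of_mem hb)) (fun a ha => hV a (Finset.mem_insert_of_mem ha))
      (fun a ha => hVW a (Finset.mem_insert_of_mem ha))
    have hd : Disjoint (S i) (I.biUnion S) := by
      rw [Finset.disjoint_biUnion_right]
      exact fun j hj => hS i (Finset.mem_insert_self _ _) j (Finset.mem_insert_of_mem hj)
        fun h => hi (h ▸ hj)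
    have hVi := hV i (Finset.mem_insert_self _ _)
    have hVWi := hVW i (Finset.mem_insert_self _ _)
    have hWi : W i ∈ cls n (Net.Good par (χ i) (ℓ i) (r i) (d i) 0 : Net s E (S i) → Prop) := by
      have := Submodule.sub_mem _ hVi (good_le_good par _ _ _ le_rfl (Nat.zero_le 1) hVWi)
      rwa [sub_sub_cancel] at this
    simp only [Finset.prod_insert hi, Finset.sum_insert hi]
    rw [Finset.biUnion_insert]
    have h1 := mul_mem_good hd hVi ih₁
    have h2 := mul_mem_good hd hVWi ih₁
    have h3 := mul_mem_good hd hWi ih₂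
    refine ⟨h1, ?_⟩
    have : V i * ∏ j ∈ I, V j - W i * ∏ j ∈ I, W j
        = (V i - W i) * ∏ j ∈ I, V j + W i * (∏ j ∈ I, V j - ∏ j ∈ I, W j) := by ring
    rw [this]
    exact Submodule.add_mem _ h2 h3

end Normal

/-! ### Symmetrization of the factors -/

section Factors

variable {n s : ℕ} {E : Type} {S : Finset E}

theorem cls_long_charge {χ χ' : Kind s → ℕ} (h : ∀ κ : Kind s, κ.IsFun → χ κ = χ' κ)
    (ℓ : ℕ) : cls n (Net.Long χ ℓ : Net s E S → Prop) ≤ cls n (Net.Long χ' ℓ : Net s E S → Prop) :=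
  cls_mono fun _ hN => ⟨fun κ hκ => (hN.1 κ hκ).trans (h κ hκ), hN.2⟩

/-- An average over permutations differs from `W` by an average of differences. -/
theorem average_mem {A : Type*} (V : Submodule ℝ (LFun n s E)) (W : LFun n s E) (L : List A)
    (F : A → LFun n s E) (hF : ∀ a ∈ L, W - F a ∈ V) (hL : (L.length : ℝ) ≠ 0) :
    W - (L.length : ℝ)⁻¹ • (L.map F).sum ∈ V := by
  have h : ∀ L : List A, (∀ a ∈ L, W - F a ∈ V) → (L.length : ℝ) • W - (L.map F).sum ∈ V := by
    intro L
    induction L with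
    | nil => intro _; simp
    | cons a L ih =>
      intro h
      have := V.add_mem (h a (by simp)) (ih fun b hb => h b (by simp [hb]))
      convert this using 1
      simp only [List.length_cons, List.map_cons, List.sum_cons]
      push_cast
      module
  have := V.smul_mem (L.length : ℝ)⁻¹ (h L hF)
  rwa [smul_sub, smul_smul, inv_mul_cancel₀ hL, one_smul] at this

variable [DecidableEq E]

theorem cls_good_charge {par : E → E} {χ χ' : Kind s → ℕ} (h : ∀ κ : Kind s, κ.IsFun → χ κ = χ' κ)
    (ℓ r d z : ℕ) : cls n (Net.Good par χ ℓ r d z : Net s E S → Prop)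
      ≤ cls n (Net.Good par χ' ℓ r d z : Net s E S → Prop) :=
  cls_mono fun _ hN => ⟨fun κ hκ => (hN.1 κ hκ).trans (h κ hκ), hN.2⟩

/-- A factor `∇^u ∇^{(m)} T` with all the indices `u` contracted against indices of `∇^{(m)} T`. -/
theorem fac_mem_good {par : E → E} (hpar : Function.Involutive par) {κ : Kind s} {m : ℕ}
    {u l : List E} (hS : Enum S (u ++ l)) (hl : l.length = κ.rank + m) (hu : ∀ z ∈ u, par z ∈ l)
    (hl' : ∀ z ∈ l, par z ∉ l) {r z : ℕ} (hr : (if κ = .ric then 1 else 0) + z ≤ r) :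
    fac n κ (u.length + m) (u ++ l) ∈ cls n (Net.Good par (unitCharge κ) 1 r
      (2 * u.length + 2 * if κ = .ric then 1 else 0) z : Net s E S → Prop) := by
  have hlen : (u ++ l).length = κ.rank + (u.length + m) := by
    rw [List.length_append, hl]
    ring
  refine mem_cls_of_net _ (Net.good_one Empty (by simpa using hlen) hS.map_inl (fun _ _ => rfl) ?_ hr ?_)
    fun B x _ lab => fac_eq_val κ _ _ hlen hS B x lab
  · refine IsNormalList.map (pt := par) (Or.inl ⟨u.length, Nat.le_add_right _ _, ?_, ?_⟩) _
      Sum.inl_injective fun _ => rfl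
    · simpa using hu
    · simpa using hl'
  · rw [doubleCount_map (pt := par) _ _ Sum.inl_injective fun _ => rfl]
    exact Nat.add_le_add_right (two_mul_length_le_doubleCount hpar hS.1 hu) _

theorem fac_psi_sub_symJet_mem (h : Fin s) (l : List E) (hS : Enum S l) :
    (fac n (.psi h) l.length l - fun B x lab => symJet B (scalar (B.ψ h)) x (l.map lab))
      ∈ cls n (Net.Long (unitCharge (.psi h)) 2 : Net s E S → Prop) := by
  have hL : l.permutations.length = l.length.factorial := List.length_permutations l
  have h1 := average_mem (cls n (Net.Long (unitCharge (.psi h)) 2 : Net s E S → Prop))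
    (fac n (.psi h) l.length l) l.permutations (fun l' => fac n (.psi h) l.length l') ?_ ?_
  · refine mem_cls_congr ?_ h1
    intro B x _ lab
    simp only [Pi.sub_apply, Pi.smul_apply, list_sum_apply, smul_eq_mul]
    rw [symJet, List.length_map, ← List.map_permutations, List.map_map, hL, div_eq_inv_mul]
    rfl
  · intro l' hl'
    have hp := (List.mem_permutations.1 hl').symm
    have := perm_mem_long (n := n) (S := S) (.psi h) [] rfl hp [] [] (by simpa using hS) _ rfl
    simpa using this
  · rw [hL]
    exact_mod_cast l.length.factorial_ne_zero

/-- Exchanging the last derivative with the first index of the Ricci tensor produces, modulo longer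
contractions, the curvature term `∇^j ∇_{u t} R_{a b c j}` (contracted second Bianchi identity). It
has one Ricci factor less and the same number of internal contractions. -/
theorem ricci_commutator_mem {par : E → E} (hpar : Function.Involutive par) {u t : List E} {a b c : E}
    (hS : Enum S (u ++ (t ++ [a, b, c]))) (hu : ∀ z ∈ u, par z ∈ t ++ [a, b, c])
    (hl' : ∀ z ∈ t ++ [a, b, c], par z ∉ t ++ [a, b, c]) :
    fac n .ric (u.length + (t.length + 1)) (u ++ (t ++ [a, b, c]))
      - fac n .ric (u.length + (t.length + 1)) (u ++ (t ++ [b, a, c]))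
      ∈ cls n (Net.Good par (unitCharge .ric) 1 1 (2 * u.length + 2) 1 : Net s E S → Prop) := by
  let e₀ : List (E ⊕ Unit × Bool) := (u ++ t).map .inl ++ .inr ((), false) ::
    ([a, b, c].map .inl ++ [.inr ((), true)])
  let e₁ : List (E ⊕ Unit × Bool) := .inr ((), false) :: ((u ++ t).map .inl ++
    ([a, b, c].map .inl ++ [.inr ((), true)]))
  have hp : e₀.Perm e₁ := List.perm_middle
  have he₁ : Enum (S.disjSum Finset.univ) e₁ := by
    have h0 : ((u ++ t).map .inl ++ ([a, b, c].map .inl ++ [.inr ((), true)]) : List (E ⊕ Unit × Bool))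
        = (u ++ (t ++ [a, b, c])).map .inl ++ [.inr ((), true)] := by simp
    constructor
    · simp only [e₁, h0]
      rw [List.nodup_cons, List.nodup_append]
      refine ⟨by simp, hS.1.map Sum.inl_injective, by simp, ?_⟩
      intro z hz w hw
      obtain ⟨v, -, rfl⟩ := List.mem_map.1 hz
      simp at hw
      simp [hw]
    · intro z
      simp only [e₁, h0]
      rcases z with z | ⟨⟨⟩, _ | _⟩
      · simpa using hS.2 z
      · simp
      · simp
  have he₀ : Enum (S.disjSum Finset.univ) e₀ := he₁.perm hp.symm
  set M := u.length + t.length + 1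
  have hgood : (fun B x lab => ∑ α : Unit × Bool → Fin n, (∏ j, (B.g x)⁻¹ (α (j, false)) (α (j, true)))
      * fac n .curv M e₁ B x (Sum.elim lab α))
      ∈ cls n (Net.Good par (unitCharge .ric) 1 1 (2 * u.length + 2) 1 : Net s E S → Prop) := by
    have hlen : e₁.length = (Kind.curv : Kind s).rank + M := by
      simp [e₁, Kind.rank, M]
      ring
    refine mem_cls_of_net _ (Net.good_one Unit hlen he₁ (χ := unitCharge .ric) ?_ ?_ ?_ ?_)
      fun B x _ lab => (Net.val_one Unit Kind.curv M e₁ hlen he₁ B x lab).symm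
    · intro κ' hκ'
      simp [unitCharge, hκ'.1.symm, hκ'.2.symm]
    · refine Or.inl ⟨u.length + 1, by omega, ?_, ?_⟩
      · have ht : e₁.take (u.length + 1) = .inr ((), false) :: u.map .inl := by
          simp [e₁]
        have hd : e₁.drop (u.length + 1) = (t ++ [a, b, c]).map .inl ++ [.inr ((), true)] := by
          simp [e₁]
        rw [ht, hd]
        intro z hz
        rcases List.mem_cons.1 hz with rfl | hz
        · simp [partner]
        · obtain ⟨w, hw, rfl⟩ := List.mem_map.1 hz
          exact List.mem_append_left _ (List.mem_map_of_mem (hu w hw))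
      · have hd : e₁.drop (u.length + 1) = (t ++ [a, b, c]).map .inl ++ [.inr ((), true)] := by
          simp [e₁]
        rw [hd]
        intro z hz
        rcases List.mem_append.1 hz with hz | hz
        · obtain ⟨w, hw, rfl⟩ := List.mem_map.1 hz
          intro h
          rcases List.mem_append.1 h with h | h
          · exact hl' w hw ((List.mem_map_of_injective Sum.inl_injective).1 h)
          · simp [partner] at h
        · rw [List.mem_singleton.1 hz]
          simp [partner]
    · simp
    · have h1 : e₁ = (.inr ((), false) :: u.map .inl) ++ ((t ++ [a, b, c]).map .inl
          ++ [.inr ((), true)]) := by simp [e₁]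
      have h2 := two_mul_length_le_doubleCount (partner_involutive hpar)
        (u := .inr ((), false) :: u.map .inl)
        (l := (t ++ [a, b, c]).map .inl ++ [.inr ((), true)]) (h1 ▸ he₁.1) (by
          intro z hz
          rcases List.mem_cons.1 hz with rfl | hz
          · simp [partner]
          · obtain ⟨w, hw, rfl⟩ := List.mem_map.1 hz
            exact List.mem_append_left _ (List.mem_map_of_mem (hu w hw)))
      rw [← h1] at h2
      simp at h2 ⊢
      omega
  have hlong : fac n .curv M e₀ - fac n .curv M e₁
      ∈ cls n (Net.Long (unitCharge .curv) 2 : Net s (E ⊕ Unit × Bool) (S.disjSum Finset.univ) → Prop) := by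
    have := perm_mem_long (n := n) (S := S.disjSum Finset.univ) (Kind.curv : Kind s)
      ([a, b, c].map .inl ++ [.inr ((), true)] : List (E ⊕ Unit × Bool)) rfl
      (List.perm_append_singleton (.inr ((), false)) ((u ++ t).map .inl)) [] []
      (by simpa [e₀] using he₀) M (by simp [M, add_assoc])
    simpa [e₀, e₁] using this
  have hlong' := cls_long_le_good (n := n) par (unitCharge (.ric : Kind s)) 1 1 (2 * u.length + 2) 1
    (cls_long_charge (χ' := unitCharge .ric) (fun κ' hκ' => by
      simp [unitCharge, hκ'.1.symm, hκ'.2.symm]) 2 (close_mem_long hlong))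
  refine mem_cls_congr ?_ (Submodule.neg_mem _ (Submodule.add_mem _ hlong' hgood))
  intro B x hx lab
  have h1 := iterCov_ricci_sub B hx ((u ++ t).map lab) (lab a) (lab b) (lab c)
  simp only [Pi.sub_apply, Pi.neg_apply, Pi.add_apply, fac, List.map_append, List.map_cons,
    List.map_nil]
  simp only [List.length_map, List.length_append, List.map_append, List.append_assoc] at h1
  rw [← add_assoc]
  refine h1.trans ?_
  congr 1
  simp only [← Finset.sum_add_distrib, ← mul_add, sub_add_cancel]
  refine Eq.trans ?_ (sum_pairs_unit _).symm
  refine Finset.sum_congr rfl fun j _ => Finset.sum_congr rfl fun l _ => ?_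
  simp [e₀, M, Background.factor, Background.base]

/-- Permuting the indices of `∇^u ∇^{(m)}_{l₁ … l_m} Ric_{l_{m+1} l_{m+2}}` other than `u` changes it
by longer contractions and by contractions with a curvature factor in place of the Ricci factor that
have the same number of internal contractions. -/
theorem ricci_perm_mem {par : E → E} (hpar : Function.Involutive par) {u : List E} {l l' : List E}
    (h : l.Perm l') : ∀ (front : List E), Enum S (u ++ (front ++ l)) →
    (∀ z ∈ u, par z ∈ front ++ l) → (∀ z ∈ front ++ l, par z ∉ front ++ l) →
    ∀ M, M + 2 = u.length + (front ++ l).length →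
    fac n .ric M (u ++ (front ++ l)) - fac n .ric M (u ++ (front ++ l'))
      ∈ cls n (Net.Good par (unitCharge .ric) 1 1 (2 * u.length + 2) 1 : Net s E S → Prop) := by
  induction h with
  | nil => intro front _ _ _ M _; simp
  | cons c _ ih =>
    intro front hS hu hl M hM
    simpa using ih (front ++ [c]) (by simpa using hS) (by simpa using hu) (by simpa using hl) M
      (by simpa [add_assoc, add_comm] using hM)
  | swap a b t =>
    intro front hS hu hl M hM
    match t with
    | [] =>
      obtain rfl : M = u.length + front.length := by simp at hM; omega
      refine mem_cls_of_zero fun B x hx lab => ?_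
      have := iterCov_ricci_symm B hx ((u ++ front).map lab) (lab b) (lab a)
      simp only [List.length_map, List.length_append] at this
      simpa [fac, sub_eq_zero, Background.factor, Background.base] using this
    | [c] =>
      obtain rfl : M = u.length + (front.length + 1) := by simp at hM; omega
      exact ricci_commutator_mem hpar hS hu hl
    | c :: c' :: t =>
      obtain rfl : M = (u ++ front).length + (t.length + 2) := by simp at hM ⊢; omega
      have := swap_mem_long (n := n) (S := S) (Kind.ric : Kind s) (u ++ front) t.length b a
        (c :: c' :: t) (by simp [Kind.rank]; ring) (by simpa using hS)
      refine cls_long_le_good _ _ _ _ _ _ ?_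
      simpa using this
  | trans h₁ h₂ ih₁ ih₂ =>
    intro front hS hu hl M hM
    have hp := h₁.append_left front
    have := Submodule.add_mem _ (ih₁ front hS hu hl M hM) (ih₂ front
      (hS.perm (hp.append_left u)) (fun z hz => hp.mem_iff.1 (hu z hz))
      (fun z hz h => hl z (hp.mem_iff.2 hz) (hp.mem_iff.2 h)) M (by rw [hM, hp.length_eq]))
    simpa using this

theorem fac_ricci_sub_ricciJet_mem {par : E → E} (hpar : Function.Involutive par) {u l : List E}
    {m : ℕ} (hS : Enum S (u ++ l)) (hl : l.length = m + 2) (hu : ∀ z ∈ u, par z ∈ l)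
    (hl' : ∀ z ∈ l, par z ∉ l) :
    (fac n .ric (u.length + m) (u ++ l) - fun B x lab => ricciJet B x (u.map lab) (l.map lab))
      ∈ cls n (Net.Good par (unitCharge .ric) 1 1 (2 * u.length + 2) 1 : Net s E S → Prop) := by
  set V := cls n (Net.Good par (unitCharge .ric) 1 1 (2 * u.length + 2) 1 : Net s E S → Prop)
  have hlu : u.permutations.length = u.length.factorial := List.length_permutations u
  have hll : l.permutations.length = l.length.factorial := List.length_permutations l
  have h1 := average_mem V (fac n .ric (u.length + m) (u ++ l)) u.permutations
    (fun u' => (l.permutations.length : ℝ)⁻¹ • (l.permutations.map fun l' =>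
      fac n .ric (u.length + m) (u' ++ l')).sum) ?_ ?_
  · refine mem_cls_congr ?_ h1
    intro B x _ lab
    simp only [Pi.sub_apply, Pi.smul_apply, list_sum_apply, smul_eq_mul]
    rw [ricciJet, List.length_map, List.length_map, ← List.map_permutations, ← List.map_permutations,
      List.map_map, hlu, hll, List.sum_map_mul_left, div_eq_inv_mul, mul_inv, mul_assoc]
    congr 3
    refine congrArg List.sum (List.map_congr_left fun u' _ => ?_)
    simp only [Function.comp_apply, List.map_map, hl, Nat.add_sub_cancel]
    congr 2
    funext l'
    simp [fac, Background.factor, Background.base]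
  · intro u' hu'
    refine average_mem V _ _ _ ?_ ?_
    · intro l' hl''
      have hpu := (List.mem_permutations.1 hu').symm
      have hpl := (List.mem_permutations.1 hl'').symm
      have e1 : fac n .ric (u.length + m) (u ++ l) - fac n .ric (u.length + m) (u' ++ l) ∈ V := by
        obtain ⟨r, post, rfl, hpost⟩ : ∃ r post, l = r ++ post ∧ post.length = 2 :=
          ⟨l.take m, l.drop m, (List.take_append_drop _ _).symm, by simp [hl]⟩
        have := perm_mem_long (n := n) (S := S) (Kind.ric : Kind s) post hpost hpu [] r
          (by simpa using hS) (u.length + m) (by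
            rw [List.length_append, hpost] at hl
            simp
            omega)
        refine cls_long_le_good _ _ _ _ _ _ ?_
        simpa using this
      have e2 : fac n .ric (u.length + m) (u' ++ l) - fac n .ric (u.length + m) (u' ++ l') ∈ V := by
        have := ricci_perm_mem (n := n) (s := s) hpar hpl [] (u := u')
          (by simpa using hS.perm (hpu.append_right l))
          (by simpa using fun z hz => hu z (hpu.mem_iff.2 hz)) (by simpa using hl') (u.length + m)
          (by rw [← hpu.length_eq, List.nil_append, hl]; ring)
        simpa [V, hpu.length_eq] using this
      simpa using Submodule.add_mem _ e1 e2
    · rw [hll]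
      exact_mod_cast l.length.factorial_ne_zero
  · rw [hlu]
    exact_mod_cast u.length.factorial_ne_zero

end Factors

section RiccFactors

variable {n s : ℕ} {E : Type} {S : Finset E}

/-- The factor `Background.riccFactor`, with its indices given by lists of labels. -/
noncomputable def riccFac (n : ℕ) (κ : Kind s) (p : ℕ) (u l : List E) : LFun n s E :=
  fun B x lab => B.riccFactor κ p x (u.map lab) (l.map lab)

/-- The factor `Background.symFactor`, with its indices given by lists of labels. -/
noncomputable def symFac (n : ℕ) (κ : Kind s) (p : ℕ) (u l : List E) : LFun n s E :=
  fun B x lab => B.symFactor κ p x (u.map lab) (l.map lab)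

/-- The numbers of factors `ψ_h`, `Ω`, `υ` in the factor that `Riccify` makes of a factor of
kind `κ`. -/
def riccCharge : Kind s → Kind s → ℕ
  | .psi h => unitCharge (.psi h)
  | _ => 0

/-- The tensor in `Background.riccFactor`, with `k` additional derivatives. -/
noncomputable def Background.riccTens (B : Background n s) (κ : Kind s) (p k : ℕ) : Tens n :=
  match κ, p with
  | .ups, _ => fun _ _ => 1
  | .omega, 0 => fun _ _ => 0
  | .omega, 1 => fun y l => (1 / 2) * ricci B.g y l
  | .omega, p + 2 => B.factor .ric (k + p)
  | .curv, p => B.factor .curv (k + p)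
  | .ric, p => B.factor .ric (k + p)
  | .psi h, p => B.factor (.psi h) (k + p)

theorem riccFactor_eq (B : Background n s) (κ : Kind s) (p : ℕ) (x : Fin n → ℝ)
    (u l : List (Fin n)) : B.riccFactor κ p x u l = B.riccTens κ p u.length x (u ++ l) := by
  match κ, p with
  | .ups, _ => rfl
  | .omega, 0 => rfl
  | .omega, 1 => rfl
  | .omega, p + 2 => rfl
  | .curv, p => rfl
  | .ric, p => rfl
  | .psi h, p => rfl

theorem smooth_riccTens (B : Background n s) (κ : Kind s) (p k : ℕ) (l : List (Fin n)) :
    ContDiffOn ℝ ∞ (fun y => B.riccTens κ p k y l) B.U := by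
  match κ, p with
  | .ups, _ => exact contDiffOn_const
  | .omega, 0 => exact contDiffOn_const
  | .omega, 1 => exact contDiffOn_const.mul (B.smooth_ricci l)
  | .omega, p + 2 => exact B.smooth_factor _ _ _
  | .curv, p => exact B.smooth_factor _ _ _
  | .ric, p => exact B.smooth_factor _ _ _
  | .psi h, p => exact B.smooth_factor _ _ _

theorem cov_riccTens (B : Background n s) {κ : Kind s} {p : ℕ} (k : ℕ) (hκ : κ ≠ .ups)
    (hp : κ = .omega → 2 ≤ p) : cov B.g (B.riccTens κ p k) = B.riccTens κ p (k + 1) := by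
  match κ, p with
  | .ups, _ => exact absurd rfl hκ
  | .omega, 0 => exact absurd (hp rfl) (by norm_num)
  | .omega, 1 => exact absurd (hp rfl) (by norm_num)
  | .omega, p + 2 => exact (factor_succ B _ _).symm.trans (by rw [add_right_comm]; rfl)
  | .curv, p => exact (factor_succ B _ _).symm.trans (by rw [add_right_comm]; rfl)
  | .ric, p => exact (factor_succ B _ _).symm.trans (by rw [add_right_comm]; rfl)
  | .psi h, p => exact (factor_succ B _ _).symm.trans (by rw [add_right_comm]; rfl)

variable [DecidableEq E]

/-- The factors of `Riccify` are normal, and symmetrizing them changes them by terms with more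
factors or with fewer Ricci factors. -/
theorem riccFac_mem_good {par : E → E} (hpar : Function.Involutive par) {κ : Kind s} {m : ℕ}
    {u l : List E} (hS : Enum S (u ++ l)) (hl : l.length = κ.rank + m) (hu : ∀ z ∈ u, par z ∈ l)
    (hl' : ∀ z ∈ l, par z ∉ l) (hric : κ ≠ .ric) (hups : κ ≠ .ups)
    (hom : κ = .omega → u = [] → 2 ≤ m) :
    riccFac n κ m u l ∈ cls n (Net.Good par (riccCharge κ) 1 (if κ = .omega then 1 else 0)
      (2 * u.length + 2 * if κ = .omega then 1 else 0) 0 : Net s E S → Prop) ∧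
    riccFac n κ m u l - symFac n κ m u l ∈ cls n (Net.Good par (riccCharge κ) 1
      (if κ = .omega then 1 else 0) (2 * u.length + 2 * if κ = .omega then 1 else 0) 1 :
        Net s E S → Prop) := by
  match κ, m with
  | .ups, _ => exact absurd rfl hups
  | .ric, _ => exact absurd rfl hric
  | .curv, m =>
    have hc : ∀ κ : Kind s, κ.IsFun → unitCharge (.curv : Kind s) κ = riccCharge .curv κ :=
      fun κ hκ => by simp [unitCharge, riccCharge, hκ.1.symm]
    constructor
    · refine mem_cls_congr ?_ (cls_good_charge hc _ _ _ _
        (fac_mem_good (n := n) hpar hS hl hu hl' (r := 0) (z := 0) (by simp)))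
      intro B x _ lab
      simp [riccFac, fac, Background.riccFactor, Background.factor, Background.base]
    · obtain ⟨r, post, rfl, hpost⟩ : ∃ r post, l = r ++ post ∧ post.length = 4 :=
        ⟨l.take m, l.drop m, (List.take_append_drop _ _).symm, by simp [hl, Kind.rank]⟩
      obtain ⟨i, j, k, l, rfl⟩ := List.length_eq_four.1 hpost
      obtain rfl : r.length = m := by simpa [Kind.rank, add_comm] using hl
      have h1 := curv_sub_linPattern_mem (n := n) (s := s) (S := S) (u ++ r) i j k l
        (by simpa using hS)
      refine mem_cls_congr ?_ (cls_long_le_good _ _ _ _ _ _ (cls_long_charge hc 2 h1))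
      intro B x _ lab
      simp only [Pi.sub_apply, riccFac, symFac, fac, Background.riccFactor, Background.symFactor,
        List.map_append, List.map_cons, List.map_nil, List.length_append, List.append_assoc,
        List.length_map, Background.factor, Background.base]
      rw [← List.length_map (f := lab) (as := r), linCurv_append]
      simp [linPattern]
  | .psi h, m =>
    have hl0 : l.length = m := by simpa [Kind.rank] using hl
    constructor
    · refine mem_cls_congr ?_
        (fac_mem_good (n := n) hpar hS hl hu hl' (r := 0) (z := 0) (by simp))
      intro B x _ lab
      simp [riccFac, fac, Background.riccFactor, Background.factor, Background.base]
    · refine mem_cls_congr ?_ (cls_long_le_good par (riccCharge (.psi h)) 1 _ _ _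
        (fac_psi_sub_symJet_mem (n := n) (S := S) h (u ++ l) hS))
      intro B x _ lab
      simp [riccFac, symFac, fac, Background.riccFactor, Background.symFactor, Background.factor,
        Background.base, hl0]
  | .omega, m + 2 =>
    have hl0 : l.length = m + 2 := by simpa [Kind.rank] using hl
    have hc : ∀ κ : Kind s, κ.IsFun → unitCharge (.ric : Kind s) κ = riccCharge .omega κ :=
      fun κ hκ => by simp [unitCharge, riccCharge, hκ.2.symm]
    constructor
    · refine mem_cls_congr ?_ (cls_good_charge hc _ _ _ _
        (fac_mem_good (n := n) (κ := .ric) (m := m) hpar hS (by simp [Kind.rank, hl0, add_comm]) hu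
          hl' (r := 1) (z := 0) (by simp)))
      intro B x _ lab
      simp [riccFac, fac, Background.riccFactor, Background.factor, Background.base]
    · refine mem_cls_congr ?_ (cls_good_charge hc _ _ _ _
        (fac_ricci_sub_ricciJet_mem (n := n) hpar hS hl0 hu hl'))
      intro B x _ lab
      simp [riccFac, symFac, fac, Background.riccFactor, Background.symFactor, Background.factor,
        Background.base, hl0]
  | .omega, 0 =>
    obtain rfl : l = [] := by simpa [Kind.rank] using hl
    have : u = [] := List.eq_nil_iff_forall_not_mem.2 fun z hz => by simpa using hu z hz
    exact absurd (hom rfl this) (by norm_num)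
  | .omega, 1 =>
    obtain ⟨e, rfl⟩ : ∃ e, l = [e] := List.length_eq_one_iff.1 (by simpa [Kind.rank] using hl)
    have hue : ∀ z ∈ u, z = par e := fun z hz => by
      rw [← List.mem_singleton.1 (hu z hz), hpar z]
    have hu1 : u = [par e] := by
      match u, hS, hue with
      | [], _, _ => exact absurd (hom rfl rfl) (by norm_num)
      | [z], _, hue => rw [hue z (by simp)]
      | z :: w :: t, hS, hue =>
        have h1 := hS.1
        rw [hue z (by simp), hue w (by simp)] at h1
        simp at h1
    subst hu1
    constructor
    · have hlen : ([par e] ++ [e]).length = (Kind.ric : Kind s).rank + 0 := rfl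
      have hg : fac n .ric 0 ([par e] ++ [e]) ∈ cls n (Net.Good par (riccCharge .omega) 1 1
          (2 * [par e].length + 2 * 1) 0 : Net s E S → Prop) := by
        refine mem_cls_of_net _ (Net.good_one Empty (by simpa using hlen) hS.map_inl ?_ ?_
          (by simp) ?_) fun B x _ lab => fac_eq_val .ric _ _ hlen hS B x lab
        · intro κ hκ
          simp [unitCharge, riccCharge, hκ.2.symm]
        · exact IsNormalList.map (pt := par) (Or.inr ⟨rfl, rfl, e, by simp, by simp⟩) _
            Sum.inl_injective fun _ => rfl
        · rw [doubleCount_map (pt := par) _ _ Sum.inl_injective fun _ => rfl]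
          have := two_mul_length_le_doubleCount hpar hS.1 hu
          simpa using this
      refine mem_cls_congr ?_ (Submodule.smul_mem _ (1 / 2 : ℝ) hg)
      intro B x _ lab
      simp [riccFac, fac, Background.riccFactor, Background.factor, Background.base, iterCov]
    · refine mem_cls_of_zero fun B x _ lab => ?_
      simp [riccFac, symFac, Background.riccFactor, Background.symFactor]

end RiccFactors

/-! ### From labelled contractions to complete contractions -/

section Complete

variable {n s : ℕ} {P : Type} [Fintype P]

/-- The other end of a contracted pair. -/
def flipEnd {P : Type} (z : P × Bool) : P × Bool := (z.1, !z.2)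

theorem flipEnd_involutive {P : Type} : Function.Involutive (flipEnd : P × Bool → P × Bool) := by
  rintro ⟨p, b⟩
  simp [flipEnd]

namespace Net

/-- The numbering of the pairs of `Net.complete`. -/
noncomputable def pairEquiv (N : Net s (P × Bool) Finset.univ) :
    P ⊕ N.P ≃ Fin (Fintype.card (P ⊕ N.P)) :=
  Fintype.equivFin _

/-- The numbering of the ends of the pairs of `Net.complete`. -/
noncomputable def endEquiv (N : Net s (P × Bool) Finset.univ) :
    (P × Bool) ⊕ N.P × Bool ≃ Fin (Fintype.card (P ⊕ N.P)) × Bool :=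
  (Equiv.sumProdDistrib _ _ _).symm.trans (Equiv.prodCongr N.pairEquiv (Equiv.refl Bool))

/-- The index of the `k`-th slot of the factor `i`. -/
def slotLabel (N : Net s (P × Bool) Finset.univ)
    (z : Σ i : N.ι, Fin ((N.kind i).rank + N.ord i)) : (P × Bool) ⊕ N.P × Bool :=
  (N.lbl z.1).get (z.2.cast (N.len z.1).symm)

theorem slotLabel_bijective (N : Net s (P × Bool) Finset.univ) :
    Function.Bijective N.slotLabel := by
  constructor
  · rintro ⟨i, k⟩ ⟨j, l⟩ h
    have hi : N.slotLabel ⟨i, k⟩ ∈ N.lbl i := List.get_mem _ _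
    have hj : N.slotLabel ⟨j, l⟩ ∈ N.lbl j := List.get_mem _ _
    obtain rfl := N.disj i j _ hi (h ▸ hj)
    have := (N.nodup i).injective_get h
    simpa [Fin.ext_iff] using this
  · intro z
    obtain ⟨i, hi⟩ := (N.cover z).2 (by rcases z with z | z <;> simp)
    obtain ⟨k, rfl⟩ := List.get_of_mem hi
    exact ⟨⟨i, k.cast (N.len i)⟩, rfl⟩

theorem endEquiv_partner (N : Net s (P × Bool) Finset.univ) (z : (P × Bool) ⊕ N.P × Bool) :
    N.endEquiv (partner flipEnd z) = flipEnd (N.endEquiv z) := by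
  rcases z with ⟨p, b⟩ | ⟨p, b⟩ <;> rfl

/-- The complete contraction that results if all labels are contracted: `(p, false)` against
`(p, true)`. -/
noncomputable abbrev complete (N : Net s (P × Bool) Finset.univ) : Contraction s 0 where
  ι := N.ι
  kind := N.kind
  ord := N.ord
  pairs := Fintype.card (P ⊕ N.P)
  slot := (Equiv.sumEmpty _ _).trans (N.endEquiv.symm.trans (Equiv.ofBijective _ N.slotLabel_bijective).symm)

theorem complete_slot_symm (N : Net s (P × Bool) Finset.univ)
    (z : Σ i : N.ι, Fin ((N.kind i).rank + N.ord i)) :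
    N.complete.slot.symm z = .inl (N.endEquiv (N.slotLabel z)) := rfl

theorem complete_slot (N : Net s (P × Bool) Finset.univ)
    (z : Σ i : N.ι, Fin ((N.kind i).rank + N.ord i)) :
    N.complete.slot (.inl (N.endEquiv (N.slotLabel z))) = z := by
  exact N.complete.slot.apply_symm_apply z

theorem complete_count (N : Net s (P × Bool) Finset.univ) (κ : Kind s) :
    N.complete.count κ = N.count κ :=
  Fintype.card_subtype _

theorem complete_paired (N : Net s (P × Bool) Finset.univ)
    (y z : Σ i : N.ι, Fin ((N.kind i).rank + N.ord i)) :
    N.complete.Paired y z ↔ N.slotLabel z = partner flipEnd (N.slotLabel y) := by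
  constructor
  · rintro ⟨j, b, hy, hz⟩
    have h1 : (j, b) = N.endEquiv (N.slotLabel y) := by
      refine Sum.inl_injective (Eq.trans ?_ (N.complete_slot_symm y))
      rw [← hy, Equiv.symm_apply_apply]
    have h2 : (j, !b) = N.endEquiv (N.slotLabel z) := by
      refine Sum.inl_injective (Eq.trans ?_ (N.complete_slot_symm z))
      rw [← hz, Equiv.symm_apply_apply]
    apply N.endEquiv.injective
    rw [endEquiv_partner, ← h1, ← h2]
    rfl
  · intro h
    refine ⟨(N.endEquiv (N.slotLabel y)).1, (N.endEquiv (N.slotLabel y)).2, N.complete_slot y, ?_⟩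
    have h1 : ((N.endEquiv (N.slotLabel y)).1, !(N.endEquiv (N.slotLabel y)).2)
        = N.endEquiv (N.slotLabel z) := by
      rw [h, endEquiv_partner]
      rfl
    rw [h1]
    exact N.complete_slot z

theorem complete_owner (N : Net s (P × Bool) Finset.univ) {i : N.ι} {z : (P × Bool) ⊕ N.P × Bool}
    (hz : z ∈ N.lbl i) :
    N.complete.owner (N.endEquiv z).1 (N.endEquiv z).2 = i := by
  obtain ⟨k, rfl⟩ := List.get_of_mem hz
  have := N.complete_slot ⟨i, k.cast (N.len i)⟩
  exact congrArg Sigma.fst this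

theorem complete_isNormalFactor (N : Net s (P × Bool) Finset.univ) (i : N.ι)
    (h : IsNormalList (partner flipEnd) (N.kind i) (N.ord i) (N.lbl i)) :
    N.complete.IsNormalFactor i := by
  have hget : ∀ z ∈ N.lbl i, ∃ k : Fin ((N.kind i).rank + N.ord i), N.slotLabel ⟨i, k⟩ = z := by
    intro z hz
    obtain ⟨k, rfl⟩ := List.get_of_mem hz
    exact ⟨k.cast (N.len i), rfl⟩
  rcases h with ⟨u, hu, h1, h2⟩ | ⟨hκ, hm, z, hz, hz'⟩
  · refine Or.inl ⟨u, hu, ?_, ?_⟩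
    · intro k hk
      have hmem : N.slotLabel ⟨i, k⟩ ∈ (N.lbl i).take u := by
        rw [List.mem_take_iff_getElem]
        exact ⟨k, by have := k.2; have := N.len i; omega, rfl⟩
      obtain ⟨l, hl, hl'⟩ := List.mem_drop_iff_getElem.1 (h1 _ hmem)
      refine ⟨⟨u + l, by rw [← N.len i]; omega⟩, Nat.le_add_right _ _, ?_⟩
      rw [complete_paired]
      exact hl'
    · intro k l hk hl hp
      rw [complete_paired] at hp
      have hmem : ∀ k : Fin ((N.kind i).rank + N.ord i), u ≤ k.val →
          N.slotLabel ⟨i, k⟩ ∈ (N.lbl i).drop u := by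
        intro k hk
        rw [List.mem_drop_iff_getElem]
        have h3 := k.2
        have h4 := N.len i
        refine ⟨k - u, by omega, ?_⟩
        simp only [Nat.add_sub_cancel' hk]
        rfl
      exact h2 _ (hmem k hk) (hp ▸ hmem l hl)
  · obtain ⟨k, hk⟩ := hget z hz
    obtain ⟨l, hl⟩ := hget _ hz'
    refine Or.inr ⟨hκ, hm, k, l, ?_⟩
    rw [complete_paired, hk, hl]

theorem double_le_delta [DecidableEq P] (N : Net s (P × Bool) Finset.univ) :
    N.double flipEnd ≤ 2 * N.complete.delta := by
  have h1 : ∀ i, doubleCount (partner flipEnd) (N.lbl i)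
      = ((N.lbl i).toFinset.filter fun z => partner flipEnd z ∈ (N.lbl i).toFinset).card := by
    intro i
    unfold doubleCount
    rw [List.countP_eq_length_filter, ← List.toFinset_card_of_nodup ((N.nodup i).filter _),
      List.toFinset_filter]
    congr 1
    refine Finset.filter_congr fun z _ => ?_
    simp
  have h2 : ∑ i, doubleCount (partner flipEnd) (N.lbl i)
      = (Finset.univ.biUnion fun i =>
          (N.lbl i).toFinset.filter fun z => partner flipEnd z ∈ (N.lbl i).toFinset).card := by
    rw [Finset.card_biUnion]
    · exact Finset.sum_congr rfl fun i _ => h1 i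
    · intro i _ j _ hij
      refine Finset.disjoint_left.2 fun z hz hz' => hij ?_
      simp only [Finset.mem_filter, List.mem_toFinset] at hz hz'
      exact N.disj i j z hz.1 hz'.1
  have h3 : (Finset.univ.biUnion fun i =>
          (N.lbl i).toFinset.filter fun z => partner flipEnd z ∈ (N.lbl i).toFinset).card
      ≤ ((Finset.univ.filter fun j => N.complete.IsInternal j) ×ˢ (Finset.univ : Finset Bool)).card := by
    refine Finset.card_le_card_of_injOn N.endEquiv ?_ N.endEquiv.injective.injOn
    intro z hz
    simp only [Finset.coe_biUnion, Finset.coe_univ, Set.mem_univ, Set.iUnion_true, Set.mem_iUnion,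
      Finset.coe_filter, List.mem_toFinset, Set.mem_ofPred_eq] at hz
    obtain ⟨i, hz, hz'⟩ := hz
    simp only [Finset.coe_product, Finset.coe_univ, Set.mem_prod, Finset.coe_filter,
      Finset.mem_univ, true_and, Set.mem_ofPred_eq, Set.mem_univ, and_true]
    have e1 := N.complete_owner hz
    have e2 := N.complete_owner hz'
    rw [endEquiv_partner] at e2
    simp only [flipEnd] at e2
    unfold Contraction.IsInternal
    rcases hb : (N.endEquiv z).2 with _ | _ <;> rw [hb] at e1 e2
    · exact e1.trans e2.symm
    · exact e2.trans e1.symm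
  rw [Net.double, h2, Contraction.delta, complete_count, Fintype.card_subtype]
  rw [Finset.card_product, Finset.card_univ, Fintype.card_bool] at h3
  omega

theorem complete_labels (N : Net s (P × Bool) Finset.univ)
    (lab : (Fin N.complete.pairs × Bool) ⊕ Fin 0 → Fin n) (i : N.ι) :
    N.complete.labels lab i = (N.lbl i).map fun z => lab (.inl (N.endEquiv z)) := by
  refine List.ext_getElem ?_ ?_
  · simp only [Contraction.labels, List.length_ofFn, List.length_map]
    exact (N.len i).symm
  · intro k h1 h2
    simp only [Contraction.labels, List.getElem_ofFn, List.getElem_map]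
    rw [complete_slot_symm]
    rfl

theorem complete_value [DecidableEq P] (N : Net s (P × Bool) Finset.univ) (B : Background n s) (x : Fin n → ℝ) :
    N.complete.value B x Fin.elim0 = ∑ α : P × Bool → Fin n,
      (∏ j, (B.g x)⁻¹ (α (j, false)) (α (j, true))) * N.val n B x α := by
  simp only [Net.val, Finset.mul_sum]
  rw [← Fintype.sum_prod_type']
  refine Fintype.sum_equiv ((Equiv.arrowCongr (Equiv.prodCongr N.pairEquiv.symm (Equiv.refl Bool))
    (Equiv.refl (Fin n))).trans (pairsSumEquiv P N.P n)) _ _ fun α => ?_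
  rw [← mul_assoc]
  congr 1
  · refine (Fintype.prod_equiv N.pairEquiv.symm _ (fun j : P ⊕ N.P => (B.g x)⁻¹
      (α (N.pairEquiv j, false)) (α (N.pairEquiv j, true))) fun j => by simp).trans ?_
    rw [Fintype.prod_sum_type]
    rfl
  · refine Finset.prod_congr rfl fun i _ => ?_
    beta_reduce
    rw [complete_labels]
    refine congrArg _ (List.map_congr_left fun z _ => ?_)
    rcases z with ⟨z, b⟩ | ⟨z, b⟩ <;> rfl

end Net

/-- The expressions that agree, on the domain of every background, with a linear combination of
complete contractions satisfying `p`. -/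
def Combination (n : ℕ) (p : Contraction s 0 → Prop) (F : Background n s → (Fin n → ℝ) → ℝ) : Prop :=
  ∃ (K : ℕ) (c : Fin K → ℝ) (C : Fin K → Contraction s 0), (∀ k, p (C k)) ∧
    ∀ B, ∀ x ∈ B.U, F B x = ∑ k, c k * (C k).value B x Fin.elim0

theorem Combination.sum {p : Contraction s 0 → Prop} {T : Type} [Fintype T]
    {F : T → Background n s → (Fin n → ℝ) → ℝ} (hF : ∀ t, Combination n p (F t)) (a : T → ℝ)
    {G : Background n s → (Fin n → ℝ) → ℝ} (hG : ∀ B, ∀ x ∈ B.U, G B x = ∑ t, a t * F t B x) :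
    Combination n p G := by
  choose K c C hp hc using hF
  refine ⟨Fintype.card (Σ t, Fin (K t)), fun k => a ((Fintype.equivFin _).symm k).1 *
    c _ ((Fintype.equivFin (Σ t, Fin (K t))).symm k).2, fun k => C _ ((Fintype.equivFin (Σ t, Fin (K t))).symm k).2,
    fun k => hp _ _, fun B x hx => ?_⟩
  rw [hG B x hx, (Fintype.equivFin (Σ t, Fin (K t))).symm.sum_comp
    fun z => a z.1 * c z.1 z.2 * (C z.1 z.2).value B x Fin.elim0, Fintype.sum_sigma]
  refine Finset.sum_congr rfl fun t _ => ?_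
  rw [hc t B x hx, Finset.mul_sum]
  exact Finset.sum_congr rfl fun k _ => by ring

/-- Contracting the remaining labels of a combination of partial contractions in pairs yields a
combination of complete contractions. -/
theorem combination_of_mem_cls [DecidableEq P] {p : Net s (P × Bool) Finset.univ → Prop}
    {q : Contraction s 0 → Prop} (hpq : ∀ N, p N → q N.complete) {W : LFun n s (P × Bool)}
    (hW : W ∈ cls n p) :
    Combination n q fun B x => ∑ α : P × Bool → Fin n,
      (∏ j, (B.g x)⁻¹ (α (j, false)) (α (j, true))) * W B x α := by
  obtain ⟨K, c, N, hN, e⟩ := mem_cls_iff.1 hW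
  refine ⟨K, c, fun k => (N k).complete, fun k => hpq _ (hN k), fun B x hx => ?_⟩
  simp only [e B x hx, Net.complete_value, Finset.mul_sum]
  rw [Finset.sum_comm]
  exact Finset.sum_congr rfl fun _ _ => Finset.sum_congr rfl fun _ _ => by ring

/-- The complete contractions that may be left over: those with more than `τ` factors, and normal
ones which have at least `a + q` internal contractions and fewer than `q` Ricci factors or at least
`a + q + 1` internal contractions and `q` Ricci factors. -/
def IsRemainder (τ q a : ℕ) (C : Contraction s 0) : Prop :=
  C.HasCounts 0 0 ∧ (τ + 1 ≤ C.length ∨ C.IsNormal τ ∧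
    (C.count .ric < q ∧ a + q ≤ C.delta ∨ C.count .ric = q ∧ a + q + 1 ≤ C.delta))

/-- The number `d` in `Net.Good` counts slots, so that it is twice a number of internal contractions. -/
theorem Net.Good.isRemainder [DecidableEq P] {τ q a d z : ℕ} {χ : Kind s → ℕ} {N : Net s (P × Bool) Finset.univ}
    (h : N.Good flipEnd χ τ q d z) (h1 : ∀ h, χ (.psi h) = 1) (h2 : χ .omega = 0)
    (h3 : χ .ups = 0) (hd : 2 * (a + q) ≤ d) (hz : z = 1 ∨ 2 * (a + q + 1) ≤ d) :
    IsRemainder τ q a N.complete := by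
  have hc : N.complete.HasCounts 0 0 := by
    refine ⟨fun h' => ?_, ?_, ?_⟩ <;> rw [Net.complete_count, h.1 _ ⟨by simp, by simp⟩]
    · exact h1 h'
    · exact h2
    · exact h3
  refine ⟨hc, h.2.imp id fun ⟨e1, e2, e3, e4⟩ => ⟨⟨hc, e1, fun i => N.complete_isNormalFactor i (e2 i)⟩, ?_⟩⟩
  have := N.double_le_delta
  rw [N.complete_count]
  omega

end Complete

/-! ### Complete contractions given by lists of indices -/

section Schemes

variable {n s : ℕ}

/-- A complete contraction whose factors come with the lists of their indices, an index being one
of the two ends of a contracted pair `p : P`. -/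
structure Scheme (s : ℕ) where
  ι : Type
  [fintypeι : Fintype ι]
  [decEqι : DecidableEq ι]
  P : Type
  [fintypeP : Fintype P]
  [decEqP : DecidableEq P]
  kind : ι → Kind s
  ord : ι → ℕ
  lbl : ι → List (P × Bool)
  len : ∀ i, (lbl i).length = (kind i).rank + ord i
  nodup : ∀ i, (lbl i).Nodup
  disj : ∀ i j z, z ∈ lbl i → z ∈ lbl j → i = j
  cover : ∀ z, ∃ i, z ∈ lbl i

attribute [instance] Scheme.fintypeι Scheme.decEqι Scheme.fintypeP Scheme.decEqP

/-- Contraction of `W` over pairs of labels. -/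
noncomputable def contractPairs {P : Type} [Fintype P] [DecidableEq P] (B : Background n s)
    (x : Fin n → ℝ) (W : (P × Bool → Fin n) → ℝ) : ℝ :=
  ∑ α : P × Bool → Fin n, (∏ j, (B.g x)⁻¹ (α (j, false)) (α (j, true))) * W α

namespace Scheme

/-- The value of a complete contraction. -/
noncomputable def val (C : Scheme s) (B : Background n s) (x : Fin n → ℝ) : ℝ :=
  contractPairs B x fun α => ∏ i, B.factor (C.kind i) (C.ord i) x ((C.lbl i).map α)

/-- The number of factors of a given kind. -/
def count (C : Scheme s) (κ : Kind s) : ℕ := (Finset.univ.filter fun i => C.kind i = κ).card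

/-- The index belongs to a factor `υ`. -/
def IsUps (C : Scheme s) (z : C.P × Bool) : Prop := ∃ i, z ∈ C.lbl i ∧ C.kind i = .ups

open Classical in
/-- The indices of factors `υ` that are contracted against the factor `i`. -/
noncomputable def upsList (C : Scheme s) (i : C.ι) : List (C.P × Bool) :=
  (C.lbl i).filterMap fun z => if C.IsUps (flipEnd z) then some (flipEnd z) else none

theorem mem_upsList (C : Scheme s) {i : C.ι} {z : C.P × Bool} :
    z ∈ C.upsList i ↔ flipEnd z ∈ C.lbl i ∧ C.IsUps z := by
  unfold upsList
  rw [List.mem_filterMap]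
  constructor
  · rintro ⟨w, hw, h⟩
    split_ifs at h with hu
    obtain rfl := Option.some_injective _ h
    exact ⟨by rwa [flipEnd_involutive w], hu⟩
  · rintro ⟨h, hu⟩
    refine ⟨flipEnd z, h, ?_⟩
    rw [flipEnd_involutive z, if_pos hu]

theorem nodup_upsList (C : Scheme s) (i : C.ι) : (C.upsList i).Nodup := by
  refine (C.nodup i).filterMap fun w w' z hw hw' => ?_
  simp only [Option.mem_def, Option.ite_none_right_eq_some, Option.some.injEq] at hw hw'
  exact flipEnd_involutive.injective (hw.2.trans hw'.2.symm)

/-- `Riccify` for contractions given by lists of indices. -/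
noncomputable def riccify (C : Scheme s) (B : Background n s) (x : Fin n → ℝ) : ℝ :=
  contractPairs B x fun α =>
    ∏ i, B.riccFactor (C.kind i) (C.ord i) x ((C.upsList i).map α) ((C.lbl i).map α)

/-- `Riccify` with symmetrized factors. -/
noncomputable def symmetrize (C : Scheme s) (B : Background n s) (x : Fin n → ℝ) : ℝ :=
  contractPairs B x fun α =>
    ∏ i, B.symFactor (C.kind i) (C.ord i) x ((C.upsList i).map α) ((C.lbl i).map α)

/-- The conditions of `Contraction.IsAdmissible` except for the absence of internal contractions
and the lower bound for the orders of the factors `∇^{(p)}ψ_h`. -/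
structure IsBalanced (C : Scheme s) (τ q a : ℕ) : Prop where
  psi : ∀ h, C.count (.psi h) = 1
  omega : C.count .omega = q
  ups : C.count .ups = a
  length_eq : Fintype.card C.ι = τ + a
  no_ric : ∀ i, C.kind i ≠ .ric
  ups_ord : ∀ i, C.kind i = .ups → C.ord i = 1
  ups_not_ups : ∀ z, C.IsUps z → ¬ C.IsUps (flipEnd z)
  omega_ord : ∀ i, C.kind i = .omega → C.upsList i = [] → 2 ≤ C.ord i

/-- The list form of `Contraction.IsAdmissible`, without the lower bound for the orders of the
factors `∇^{(p)}ψ_h`. -/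
structure IsAdmissible (C : Scheme s) (τ q a : ℕ) : Prop extends C.IsBalanced τ q a where
  no_internal : ∀ i, ∀ z ∈ C.lbl i, flipEnd z ∉ C.lbl i

/-- The factors other than `∇υ`. -/
def nonUps (C : Scheme s) : Finset C.ι := Finset.univ.filter fun i => C.kind i ≠ .ups

theorem prod_eq_prod_nonUps (C : Scheme s) (f : C.ι → ℝ) (hf : ∀ i, C.kind i = .ups → f i = 1) :
    ∏ i, f i = ∏ i ∈ C.nonUps, f i := by
  refine (Finset.prod_subset (Finset.subset_univ _) fun i _ hi => hf i ?_).symm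
  simpa [nonUps] using hi

theorem mem_nonUps (C : Scheme s) {i : C.ι} : i ∈ C.nonUps ↔ C.kind i ≠ .ups := by
  simp [nonUps]

theorem not_isUps (C : Scheme s) {i : C.ι} (hi : i ∈ C.nonUps) {z : C.P × Bool} (hz : z ∈ C.lbl i) :
    ¬ C.IsUps z := by
  rintro ⟨j, hj, hk⟩
  obtain rfl := C.disj i j z hz hj
  exact C.mem_nonUps.1 hi hk

theorem exists_mem_nonUps (C : Scheme s) {z : C.P × Bool} (hz : ¬ C.IsUps z) :
    ∃ i ∈ C.nonUps, z ∈ C.lbl i := by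
  obtain ⟨i, hi⟩ := C.cover z
  exact ⟨i, C.mem_nonUps.2 fun h => hz ⟨i, hi, h⟩, hi⟩

namespace IsBalanced

variable {C : Scheme s} {τ q a : ℕ}

theorem card_nonUps (h : C.IsBalanced τ q a) : C.nonUps.card = τ := by
  have h1 : C.count .ups + C.nonUps.card = (Finset.univ : Finset C.ι).card :=
    Finset.card_filter_add_card_filter_not _
  rw [Finset.card_univ, h.length_eq, h.ups] at h1
  omega

theorem sum_upsList (h : C.IsBalanced τ q a) : ∑ i ∈ C.nonUps, (C.upsList i).length = a := by
  classical
  have h1 : ∑ i ∈ C.nonUps, (C.upsList i).length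
      = (C.nonUps.biUnion fun i => (C.upsList i).toFinset).card := by
    rw [Finset.card_biUnion]
    · exact Finset.sum_congr rfl fun i _ => (List.toFinset_card_of_nodup (C.nodup_upsList i)).symm
    · intro i _ j _ hij
      refine Finset.disjoint_left.2 fun z hz hz' => hij ?_
      rw [List.mem_toFinset, mem_upsList] at hz hz'
      exact C.disj i j _ hz.1 hz'.1
  have h2 : C.nonUps.biUnion (fun i => (C.upsList i).toFinset)
      = (Finset.univ.filter fun i => C.kind i = .ups).biUnion fun i => (C.lbl i).toFinset := by
    ext z
    simp only [Finset.mem_biUnion, List.mem_toFinset, mem_upsList, Finset.mem_filter,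
      Finset.mem_univ, true_and]
    constructor
    · rintro ⟨i, -, -, j, hj, hk⟩
      exact ⟨j, hk, hj⟩
    · rintro ⟨j, hk, hj⟩
      obtain ⟨i, hi, hi'⟩ := C.exists_mem_nonUps (h.ups_not_ups z ⟨j, hj, hk⟩)
      exact ⟨i, hi, hi', j, hj, hk⟩
  rw [h1, h2, Finset.card_biUnion]
  · rw [Finset.sum_congr rfl (g := fun _ => 1), Finset.sum_const, smul_eq_mul, mul_one]
    · exact h.ups
    · intro i hi
      have hk := (Finset.mem_filter.1 hi).2
      rw [List.toFinset_card_of_nodup (C.nodup i), C.len i, h.ups_ord i hk, hk]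
      rfl
  · intro i _ j _ hij
    refine Finset.disjoint_left.2 fun z hz hz' => hij ?_
    rw [List.mem_toFinset] at hz hz'
    exact C.disj i j _ hz hz'

theorem sum_omega (h : C.IsBalanced τ q a) :
    ∑ i ∈ C.nonUps, (if C.kind i = .omega then 1 else 0) = q := by
  rw [nonUps, Finset.sum_filter]
  refine Eq.trans ?_ h.omega
  unfold count
  rw [Finset.card_filter]
  refine Finset.sum_congr rfl fun i _ => ?_
  by_cases hi : C.kind i = .omega <;> simp [hi]

theorem sum_charge (h : C.IsBalanced τ q a) (h' : Fin s) :
    (∑ i ∈ C.nonUps, riccCharge (C.kind i)) (.psi h') = 1 := by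
  rw [Finset.sum_apply, nonUps, Finset.sum_filter]
  refine Eq.trans ?_ (h.psi h')
  unfold count
  rw [Finset.card_filter]
  refine Finset.sum_congr rfl fun i _ => ?_
  rcases hk : C.kind i with _ | _ | h'' | _ | _ <;> simp [riccCharge, unitCharge]

theorem nodup_append {i : C.ι} (hi : i ∈ C.nonUps) :
    (C.upsList i ++ C.lbl i).Nodup := by
  refine List.nodup_append.2 ⟨C.nodup_upsList i, C.nodup i, fun z hz w hw hzw => ?_⟩
  subst hzw
  exact C.not_isUps hi hw (C.mem_upsList.1 hz).2

theorem eq_of_mem_append {i j : C.ι} (hi : i ∈ C.nonUps) (hj : j ∈ C.nonUps)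
    {z : C.P × Bool} (hz : z ∈ C.upsList i ++ C.lbl i) (hz' : z ∈ C.upsList j ++ C.lbl j) : i = j := by
  rw [List.mem_append, mem_upsList] at hz hz'
  rcases hz with ⟨h1, h2⟩ | h1 <;> rcases hz' with ⟨h1', h2'⟩ | h1'
  · exact C.disj i j _ h1 h1'
  · exact absurd h2 (C.not_isUps hj h1')
  · exact absurd h2' (C.not_isUps hi h1)
  · exact C.disj i j _ h1 h1'

theorem exists_mem_append (h : C.IsBalanced τ q a) (z : C.P × Bool) :
    ∃ i ∈ C.nonUps, z ∈ C.upsList i ++ C.lbl i := by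
  by_cases hz : C.IsUps z
  · obtain ⟨i, hi, hi'⟩ := C.exists_mem_nonUps (h.ups_not_ups z hz)
    exact ⟨i, hi, List.mem_append_left _ (C.mem_upsList.2 ⟨hi', hz⟩)⟩
  · obtain ⟨i, hi, hi'⟩ := C.exists_mem_nonUps hz
    exact ⟨i, hi, List.mem_append_right _ hi'⟩

end IsBalanced

theorem sum_charge_omega (C : Scheme s) :
    (∑ i ∈ C.nonUps, riccCharge (C.kind i)) .omega = 0 := by
  rw [Finset.sum_apply]
  refine Finset.sum_eq_zero fun i _ => ?_
  rcases C.kind i with _ | _ | h'' | _ | _ <;> simp [riccCharge, unitCharge]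

theorem sum_charge_ups (C : Scheme s) :
    (∑ i ∈ C.nonUps, riccCharge (C.kind i)) .ups = 0 := by
  rw [Finset.sum_apply]
  refine Finset.sum_eq_zero fun i _ => ?_
  rcases C.kind i with _ | _ | h'' | _ | _ <;> simp [riccCharge, unitCharge]

/-- Symmetrizing the factors of `Riccify[C]` changes it by terms with more factors or with fewer
Ricci factors. -/
theorem combination_riccify_sub {C : Scheme s} {τ q a : ℕ} (h : C.IsAdmissible τ q a) :
    Combination n (IsRemainder τ q a) fun B x => C.riccify B x - C.symmetrize B x := by
  have hfac := fun i (hi : i ∈ C.nonUps) => riccFac_mem_good (n := n) flipEnd_involutive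
    (κ := C.kind i) (m := C.ord i) (u := C.upsList i) (l := C.lbl i)
    (S := (C.upsList i ++ C.lbl i).toFinset) ⟨IsBalanced.nodup_append hi, fun _ => List.mem_toFinset.symm⟩
    (C.len i) (fun z hz => (C.mem_upsList.1 hz).1) (h.no_internal i) (h.no_ric i)
    (C.mem_nonUps.1 hi) (h.omega_ord i)
  have h1 := (prod_mem_good (n := n) (s := s) (par := flipEnd)
    (fun i => (C.upsList i ++ C.lbl i).toFinset)
    (fun i => riccCharge (C.kind i)) (fun _ => 1) (fun i => if C.kind i = .omega then 1 else 0)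
    (fun i => 2 * (C.upsList i).length + 2 * if C.kind i = .omega then 1 else 0)
    (fun i => riccFac n (C.kind i) (C.ord i) (C.upsList i) (C.lbl i))
    (fun i => symFac n (C.kind i) (C.ord i) (C.upsList i) (C.lbl i)) C.nonUps ?_
    (fun i hi => (hfac i hi).1) (fun i hi => (hfac i hi).2)).2
  · have hU : C.nonUps.biUnion (fun i => (C.upsList i ++ C.lbl i).toFinset) = Finset.univ := by
      ext z
      simpa using h.exists_mem_append z
    rw [hU, h.sum_omega, Finset.sum_const, h.card_nonUps, smul_eq_mul, mul_one,
      Finset.sum_add_distrib, ← Finset.mul_sum, ← Finset.mul_sum, h.sum_omega, h.sum_upsList] at h1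
    have h2 := combination_of_mem_cls (fun N hN => Net.Good.isRemainder (τ := τ) (q := q) (a := a) hN
      h.sum_charge C.sum_charge_omega C.sum_charge_ups (by omega) (Or.inl rfl)) h1
    convert h2 using 3 with B x
    rw [riccify, symmetrize, contractPairs, contractPairs, ← Finset.sum_sub_distrib]
    refine Finset.sum_congr rfl fun α _ => ?_
    rw [← mul_sub, C.prod_eq_prod_nonUps _ fun i hi => by rw [hi]; rfl,
      C.prod_eq_prod_nonUps _ fun i hi => by rw [hi]; rfl]
    simp only [Pi.sub_apply, Finset.prod_apply]
    rfl
  · intro i hi j hj hij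
    refine Finset.disjoint_left.2 fun z hz hz' => hij ?_
    rw [List.mem_toFinset] at hz hz'
    exact IsBalanced.eq_of_mem_append hi hj hz hz'

end Scheme
end Schemes

/-! ### Functions with prescribed derivatives at the origin -/

section JetFunctions

variable {n : ℕ}

/-- The homogeneous polynomial `∑ x_{i₁} ⋯ x_{i_m} J [i₁, …, i_m]`. -/
def jetPoly : ℕ → (List (Fin n) → ℝ) → (Fin n → ℝ) → ℝ
  | 0, J, _ => J []
  | m + 1, J, x => ∑ i, x i * jetPoly m (fun L => J (i :: L)) x

theorem smooth_jetPoly (m : ℕ) (J : List (Fin n) → ℝ) : ContDiff ℝ ∞ (jetPoly m J) := by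
  induction m generalizing J with
  | zero => exact contDiff_const
  | succ m ih => exact ContDiff.sum fun i _ => (contDiff_apply ℝ ℝ i).mul (ih _)

theorem pd_jetPoly (m : ℕ) (J : List (Fin n) → ℝ) (hJ : ∀ L L', L.Perm L' → J L = J L') (k : Fin n)
    (x : Fin n → ℝ) :
    pd k (jetPoly (m + 1) J) x = (m + 1) * jetPoly m (fun L => J (k :: L)) x := by
  have hd : ∀ (m : ℕ) (J : List (Fin n) → ℝ), DifferentiableAt ℝ (jetPoly m J) x := fun m J =>
    (smooth_jetPoly m J).differentiable (by simp) x
  have hx : ∀ i, DifferentiableAt ℝ (fun y : Fin n → ℝ => y i) x := fun i => differentiableAt_apply i x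
  have hpx : ∀ i, pd k (fun y : Fin n → ℝ => y i) x = if i = k then 1 else 0 := by
    intro i
    have : HasFDerivAt (fun y : Fin n → ℝ => y i) (ContinuousLinearMap.proj (R := ℝ) i) x :=
      hasFDerivAt_apply i x
    rw [pd, this.fderiv]
    simp [Pi.single_apply]
  have hstep : ∀ m J, pd k (jetPoly (m + 1) J) x = jetPoly m (fun L => J (k :: L)) x
      + ∑ i, x i * pd k (jetPoly m fun L => J (i :: L)) x := by
    intro m J
    have h1 := pd_sum (x := x) k Finset.univ (F := fun (i : Fin n) y => y i *
      jetPoly m (fun L => J (i :: L)) y) fun i _ => (hx i).mul (hd _ _)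
    refine h1.trans ?_
    simp only [pd_mul k (hx _) (hd _ _), hpx, Finset.sum_add_distrib, ite_mul, one_mul, zero_mul,
      Finset.sum_ite_eq', Finset.mem_univ, if_true]
  induction m generalizing J with
  | zero =>
    rw [hstep]
    have : ∀ J : List (Fin n) → ℝ, pd k (jetPoly 0 J) x = 0 := fun J => pd_const k _
    simp [this]
  | succ m ih =>
    rw [hstep]
    have h1 : ∀ i, pd k (jetPoly (m + 1) fun L => J (i :: L)) x
        = (m + 1) * jetPoly m (fun L => J (k :: i :: L)) x := by
      intro i
      rw [ih _ fun L L' h => hJ _ _ (h.cons i)]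
      congr 2
      funext L
      exact hJ _ _ (List.Perm.swap k i L)
    simp only [h1]
    have h2 : ∑ i, x i * ((m + 1) * jetPoly m (fun L => J (k :: i :: L)) x)
        = (m + 1) * jetPoly (m + 1) (fun L => J (k :: L)) x := by
      simp only [jetPoly, Finset.mul_sum]
      exact Finset.sum_congr rfl fun i _ => by ring
    rw [h2]
    push_cast
    ring

/-- A polynomial of degree `M` whose derivatives at the origin up to order `M` are given by `J`. -/
noncomputable def jetFun (M : ℕ) (J : List (Fin n) → ℝ) (x : Fin n → ℝ) : ℝ :=
  ∑ m ∈ Finset.range (M + 1), (m.factorial : ℝ)⁻¹ * jetPoly m J x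

theorem smooth_jetFun (M : ℕ) (J : List (Fin n) → ℝ) : ContDiff ℝ ∞ (jetFun M J) :=
  ContDiff.sum fun _ _ => contDiff_const.mul (smooth_jetPoly _ _)

theorem jetFun_zero (M : ℕ) (J : List (Fin n) → ℝ) : jetFun M J 0 = J [] := by
  rw [jetFun, Finset.sum_range_succ']
  simp [jetPoly]

theorem pd_jetFun (M : ℕ) (J : List (Fin n) → ℝ) (hJ : ∀ L L', L.Perm L' → J L = J L') (k : Fin n) :
    pd k (jetFun (M + 1) J) = jetFun M fun L => J (k :: L) := by
  funext x
  have hd : ∀ (m : ℕ) (J : List (Fin n) → ℝ), DifferentiableAt ℝ (jetPoly m J) x := fun m J =>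
    (smooth_jetPoly m J).differentiable (by simp) x
  have h1 := pd_sum (x := x) k (Finset.range (M + 1 + 1)) (F := fun m y =>
    (m.factorial : ℝ)⁻¹ * jetPoly m J y) fun m _ => (differentiableAt_const _).mul (hd _ _)
  refine h1.trans ?_
  rw [Finset.sum_range_succ']
  have h0 : pd k (jetPoly 0 J) x = 0 := pd_const k _
  simp only [pd_const_mul k _ (hd _ _), h0, pd_jetPoly _ J hJ, mul_zero, add_zero]
  refine Finset.sum_congr rfl fun m _ => ?_
  rw [Nat.factorial_succ]
  push_cast
  have := m.factorial_ne_zero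
  field_simp

/-- Iterated partial derivatives. -/
noncomputable def pdList : List (Fin n) → ((Fin n → ℝ) → ℝ) → (Fin n → ℝ) → ℝ
  | [], f => f
  | i :: L, f => pd i (pdList L f)

theorem pdList_append (L L' : List (Fin n)) (f : (Fin n → ℝ) → ℝ) :
    pdList (L ++ L') f = pdList L (pdList L' f) := by
  induction L with
  | nil => rfl
  | cons i L ih => simp [pdList, ih]

theorem smooth_pdList (L : List (Fin n)) {f : (Fin n → ℝ) → ℝ} (hf : ContDiff ℝ ∞ f) :
    ContDiff ℝ ∞ (pdList L f) := by
  induction L with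
  | nil => exact hf
  | cons i L ih =>
    rw [← contDiffOn_univ] at ih ⊢
    exact pd_smooth isOpen_univ i ih

theorem pdList_jetFun (L : List (Fin n)) (M : ℕ) (J : List (Fin n) → ℝ)
    (hJ : ∀ L L', L.Perm L' → J L = J L') :
    pdList L (jetFun (L.length + M) J) = jetFun M fun L' => J (L ++ L') := by
  induction L generalizing M with
  | nil => simp [pdList]
  | cons i L ih =>
    have h1 := ih (M + 1)
    rw [← add_assoc] at h1
    rw [pdList, List.length_cons, add_right_comm, h1,
      pd_jetFun M _ fun L₁ L₂ h => hJ _ _ (h.append_left L)]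
    congr 1
    funext L'
    exact hJ _ _ List.perm_middle

theorem pdList_jetFun_zero {L : List (Fin n)} {M : ℕ} (hL : L.length ≤ M) (J : List (Fin n) → ℝ)
    (hJ : ∀ L L', L.Perm L' → J L = J L') : pdList L (jetFun M J) 0 = J L := by
  obtain ⟨M, rfl⟩ := Nat.exists_eq_add_of_le hL
  rw [pdList_jetFun L M J hJ, jetFun_zero, List.append_nil]

end JetFunctions

/-! ### Leading terms of families of functions -/

section LeadingTerms

variable {n : ℕ} {W : Set (ℝ × (Fin n → ℝ))}

/-- On `W`, the family of functions `F t` is `t ^ k` times a family that depends smoothly on `t`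
and equals `f` at `t = 0`. -/
def Lead (W : Set (ℝ × (Fin n → ℝ))) (k : ℕ) (F : ℝ → (Fin n → ℝ) → ℝ) (f : (Fin n → ℝ) → ℝ) : Prop :=
  ∃ G : ℝ × (Fin n → ℝ) → ℝ, ContDiffOn ℝ ∞ G W ∧ (∀ p ∈ W, F p.1 p.2 = p.1 ^ k * G p) ∧
    ∀ x, G (0, x) = f x

namespace Lead

variable {k k' : ℕ} {F F' : ℝ → (Fin n → ℝ) → ℝ} {f f' : (Fin n → ℝ) → ℝ}

theorem congr (h : Lead W k F f) (hF : ∀ p ∈ W, F' p.1 p.2 = F p.1 p.2) (hf : f' = f) :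
    Lead W k F' f' := by
  obtain ⟨G, h1, h2, h3⟩ := h
  exact ⟨G, h1, fun p hp => (hF p hp).trans (h2 p hp), hf ▸ h3⟩

theorem add (h : Lead W k F f) (h' : Lead W k F' f') :
    Lead W k (fun t x => F t x + F' t x) fun x => f x + f' x := by
  obtain ⟨G, h1, h2, h3⟩ := h
  obtain ⟨G', h1', h2', h3'⟩ := h'
  refine ⟨fun p => G p + G' p, h1.add h1', fun p hp => ?_, fun x => ?_⟩
  · beta_reduce
    rw [h2 p hp, h2' p hp]
    ring
  · beta_reduce
    rw [h3, h3']

theorem mul (h : Lead W k F f) (h' : Lead W k' F' f') :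
    Lead W (k + k') (fun t x => F t x * F' t x) fun x => f x * f' x := by
  obtain ⟨G, h1, h2, h3⟩ := h
  obtain ⟨G', h1', h2', h3'⟩ := h'
  refine ⟨fun p => G p * G' p, h1.mul h1', fun p hp => ?_, fun x => ?_⟩
  · beta_reduce
    rw [h2 p hp, h2' p hp]
    ring
  · beta_reduce
    rw [h3, h3']

theorem const (c : ℝ) : Lead W 0 (fun _ _ => c) fun _ => c :=
  ⟨fun _ => c, contDiffOn_const, fun _ _ => by simp, fun _ => rfl⟩

theorem zero (k : ℕ) : Lead W k (fun _ _ => 0) fun _ => 0 :=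
  ⟨fun _ => 0, contDiffOn_const, fun _ _ => by simp, fun _ => rfl⟩

theorem const_mul (c : ℝ) (h : Lead W k F f) :
    Lead W k (fun t x => c * F t x) fun x => c * f x := by
  simpa using (Lead.const c).mul h

theorem neg (h : Lead W k F f) : Lead W k (fun t x => - F t x) fun x => - f x := by
  simpa using h.const_mul (-1)

theorem sub (h : Lead W k F f) (h' : Lead W k F' f') :
    Lead W k (fun t x => F t x - F' t x) fun x => f x - f' x := by
  simpa only [sub_eq_add_neg] using h.add h'.neg

theorem weaken (h : Lead W (k + 1) F f) : Lead W k F fun _ => 0 := by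
  obtain ⟨G, h1, h2, h3⟩ := h
  exact ⟨fun p => p.1 * G p, contDiffOn_fst.mul h1, fun p hp => by rw [h2 p hp]; ring,
    fun x => by simp⟩

theorem add_higher (h : Lead W k F f) (h' : Lead W (k + 1) F' f') :
    Lead W k (fun t x => F t x + F' t x) f := by
  simpa using h.add h'.weaken

theorem sum {ι : Type*} (I : Finset ι) {F : ι → ℝ → (Fin n → ℝ) → ℝ} {f : ι → (Fin n → ℝ) → ℝ}
    (h : ∀ i ∈ I, Lead W k (F i) (f i)) :
    Lead W k (fun t x => ∑ i ∈ I, F i t x) fun x => ∑ i ∈ I, f i x := by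
  classical
  induction I using Finset.induction_on with
  | empty => simpa using Lead.zero k
  | insert i I hi ih =>
    simp only [Finset.sum_insert hi]
    exact (h i (Finset.mem_insert_self _ _)).add (ih fun j hj => h j (Finset.mem_insert_of_mem hj))

theorem prod {ι : Type*} (I : Finset ι) {K : ι → ℕ} {F : ι → ℝ → (Fin n → ℝ) → ℝ}
    {f : ι → (Fin n → ℝ) → ℝ} (h : ∀ i ∈ I, Lead W (K i) (F i) (f i)) :
    Lead W (∑ i ∈ I, K i) (fun t x => ∏ i ∈ I, F i t x) fun x => ∏ i ∈ I, f i x := by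
  classical
  induction I using Finset.induction_on with
  | empty => simpa using Lead.const 1
  | insert i I hi ih =>
    simp only [Finset.sum_insert hi, Finset.prod_insert hi]
    exact (h i (Finset.mem_insert_self _ _)).mul (ih fun j hj => h j (Finset.mem_insert_of_mem hj))

theorem pd (hW : IsOpen W) (h0 : ∀ x, ((0 : ℝ), x) ∈ W) (h : Lead W k F f) (i : Fin n) :
    Lead W k (fun t => RicciInvariants.pd i (F t)) (RicciInvariants.pd i f) := by
  obtain ⟨G, h1, h2, h3⟩ := h
  have hslice : ∀ p ∈ W, HasFDerivAt (fun y => G (p.1, y))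
      ((fderiv ℝ G p).comp (ContinuousLinearMap.inr ℝ ℝ (Fin n → ℝ))) p.2 := by
    rintro ⟨t, x⟩ hp
    have hd : DifferentiableAt ℝ G (t, x) :=
      (h1.contDiffAt (hW.mem_nhds hp)).differentiableAt (by simp)
    exact hd.hasFDerivAt.comp x (hasFDerivAt_prodMk_right t x)
  have hpd : ∀ p ∈ W, RicciInvariants.pd i (fun y => G (p.1, y)) p.2
      = fderiv ℝ G p (0, Pi.single i 1) := by
    intro p hp
    rw [RicciInvariants.pd, (hslice p hp).fderiv]
    rfl
  refine ⟨fun p => fderiv ℝ G p (0, Pi.single i 1),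
    (h1.fderiv_of_isOpen hW (m := ∞) (by simp)).clm_apply contDiffOn_const, ?_, ?_⟩
  · rintro ⟨t, x⟩ hp
    have hU : IsOpen {y | (t, y) ∈ W} := hW.preimage (by fun_prop)
    have e1 := pd_congr (f := F t) (h := fun y => t ^ k * G (t, y)) hU hp i fun y hy => h2 (t, y) hy
    change RicciInvariants.pd i (F t) x = _
    rw [e1, pd_const_mul i _ (hslice _ hp).differentiableAt, hpd _ hp]
  · intro x
    beta_reduce
    rw [← hpd _ (h0 x)]
    simp only [h3]

end Lead
end LeadingTerms

/-! ### Perturbations of the flat metric -/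

/-- Formal derivatives at a point of a symmetric bilinear form `h` and of functions: `h L c d`
stands for `∂_L h_{cd}`. The indices range over an arbitrary type. -/
structure Jets (s : ℕ) (A : Type) where
  h : List A → A → A → ℝ
  ψ : Fin s → List A → ℝ
  Ω : List A → ℝ
  υ : List A → ℝ
  perm_h : ∀ {L L'}, L.Perm L' → ∀ c d, h L c d = h L' c d
  symm_h : ∀ L c d, h L c d = h L d c
  perm_ψ : ∀ {L L'}, L.Perm L' → ∀ i, ψ i L = ψ i L'
  perm_Ω : ∀ {L L'}, L.Perm L' → Ω L = Ω L'
  perm_υ : ∀ {L L'}, L.Perm L' → υ L = υ L'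

/-- The linearization of a factor at the flat metric. Admissible contractions have no Ricci factors,
which get the value `0`. -/
noncomputable def Jets.factor {s : ℕ} {A : Type} (J : Jets s A) (κ : Kind s) (m : ℕ) (l : List A) : ℝ :=
  match κ with
  | .curv => linCurv m J.h l
  | .ric => 0
  | .psi i => J.ψ i l
  | .omega => J.Ω l
  | .ups => J.υ l

/-- The linearization of a complete contraction, with contractions by means of `γ`. -/
noncomputable def Scheme.linVal {s : ℕ} {A : Type} [Fintype A] (C : Scheme s) (γ : A → A → ℝ)
    (J : Jets s A) : ℝ :=
  ∑ α : C.P × Bool → A, (∏ j, γ (α (j, false)) (α (j, true))) *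
    ∏ i, J.factor (C.kind i) (C.ord i) ((C.lbl i).map α)

section Flat

variable {n s : ℕ}

theorem posDef_one_add {A : Matrix (Fin n) (Fin n) ℝ} (hA : ∀ i j, A i j = A j i)
    (h : ∀ i j, |A i j| * (n + 1) < 1) : (1 + A).PosDef := by
  rw [Matrix.posDef_iff_dotProduct_mulVec]
  constructor
  · ext i j
    simp [Matrix.one_apply, hA i j, eq_comm]
  · intro x hx
    have hpos : 0 < ∑ i, x i ^ 2 := by
      obtain ⟨i, hi⟩ := Function.ne_iff.1 hx
      exact Finset.sum_pos' (fun _ _ => sq_nonneg _) ⟨i, Finset.mem_univ _, by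
        have : x i ≠ 0 := hi
        positivity⟩
    have h1 : star x ⬝ᵥ ((1 + A).mulVec x) = ∑ i, x i ^ 2 + ∑ i, ∑ j, x i * A i j * x j := by
      rw [Matrix.add_mulVec, Matrix.one_mulVec, dotProduct_add]
      simp only [dotProduct, Matrix.mulVec, Finset.mul_sum, star_trivial]
      congr 1
      · exact Finset.sum_congr rfl fun i _ => by ring
      · exact Finset.sum_congr rfl fun i _ => Finset.sum_congr rfl fun j _ => by ring
    have h2 : ∀ i j, -((x i ^ 2 + x j ^ 2) / (2 * (n + 1))) ≤ x i * A i j * x j := by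
      intro i j
      have hn : (0 : ℝ) < n + 1 := by positivity
      have h3 : |A i j| ≤ 1 / (n + 1) := by
        rw [le_div_iff₀ hn]
        exact (h i j).le
      have h4 : |x i * A i j * x j| ≤ (x i ^ 2 + x j ^ 2) / (2 * (n + 1)) := by
        rw [abs_mul, abs_mul]
        have h5 : |x i| * |x j| ≤ (x i ^ 2 + x j ^ 2) / 2 := by
          nlinarith [sq_nonneg (|x i| - |x j|), sq_abs (x i), sq_abs (x j)]
        calc |x i| * |A i j| * |x j| = |A i j| * (|x i| * |x j|) := by ring
          _ ≤ 1 / (n + 1) * ((x i ^ 2 + x j ^ 2) / 2) := by gcongr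
          _ = _ := by field_simp
      exact (abs_le.1 h4).1
    have h3 : -((n / (n + 1)) * ∑ i, x i ^ 2) ≤ ∑ i, ∑ j, x i * A i j * x j := by
      refine le_trans (le_of_eq ?_) (Finset.sum_le_sum fun i _ => Finset.sum_le_sum fun j _ => h2 i j)
      simp only [Finset.sum_neg_distrib, ← Finset.sum_div, Finset.sum_add_distrib, Finset.sum_const,
        Finset.card_univ, Fintype.card_fin, nsmul_eq_mul, ← Finset.mul_sum]
      field_simp
      ring
    rw [h1]
    have h4 : (n / (n + 1) : ℝ) * ∑ i, x i ^ 2 < ∑ i, x i ^ 2 := by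
      have : (n / (n + 1) : ℝ) < 1 := by
        rw [div_lt_one (by positivity)]
        linarith
      nlinarith
    linarith

namespace Jets

variable (J : Jets s (Fin n)) (M : ℕ)

/-- The perturbation of the metric with the given derivatives at the origin. -/
noncomputable def pert (i j : Fin n) : (Fin n → ℝ) → ℝ := jetFun M fun L => J.h L i j

theorem smooth_pert (i j : Fin n) : ContDiff ℝ ∞ (J.pert M i j) := smooth_jetFun _ _

theorem pert_symm (i j : Fin n) : J.pert M i j = J.pert M j i := by
  unfold pert
  simp only [J.symm_h _ i j]

/-- The pairs `(t, x)` at which `1 + t h(x)` is close to the identity. -/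
def region : Set (ℝ × (Fin n → ℝ)) := {p | ∀ i j, |p.1 * J.pert M i j p.2| * (n + 1) < 1}

theorem isOpen_region : IsOpen (J.region M) := by
  simp only [region, Set.ofPred_forall]
  refine isOpen_iInter_of_finite fun i => isOpen_iInter_of_finite fun j => isOpen_lt ?_ continuous_const
  have := (J.smooth_pert M i j).continuous
  fun_prop

theorem zero_mem_region (x : Fin n → ℝ) : ((0 : ℝ), x) ∈ J.region M := by
  intro i j
  simp

/-- The background with the metric `1 + t h`. -/
noncomputable def background (t : ℝ) : Background n s where
  U := {x | (t, x) ∈ J.region M}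
  isOpen := (J.isOpen_region M).preimage (by fun_prop)
  g := fun x => 1 + Matrix.of fun i j => t * J.pert M i j x
  smooth_g := fun i j => (contDiff_const.add (contDiff_const.mul (J.smooth_pert M i j))).contDiffOn
  posDef_g := fun x hx => posDef_one_add (fun i j => by simp [J.pert_symm M i j]) hx
  ψ := fun i => jetFun M (J.ψ i)
  smooth_ψ := fun _ => (smooth_jetFun _ _).contDiffOn
  Ω := jetFun M J.Ω
  smooth_Ω := (smooth_jetFun _ _).contDiffOn
  υ := jetFun M J.υ
  smooth_υ := (smooth_jetFun _ _).contDiffOn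

theorem lead_of_smooth {f : (Fin n → ℝ) → ℝ} (hf : ContDiff ℝ ∞ f) :
    Lead (J.region M) 0 (fun _ => f) f :=
  ⟨fun p => f p.2, (hf.comp contDiff_snd).contDiffOn, fun _ _ => by simp, fun _ => rfl⟩

theorem lead_g (i j : Fin n) : Lead (J.region M) 0 (fun t x => (J.background M t).g x i j)
    fun _ => (1 : Matrix (Fin n) (Fin n) ℝ) i j :=
  ⟨fun p => (1 : Matrix (Fin n) (Fin n) ℝ) i j + p.1 * J.pert M i j p.2,
    (contDiff_const.add (contDiff_fst.mul ((J.smooth_pert M i j).comp contDiff_snd))).contDiffOn,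
    fun p _ => by simp [background], fun x => by simp⟩

theorem lead_pd_g (k i j : Fin n) :
    Lead (J.region M) 1 (fun t => pd k fun x => (J.background M t).g x i j) (pd k (J.pert M i j)) := by
  refine ⟨fun p => pd k (J.pert M i j) p.2, ?_, fun p _ => ?_, fun x => rfl⟩
  · have := pd_smooth isOpen_univ k (J.smooth_pert M i j).contDiffOn
    exact ((contDiffOn_univ.1 this).comp contDiff_snd).contDiffOn
  · have hd : DifferentiableAt ℝ (J.pert M i j) p.2 :=
      (J.smooth_pert M i j).differentiable (by simp) _
    have h1 := pd_add k (differentiableAt_const (x := p.2) ((1 : Matrix (Fin n) (Fin n) ℝ) i j))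
      ((differentiableAt_const p.1).mul hd)
    rw [pow_one]
    have h2 := pd_const_mul k p.1 hd
    exact h1.trans ((congrArg₂ (· + ·) (pd_const k _) h2).trans (zero_add _))

theorem lead_ginv (i j : Fin n) : Lead (J.region M) 0 (fun t x => ((J.background M t).g x)⁻¹ i j)
    fun _ => (1 : Matrix (Fin n) (Fin n) ℝ) i j := by
  refine ⟨fun p : ℝ × (Fin n → ℝ) => ((J.background M p.1).g p.2)⁻¹ i j, ?_, fun p _ => by simp, fun x => ?_⟩
  · refine contDiffOn_matrix_inv (A := fun p : ℝ × (Fin n → ℝ) => (J.background M p.1).g p.2) (fun i j => ?_)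
      (fun p hp => (J.background M p.1).det_ne_zero hp) i j
    exact (contDiff_const.add (contDiff_fst.mul ((J.smooth_pert M i j).comp contDiff_snd))).contDiffOn
  · have : (J.background M 0).g x = 1 := by
      ext i j
      simp [background]
    beta_reduce
    rw [this, inv_one]

/-- The linearized Christoffel symbols. -/
noncomputable def christoffelLin (k i j : Fin n) (x : Fin n → ℝ) : ℝ :=
  1 / 2 * (pd i (J.pert M j k) x + pd j (J.pert M i k) x - pd k (J.pert M i j) x)

theorem lead_christoffel (k i j : Fin n) :
    Lead (J.region M) 1 (fun t x => christoffel (J.background M t).g x k i j)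
      (J.christoffelLin M k i j) := by
  have h1 := (Lead.sum Finset.univ fun l _ => (J.lead_ginv M k l).mul
    (((J.lead_pd_g M i j l).add (J.lead_pd_g M j i l)).sub (J.lead_pd_g M l i j))).const_mul (1 / 2)
  refine h1.congr (fun p _ => rfl) ?_
  funext x
  simp [christoffelLin, Matrix.one_apply]

/-- The linearized curvature tensor. -/
noncomputable def curvLin (i j k l : Fin n) (x : Fin n → ℝ) : ℝ :=
  -(pd i (J.christoffelLin M k j l) x - pd j (J.christoffelLin M k i l) x)

theorem lead_riem (i j k l : Fin n) :
    Lead (J.region M) 1 (fun t x => riem (J.background M t).g x [i, j, k, l])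
      (J.curvLin M i j k l) := by
  have hW := J.isOpen_region M
  have h0 := J.zero_mem_region M
  have h1 := (Lead.sum Finset.univ fun p _ => (J.lead_g M k p).mul
    ((((J.lead_christoffel M p j l).pd hW h0 i).sub ((J.lead_christoffel M p i l).pd hW h0 j)).add_higher
      (Lead.sum Finset.univ fun m _ => ((J.lead_christoffel M p i m).mul
        (J.lead_christoffel M m j l)).sub ((J.lead_christoffel M p j m).mul
          (J.lead_christoffel M m i l))))).neg
  refine h1.congr (fun p _ => rfl) ?_
  funext x
  simp [curvLin, Matrix.one_apply]

theorem lead_ricci (i k : Fin n) :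
    ∃ f, Lead (J.region M) 1 (fun t x => ricci (J.background M t).g x [i, k]) f := by
  have h1 := Lead.sum Finset.univ fun j _ => Lead.sum Finset.univ fun l _ =>
    (J.lead_ginv M j l).mul (J.lead_riem M i j k l)
  exact ⟨_, h1⟩

theorem lead_cov {T : ℝ → Tens n} {k : ℕ} {f : List (Fin n) → (Fin n → ℝ) → ℝ} {r : ℕ}
    (hT : ∀ l : List (Fin n), l.length = r → Lead (J.region M) k (fun t x => T t x l) (f l))
    (i : Fin n) (l : List (Fin n)) (hl : l.length = r) :
    Lead (J.region M) k (fun t x => cov (J.background M t).g (T t) x (i :: l)) (pd i (f l)) := by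
  have h1 := ((hT l hl).pd (J.isOpen_region M) (J.zero_mem_region M) i).add_higher
    (Lead.sum Finset.univ fun p _ => Lead.sum Finset.univ fun k' _ => by
      have := (J.lead_christoffel M k' i (l.get p)).mul (hT (l.set p k') (by simpa using hl))
      rw [add_comm] at this
      exact this).neg
  exact h1.congr (fun p _ => by simp [cov, sub_eq_add_neg]) rfl

theorem lead_iterCov {T : ℝ → Tens n} {k : ℕ} {f : List (Fin n) → (Fin n → ℝ) → ℝ} {r : ℕ}
    (hT : ∀ l : List (Fin n), l.length = r → Lead (J.region M) k (fun t x => T t x l) (f l))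
    (L l : List (Fin n)) (hl : l.length = r) :
    Lead (J.region M) k (fun t x => iterCov (J.background M t).g L.length (T t) x (L ++ l))
      (pdList L (f l)) := by
  induction L with
  | nil => exact hT l hl
  | cons i L ih =>
    have hT' : ∀ v : List (Fin n), v.length = L.length + r →
        Lead (J.region M) k (fun t x => iterCov (J.background M t).g L.length (T t) x v)
          (pdList (v.take L.length) (f (v.drop L.length))) := by
      intro v hv
      clear ih
      generalize hL : L.length = m at *
      clear hL
      induction m generalizing v with
      | zero =>
        simpa [pdList, iterCov] using hT v (by simpa using hv)
      | succ m ih =>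
        match v, hv with
        | [], hv => simp at hv; omega
        | a :: v, hv =>
          have := J.lead_cov M ih a v (by simp at hv; omega)
          simpa [iterCov_succ, pdList] using this
    have := J.lead_cov M hT' i (L ++ l) (by simp [hl])
    simpa [iterCov_succ, pdList] using this

theorem curvLin_eq (i j k l : Fin n) (x : Fin n → ℝ) :
    J.curvLin M i j k l x = 1 / 2 * (pd i (pd k (J.pert M j l)) x + pd j (pd l (J.pert M i k)) x
      - pd j (pd k (J.pert M i l)) x - pd i (pd l (J.pert M j k)) x) := by
  have hs : ∀ a b c, ContDiffOn ℝ ∞ (pd a (J.pert M b c)) Set.univ := fun a b c =>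
    pd_smooth isOpen_univ a (J.smooth_pert M b c).contDiffOn
  have hd : ∀ a b c, DifferentiableAt ℝ (pd a (J.pert M b c)) x := fun a b c =>
    differentiableAt_of_smooth isOpen_univ (hs a b c) (Set.mem_univ x)
  have h1 : ∀ a k i j, pd a (J.christoffelLin M k i j) x = 1 / 2 * (pd a (pd i (J.pert M j k)) x
      + pd a (pd j (J.pert M i k)) x - pd a (pd k (J.pert M i j)) x) := by
    intro a k i j
    have e1 := pd_const_mul (x := x) a (1 / 2) (((hd i j k).add (hd j i k)).sub (hd k i j))
    have e2 := pd_sub a ((hd i j k).add (hd j i k)) (hd k i j)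
    have e3 := pd_add a (hd i j k) (hd j i k)
    rw [← e3]
    exact e1.trans (congrArg _ e2)
  rw [curvLin, h1, h1, pd_comm isOpen_univ (Set.mem_univ x) j i (J.smooth_pert M l k).contDiffOn]
  ring

theorem pdList_curvLin {L : List (Fin n)} (i j k l : Fin n) (hL : L.length + 2 ≤ M) :
    pdList L (J.curvLin M i j k l) 0 = linPattern J.h L i j k l := by
  have hs : ∀ a b c d, ContDiff ℝ ∞ (pdList [a, b] (J.pert M c d)) := fun a b c d =>
    smooth_pdList _ (J.smooth_pert M c d)
  have h1 : J.curvLin M i j k l = fun x => 1 / 2 * (pdList [i, k] (J.pert M j l) x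
      + pdList [j, l] (J.pert M i k) x - pdList [j, k] (J.pert M i l) x
        - pdList [i, l] (J.pert M j k) x) := funext fun x => J.curvLin_eq M i j k l x
  have hlin : ∀ (L : List (Fin n)) {f₁ f₂ f₃ f₄ : (Fin n → ℝ) → ℝ}, ContDiff ℝ ∞ f₁ →
      ContDiff ℝ ∞ f₂ → ContDiff ℝ ∞ f₃ → ContDiff ℝ ∞ f₄ →
      pdList L (fun x => 1 / 2 * (f₁ x + f₂ x - f₃ x - f₄ x))
        = fun x => 1 / 2 * (pdList L f₁ x + pdList L f₂ x - pdList L f₃ x - pdList L f₄ x) := by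
    intro L f₁ f₂ f₃ f₄ h₁ h₂ h₃ h₄
    induction L with
    | nil => rfl
    | cons a L ih =>
      funext x
      have d₁ := (smooth_pdList L h₁).differentiable (by simp) x
      have d₂ := (smooth_pdList L h₂).differentiable (by simp) x
      have d₃ := (smooth_pdList L h₃).differentiable (by simp) x
      have d₄ := (smooth_pdList L h₄).differentiable (by simp) x
      have e1 := pd_const_mul a (1 / 2) (((d₁.add d₂).sub d₃).sub d₄)
      have e2 := pd_sub a ((d₁.add d₂).sub d₃) d₄
      have e3 := pd_sub a (d₁.add d₂) d₃
      have e4 := pd_add a d₁ d₂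
      simp only [pdList, ih, ← e4]
      refine e1.trans (congrArg _ (e2.trans ?_))
      exact congrArg (· - _) e3
  have hJ : ∀ a b c d, pdList L (pdList [a, b] (J.pert M c d)) 0 = J.h (L ++ [a, b]) c d := by
    intro a b c d
    rw [← pdList_append]
    exact pdList_jetFun_zero (by simpa using hL) _ fun L L' h => J.perm_h h c d
  rw [h1, hlin L (hs _ _ _ _) (hs _ _ _ _) (hs _ _ _ _) (hs _ _ _ _)]
  simp only [hJ, linPattern]

/-- The order of vanishing of a factor at the flat metric: the curvature vanishes to first order in
`t`. -/
def leadOrder : Kind s → ℕ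
  | .curv => 1
  | .ric => 1
  | _ => 0

theorem lead_factor (κ : Kind s) (m : ℕ) (l : List (Fin n)) (hl : l.length = κ.rank + m)
    (hM : m + 2 ≤ M) :
    ∃ f, Lead (J.region M) (leadOrder κ) (fun t x => (J.background M t).factor κ m x l) f ∧
      (κ ≠ .ric → f 0 = J.factor κ m l) := by
  obtain ⟨L, v, rfl, rfl, hv⟩ : ∃ L v, l = L ++ v ∧ L.length = m ∧ v.length = κ.rank :=
    ⟨l.take m, l.drop m, (List.take_append_drop _ _).symm, by simp [hl], by simp [hl]⟩
  have hsc : ∀ (f : List (Fin n) → ℝ), (∀ L L', L.Perm L' → f L = f L') →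
      Lead (J.region M) 0 (fun t x => iterCov (J.background M t).g L.length (scalar (jetFun M f)) x
        (L ++ [])) (pdList L (jetFun M f)) ∧ pdList L (jetFun M f) 0 = f L := by
    intro f hf
    refine ⟨J.lead_iterCov M (r := 0) (f := fun _ => jetFun M f) ?_ L [] rfl,
      pdList_jetFun_zero (by omega) f hf⟩
    intro l hl
    obtain rfl := List.length_eq_zero_iff.1 hl
    exact J.lead_of_smooth M (smooth_jetFun _ _)
  match κ, hv with
  | .curv, hv =>
    obtain ⟨i, j, k, l, rfl⟩ := List.length_eq_four.1 hv
    refine ⟨pdList L (J.curvLin M i j k l), ?_, fun _ => ?_⟩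
    · refine J.lead_iterCov M (r := 4) (T := fun t => riem (J.background M t).g) (f := fun l => match l with
        | [i, j, k, l] => J.curvLin M i j k l
        | _ => fun _ => 0) ?_ L [i, j, k, l] rfl
      intro l hl
      obtain ⟨i, j, k, l, rfl⟩ := List.length_eq_four.1 hl
      exact J.lead_riem M i j k l
    · rw [J.pdList_curvLin M i j k l hM]
      exact (linCurv_append L J.h i j k l).symm
  | .ric, hv =>
    choose f hf using fun i k => J.lead_ricci M i k
    obtain ⟨i, k, rfl⟩ := List.length_eq_two.1 hv
    refine ⟨pdList L (f i k), ?_, fun h => absurd rfl h⟩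
    refine J.lead_iterCov M (r := 2) (T := fun t => ricci (J.background M t).g) (f := fun l => match l with
        | [i, k] => f i k
        | _ => fun _ => 0) ?_ L [i, k] rfl
    intro l hl
    obtain ⟨i, k, rfl⟩ := List.length_eq_two.1 hl
    exact hf i k
  | .psi h, hv =>
    obtain rfl := List.length_eq_zero_iff.1 hv
    obtain ⟨h1, h2⟩ := hsc (J.ψ h) fun L L' hL => J.perm_ψ hL h
    exact ⟨_, h1, fun _ => by simpa [factor] using h2⟩
  | .omega, hv =>
    obtain rfl := List.length_eq_zero_iff.1 hv
    obtain ⟨h1, h2⟩ := hsc J.Ω fun L L' hL => J.perm_Ω hL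
    exact ⟨_, h1, fun _ => by simpa [factor] using h2⟩
  | .ups, hv =>
    obtain rfl := List.length_eq_zero_iff.1 hv
    obtain ⟨h1, h2⟩ := hsc J.υ fun L L' hL => J.perm_υ hL
    exact ⟨_, h1, fun _ => by simpa [factor] using h2⟩

end Jets
end Flat

open scoped Topology

section FlatIdentity

variable {n s : ℕ}

theorem Lead.weaken_of_lt {W : Set (ℝ × (Fin n → ℝ))} {k l : ℕ} (hkl : k < l)
    {F : ℝ → (Fin n → ℝ) → ℝ} {f : (Fin n → ℝ) → ℝ} (h : Lead W l F f) : Lead W k F fun _ => 0 := by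
  obtain ⟨m, rfl⟩ := Nat.exists_eq_add_of_lt hkl
  induction m generalizing f with
  | zero => exact h.weaken
  | succ m ih => exact ih (by omega) h.weaken

/-- A family that vanishes for all `t` has leading term zero. -/
theorem Lead.eq_zero {W : Set (ℝ × (Fin n → ℝ))} (hW : IsOpen W) {k : ℕ}
    {F : ℝ → (Fin n → ℝ) → ℝ} {f : (Fin n → ℝ) → ℝ} (h : Lead W k F f)
    (hF : ∀ p ∈ W, F p.1 p.2 = 0) {x : Fin n → ℝ} (hx : ((0 : ℝ), x) ∈ W) : f x = 0 := by
  obtain ⟨G, h1, h2, h3⟩ := h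
  rw [← h3]
  have hc : ContinuousAt (fun t : ℝ => G (t, x)) 0 := by
    have : ContinuousAt G (0, x) := (h1.continuousOn).continuousAt (hW.mem_nhds hx)
    exact ContinuousAt.comp (f := fun t : ℝ => (t, x)) this (by fun_prop)
  have hmem : ∀ᶠ t : ℝ in 𝓝[≠] 0, (t, x) ∈ W := by
    refine nhdsWithin_le_nhds ?_
    exact (show ContinuousAt (fun t : ℝ => (t, x)) 0 by fun_prop).preimage_mem_nhds (hW.mem_nhds hx)
  have hz : ∀ᶠ t : ℝ in 𝓝[≠] 0, G (t, x) = 0 := by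
    filter_upwards [hmem, self_mem_nhdsWithin] with t ht ht0
    have h4 := (h2 _ ht).symm.trans (hF _ ht)
    exact (mul_eq_zero.1 h4).resolve_left (pow_ne_zero _ ht0)
  have h5 : Filter.Tendsto (fun t : ℝ => G (t, x)) (𝓝[≠] 0) (𝓝 (G (0, x))) :=
    hc.tendsto.mono_left nhdsWithin_le_nhds
  have h6 : Filter.Tendsto (fun t : ℝ => G (t, x)) (𝓝[≠] 0) (𝓝 0) :=
    tendsto_const_nhds.congr' (hz.mono fun t ht => ht.symm)
  exact tendsto_nhds_unique h5 h6

theorem Scheme.lead_val (C : Scheme s) (J : Jets s (Fin n)) {M : ℕ} (hM : ∀ i, C.ord i + 2 ≤ M) :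
    ∃ f, Lead (J.region M) (∑ i, Jets.leadOrder (C.kind i)) (fun t x => C.val (J.background M t) x) f ∧
      ((∀ i, C.kind i ≠ .ric) → f 0 = C.linVal (1 : Matrix (Fin n) (Fin n) ℝ) J) := by
  have h := fun (α : C.P × Bool → Fin n) i => J.lead_factor M (C.kind i) (C.ord i) ((C.lbl i).map α)
    (by rw [List.length_map, C.len i]) (hM i)
  choose f hf hf0 using h
  have h1 := Lead.sum Finset.univ fun (α : C.P × Bool → Fin n) _ =>
    (Lead.prod Finset.univ fun j _ => J.lead_ginv M (α (j, false)) (α (j, true))).mul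
      (Lead.prod Finset.univ fun i _ => hf α i)
  rw [Finset.sum_const_zero, zero_add] at h1
  refine ⟨_, h1, fun hr => ?_⟩
  · refine Finset.sum_congr rfl fun α _ => ?_
    congr 1
    exact Finset.prod_congr rfl fun i _ => hf0 α i (hr i)

/-- The linearization at the flat metric of an identity modulo longer contractions. -/
theorem sum_linVal_one_eq_zero {T T' : Type} [Fintype T] [Fintype T'] (c : T → ℝ) (C : T → Scheme s)
    (e : T' → ℝ) (D : T' → Scheme s) (hr : ∀ t i, (C t).kind i ≠ .ric) {σ : ℕ}
    (hC : ∀ t, ∑ i, Jets.leadOrder ((C t).kind i) = σ)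
    (hD : ∀ t, σ < ∑ i, Jets.leadOrder ((D t).kind i))
    (h : ∀ B : Background n s, ∀ x ∈ B.U, ∑ t, c t * (C t).val B x = ∑ t, e t * (D t).val B x)
    (J : Jets s (Fin n)) : ∑ t, c t * (C t).linVal (1 : Matrix (Fin n) (Fin n) ℝ) J = 0 := by
  obtain ⟨M, hMC, hMD⟩ : ∃ M, (∀ t i, (C t).ord i + 2 ≤ M) ∧ ∀ t i, (D t).ord i + 2 ≤ M := by
    refine ⟨∑ t, ∑ i, ((C t).ord i + 2) + ∑ t, ∑ i, ((D t).ord i + 2), fun t i => ?_, fun t i => ?_⟩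
    · refine le_trans ?_ (Nat.le_add_right _ _)
      exact (Finset.single_le_sum (f := fun i => (C t).ord i + 2) (fun _ _ => Nat.zero_le _)
        (Finset.mem_univ i)).trans (Finset.single_le_sum (f := fun t => ∑ i, ((C t).ord i + 2))
          (fun _ _ => Nat.zero_le _) (Finset.mem_univ t))
    · refine le_trans ?_ (Nat.le_add_left _ _)
      exact (Finset.single_le_sum (f := fun i => (D t).ord i + 2) (fun _ _ => Nat.zero_le _)
        (Finset.mem_univ i)).trans (Finset.single_le_sum (f := fun t => ∑ i, ((D t).ord i + 2))
          (fun _ _ => Nat.zero_le _) (Finset.mem_univ t))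
  choose f hf hf0 using fun t => (C t).lead_val J (hMC t)
  choose f' hf' _ using fun t => (D t).lead_val J (hMD t)
  have h1 : Lead (J.region M) σ (fun t x => ∑ i, c i * (C i).val (J.background M t) x
      - ∑ i, e i * (D i).val (J.background M t) x) fun x => ∑ i, c i * f i x - ∑ i, e i * 0 :=
    (Lead.sum Finset.univ fun i _ => by
      have := (hf i).const_mul (c i)
      rwa [hC i] at this).sub
    (Lead.sum Finset.univ fun i _ => ((hf' i).weaken_of_lt (hD i)).const_mul (e i))
  have h2 := h1.eq_zero (J.isOpen_region M) (fun p hp => sub_eq_zero.2 (h (J.background M p.1) p.2 hp))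
    (J.zero_mem_region M 0)
  simpa [hf0 _ (hr _)] using h2

end FlatIdentity

/-! ### Formal contractions in any number of dimensions -/

section Pullback

variable {s : ℕ} {A I : Type} [Fintype A]

/-- Substitution of `∑ a, v i a • a` for each index `i`. -/
def pullList (v : I → A → ℝ) : (List A → ℝ) → List I → ℝ
  | f, [] => f []
  | f, i :: L => ∑ a, v i a * pullList v (fun W => f (a :: W)) L

theorem pullList_perm (v : I → A → ℝ) {L L' : List I} (h : L.Perm L') :
    ∀ f : List A → ℝ, (∀ W W', W.Perm W' → f W = f W') → pullList v f L = pullList v f L' := by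
  induction h with
  | nil => intro f _; rfl
  | cons i _ ih =>
    intro f hf
    exact Finset.sum_congr rfl fun a _ => by rw [ih _ fun W W' h => hf _ _ (h.cons a)]
  | swap i j L =>
    intro f hf
    simp only [pullList, Finset.mul_sum]
    rw [Finset.sum_comm]
    refine Finset.sum_congr rfl fun a _ => Finset.sum_congr rfl fun b _ => ?_
    have : (fun W => f (b :: a :: W)) = fun W => f (a :: b :: W) :=
      funext fun W => hf _ _ (List.Perm.swap a b W)
    rw [this]
    ring
  | trans _ _ ih₁ ih₂ =>
    intro f hf
    rw [ih₁ f hf, ih₂ f hf]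

/-- Substitution in a function with two distinguished indices. -/
def pullPair (v : I → A → ℝ) (h : List A → A → A → ℝ) (L : List I) (c d : I) : ℝ :=
  ∑ a, ∑ b, v c a * v d b * pullList v (fun W => h W a b) L

/-- Substitution in formal derivatives. -/
def Jets.pull (J : Jets s A) (v : I → A → ℝ) : Jets s I where
  h := pullPair v J.h
  ψ := fun i => pullList v (J.ψ i)
  Ω := pullList v J.Ω
  υ := pullList v J.υ
  perm_h := fun hL c d => Finset.sum_congr rfl fun a _ => Finset.sum_congr rfl fun b _ => by
    rw [pullList_perm v hL _ fun W W' hW => J.perm_h hW a b]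
  symm_h := fun L c d => by
    unfold pullPair
    rw [Finset.sum_comm]
    refine Finset.sum_congr rfl fun a _ => Finset.sum_congr rfl fun b _ => ?_
    simp only [J.symm_h _ b a]
    ring
  perm_ψ := fun hL i => pullList_perm v hL _ fun _ _ hW => J.perm_ψ hW i
  perm_Ω := fun hL => pullList_perm v hL _ fun _ _ hW => J.perm_Ω hW
  perm_υ := fun hL => pullList_perm v hL _ fun _ _ hW => J.perm_υ hW

theorem linCurv_sum {K : Type*} (T : Finset K) (w : K → ℝ) (h : K → List I → I → I → ℝ) (m : ℕ)
    (l : List I) : linCurv m (fun L c d => ∑ k ∈ T, w k * h k L c d) l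
      = ∑ k ∈ T, w k * linCurv m (h k) l := by
  induction m generalizing h l with
  | zero =>
    match l with
    | [i, j, k, l] =>
      simp only [linCurv, linPattern]
      rw [← Finset.sum_add_distrib, ← Finset.sum_sub_distrib, ← Finset.sum_sub_distrib,
        Finset.mul_sum]
      exact Finset.sum_congr rfl fun _ _ => by ring
    | [] => simp [linCurv]
    | [_] => simp [linCurv]
    | [_, _] => simp [linCurv]
    | [_, _, _] => simp [linCurv]
    | _ :: _ :: _ :: _ :: _ :: _ => simp [linCurv]
  | succ m ih =>
    match l with
    | [] => simp [linCurv]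
    | a :: l => exact ih (fun k r => h k (a :: r)) l

theorem linCurv_pull (v : I → A → ℝ) (m : ℕ) (h : List A → A → A → ℝ) (l : List I)
    (hl : l.length = 4 + m) : linCurv m (pullPair v h) l = pullList v (linCurv m h) l := by
  induction m generalizing h l with
  | zero =>
    obtain ⟨i, j, k, l, rfl⟩ := List.length_eq_four.1 hl
    have s0 : ∀ F : A → A → A → A → ℝ, ∑ a, ∑ b, ∑ c, ∑ d, F a b c d = ∑ b, ∑ a, ∑ c, ∑ d, F a b c d :=
      fun F => Finset.sum_comm
    have s1 : ∀ F : A → A → A → A → ℝ, ∑ a, ∑ b, ∑ c, ∑ d, F a b c d = ∑ a, ∑ c, ∑ b, ∑ d, F a b c d :=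
      fun F => Finset.sum_congr rfl fun _ _ => Finset.sum_comm
    have s2 : ∀ F : A → A → A → A → ℝ, ∑ a, ∑ b, ∑ c, ∑ d, F a b c d = ∑ a, ∑ b, ∑ d, ∑ c, F a b c d :=
      fun F => Finset.sum_congr rfl fun _ _ => Finset.sum_congr rfl fun _ _ => Finset.sum_comm
    have t1 : ∀ F : A → A → A → A → ℝ, ∑ b, ∑ d, ∑ a, ∑ c, F a b c d = ∑ a, ∑ b, ∑ c, ∑ d, F a b c d :=
      fun F => (s1 fun b d a c => F a b c d).trans ((s0 fun b a d c => F a b c d).trans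
        (s2 fun a b d c => F a b c d))
    have t2 : ∀ F : A → A → A → A → ℝ, ∑ a, ∑ c, ∑ b, ∑ d, F a b c d = ∑ a, ∑ b, ∑ c, ∑ d, F a b c d :=
      fun F => s1 fun a c b d => F a b c d
    have t3 : ∀ F : A → A → A → A → ℝ, ∑ a, ∑ d, ∑ b, ∑ c, F a b c d = ∑ a, ∑ b, ∑ c, ∑ d, F a b c d :=
      fun F => (s1 fun a d b c => F a b c d).trans (s2 fun a b d c => F a b c d)
    have t4 : ∀ F : A → A → A → A → ℝ, ∑ b, ∑ c, ∑ a, ∑ d, F a b c d = ∑ a, ∑ b, ∑ c, ∑ d, F a b c d :=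
      fun F => (s1 fun b c a d => F a b c d).trans (s0 fun b a c d => F a b c d)
    have hF : ∀ (G : A → A → A → A → ℝ), ∑ a, v i a * ∑ b, v j b * ∑ c, v k c * ∑ d, v l d * G a b c d
        = ∑ a, ∑ b, ∑ c, ∑ d, v i a * v j b * v k c * v l d * G a b c d := fun G => by
      simp only [Finset.mul_sum, mul_assoc]
    have e1 : pullPair v h [i, k] j l
        = ∑ a, ∑ b, ∑ c, ∑ d, v i a * v j b * v k c * v l d * h [a, c] b d := by
      rw [← t1]
      simp only [pullPair, pullList, Finset.mul_sum]
      exact Finset.sum_congr rfl fun _ _ => Finset.sum_congr rfl fun _ _ =>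
        Finset.sum_congr rfl fun _ _ => Finset.sum_congr rfl fun _ _ => by ring
    have e2 : pullPair v h [j, l] i k
        = ∑ a, ∑ b, ∑ c, ∑ d, v i a * v j b * v k c * v l d * h [b, d] a c := by
      rw [← t2]
      simp only [pullPair, pullList, Finset.mul_sum]
      exact Finset.sum_congr rfl fun _ _ => Finset.sum_congr rfl fun _ _ =>
        Finset.sum_congr rfl fun _ _ => Finset.sum_congr rfl fun _ _ => by ring
    have e3 : pullPair v h [j, k] i l
        = ∑ a, ∑ b, ∑ c, ∑ d, v i a * v j b * v k c * v l d * h [b, c] a d := by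
      rw [← t3]
      simp only [pullPair, pullList, Finset.mul_sum]
      exact Finset.sum_congr rfl fun _ _ => Finset.sum_congr rfl fun _ _ =>
        Finset.sum_congr rfl fun _ _ => Finset.sum_congr rfl fun _ _ => by ring
    have e4 : pullPair v h [i, l] j k
        = ∑ a, ∑ b, ∑ c, ∑ d, v i a * v j b * v k c * v l d * h [a, d] b c := by
      rw [← t4]
      simp only [pullPair, pullList, Finset.mul_sum]
      exact Finset.sum_congr rfl fun _ _ => Finset.sum_congr rfl fun _ _ =>
        Finset.sum_congr rfl fun _ _ => Finset.sum_congr rfl fun _ _ => by ring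
    simp only [linCurv, linPattern, pullList, List.nil_append]
    rw [e1, e2, e3, e4, hF]
    simp only [Finset.mul_sum, ← Finset.sum_add_distrib, ← Finset.sum_sub_distrib]
    exact Finset.sum_congr rfl fun _ _ => Finset.sum_congr rfl fun _ _ =>
      Finset.sum_congr rfl fun _ _ => Finset.sum_congr rfl fun _ _ => by ring
  | succ m ih =>
    match l, hl with
    | [], hl => simp at hl
    | i :: l, hl =>
      have h1 : (fun r => pullPair v h (i :: r)) = fun L c d =>
          ∑ a, v i a * pullPair v (fun W => h (a :: W)) L c d := by
        funext L c d
        simp only [pullPair, pullList, Finset.mul_sum]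
        rw [Finset.sum_comm_cycle]
        refine Finset.sum_congr rfl fun a _ => Finset.sum_congr rfl fun b _ =>
          Finset.sum_congr rfl fun b' _ => ?_
        ring
      change linCurv m (fun r => pullPair v h (i :: r)) l = _
      rw [h1, linCurv_sum]
      refine Finset.sum_congr rfl fun a _ => ?_
      rw [ih _ l (by simp at hl; omega)]
      rfl

theorem Jets.factor_pull (J : Jets s A) (v : I → A → ℝ) {κ : Kind s} {m : ℕ} (l : List I)
    (hl : l.length = κ.rank + m) : (J.pull v).factor κ m l = pullList v (J.factor κ m) l := by
  match κ with
  | .curv => exact linCurv_pull v m J.h l hl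
  | .ric =>
    have : ∀ l : List I, pullList v (fun _ => (0 : ℝ)) l = 0 := by
      intro l
      induction l with
      | nil => rfl
      | cons i l ih => simp [pullList, ih]
    exact (this l).symm
  | .psi _ => rfl
  | .omega => rfl
  | .ups => rfl

theorem pullList_eq (v : I → A → ℝ) (f : List A → ℝ) (l : List I) :
    pullList v f l = ∑ β : Fin l.length → A, (∏ k, v (l.get k) (β k)) * f (List.ofFn β) := by
  induction l generalizing f with
  | nil => simp [pullList]
  | cons i l ih =>
    simp only [pullList, ih, Finset.mul_sum]
    rw [← Fintype.sum_prod_type']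
    refine Fintype.sum_equiv (Fin.consEquiv fun _ => A) _ _ fun z => ?_
    simp only [Fin.consEquiv_apply, List.length_cons, Fin.prod_univ_succ, List.ofFn_succ, Fin.cons_zero,
      Fin.cons_succ, List.get_cons_zero, List.get_cons_succ']
    ring

variable {P : Type} [Fintype P] [DecidableEq P]

theorem prod_sum_pairs {X : Type} [Fintype X] (F : P → X → X → ℝ) :
    ∑ α : P × Bool → X, ∏ j, F j (α (j, false)) (α (j, true)) = ∏ j, ∑ a, ∑ b, F j a b := by
  simp only [← Fintype.sum_prod_type']
  rw [Finset.prod_univ_sum, Fintype.piFinset_univ]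
  refine Fintype.sum_equiv ((Equiv.curry P Bool X).trans
    (Equiv.arrowCongr (Equiv.refl P) (Equiv.boolArrowEquivProd X))) _ _ fun α => rfl

/-- The enumeration of the indices of a scheme by the slots of its factors. -/
noncomputable def Scheme.slotEquiv (C : Scheme s) :
    (Σ i, Fin (C.lbl i).length) ≃ C.P × Bool :=
  Equiv.ofBijective (fun z => (C.lbl z.1).get z.2) <| by
    constructor
    · rintro ⟨i, k⟩ ⟨j, l⟩ h
      have hi : (C.lbl i).get k ∈ C.lbl i := List.get_mem _ _
      have hj : (C.lbl j).get l ∈ C.lbl j := List.get_mem _ _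
      obtain rfl := C.disj i j _ hi (by
        change (C.lbl i).get k = (C.lbl j).get l at h
        rw [h]
        exact hj)
      have hkl : k = l := (C.nodup i).injective_get h
      rw [hkl]
    · intro z
      obtain ⟨i, hi⟩ := C.cover z
      obtain ⟨k, rfl⟩ := List.get_of_mem hi
      exact ⟨⟨i, k⟩, rfl⟩

/-- Substitution in all factors of a contraction. -/
theorem Scheme.prod_pullList (C : Scheme s) (v : I → A → ℝ) (f : C.ι → List A → ℝ)
    (α : C.P × Bool → I) :
    ∏ i, pullList v (f i) ((C.lbl i).map α)
      = ∑ β : C.P × Bool → A, (∏ z, v (α z) (β z)) * ∏ i, f i ((C.lbl i).map β) := by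
  have h1 : ∀ i, pullList v (f i) ((C.lbl i).map α)
      = ∑ β : Fin (C.lbl i).length → A, (∏ k, v (α ((C.lbl i).get k)) (β k)) * f i (List.ofFn β) := by
    intro i
    rw [pullList_eq]
    refine Fintype.sum_equiv (Equiv.arrowCongr (finCongr (List.length_map _)) (Equiv.refl A)) _ _
      fun β => ?_
    congr 1
    · refine Fintype.prod_equiv (finCongr (List.length_map _)) _ _ fun k => ?_
      simp
    · congr 1
      refine List.ext_getElem (by simp) fun k h1 h2 => ?_
      simp
  simp only [h1]
  rw [Finset.prod_univ_sum, Fintype.piFinset_univ]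
  refine Fintype.sum_equiv ((Equiv.piCurry fun _ _ => A).symm.trans
    (Equiv.arrowCongr C.slotEquiv (Equiv.refl A))) _ _ fun β => ?_
  rw [Finset.prod_mul_distrib]
  have hβ : ∀ i (k : Fin (C.lbl i).length), ((Equiv.piCurry fun _ _ => A).symm.trans
      (Equiv.arrowCongr C.slotEquiv (Equiv.refl A))) β ((C.lbl i).get k) = β i k := by
    intro i k
    have : C.slotEquiv.symm ((C.lbl i).get k) = ⟨i, k⟩ := by
      rw [Equiv.symm_apply_eq]
      rfl
    simp only [Equiv.trans_apply, Equiv.arrowCongr_apply, Function.comp_apply, this]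
    rfl
  congr 1
  · rw [← C.slotEquiv.prod_comp, Fintype.prod_sigma]
    refine Finset.prod_congr rfl fun i _ => Finset.prod_congr rfl fun k _ => ?_
    exact congrArg (v _) (hβ i k).symm
  · refine Finset.prod_congr rfl fun i _ => congrArg _ ?_
    refine List.ext_getElem (by simp) fun k h1 h2 => ?_
    simp only [List.getElem_ofFn, List.getElem_map]
    exact (hβ i ⟨k, by simpa using h1⟩).symm

/-- Contraction by the identity matrix after substitution is contraction by `∑ i, v i ⊗ v i`. -/
theorem Scheme.linVal_pull [Fintype I] [DecidableEq I] (C : Scheme s) (v : I → A → ℝ) (J : Jets s A) :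
    C.linVal (1 : Matrix I I ℝ) (J.pull v) = C.linVal (fun a b => ∑ i, v i a * v i b) J := by
  unfold Scheme.linVal
  have h1 : ∀ (α : C.P × Bool → I) i, (J.pull v).factor (C.kind i) (C.ord i) ((C.lbl i).map α)
      = pullList v (J.factor (C.kind i) (C.ord i)) ((C.lbl i).map α) := fun α i =>
    J.factor_pull v _ (by rw [List.length_map, C.len i])
  simp only [h1, C.prod_pullList, Finset.mul_sum]
  rw [Finset.sum_comm]
  refine Finset.sum_congr rfl fun β _ => ?_
  simp only [← mul_assoc, ← Finset.sum_mul]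
  congr 1
  simp only [Fintype.prod_prod_type, Fintype.prod_bool, ← Finset.prod_mul_distrib]
  rw [prod_sum_pairs fun j a b => (1 : Matrix I I ℝ) a b * (v b (β (j, true)) * v a (β (j, false)))]
  refine Finset.prod_congr rfl fun j _ => Finset.sum_congr rfl fun a _ => ?_
  simp [Matrix.one_apply, mul_comm]

end Pullback

section Polarization

variable {s : ℕ} {A : Type} [Fintype A]

/-- The terms of the expansion of `C.linVal (∑ k, w k)`: the pair `j` is contracted by `w (κ j)`. -/
noncomputable def Scheme.linTerm {K : Type} (C : Scheme s) (w : K → A → A → ℝ) (J : Jets s A)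
    (κ : C.P → K) : ℝ :=
  ∑ α : C.P × Bool → A, (∏ j, w (κ j) (α (j, false)) (α (j, true))) *
    ∏ i, J.factor (C.kind i) (C.ord i) ((C.lbl i).map α)

theorem Scheme.linVal_sum {K : Type} [DecidableEq K] (C : Scheme s) (w : K → A → A → ℝ) (J : Jets s A)
    (T : Finset K) : C.linVal (fun a b => ∑ k ∈ T, w k a b) J
      = ∑ κ ∈ Fintype.piFinset fun _ : C.P => T, C.linTerm w J κ := by
  unfold Scheme.linVal Scheme.linTerm
  rw [Finset.sum_comm]
  refine Finset.sum_congr rfl fun α _ => ?_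
  rw [Finset.prod_univ_sum, Finset.sum_mul]

/-- A combination of linearized contractions with at most `n` pairs each vanishes if it does so
for contractions by sums of at most `n` of the matrices `w k`: expanding the sum over `Z` in each
pair, at most `n` matrices occur in a term, so inclusion-exclusion applies. -/
theorem sum_linVal_sum_eq_zero {K T : Type} [Fintype T] [DecidableEq K] {n : ℕ} (c : T → ℝ)
    (C : T → Scheme s) (hP : ∀ t, Fintype.card (C t).P ≤ n) (J : Jets s A) (w : K → A → A → ℝ)
    (h : ∀ Z : Finset K, Z.card ≤ n → ∑ t, c t * (C t).linVal (fun a b => ∑ k ∈ Z, w k a b) J = 0)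
    (Z : Finset K) : ∑ t, c t * (C t).linVal (fun a b => ∑ k ∈ Z, w k a b) J = 0 := by
  -- `G S` collects the terms in which exactly the matrices `w k`, `k ∈ S`, occur.
  let G : Finset K → ℝ := fun S => ∑ t, c t *
    ∑ κ ∈ (Fintype.piFinset fun _ : (C t).P => S).filter (fun κ => Finset.univ.image κ = S),
      (C t).linTerm w J κ
  have hG : ∀ Z : Finset K, ∑ t, c t * (C t).linVal (fun a b => ∑ k ∈ Z, w k a b) J
      = ∑ S ∈ Z.powerset, G S := by
    intro Z
    simp only [G]
    rw [Finset.sum_comm]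
    refine Finset.sum_congr rfl fun t _ => ?_
    rw [Scheme.linVal_sum, ← Finset.mul_sum]
    congr 1
    rw [← Finset.sum_fiberwise_of_maps_to (t := Z.powerset) (g := fun κ => Finset.univ.image κ)]
    · refine Finset.sum_congr rfl fun S hS => Finset.sum_congr ?_ fun _ _ => rfl
      ext κ
      simp only [Finset.mem_filter, Fintype.mem_piFinset]
      constructor
      · rintro ⟨-, h2⟩
        exact ⟨fun a => h2 ▸ Finset.mem_image_of_mem κ (Finset.mem_univ a), h2⟩
      · rintro ⟨h1, h2⟩
        exact ⟨fun a => Finset.mem_powerset.1 hS (h1 a), h2⟩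
    · intro κ hκ
      rw [Finset.mem_powerset, Finset.image_subset_iff]
      exact fun a _ => Fintype.mem_piFinset.1 hκ a
  have hbig : ∀ S : Finset K, n < S.card → G S = 0 := by
    intro S hS
    refine Finset.sum_eq_zero fun t _ => ?_
    rw [Finset.sum_eq_zero, mul_zero]
    intro κ hκ
    have h1 := (Finset.mem_filter.1 hκ).2
    have h2 : (Finset.univ.image κ).card ≤ Fintype.card (C t).P := Finset.card_image_le
    rw [h1] at h2
    exact absurd (h2.trans (hP t)) (by omega)
  have hsmall : ∀ S : Finset K, G S = 0 := by
    intro S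
    induction S using Finset.strongInduction with
    | H S ih =>
      by_cases hS : n < S.card
      · exact hbig S hS
      · have h1 := (hG S).symm.trans (h S (by omega))
        rw [← Finset.insert_erase (Finset.mem_powerset_self S),
          Finset.sum_insert (Finset.notMem_erase _ _)] at h1
        rwa [Finset.sum_eq_zero, add_zero] at h1
        intro S' hS'
        rw [Finset.mem_erase, Finset.mem_powerset] at hS'
        exact ih S' (hS'.2.ssubset_of_ne hS'.1)
  rw [hG]
  exact Finset.sum_eq_zero fun S _ => hsmall S

theorem sum_linVal_squares_eq_zero {T : Type} [Fintype T] {n : ℕ} (c : T → ℝ)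
    (C : T → Scheme s) (hP : ∀ t, Fintype.card (C t).P ≤ n)
    (h : ∀ J : Jets s (Fin n), ∑ t, c t * (C t).linVal (1 : Matrix (Fin n) (Fin n) ℝ) J = 0)
    (J : Jets s A) {K : Type} [Fintype K] (v : K → A → ℝ) :
    ∑ t, c t * (C t).linVal (fun a b => ∑ k, v k a * v k b) J = 0 := by
  classical
  refine sum_linVal_sum_eq_zero (n := n) c C hP J (fun k a b => v k a * v k b) (fun Z hZ => ?_)
    Finset.univ
  let e : Z ↪ Fin n := (Z.equivFin.toEmbedding.trans (Fin.castLEEmb hZ))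
  have h1 := h (J.pull (Function.extend e (fun k => v k) 0))
  simp only [Scheme.linVal_pull] at h1
  have h2 : ∀ a b, ∑ i, Function.extend e (fun k => v k) 0 i a * Function.extend e (fun k => v k) 0 i b
      = ∑ k ∈ Z, v k a * v k b := by
    intro a b
    rw [← Finset.sum_coe_sort Z fun k => v k a * v k b]
    refine (Fintype.sum_of_injective e e.injective _ _ (fun i hi => ?_) fun k => ?_).symm
    · rw [Function.extend_apply' _ _ _ (by simpa using hi)]
      simp
    · rw [e.injective.extend_apply]
  simpa only [h2] using h1

/-- Values of linearized contractions depend polynomially on the matrix. -/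
theorem sum_linVal_add_smul_eq_zero {T : Type} [Fintype T] (c : T → ℝ) (C : T → Scheme s) (J : Jets s A)
    (γ γ' : A → A → ℝ)
    (h : ∀ r : ℝ, 0 ≤ r → ∑ t, c t * (C t).linVal (fun a b => γ a b + r * γ' a b) J = 0) (r : ℝ) :
    ∑ t, c t * (C t).linVal (fun a b => γ a b + r * γ' a b) J = 0 := by
  let p : Polynomial ℝ := ∑ t, Polynomial.C (c t) * ∑ α : (C t).P × Bool → A,
    (∏ j, (Polynomial.C (γ (α (j, false)) (α (j, true)))
      + Polynomial.X * Polynomial.C (γ' (α (j, false)) (α (j, true))))) *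
    ∏ i, Polynomial.C (J.factor ((C t).kind i) ((C t).ord i) (((C t).lbl i).map α))
  have hp : ∀ r, p.eval r = ∑ t, c t * (C t).linVal (fun a b => γ a b + r * γ' a b) J := by
    intro r
    simp only [p, Scheme.linVal, Polynomial.eval_finsetSum, Polynomial.eval_mul, Polynomial.eval_C,
      Polynomial.eval_prod, Polynomial.eval_add, Polynomial.eval_X]
  have h0 : p = 0 := by
    refine Polynomial.eq_zero_of_infinite_isRoot p ((Set.Ici_infinite (0 : ℝ)).mono fun r hr => ?_)
    exact (hp r).trans (h r hr)
  rw [← hp, h0, Polynomial.eval_zero]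

/-- An identity between contractions with at most `n` pairs that holds formally in dimension `n`
holds formally for all symmetric matrices of any size. -/
theorem sum_linVal_eq_zero {T : Type} [Fintype T] {n : ℕ} (c : T → ℝ)
    (C : T → Scheme s) (hP : ∀ t, Fintype.card (C t).P ≤ n)
    (h : ∀ J : Jets s (Fin n), ∑ t, c t * (C t).linVal (1 : Matrix (Fin n) (Fin n) ℝ) J = 0)
    (J : Jets s A) (γ : A → A → ℝ) (hγ : ∀ a b, γ a b = γ b a) :
    ∑ t, c t * (C t).linVal γ J = 0 := by
  classical
  -- `γ = ¼ ∑ γ a b ((e_a + e_b)² - (e_a - e_b)²)`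
  let v : (A × A) × Bool → A → ℝ := fun k a => (if k.1.1 = a then 1 else 0)
    + (if k.2 then 1 else -1) * if k.1.2 = a then 1 else 0
  let w : (A × A) × Bool → ℝ := fun k => (if k.2 then 1 else -1) * γ k.1.1 k.1.2 / 4
  have hγ' : ∀ a b, γ a b = ∑ k, w k * (v k a * v k b) := by
    intro a b
    have h1 : ∀ x : A × A, ∑ t : Bool, w (x, t) * (v (x, t) a * v (x, t) b)
        = γ x.1 x.2 / 2 * (if x.1 = a then if x.2 = b then 1 else 0 else 0)
          + γ x.1 x.2 / 2 * if x.2 = a then if x.1 = b then 1 else 0 else 0 := by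
      intro x
      rw [Fintype.sum_bool]
      simp only [w, v, if_true, Bool.false_eq_true, if_false]
      split_ifs <;> ring
    rw [Fintype.sum_prod_type]
    simp only [h1, Fintype.sum_prod_type, Finset.sum_add_distrib]
    have h2 : ∑ x, ∑ y, γ x y / 2 * (if x = a then if y = b then 1 else 0 else 0) = γ a b / 2 := by
      simp
    have h3 : ∑ x, ∑ y, γ x y / 2 * (if y = a then if x = b then 1 else 0 else 0) = γ a b / 2 := by
      simp [hγ b a]
    rw [h2, h3, add_halves]
  have h1 := sum_linVal_add_smul_eq_zero c C J (fun a b => ∑ k, max (w k) 0 * (v k a * v k b))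
    (fun a b => ∑ k, max (-w k) 0 * (v k a * v k b)) ?_ (-1)
  · convert h1 using 4 with t
    funext a b
    rw [hγ', neg_one_mul, ← sub_eq_add_neg, ← Finset.sum_sub_distrib]
    refine Finset.sum_congr rfl fun k _ => ?_
    have hw : w k = max (w k) 0 - max (-w k) 0 := by
      rcases le_total 0 (w k) with h | h <;> simp [h]
    rw [← sub_mul, ← hw]
  · intro r hr
    have h2 := sum_linVal_squares_eq_zero c C hP h J
      fun k a => Real.sqrt (max (w k) 0 + r * max (-w k) 0) * v k a
    convert h2 using 4 with t
    funext a b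
    rw [Finset.mul_sum, ← Finset.sum_add_distrib]
    refine Finset.sum_congr rfl fun k _ => ?_
    have h3 : 0 ≤ max (w k) 0 + r * max (-w k) 0 := by positivity
    calc _ = (max (w k) 0 + r * max (-w k) 0) * (v k a * v k b) := by ring
      _ = Real.sqrt (max (w k) 0 + r * max (-w k) 0) * Real.sqrt (max (w k) 0 + r * max (-w k) 0)
          * (v k a * v k b) := by rw [Real.mul_self_sqrt h3]
      _ = _ := by ring

end Polarization

/-! ### From linearized contractions to `Riccify` -/

section Specialization

variable {n s : ℕ}

/-- The indices of the formal contractions used for `Riccify`: besides the ordinary ones, there are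
indices `inr (true, a, b)` for the factors `∇υ` and `inr (false, a, b)` for the indices contracted
against them. Such a contraction stands for a derivative with the index `a` contracted against the
index `b` of the factor. -/
abbrev ExtIndex (n : ℕ) : Type := Fin n ⊕ Bool × Fin n × Fin n

namespace ExtIndex

/-- The index of the factor itself. -/
def low : ExtIndex n → Fin n
  | .inl i => i
  | .inr (false, _, b) => b
  | .inr (true, a, _) => a

/-- The additional derivative index. -/
def upper : ExtIndex n → Option (Fin n)
  | .inl _ => none
  | .inr (false, a, _) => some a
  | .inr (true, _, _) => none

/-- The indices of the factors `∇υ`. -/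
def IsUps : ExtIndex n → Prop
  | .inr (true, _, _) => True
  | _ => False

/-- The matrix by which indices are contracted: the inverse metric on the ordinary indices, and the
index `(a, b)` of a factor `∇υ` pairs with the partner index `(a, b)` only. -/
noncomputable def pairing (B : Background n s) (x : Fin n → ℝ) : ExtIndex n → ExtIndex n → ℝ
  | .inl i, .inl j => (B.g x)⁻¹ i j
  | .inr (true, a, b), .inr (false, c, d) => if a = c ∧ b = d then (B.g x)⁻¹ a b else 0
  | .inr (false, c, d), .inr (true, a, b) => if a = c ∧ b = d then (B.g x)⁻¹ a b else 0
  | _, _ => 0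

theorem pairing_symm (B : Background n s) {x : Fin n → ℝ} (hx : x ∈ B.U) (y z : ExtIndex n) :
    pairing B x y z = pairing B x z y := by
  rcases y with i | ⟨_ | _, a, b⟩ <;> rcases z with j | ⟨_ | _, c, d⟩ <;> simp only [pairing]
  exact B.ginv_symm hx i j

end ExtIndex

open ExtIndex

theorem symFactor_perm (B : Background n s) (x : Fin n → ℝ) {κ : Kind s} (hκ : κ ≠ .curv) (m : ℕ)
    {L L' : List (ExtIndex n)} (h : L.Perm L') :
    B.symFactor κ m x (L.filterMap upper) (L.map low)
      = B.symFactor κ m x (L'.filterMap upper) (L'.map low) := by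
  have h1 := h.filterMap upper
  have h2 := h.map low
  match κ with
  | .curv => exact absurd rfl hκ
  | .ric => rfl
  | .psi i => exact symJet_perm B _ x (h1.append h2)
  | .omega =>
    simp only [Background.symFactor, List.length_map, h.length_eq]
    split_ifs with e1 e2
    · rfl
    · obtain ⟨z, rfl⟩ := List.length_eq_one_iff.1 e2
      rw [List.perm_singleton.1 h]
    · exact ricciJet_perm B x h1 h2
  | .ups => rfl

open Classical in
/-- The formal derivatives whose contractions are the contractions of `Background.symFactor`. A factor
`∇υ` is `1` on its own indices, and the other factors vanish on those; a partner index of a factor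
`∇υ` counts twice, as a slot of the factor and as an additional derivative. -/
noncomputable def specialJets (B : Background n s) (x : Fin n → ℝ) : Jets s (ExtIndex n) where
  h := fun L c d => if ∃ z ∈ L ++ [c, d], z.IsUps then 0 else
    metricJet B x ((L ++ [c, d]).filterMap upper ++ L.map low) c.low d.low
  ψ := fun i L => if ∃ z ∈ L, z.IsUps then 0 else
    B.symFactor (.psi i) 0 x (L.filterMap upper) (L.map low)
  Ω := fun L => if ∃ z ∈ L, z.IsUps then 0 else
    B.symFactor .omega 0 x (L.filterMap upper) (L.map low)
  υ := fun L => if ∃ z, L = [z] ∧ z.IsUps then 1 else 0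
  perm_h := fun h c d => by
    have h' := h.append_right [c, d]
    simp only [h'.mem_iff]
    rw [metricJet_perm B x ((h'.filterMap upper).append (h.map low))]
  symm_h := fun L c d => by
    have h' : (L ++ [c, d]).Perm (L ++ [d, c]) := (List.Perm.swap d c []).append_left L
    simp only [h'.mem_iff]
    rw [metricJet_perm B x ((h'.filterMap upper).append_right (L.map low)), metricJet_symm]
  perm_ψ := fun h i => by
    simp only [h.mem_iff]
    rw [symFactor_perm B x (by simp) 0 h]
  perm_Ω := fun h => by
    simp only [h.mem_iff]
    rw [symFactor_perm B x (by simp) 0 h]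
  perm_υ := fun {L L'} h => by
    have : ∀ z, L = [z] ↔ L' = [z] := fun z => by
      rw [← List.perm_singleton, ← List.perm_singleton]
      exact ⟨fun h' => h.symm.trans h', fun h' => h.trans h'⟩
    simp only [this]

theorem specialJets_factor_of_isUps (B : Background n s) (x : Fin n → ℝ) {κ : Kind s} {m : ℕ}
    {L : List (ExtIndex n)} (hL : L.length = κ.rank + m) (hκ : κ ≠ .ups) {z : ExtIndex n}
    (hz : z ∈ L) (hz' : z.IsUps) : (specialJets B x).factor κ m L = 0 := by
  match κ with
  | .curv =>
    obtain ⟨r, v, rfl, rfl, hv⟩ : ∃ r v, L = r ++ v ∧ r.length = m ∧ v.length = 4 :=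
      ⟨L.take m, L.drop m, (List.take_append_drop _ _).symm, by simp [hL], by simp [hL, Kind.rank]⟩
    obtain ⟨i, j, k, l, rfl⟩ := List.length_eq_four.1 hv
    have h : ∀ a b c d : ExtIndex n, [i, j, k, l].Perm [a, b, c, d] →
        (specialJets B x).h (r ++ [a, b]) c d = 0 := by
      intro a b c d hp
      refine if_pos ⟨z, ?_, hz'⟩
      have h' := (hp.append_left r).mem_iff.1 hz
      simpa using h'
    change linCurv r.length (specialJets B x).h (r ++ [i, j, k, l]) = 0
    rw [linCurv_append, linPattern, h i k j l ((List.Perm.swap k j [l]).cons i),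
      h j l i k (((List.Perm.swap j i [k, l])).trans
        ((List.perm_append_comm (l₁ := [i, k]) (l₂ := [l])).cons j)),
      h j k i l ((List.perm_append_comm (l₁ := [i]) (l₂ := [j, k])).append_right [l]),
      h i l j k ((List.perm_append_comm (l₁ := [j, k]) (l₂ := [l])).cons i)]
    simp
  | .ric => rfl
  | .psi i => exact if_pos ⟨z, hz, hz'⟩
  | .omega => exact if_pos ⟨z, hz, hz'⟩
  | .ups => exact absurd rfl hκ

theorem specialJets_factor (B : Background n s) (x : Fin n → ℝ) {κ : Kind s} {m : ℕ}
    {L : List (ExtIndex n)} (hL : L.length = κ.rank + m) (hκ : κ ≠ .ups)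
    (hz : ∀ z ∈ L, ¬ z.IsUps) : (specialJets B x).factor κ m L
      = B.symFactor κ m x (L.filterMap upper) (L.map low) := by
  have hz' : ¬ ∃ z ∈ L, z.IsUps := fun ⟨z, h1, h2⟩ => hz z h1 h2
  match κ with
  | .curv =>
    obtain ⟨r, v, rfl, rfl, hv⟩ : ∃ r v, L = r ++ v ∧ r.length = m ∧ v.length = 4 :=
      ⟨L.take m, L.drop m, (List.take_append_drop _ _).symm, by simp [hL], by simp [hL, Kind.rank]⟩
    obtain ⟨i, j, k, l, rfl⟩ := List.length_eq_four.1 hv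
    have h : ∀ a b c d : ExtIndex n, [i, j, k, l].Perm [a, b, c, d] →
        (specialJets B x).h (r ++ [a, b]) c d = metricJet B x ((r ++ [i, j, k, l]).filterMap upper
          ++ (r.map low ++ [a.low, b.low])) c.low d.low := by
      intro a b c d hp
      have h' := hp.append_left r
      have e : r ++ [a, b] ++ [c, d] = r ++ [a, b, c, d] := by simp
      refine (if_neg ?_).trans ?_
      · rw [e]
        rintro ⟨z, h1, h2⟩
        exact hz z (h'.mem_iff.2 h1) h2
      · rw [e, metricJet_perm B x ((h'.filterMap upper).symm.append_right _)]
        simp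
    change linCurv r.length (specialJets B x).h (r ++ [i, j, k, l])
      = linCurv r.length (fun L' => metricJet B x ((r ++ [i, j, k, l]).filterMap upper ++ L'))
        ((r ++ [i, j, k, l]).map low)
    rw [linCurv_append, linPattern, h i k j l ((List.Perm.swap k j [l]).cons i),
      h j l i k (((List.Perm.swap j i [k, l])).trans
        ((List.perm_append_comm (l₁ := [i, k]) (l₂ := [l])).cons j)),
      h j k i l ((List.perm_append_comm (l₁ := [i]) (l₂ := [j, k])).append_right [l]),
      h i l j k ((List.perm_append_comm (l₁ := [j, k]) (l₂ := [l])).cons i)]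
    have e : (r ++ [i, j, k, l]).map low = r.map low ++ [i.low, j.low, k.low, l.low] := by simp
    rw [e, ← List.length_map (f := low) (as := r), linCurv_append, linPattern]
  | .ric => rfl
  | .psi i => exact if_neg hz'
  | .omega => exact if_neg hz'
  | .ups => exact absurd rfl hκ

namespace Scheme

variable {C : Scheme s}

open Classical in
/-- The extended index of a slot that belongs to given values of the indices. -/
noncomputable def extend (C : Scheme s) (α : C.P × Bool → Fin n) (z : C.P × Bool) : ExtIndex n :=
  if C.IsUps z then .inr (true, α z, α (flipEnd z))
  else if C.IsUps (flipEnd z) then .inr (false, α (flipEnd z), α z) else .inl (α z)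

theorem low_extend (α : C.P × Bool → Fin n) (z : C.P × Bool) : (C.extend α z).low = α z := by
  unfold extend
  split_ifs <;> rfl

theorem extend_injective : Function.Injective (C.extend : (C.P × Bool → Fin n) → _) := by
  intro α β h
  funext z
  rw [← low_extend (C := C) α, h, low_extend]

theorem prod_pairing_extend (B : Background n s) {x : Fin n → ℝ} (hx : x ∈ B.U)
    (hC : ∀ z, C.IsUps z → ¬ C.IsUps (flipEnd z)) (α : C.P × Bool → Fin n) (j : C.P) :
    pairing B x (C.extend α (j, false)) (C.extend α (j, true))
      = (B.g x)⁻¹ (α (j, false)) (α (j, true)) := by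
  have hf : flipEnd (j, false) = (j, true) := rfl
  have ht : flipEnd (j, true) = (j, false) := rfl
  by_cases h1 : C.IsUps (j, false)
  · have h2 : ¬ C.IsUps (j, true) := hC _ h1
    simp [extend, h1, h2, hf, ht, pairing]
  · by_cases h2 : C.IsUps (j, true)
    · simp [extend, h1, h2, hf, ht, pairing, B.ginv_symm hx]
    · simp [extend, h1, h2, hf, ht, pairing]

theorem filterMap_upper_extend {i : C.ι} (hi : i ∈ C.nonUps) (α : C.P × Bool → Fin n) :
    ((C.lbl i).map (C.extend α)).filterMap upper = (C.upsList i).map α := by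
  classical
  rw [List.filterMap_map, upsList, List.map_filterMap]
  refine List.filterMap_congr fun z hz => ?_
  have h1 := C.not_isUps hi hz
  by_cases h2 : C.IsUps (flipEnd z)
  · simp [extend, h1, h2, ExtIndex.upper]
  · simp [extend, h1, h2, ExtIndex.upper]

theorem eq_extend_of_ne_zero (B : Background n s) (x : Fin n → ℝ) {τ q a : ℕ}
    (hC : C.IsAdmissible τ q a) (β : C.P × Bool → ExtIndex n)
    (h1 : ∀ j, pairing B x (β (j, false)) (β (j, true)) ≠ 0)
    (h2 : ∀ i, (specialJets B x).factor (C.kind i) (C.ord i) ((C.lbl i).map β) ≠ 0) :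
    C.extend (fun z => (β z).low) = β := by
  have hups : ∀ z, C.IsUps z → (β z).IsUps := by
    rintro z ⟨i, hz, hi⟩
    have h3 := h2 i
    rw [hi] at h3
    have h4 : ∃ y, (C.lbl i).map β = [y] ∧ y.IsUps := by
      by_contra h
      exact h3 (if_neg h)
    obtain ⟨y, h5, h6⟩ := h4
    have : β z ∈ (C.lbl i).map β := List.mem_map_of_mem hz
    rw [h5, List.mem_singleton] at this
    rwa [this]
  have hnon : ∀ z, ¬ C.IsUps z → ¬ (β z).IsUps := by
    intro z hz hz'
    obtain ⟨i, hi, hiz⟩ := C.exists_mem_nonUps hz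
    exact h2 i (specialJets_factor_of_isUps B x (by rw [List.length_map, C.len i])
      (C.mem_nonUps.1 hi) (List.mem_map_of_mem hiz) hz')
  have hpair : ∀ z, pairing B x (β z) (β (flipEnd z)) ≠ 0 ∨ pairing B x (β (flipEnd z)) (β z) ≠ 0 := by
    rintro ⟨j, _ | _⟩
    · exact Or.inl (h1 j)
    · exact Or.inr (h1 j)
  funext z
  have hp := hpair z
  by_cases hz : C.IsUps z
  · have h3 := hups z hz
    have h4 := hnon _ (hC.ups_not_ups z hz)
    rw [extend, if_pos hz]
    rcases hy : β z with i | ⟨_ | _, a, b⟩ <;> rcases hw : β (flipEnd z) with i' | ⟨_ | _, a', b'⟩ <;>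
      rw [hy] at h3 hp <;> rw [hw] at h4 hp <;> simp [ExtIndex.IsUps, pairing, low] at h3 h4 hp ⊢
    exact hp.2.1.symm
  · by_cases hz' : C.IsUps (flipEnd z)
    · have h3 := hups _ hz'
      have h4 := hnon _ hz
      rw [extend, if_neg hz, if_pos hz']
      rcases hy : β z with i | ⟨_ | _, a, b⟩ <;> rcases hw : β (flipEnd z) with i' | ⟨_ | _, a', b'⟩ <;>
        rw [hy] at h4 hp <;> rw [hw] at h3 hp <;> simp [ExtIndex.IsUps, pairing, low] at h3 h4 hp ⊢
      exact hp.1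
    · have h3 := hnon _ hz'
      have h4 := hnon _ hz
      rw [extend, if_neg hz, if_neg hz']
      rcases hy : β z with i | ⟨_ | _, a, b⟩ <;> rcases hw : β (flipEnd z) with i' | ⟨_ | _, a', b'⟩ <;>
        rw [hy] at h4 hp <;> rw [hw] at h3 hp <;> simp [ExtIndex.IsUps, pairing, low] at h3 h4 hp ⊢

/-- The symmetrized `Riccify` is a formal contraction. -/
theorem linVal_specialJets (B : Background n s) {x : Fin n → ℝ} (hx : x ∈ B.U) {τ q a : ℕ}
    (hC : C.IsAdmissible τ q a) :
    C.linVal (pairing B x) (specialJets B x) = C.symmetrize B x := by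
  unfold linVal symmetrize contractPairs
  refine (Fintype.sum_of_injective C.extend extend_injective _ _ (fun β hβ => ?_) fun α => ?_).symm
  · by_contra h
    refine hβ ⟨fun z => (β z).low, eq_extend_of_ne_zero B x hC β ?_ ?_⟩
    · intro j
      exact Finset.prod_ne_zero_iff.1 (left_ne_zero_of_mul h) j (Finset.mem_univ j)
    · intro i
      exact Finset.prod_ne_zero_iff.1 (right_ne_zero_of_mul h) i (Finset.mem_univ i)
  · congr 1
    · exact Finset.prod_congr rfl fun j _ => (prod_pairing_extend B hx hC.ups_not_ups α j).symm
    · refine Finset.prod_congr rfl fun i _ => ?_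
      by_cases hi : i ∈ C.nonUps
      · rw [specialJets_factor B x (by rw [List.length_map, C.len i]) (C.mem_nonUps.1 hi),
          filterMap_upper_extend hi, List.map_map]
        · congr 1
          exact List.map_congr_left fun z _ => (low_extend α z).symm
        · intro y hy
          obtain ⟨z, hz, rfl⟩ := List.mem_map.1 hy
          rw [extend, if_neg (C.not_isUps hi hz)]
          split_ifs <;> simp [ExtIndex.IsUps]
      · have hk : C.kind i = .ups := by simpa [nonUps] using hi
        obtain ⟨z, hz⟩ : ∃ z, C.lbl i = [z] := List.length_eq_one_iff.1 (by
          rw [C.len i, hk, hC.ups_ord i hk]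
          rfl)
        rw [hk, hz]
        refine (if_pos ⟨_, rfl, ?_⟩).symm
        rw [extend, if_pos ⟨i, by simp [hz], hk⟩]
        trivial

end Scheme
end Specialization

/-! ### Identities among contractions yield identities among their Riccifications -/

section Transfer

variable {n s : ℕ}

theorem Scheme.sum_leadOrder (C : Scheme s) {q a : ℕ} (hpsi : ∀ h, C.count (.psi h) = 1)
    (homega : C.count .omega = q) (hups : C.count .ups = a) :
    ∑ i, Jets.leadOrder (C.kind i) + (s + q + a) = Fintype.card C.ι := by
  have h1 : ∀ κ : Kind s, Jets.leadOrder κ + ((∑ h, if κ = .psi h then 1 else 0)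
      + (if κ = .omega then 1 else 0) + if κ = .ups then 1 else 0) = 1 := by
    intro κ
    rcases κ with _ | _ | h | _ | _ <;> simp [Jets.leadOrder]
  have h2 : ∑ i, (Jets.leadOrder (C.kind i) + ((∑ h, if C.kind i = .psi h then 1 else 0)
      + (if C.kind i = .omega then 1 else 0) + if C.kind i = .ups then 1 else 0))
      = Fintype.card C.ι := by
    simp only [h1, Finset.sum_const, Finset.card_univ, smul_eq_mul, mul_one]
  rw [← h2, Finset.sum_add_distrib, Finset.sum_add_distrib, Finset.sum_add_distrib, Finset.sum_comm]
  simp only [← Finset.card_filter]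
  change _ = _ + (∑ h, C.count (.psi h) + C.count .omega + C.count .ups)
  simp only [hpsi, homega, hups, Finset.sum_const, Finset.card_univ, Fintype.card_fin, smul_eq_mul,
    mul_one]

/-- An identity among admissible contractions, modulo longer ones, remains true for the linearized
contractions of the formal derivatives `specialJets`; these are the symmetrized Riccifications. -/
theorem combination_sum_riccify {T T' : Type} [Fintype T] [Fintype T'] {τ q a : ℕ} (c : T → ℝ)
    (C : T → Scheme s) (hC : ∀ t, (C t).IsAdmissible τ q a) (hP : ∀ t, Fintype.card (C t).P ≤ n)
    (e : T' → ℝ) (D : T' → Scheme s) (hpsi : ∀ t h, (D t).count (.psi h) = 1)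
    (homega : ∀ t, (D t).count .omega = q) (hups : ∀ t, (D t).count .ups = a)
    (hD : ∀ t, τ + a + 1 ≤ Fintype.card (D t).ι)
    (h : ∀ B : Background n s, ∀ x ∈ B.U, ∑ t, c t * (C t).val B x = ∑ t, e t * (D t).val B x) :
    Combination n (IsRemainder τ q a) fun B x => ∑ t, c t * (C t).riccify B x := by
  have h1 : ∀ t, ∑ i, Jets.leadOrder ((C t).kind i) = τ - (s + q) := fun t => by
    have h2 := (C t).sum_leadOrder (hC t).psi (hC t).omega (hC t).ups
    rw [(hC t).length_eq] at h2
    omega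
  have h2 : ∀ B : Background n s, ∀ x ∈ B.U, ∑ t, c t * (C t).symmetrize B x = 0 := by
    intro B x hx
    rcases isEmpty_or_nonempty T with hT | ⟨⟨t₀⟩⟩
    · exact Fintype.sum_empty _
    have h3 := (C t₀).sum_leadOrder (hC t₀).psi (hC t₀).omega (hC t₀).ups
    rw [(hC t₀).length_eq, h1] at h3
    have h4 := sum_linVal_eq_zero c C hP (fun J => sum_linVal_one_eq_zero c C e D
      (fun t i => (hC t).no_ric i) h1 (fun t => by
        have h5 := (D t).sum_leadOrder (hpsi t) (homega t) (hups t)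
        have h6 := hD t
        omega) h J) (specialJets B x) (ExtIndex.pairing B x) (ExtIndex.pairing_symm B hx)
    rw [← h4]
    exact Finset.sum_congr rfl fun t _ => by rw [(C t).linVal_specialJets B hx (hC t)]
  refine Combination.sum (fun t => Scheme.combination_riccify_sub (hC t)) c fun B x hx => ?_
  simp only [mul_sub, Finset.sum_sub_distrib]
  rw [h2 B x hx, sub_zero]

end Transfer

/-! ### From contractions to lists of indices -/

section Conversion

variable {n s f : ℕ}

namespace Contraction

/-- The list of the slots of a factor, a slot being given by its position in the pattern of
contractions. -/
def slots (C : Contraction s f) (i : C.ι) : List ((Fin C.pairs × Bool) ⊕ Fin f) :=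
  List.ofFn fun k : Fin ((C.kind i).rank + C.ord i) => C.slot.symm ⟨i, k⟩

theorem mem_slots (C : Contraction s f) {i : C.ι} {z : (Fin C.pairs × Bool) ⊕ Fin f} :
    z ∈ C.slots i ↔ (C.slot z).1 = i := by
  unfold slots
  rw [List.mem_ofFn]
  constructor
  · rintro ⟨k, rfl⟩
    rw [Equiv.apply_symm_apply]
  · rintro rfl
    exact ⟨(C.slot z).2, C.slot.symm_apply_apply z⟩

theorem nodup_slots (C : Contraction s f) (i : C.ι) : (C.slots i).Nodup := by
  refine List.nodup_ofFn_ofInjective fun k l h => ?_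
  simpa using C.slot.symm.injective h

theorem length_slots (C : Contraction s f) (i : C.ι) :
    (C.slots i).length = (C.kind i).rank + C.ord i := by
  simp [slots]

theorem labels_eq (C : Contraction s f) (lab : (Fin C.pairs × Bool) ⊕ Fin f → Fin n) (i : C.ι) :
    C.labels lab i = (C.slots i).map lab := by
  simp [labels, slots, List.map_ofFn, Function.comp_def]

/-- The slot contracted against a given one, provided that it belongs to a factor `υ`. -/
def upsPartner (C : Contraction s f) : (Fin C.pairs × Bool) ⊕ Fin f → Option ((Fin C.pairs × Bool) ⊕ Fin f)
  | .inl (j, b) => if C.kind (C.owner j !b) = .ups then some (.inl (j, !b)) else none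
  | .inr _ => none

/-- The slots of factors `υ` that are contracted against the factor `i`. -/
def upsSlots (C : Contraction s f) (i : C.ι) : List ((Fin C.pairs × Bool) ⊕ Fin f) :=
  (C.slots i).filterMap C.upsPartner

theorem upsPartner_eq_some (C : Contraction s f) {z w : (Fin C.pairs × Bool) ⊕ Fin f} :
    C.upsPartner z = some w ↔ ∃ j b, z = .inl (j, !b) ∧ w = .inl (j, b) ∧ C.kind (C.owner j b) = .ups := by
  constructor
  · intro h
    rcases z with ⟨j, b⟩ | k
    · rw [upsPartner] at h
      split_ifs at h with hk
      exact ⟨j, !b, by rw [Bool.not_not], (Option.some_injective _ h).symm, hk⟩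
    · cases h
  · rintro ⟨j, b, rfl, rfl, hk⟩
    rw [upsPartner, Bool.not_not, if_pos hk]

theorem nodup_upsSlots (C : Contraction s f) (i : C.ι) : (C.upsSlots i).Nodup := by
  refine (C.nodup_slots i).filterMap fun z z' w hz hz' => ?_
  obtain ⟨j, b, rfl, rfl, -⟩ := C.upsPartner_eq_some.1 hz
  obtain ⟨j', b', rfl, h, -⟩ := C.upsPartner_eq_some.1 hz'
  simp only [Sum.inl.injEq, Prod.mk.injEq] at h
  rw [h.1, h.2]

theorem mem_upsSlots (C : Contraction s f) {i : C.ι} {w : (Fin C.pairs × Bool) ⊕ Fin f} :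
    w ∈ C.upsSlots i ↔ ∃ j b, w = .inl (j, b) ∧ C.kind (C.owner j b) = .ups ∧ C.owner j (!b) = i := by
  rw [upsSlots, List.mem_filterMap]
  constructor
  · rintro ⟨z, hz, h⟩
    obtain ⟨j, b, rfl, rfl, hk⟩ := C.upsPartner_eq_some.1 h
    exact ⟨j, b, rfl, hk, C.mem_slots.1 hz⟩
  · rintro ⟨j, b, rfl, hk, hi⟩
    exact ⟨.inl (j, !b), C.mem_slots.2 hi, C.upsPartner_eq_some.2 ⟨j, b, rfl, rfl, hk⟩⟩

theorem upsLabels_eq (C : Contraction s f) (lab : (Fin C.pairs × Bool) ⊕ Fin f → Fin n) (i : C.ι) :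
    C.upsLabels lab i = (C.upsSlots i).map lab := by
  rw [upsSlots, slots, List.ofFn_eq_map, List.filterMap_map, List.map_filterMap, upsLabels]
  refine List.filterMap_congr fun k _ => ?_
  simp only [Function.comp_apply]
  rcases C.slot.symm ⟨i, k⟩ with ⟨j, b⟩ | k
  · by_cases h : C.kind (C.owner j !b) = .ups <;> simp [upsPartner, h]
  · rfl

theorem two_mul_pairs_le (C : Contraction s f) : 2 * C.pairs + f ≤ 2 * C.weight := by
  have h1 := Fintype.card_congr C.slot
  rw [Fintype.card_sum, Fintype.card_prod, Fintype.card_fin, Fintype.card_fin, Fintype.card_bool,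
    Fintype.card_sigma] at h1
  rw [mul_comm 2, h1, weight, Finset.mul_sum]
  refine Finset.sum_le_sum fun i _ => ?_
  rw [Fintype.card_fin]
  have h2 : ∀ κ : Kind s, κ.rank ≤ 2 * κ.weight := fun κ => by
    rcases κ with _ | _ | _ | _ | _ <;> simp [Kind.rank, Kind.weight]
  have := h2 (C.kind i)
  omega

/-- A way of contracting the free slots of a contraction against additional derivative indices of
its factors: `new i` lists the indices that are put in front of the indices of the factor `i`. -/
structure Completion (C : Contraction s f) where
  Q : Type
  [fintypeQ : Fintype Q]
  [decEqQ : DecidableEq Q]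
  φ : (Fin C.pairs × Bool) ⊕ Fin f → Q × Bool
  new : C.ι → List (Q × Bool)
  injective : Function.Injective φ
  nodup_new : ∀ i, (new i).Nodup
  notMem_new : ∀ i z, φ z ∉ new i
  disj_new : ∀ i j z, z ∈ new i → z ∈ new j → i = j
  cover : ∀ z, (∃ w, φ w = z) ∨ ∃ i, z ∈ new i
  flip_pair : ∀ j b, flipEnd (φ (.inl (j, b))) = φ (.inl (j, !b))
  flip_new : ∀ i, ∀ z ∈ new i, ∃ k, flipEnd z = φ (.inr k)
  flip_free : ∀ k, ∃ i, flipEnd (φ (.inr k)) ∈ new i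
  new_ups : ∀ i, C.kind i = .ups → new i = []

attribute [instance] Completion.fintypeQ Completion.decEqQ

namespace Completion

variable {C : Contraction s f}

/-- The resulting complete contraction. -/
abbrev toScheme (D : C.Completion) : Scheme s where
  ι := C.ι
  P := D.Q
  kind := C.kind
  ord := fun i => C.ord i + (D.new i).length
  lbl := fun i => D.new i ++ (C.slots i).map D.φ
  len := fun i => by
    rw [List.length_append, List.length_map, length_slots]
    omega
  nodup := fun i => by
    refine List.nodup_append.2 ⟨D.nodup_new i, (C.nodup_slots i).map D.injective, ?_⟩
    rintro z hz w hw rfl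
    obtain ⟨w, -, rfl⟩ := List.mem_map.1 hw
    exact D.notMem_new i w hz
  disj := fun i j z hi hj => by
    rw [List.mem_append, List.mem_map] at hi hj
    rcases hi with hi | ⟨w, hw, rfl⟩ <;> rcases hj with hj | ⟨w', hw', hz⟩
    · exact D.disj_new i j z hi hj
    · exact absurd (hz ▸ hi) (D.notMem_new i w')
    · exact absurd hj (D.notMem_new j w)
    · obtain rfl := D.injective hz
      exact (C.mem_slots.1 hw).symm.trans (C.mem_slots.1 hw')
  cover := fun z => by
    rcases D.cover z with ⟨w, rfl⟩ | ⟨i, hi⟩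
    · exact ⟨(C.slot w).1, List.mem_append_right _ (List.mem_map_of_mem (C.mem_slots.2 rfl))⟩
    · exact ⟨i, List.mem_append_left _ hi⟩

theorem count_toScheme (D : C.Completion) (κ : Kind s) : D.toScheme.count κ = C.count κ :=
  (Fintype.card_subtype _).symm

theorem isUps_toScheme (D : C.Completion) (w : (Fin C.pairs × Bool) ⊕ Fin f) :
    D.toScheme.IsUps (D.φ w) ↔ C.kind (C.slot w).1 = .ups := by
  constructor
  · rintro ⟨i, hi, hk⟩
    rcases List.mem_append.1 hi with h | h
    · exact absurd h (D.notMem_new i w)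
    · rw [List.mem_map_of_injective D.injective, C.mem_slots] at h
      rw [h]
      exact hk
  · intro h
    exact ⟨_, List.mem_append_right _ (List.mem_map_of_mem (C.mem_slots.2 rfl)), h⟩

theorem not_isUps_new (D : C.Completion) {i : C.ι} {z : D.Q × Bool} (hz : z ∈ D.new i) :
    ¬ D.toScheme.IsUps z := by
  rintro ⟨j, hj, hk⟩
  rcases List.mem_append.1 hj with h | h
  · rw [D.new_ups j hk] at h
    exact List.not_mem_nil h
  · obtain ⟨w, -, rfl⟩ := List.mem_map.1 h
    exact D.notMem_new i w hz

theorem not_isUps_flip_free (D : C.Completion) (k : Fin f) :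
    ¬ D.toScheme.IsUps (flipEnd (D.φ (.inr k))) := by
  obtain ⟨i, hi⟩ := D.flip_free k
  exact D.not_isUps_new hi

theorem isBalanced_toScheme (D : C.Completion) {τ q a : ℕ} (hC : C.IsAdmissible τ q a) :
    D.toScheme.IsBalanced τ q a where
  psi := fun h => (D.count_toScheme _).trans (hC.counts.psi h)
  omega := (D.count_toScheme _).trans hC.counts.omega
  ups := (D.count_toScheme _).trans hC.counts.ups
  length_eq := hC.length_eq
  no_ric := hC.no_ric
  ups_ord := fun i hi => by
    change C.ord i + (D.new i).length = 1
    rw [D.new_ups i hi, hC.ups_ord i hi]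
    rfl
  ups_not_ups := fun z hz hz' => by
    rcases D.cover z with ⟨w, rfl⟩ | ⟨i, hi⟩
    · rw [isUps_toScheme] at hz
      rcases w with ⟨j, b⟩ | k
      · rw [D.flip_pair, isUps_toScheme] at hz'
        refine hC.ups_not_ups j ?_
        rcases b with _ | _
        · exact ⟨hz, hz'⟩
        · exact ⟨hz', hz⟩
      · exact hC.ups_not_free k hz
    · exact D.not_isUps_new hi hz
  omega_ord := fun i hi hu => by
    refine le_trans (hC.omega_ord i hi ?_) (Nat.le_add_right _ _)
    rintro ⟨j, b, hj, hk⟩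
    have : D.φ (.inl (j, !b)) ∈ D.toScheme.upsList i := by
      rw [Scheme.mem_upsList, D.flip_pair, Bool.not_not, isUps_toScheme]
      exact ⟨List.mem_append_right _ (List.mem_map_of_mem (C.mem_slots.2 hj)), hk⟩
    rw [hu] at this
    exact List.not_mem_nil this

theorem not_internal (D : C.Completion) {τ q a : ℕ} (hC : C.IsAdmissible τ q a) {i : C.ι}
    (hne : ∀ z ∈ D.new i, ∀ k, flipEnd z = D.φ (.inr k) → (C.slot (.inr k)).1 ≠ i) :
    ∀ z ∈ D.toScheme.lbl i, flipEnd z ∉ D.toScheme.lbl i := by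
  intro z hz hz'
  rcases List.mem_append.1 hz with h | h
  · obtain ⟨k, hk⟩ := D.flip_new i z h
    rw [hk] at hz'
    rcases List.mem_append.1 hz' with h' | h'
    · exact D.notMem_new _ _ h'
    · rw [List.mem_map_of_injective D.injective, C.mem_slots] at h'
      exact hne z h k hk h'
  · obtain ⟨w, hw, rfl⟩ := List.mem_map.1 h
    rcases w with ⟨j, b⟩ | k
    · rw [D.flip_pair] at hz'
      rcases List.mem_append.1 hz' with h' | h'
      · exact D.notMem_new _ _ h'
      · rw [List.mem_map_of_injective D.injective, C.mem_slots] at h'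
        rw [C.mem_slots] at hw
        refine hC.no_internal j ?_
        rcases b with _ | _
        · exact hw.trans h'.symm
        · exact h'.trans hw.symm
    · rcases List.mem_append.1 hz' with h' | h'
      · exact hne _ h' k (flipEnd_involutive _) (C.mem_slots.1 hw)
      · obtain ⟨w, -, hw'⟩ := List.mem_map.1 h'
        obtain ⟨i', hi'⟩ := D.flip_free k
        rw [← hw'] at hi'
        exact D.notMem_new _ _ hi'

theorem isAdmissible_toScheme (D : C.Completion) {τ q a : ℕ} (hC : C.IsAdmissible τ q a)
    (hne : ∀ i, ∀ z ∈ D.new i, ∀ k, flipEnd z = D.φ (.inr k) → (C.slot (.inr k)).1 ≠ i) :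
    D.toScheme.IsAdmissible τ q a := by
  refine ⟨D.isBalanced_toScheme hC, fun i => D.not_internal hC fun z hz k hk => hne i z hz k hk⟩

theorem upsList_toScheme (D : C.Completion) (hD : ∀ k, C.kind (C.slot (.inr k)).1 ≠ .ups)
    (i : C.ι) : D.toScheme.upsList i = (C.upsSlots i).map D.φ := by
  classical
  have h1 : (D.new i).filterMap (fun z => if D.toScheme.IsUps (flipEnd z) then some (flipEnd z) else none)
      = [] := by
    rw [List.filterMap_eq_nil_iff]
    intro z hz
    obtain ⟨k, hk⟩ := D.flip_new i z hz
    rw [hk, isUps_toScheme, if_neg (hD k)]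
  rw [Scheme.upsList, List.filterMap_append, h1, List.nil_append, List.filterMap_map, upsSlots,
    List.map_filterMap]
  refine List.filterMap_congr fun z _ => ?_
  simp only [Function.comp_apply]
  rcases z with ⟨j, b⟩ | k
  · rw [D.flip_pair]
    have h2 : D.toScheme.IsUps (D.φ (.inl (j, !b))) ↔ C.kind (C.owner j !b) = .ups :=
      D.isUps_toScheme _
    by_cases h : C.kind (C.owner j !b) = .ups
    · rw [if_pos (h2.2 h), upsPartner, if_pos h]
      rfl
    · rw [if_neg (mt h2.1 h), upsPartner, if_neg h]
      rfl
  · rw [if_neg (D.not_isUps_flip_free k)]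
    rfl

end Completion

/-- A complete contraction is its own completion. -/
abbrev completion (C : Contraction s 0) : C.Completion where
  Q := Fin C.pairs
  φ := Sum.elim id Fin.elim0
  new := fun _ => []
  injective := by
    rintro (z | z) (w | w) h
    · exact congrArg _ h
    · exact w.elim0
    · exact z.elim0
    · exact w.elim0
  nodup_new := fun _ => List.nodup_nil
  notMem_new := fun _ _ => List.not_mem_nil
  disj_new := fun _ _ _ h => absurd h List.not_mem_nil
  cover := fun z => Or.inl ⟨.inl z, rfl⟩
  flip_pair := fun _ _ => rfl
  flip_new := fun _ _ h => absurd h List.not_mem_nil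
  flip_free := fun k => k.elim0
  new_ups := fun _ _ => rfl

theorem elim_elim0 (C : Contraction s 0) (α : Fin C.pairs × Bool → Fin n) (β : Fin 0 → Fin n) :
    Sum.elim α β = α ∘ C.completion.φ := by
  funext z
  rcases z with z | z
  · rfl
  · exact z.elim0

theorem value_eq_val (C : Contraction s 0) (B : Background n s) (x : Fin n → ℝ) :
    C.value B x Fin.elim0 = C.completion.toScheme.val B x := by
  unfold value contract Scheme.val contractPairs
  refine Finset.sum_congr rfl fun α _ => ?_
  rw [C.elim_elim0]
  congr 1
  refine Finset.prod_congr rfl fun i _ => ?_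
  beta_reduce
  rw [labels_eq, ← List.map_map]
  rfl

theorem riccify_eq_riccify (C : Contraction s 0) (B : Background n s) (x : Fin n → ℝ) :
    C.riccify B x Fin.elim0 = C.completion.toScheme.riccify B x := by
  unfold riccify contract Scheme.riccify contractPairs
  refine Finset.sum_congr rfl fun α _ => ?_
  rw [C.elim_elim0]
  congr 1
  refine Finset.prod_congr rfl fun i _ => ?_
  beta_reduce
  rw [labels_eq, upsLabels_eq, ← List.map_map, ← List.map_map,
    ← C.completion.upsList_toScheme (fun k => k.elim0)]
  rfl

/-- The free slot of a vector field is contracted against a derivative of the factor `i₀`. -/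
abbrev divCompletion (X : Contraction s 1) (i₀ : X.ι) (h₀ : X.kind i₀ ≠ .ups) : X.Completion where
  Q := Option (Fin X.pairs)
  φ := Sum.elim (Prod.map some id) fun _ => (none, true)
  new := fun i => if i = i₀ then [(none, false)] else []
  injective := by
    rintro (⟨j, b⟩ | z) (⟨j', b'⟩ | w) h
    · simpa using h
    · simp at h
    · simp at h
    · exact congrArg _ (Subsingleton.elim z w)
  nodup_new := fun i => by split_ifs <;> simp
  notMem_new := fun i z => by
    rcases z with ⟨j, b⟩ | z <;> split_ifs <;> simp
  disj_new := fun i j z hi hj => by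
    split_ifs at hi hj with h1 h2
    · exact h1.trans h2.symm
    all_goals simp_all
  cover := by
    rintro ⟨_ | j, b⟩
    · rcases b with _ | _
      · exact Or.inr ⟨i₀, by simp⟩
      · exact Or.inl ⟨.inr 0, rfl⟩
    · exact Or.inl ⟨.inl (j, b), rfl⟩
  flip_pair := fun _ _ => rfl
  flip_new := fun i z hz => by
    split_ifs at hz with h1
    · rw [List.mem_singleton.1 hz]
      exact ⟨0, rfl⟩
    · exact absurd hz List.not_mem_nil
  flip_free := fun k => ⟨i₀, by simp [flipEnd]⟩
  new_ups := fun i hi => if_neg (by rintro rfl; exact h₀ hi)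

end Contraction

/-- Contraction over the pairs of `Option P` is contraction over the pairs of `P`, followed by the
contraction of two further labels. -/
theorem contractPairs_option {P : Type} [Fintype P] [DecidableEq P] (B : Background n s)
    (x : Fin n → ℝ) (W : (Option P × Bool → Fin n) → ℝ)
    (V : Fin n → Fin n → (P × Bool → Fin n) → ℝ)
    (hV : ∀ α : Option P × Bool → Fin n,
      W α = V (α (none, false)) (α (none, true)) fun z => α (some z.1, z.2)) :
    contractPairs B x W = ∑ β, ∑ γ, (B.g x)⁻¹ β γ * contractPairs B x (V β γ) := by
  unfold contractPairs
  let e : (Option P × Bool → Fin n) ≃ (Fin n × Fin n) × (P × Bool → Fin n) :=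
    { toFun := fun α => ((α (none, false), α (none, true)), fun z => α (some z.1, z.2))
      invFun := fun p z => z.1.elim (if z.2 then p.1.2 else p.1.1) fun j => p.2 (j, z.2)
      left_inv := fun α => by
        funext ⟨j, b⟩
        rcases j with _ | j
        · rcases b with _ | _ <;> rfl
        · rfl
      right_inv := fun p => rfl }
  rw [← Fintype.sum_prod_type' fun β γ => (B.g x)⁻¹ β γ * ∑ α : P × Bool → Fin n, _]
  simp only [Finset.mul_sum]
  rw [← Fintype.sum_prod_type']
  refine Fintype.sum_equiv e _ _ fun α => ?_
  rw [hV α, Fintype.prod_option, mul_assoc]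
  rfl

namespace Contraction

theorem xdiv_eq_sum_val (X : Contraction s 1) (B : Background n s) (x : Fin n → ℝ) :
    X.xdiv B x = ∑ i₀ : {i : X.ι // i ≠ (X.slot (.inr 0)).1 ∧ X.kind i ≠ .ups},
      (X.divCompletion i₀ i₀.2.2).toScheme.val B x := by
  refine Finset.sum_congr rfl fun i₀ _ => ?_
  rw [Scheme.val, contractPairs_option (V := fun β γ α => ∏ i, if i = i₀.1 then
    B.factor (X.kind i) (X.ord i + 1) x (β :: X.labels (Sum.elim α fun _ => γ) i)
      else B.factor (X.kind i) (X.ord i) x (X.labels (Sum.elim α fun _ => γ) i))]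
  · rfl
  · intro α
    refine Finset.prod_congr rfl fun i _ => ?_
    have h1 : X.labels (Sum.elim (fun z => α (some z.1, z.2)) fun _ => α (none, true)) i
        = ((X.slots i).map (X.divCompletion i₀ i₀.2.2).φ).map α := by
      rw [labels_eq, List.map_map]
      refine List.map_congr_left fun z _ => ?_
      rcases z with z | z <;> rfl
    rw [h1, List.map_append]
    split_ifs with hi <;> simp [hi]

theorem isAdmissible_divCompletion (X : Contraction s 1) {i₀ : X.ι} (h₀ : X.kind i₀ ≠ .ups)
    (h₁ : i₀ ≠ (X.slot (.inr 0)).1) {τ q a : ℕ} (hX : X.IsAdmissible τ q a) :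
    (X.divCompletion i₀ h₀).toScheme.IsAdmissible τ q a := by
  refine (X.divCompletion i₀ h₀).isAdmissible_toScheme hX fun i z hz k _ => ?_
  have hi : i = i₀ := by
    by_contra h
    simp [h] at hz
  rw [hi, Subsingleton.elim k 0]
  exact h₁.symm

end Contraction

end Conversion

/-! ### Differentiating one factor of a Riccification -/

section Derivative

variable {n s : ℕ}

section Factors

variable {E : Type} [DecidableEq E] {S : Finset E}

theorem fac_cons_append_sub_mem (κ : Kind s) {c : E} {u l : List E} (hS : Enum S (c :: (u ++ l)))
    (hl : κ.rank ≤ l.length) {M : ℕ} (hM : M + κ.rank = u.length + l.length + 1) :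
    fac n κ M (c :: (u ++ l)) - fac n κ M (u ++ c :: l)
      ∈ cls n (Net.Long (unitCharge κ) 2 : Net s E S → Prop) := by
  obtain ⟨r, post, rfl, hpost⟩ : ∃ r post, l = r ++ post ∧ post.length = κ.rank :=
    ⟨l.take (l.length - κ.rank), l.drop (l.length - κ.rank), (List.take_append_drop _ _).symm,
      by rw [List.length_drop]; omega⟩
  rw [List.length_append] at hM
  have h := perm_mem_long (n := n) κ post hpost (r := c :: u) (r' := u ++ [c])
    (List.perm_append_singleton c u).symm [] r (S := S) (by simpa using hS) M
    (by simp only [List.length_nil, List.length_cons]; omega)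
  simpa using h

/-- A derivative of a factor of `Riccify` may be moved past the derivatives that come from
factors `∇υ`. -/
theorem riccFac_cons_sub_mem {κ : Kind s} {p : ℕ} {c : E} {u l : List E}
    (hS : Enum S (c :: (u ++ l))) (hl : l.length = κ.rank + p) (hric : κ ≠ .ric) (hups : κ ≠ .ups)
    (hom : κ = .omega → 2 ≤ p) :
    riccFac n κ p (c :: u) l - riccFac n κ (p + 1) u (c :: l)
      ∈ cls n (Net.Long (riccCharge κ) 2 : Net s E S → Prop) := by
  have key : ∀ (κ' : Kind s) (p' : ℕ), l.length = κ'.rank + p' →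
      (∀ κ'' : Kind s, κ''.IsFun → unitCharge κ' κ'' = riccCharge κ κ'') →
      (∀ B x lab, riccFac n κ p (c :: u) l B x lab
        = fac n κ' (u.length + 1 + p') (c :: (u ++ l)) B x lab) →
      (∀ B x lab, riccFac n κ (p + 1) u (c :: l) B x lab
        = fac n κ' (u.length + 1 + p') (u ++ c :: l) B x lab) →
      riccFac n κ p (c :: u) l - riccFac n κ (p + 1) u (c :: l)
        ∈ cls n (Net.Long (riccCharge κ) 2 : Net s E S → Prop) := by
    intro κ' p' hl' hc h1 h2
    refine mem_cls_congr ?_ (cls_long_charge hc 2 (fac_cons_append_sub_mem (n := n) κ' hS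
      (by omega) (M := u.length + 1 + p') (by omega)))
    intro B x _ lab
    rw [Pi.sub_apply, Pi.sub_apply, Pi.sub_apply, h1, h2]
    rfl
  match κ, p with
  | .ups, _ => exact absurd rfl hups
  | .ric, _ => exact absurd rfl hric
  | .omega, 0 => exact absurd (hom rfl) (by norm_num)
  | .omega, 1 => exact absurd (hom rfl) (by norm_num)
  | .curv, p =>
    refine key .curv p hl (fun κ hκ => by simp [unitCharge, riccCharge, hκ.1.symm]) ?_ ?_
    · intro B x lab
      simp [riccFac, fac, Background.riccFactor, Background.factor, Background.base]
    · intro B x lab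
      simp [riccFac, fac, Background.riccFactor, Background.factor, Background.base, add_comm,
        add_left_comm]
  | .psi h, p =>
    refine key (.psi h) p hl (fun κ hκ => rfl) ?_ ?_
    · intro B x lab
      simp [riccFac, fac, Background.riccFactor, Background.factor, Background.base]
    · intro B x lab
      simp [riccFac, fac, Background.riccFactor, Background.factor, Background.base, add_comm,
        add_left_comm]
  | .omega, p + 2 =>
    refine key .ric p (by simpa [Kind.rank, add_comm] using hl)
      (fun κ hκ => by simp [unitCharge, riccCharge, hκ.2.symm]) ?_ ?_
    · intro B x lab
      simp [riccFac, fac, Background.riccFactor, Background.factor, Background.base]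
    · intro B x lab
      simp [riccFac, fac, Background.riccFactor, Background.factor, Background.base, add_comm,
        add_left_comm]

end Factors

/-- A contraction vanishes if the part of the integrand that depends on one of the pairs of labels
does so after contraction of this pair. -/
theorem contractPairs_eq_zero {P : Type} [Fintype P] [DecidableEq P] (B : Background n s)
    (x : Fin n → ℝ) (j : P) (A H : (P × Bool → Fin n) → ℝ)
    (hA : ∀ α b k, A (Function.update α (j, b) k) = A α)
    (hH : ∀ α, ∑ a, ∑ b, (B.g x)⁻¹ a b *
      H (Function.update (Function.update α (j, false) a) (j, true) b) = 0) :
    contractPairs B x (fun α => A α * H α) = 0 := by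
  unfold contractPairs
  have hsum : ∀ (z : P × Bool) (F : (P × Bool → Fin n) → ℝ),
      ∑ α, ∑ a, F (Function.update α z a) = n * ∑ α, F α := by
    intro z F
    have h1 : ∑ α, ∑ a, F (Function.update α z a) = ∑ α : P × Bool → Fin n, ∑ a : Fin n, F α := by
      rw [← Fintype.sum_prod_type', ← Fintype.sum_prod_type']
      refine Fintype.sum_bijective (fun p : (P × Bool → Fin n) × Fin n => (Function.update p.1 z p.2, p.1 z))
        (Function.Involutive.bijective ?_) _ _ fun _ => rfl
      rintro ⟨α, a⟩
      simp
    rw [h1, Finset.mul_sum]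
    simp
  -- Resumming over the value of a label multiplies the sum by `n`, so `n = 0` is separate.
  rcases Nat.eq_zero_or_pos n with hn | hn
  · subst hn
    exact Finset.sum_eq_zero fun α _ => (α (j, false)).elim0
  have hn' : (n : ℝ) ≠ 0 := by positivity
  refine mul_left_cancel₀ hn' (mul_left_cancel₀ hn' ?_)
  rw [mul_zero, mul_zero, ← hsum (j, true), ← hsum (j, false)]
  refine Finset.sum_eq_zero fun α _ => ?_
  have h2 : ∀ a b, (∏ i, (B.g x)⁻¹
        (Function.update (Function.update α (j, false) a) (j, true) b (i, false))
        (Function.update (Function.update α (j, false) a) (j, true) b (i, true)))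
      = (B.g x)⁻¹ a b * ∏ i ∈ Finset.univ.erase j, (B.g x)⁻¹ (α (i, false)) (α (i, true)) := by
    intro a b
    rw [← Finset.mul_prod_erase _ _ (Finset.mem_univ j)]
    congr 1
    · rw [Function.update_self, Function.update_of_ne (by simp), Function.update_self]
    · refine Finset.prod_congr rfl fun i hi => ?_
      have hij := (Finset.mem_erase.1 hi).1
      simp [Function.update_of_ne, hij]
  have h3 := hH α
  calc _ = ∑ a, ∑ b, (A α * ∏ i ∈ Finset.univ.erase j, (B.g x)⁻¹ (α (i, false)) (α (i, true))) *
        ((B.g x)⁻¹ a b * H (Function.update (Function.update α (j, false) a) (j, true) b)) := by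
        refine Finset.sum_congr rfl fun a _ => Finset.sum_congr rfl fun b _ => ?_
        beta_reduce
        rw [h2, hA, hA]
        ring
    _ = 0 := by
        simp only [← Finset.mul_sum]
        rw [h3, mul_zero]

theorem cov_const_mul (B : Background n s) {x : Fin n → ℝ} (hx : x ∈ B.U) {T : Tens n}
    (hT : ∀ l, ContDiffOn ℝ ∞ (fun y => T y l) B.U) (r : ℝ) (i : Fin n) (l : List (Fin n)) :
    cov B.g (fun y l => r * T y l) x (i :: l) = r * cov B.g T x (i :: l) := by
  simp only [cov]
  rw [pd_const_mul i r (differentiableAt_of_smooth B.isOpen (hT l) hx), mul_sub, Finset.mul_sum]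
  congr 1
  refine Finset.sum_congr rfl fun p _ => ?_
  rw [Finset.mul_sum]
  exact Finset.sum_congr rfl fun k _ => by ring

namespace Scheme

variable {C : Scheme s} {τ q a : ℕ}

theorem IsBalanced.enum_append {i : C.ι} (hi : i ∈ C.nonUps) :
    Enum (C.upsList i ++ C.lbl i).toFinset (C.upsList i ++ C.lbl i) :=
  ⟨IsBalanced.nodup_append hi, fun _ => List.mem_toFinset.symm⟩

/-- A Riccification in which one factor is replaced by a good expression `V` is a combination of
remainders, provided that `V` is longer or has fewer Ricci factors or an additional internal
contraction. -/
theorem IsBalanced.combination_replace (h : C.IsBalanced τ q a) {i₀ : C.ι} (hi₀ : i₀ ∈ C.nonUps)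
    (hint : ∀ i ≠ i₀, ∀ z ∈ C.lbl i, flipEnd z ∉ C.lbl i) {V : LFun n s (C.P × Bool)} {d z : ℕ}
    (hV : V ∈ cls n (Net.Good flipEnd (riccCharge (C.kind i₀)) 1 (if C.kind i₀ = .omega then 1 else 0)
      d z : Net s _ (C.upsList i₀ ++ C.lbl i₀).toFinset → Prop))
    (hd : 2 * (C.upsList i₀).length + 2 * (if C.kind i₀ = .omega then 1 else 0) ≤ d)
    (hz : z = 1 ∨ 2 * (C.upsList i₀).length + 2 * (if C.kind i₀ = .omega then 1 else 0) + 2 ≤ d) :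
    Combination n (IsRemainder τ q a) fun B x => contractPairs B x fun α =>
      (∏ i ∈ C.nonUps.erase i₀, B.riccFactor (C.kind i) (C.ord i) x ((C.upsList i).map α)
        ((C.lbl i).map α)) * V B x α := by
  have hI : ∀ i ∈ C.nonUps.erase i₀, i ≠ i₀ ∧ i ∈ C.nonUps := fun i hi => Finset.mem_erase.1 hi
  have hfac := fun i (hi : i ∈ C.nonUps.erase i₀) => (riccFac_mem_good (n := n) flipEnd_involutive
    (κ := C.kind i) (m := C.ord i) (u := C.upsList i) (l := C.lbl i)
    (IsBalanced.enum_append (hI i hi).2) (C.len i) (fun z hz => (C.mem_upsList.1 hz).1)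
    (hint i (hI i hi).1) (h.no_ric i) (C.mem_nonUps.1 (hI i hi).2) (h.omega_ord i)).1
  have hdisj : ∀ i ∈ C.nonUps, ∀ j ∈ C.nonUps, i ≠ j →
      Disjoint (C.upsList i ++ C.lbl i).toFinset (C.upsList j ++ C.lbl j).toFinset := by
    intro i hi j hj hij
    refine Finset.disjoint_left.2 fun z hz hz' => hij ?_
    rw [List.mem_toFinset] at hz hz'
    exact IsBalanced.eq_of_mem_append hi hj hz hz'
  have h1 := (prod_mem_good (n := n) (s := s) (par := flipEnd)
    (fun i => (C.upsList i ++ C.lbl i).toFinset)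
    (fun i => riccCharge (C.kind i)) (fun _ => 1) (fun i => if C.kind i = .omega then 1 else 0)
    (fun i => 2 * (C.upsList i).length + 2 * if C.kind i = .omega then 1 else 0)
    (fun i => riccFac n (C.kind i) (C.ord i) (C.upsList i) (C.lbl i))
    (fun i => riccFac n (C.kind i) (C.ord i) (C.upsList i) (C.lbl i)) (C.nonUps.erase i₀)
    (fun i hi j hj => hdisj i (hI i hi).2 j (hI j hj).2)
    hfac (fun i _ => by rw [sub_self]; exact Submodule.zero_mem _)).1
  have hd₀ : Disjoint ((C.nonUps.erase i₀).biUnion fun i => (C.upsList i ++ C.lbl i).toFinset)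
      (C.upsList i₀ ++ C.lbl i₀).toFinset := by
    rw [Finset.disjoint_biUnion_left]
    exact fun i hi => hdisj i (hI i hi).2 i₀ hi₀ (hI i hi).1
  have h2 := mul_mem_good hd₀ h1 hV
  have hU : ((C.nonUps.erase i₀).biUnion fun i => (C.upsList i ++ C.lbl i).toFinset)
      ∪ (C.upsList i₀ ++ C.lbl i₀).toFinset = Finset.univ := by
    ext w
    obtain ⟨i, hi, hw⟩ := h.exists_mem_append w
    by_cases hii : i = i₀
    · subst hii
      exact iff_of_true (Finset.mem_union_right _ (List.mem_toFinset.2 hw)) (Finset.mem_univ w)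
    · simp only [Finset.mem_union, Finset.mem_biUnion, List.mem_toFinset, Finset.mem_univ, iff_true]
      exact Or.inl ⟨i, Finset.mem_erase.2 ⟨hii, hi⟩, hw⟩
  have hsum : ∑ i ∈ C.nonUps.erase i₀,
        (2 * (C.upsList i).length + 2 * if C.kind i = .omega then 1 else 0)
      + (2 * (C.upsList i₀).length + 2 * if C.kind i₀ = .omega then 1 else 0) = 2 * a + 2 * q := by
    rw [Finset.sum_erase_add C.nonUps
      (fun i => 2 * (C.upsList i).length + 2 * if C.kind i = .omega then 1 else 0) hi₀,
      Finset.sum_add_distrib, ← Finset.mul_sum, ← Finset.mul_sum, h.sum_omega, h.sum_upsList]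
  rw [hU, Finset.sum_erase_add _ _ hi₀, Finset.sum_erase_add _ _ hi₀, Finset.sum_erase_add _ _ hi₀,
    h.sum_omega, Finset.sum_const, h.card_nonUps, smul_eq_mul, mul_one] at h2
  have h3 := combination_of_mem_cls (fun N hN => Net.Good.isRemainder (τ := τ) (q := q) (a := a)
    (Net.Good.mono hN le_rfl (Nat.le_add_left z 0)) h.sum_charge C.sum_charge_omega C.sum_charge_ups
    (by omega) (by omega)) h2
  convert h3 using 4 with B x
  simp only [Pi.mul_apply, Finset.prod_apply]
  rfl

/-- The contraction `Riccify[C]` in which, instead of the differentiated factor `i₀` with indices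
`c :: l`, the derivative of the factor with indices `l` occurs. -/
noncomputable def derivRiccify (C : Scheme s) (i₀ : C.ι) (p : ℕ) (c : C.P × Bool)
    (l : List (C.P × Bool)) (B : Background n s) (x : Fin n → ℝ) : ℝ :=
  contractPairs B x fun α => (∏ i ∈ C.nonUps.erase i₀, B.riccFactor (C.kind i) (C.ord i) x
    ((C.upsList i).map α) ((C.lbl i).map α)) *
      cov B.g (B.riccTens (C.kind i₀) p (C.upsList i₀).length) x
        (α c :: (C.upsList i₀ ++ l).map α)

theorem riccify_eq_mul (C : Scheme s) {i₀ : C.ι} (hi₀ : i₀ ∈ C.nonUps) (B : Background n s)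
    (x : Fin n → ℝ) : C.riccify B x = contractPairs B x fun α =>
      (∏ i ∈ C.nonUps.erase i₀, B.riccFactor (C.kind i) (C.ord i) x ((C.upsList i).map α)
        ((C.lbl i).map α)) *
        B.riccFactor (C.kind i₀) (C.ord i₀) x ((C.upsList i₀).map α) ((C.lbl i₀).map α) := by
  unfold riccify
  congr 1
  funext α
  rw [C.prod_eq_prod_nonUps _ fun i hi => by rw [hi]; rfl, ← Finset.prod_erase_mul _ _ hi₀]

theorem contractPairs_sub {P : Type} [Fintype P] [DecidableEq P] (B : Background n s)
    (x : Fin n → ℝ) (V W : (P × Bool → Fin n) → ℝ) :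
    contractPairs B x V - contractPairs B x W = contractPairs B x fun α => V α - W α := by
  simp only [contractPairs, mul_sub, Finset.sum_sub_distrib]

theorem cov_riccTens_eq_riccFac (B : Background n s) (x : Fin n → ℝ) {κ : Kind s} {p : ℕ}
    (hκ : κ ≠ .ups) (hp : κ = .omega → 2 ≤ p) {E : Type} (c : E) (u l : List E) (α : E → Fin n) :
    cov B.g (B.riccTens κ p u.length) x (α c :: (u ++ l).map α) = riccFac n κ p (c :: u) l B x α := by
  rw [cov_riccTens B _ hκ hp, riccFac, riccFactor_eq]
  simp

/-- If the free index is on the differentiated factor, the derivative yields one more internal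
contraction. -/
theorem IsBalanced.combination_derivRiccify (h : C.IsBalanced τ q a) {i₀ : C.ι}
    (hi₀ : i₀ ∈ C.nonUps) (hint : ∀ i ≠ i₀, ∀ z ∈ C.lbl i, flipEnd z ∉ C.lbl i) {p : ℕ}
    {c : C.P × Bool} {l : List (C.P × Bool)} (hl : C.lbl i₀ = c :: l) (hp : C.ord i₀ = p + 1)
    (hc : flipEnd c ∈ l) (hl' : ∀ z ∈ l, flipEnd z ∉ l)
    (hom : C.kind i₀ = .omega → C.upsList i₀ = [] → 2 ≤ p) :
    Combination n (IsRemainder τ q a) (C.derivRiccify (n := n) i₀ p c l) := by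
  have hu : ∀ z ∈ C.upsList i₀, flipEnd z ∈ l := by
    intro z hz
    obtain ⟨h1, h2⟩ := C.mem_upsList.1 hz
    rw [hl, List.mem_cons] at h1
    refine h1.resolve_left fun h3 => C.not_isUps hi₀ ?_ h2
    rw [hl, ← flipEnd_involutive z, h3]
    exact List.mem_cons_of_mem _ hc
  have hlen : l.length = (C.kind i₀).rank + p := by
    have := C.len i₀
    rw [hl, hp, List.length_cons] at this
    omega
  have hnd := IsBalanced.enum_append hi₀
  rw [hl] at hnd
  have hS : Enum (C.upsList i₀ ++ C.lbl i₀).toFinset (c :: C.upsList i₀ ++ l) := by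
    rw [hl]
    exact hnd.perm List.perm_middle
  have hom' : C.kind i₀ = .omega → 2 ≤ p := by
    intro hk
    by_cases hnil : C.upsList i₀ = []
    · exact hom hk hnil
    obtain ⟨z, hz⟩ := List.exists_mem_of_ne_nil _ hnil
    by_contra hlt
    rw [hk] at hlen
    have hlen' : l.length ≤ 1 := by
      simp only [Kind.rank] at hlen
      omega
    have h1 : flipEnd z = flipEnd c := by
      match l, hlen', hu z hz, hc with
      | [e], _, h1, h2 => rw [List.mem_singleton.1 h1, List.mem_singleton.1 h2]
    obtain rfl := flipEnd_involutive.injective h1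
    exact C.not_isUps hi₀ (by rw [hl]; exact List.mem_cons_self) (C.mem_upsList.1 hz).2
  have hV := (riccFac_mem_good (n := n) flipEnd_involutive hS hlen
    (fun z hz => (List.mem_cons.1 hz).elim (fun h => h ▸ hc) (hu z)) hl' (h.no_ric i₀)
    (C.mem_nonUps.1 hi₀) fun _ hn => absurd hn (List.cons_ne_nil _ _)).1
  rw [List.length_cons] at hV
  refine cast ?_ (h.combination_replace hi₀ hint hV (by omega) (Or.inr (by omega)))
  congr 1
  funext B x
  unfold derivRiccify
  congr 1
  funext α
  rw [cov_riccTens_eq_riccFac B x (C.mem_nonUps.1 hi₀) hom']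

/-- `∇_c (½R)` is `∇^e Ric_{ce}`. -/
theorem derivRiccify_eq_riccify (h : C.IsAdmissible τ q a) {i₀ : C.ι}
    (hi₀ : i₀ ∈ C.nonUps) {c e : C.P × Bool} (hk : C.kind i₀ = .omega)
    (hl : C.lbl i₀ = [c, e]) (hp : C.ord i₀ = 2) (hu : C.upsList i₀ = [flipEnd e])
    (B : Background n s) {x : Fin n → ℝ} (hx : x ∈ B.U) :
    C.derivRiccify i₀ 1 c [e] B x = C.riccify B x := by
  rw [← sub_eq_zero, C.riccify_eq_mul hi₀, derivRiccify, contractPairs_sub]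
  simp only [← mul_sub]
  have he : e.1 ≠ c.1 := by
    intro h1
    have hce : c ≠ e := by
      have := C.nodup i₀
      rw [hl] at this
      simpa using this
    refine h.no_internal i₀ c (by simp [hl]) ?_
    have : flipEnd c = e := by
      obtain ⟨p, b⟩ := c
      obtain ⟨p', b'⟩ := e
      obtain rfl : p' = p := h1
      simp only [flipEnd, Prod.mk.injEq, true_and]
      rcases b with _ | _ <;> rcases b' with _ | _ <;> simp_all
    simp [hl, this]
  have hcov : ∀ i j k, cov B.g (fun y l => 1 / 2 * ricci B.g y l) x [i, j, k]
      = 1 / 2 * cov B.g (ricci B.g) x [i, j, k] := fun i j k =>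
    cov_const_mul B hx B.smooth_ricci (1 / 2) i [j, k]
  refine contractPairs_eq_zero B x e.1 _ _ ?_ ?_
  · intro α b k
    refine Finset.prod_congr rfl fun i hi => ?_
    have hz : (e.1, b) ∈ C.upsList i₀ ++ C.lbl i₀ := by
      rw [hl, hu]
      obtain ⟨p, b'⟩ := e
      rcases b with _ | _ <;> rcases b' with _ | _ <;> simp [flipEnd]
    have hz' : (e.1, b) ∉ C.upsList i ++ C.lbl i := fun h' =>
      (Finset.mem_erase.1 hi).1 (IsBalanced.eq_of_mem_append (Finset.mem_erase.1 hi).2 hi₀ h' hz)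
    rw [List.mem_append, not_or] at hz'
    rw [map_update_of_notMem hz'.1, map_update_of_notMem hz'.2]
  · intro α
    have h1 := cov_scalar_curvature B hx (α c)
    have h2 : ∑ a, ∑ b, (B.g x)⁻¹ a b * cov B.g (ricci B.g) x [b, α c, a]
        = ∑ a, ∑ b, (B.g x)⁻¹ a b * cov B.g (ricci B.g) x [a, α c, b] := by
      rw [Finset.sum_comm]
      refine Finset.sum_congr rfl fun a _ => Finset.sum_congr rfl fun b _ => ?_
      rw [B.ginv_symm hx]
    have h3 : ∑ a, ∑ b, (B.g x)⁻¹ a b * cov B.g (ricci B.g) x [α c, b, a]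
        = ∑ a, ∑ b, (B.g x)⁻¹ a b * cov B.g (ricci B.g) x [α c, a, b] := by
      rw [Finset.sum_comm]
      refine Finset.sum_congr rfl fun a _ => Finset.sum_congr rfl fun b _ => ?_
      rw [B.ginv_symm hx]
    rw [hk, hp, hl, hu]
    obtain ⟨p, b⟩ := e
    obtain ⟨p', b'⟩ := c
    have hpp : p' ≠ p := fun h => he h.symm
    have hF : ∀ i j k, B.riccFactor (.omega : Kind s) 2 x [i] [j, k]
        = cov B.g (ricci B.g) x [i, j, k] := fun _ _ _ => rfl
    have hT : B.riccTens (.omega : Kind s) 1 [flipEnd (p, b)].length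
        = fun y l => 1 / 2 * ricci B.g y l := rfl
    rw [hT]
    rcases b with _ | _
    · have h4 : ∑ a, ∑ b, (B.g x)⁻¹ a b * (1 / 2 * cov B.g (ricci B.g) x [α (p', b'), b, a]
          - cov B.g (ricci B.g) x [b, α (p', b'), a]) = 0 := by
        simp only [mul_sub, mul_left_comm _ (1 / 2 : ℝ), Finset.sum_sub_distrib, ← Finset.mul_sum]
        rw [h3, h1, h2]
        ring
      refine Eq.trans (Finset.sum_congr rfl fun a _ => Finset.sum_congr rfl fun b _ => ?_) h4
      have h5 := hcov (α (p', b')) b a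
      simp only [one_div] at h5
      simp [flipEnd, hF, Function.update_of_ne, hpp, h5]
    · have h4 : ∑ a, ∑ b, (B.g x)⁻¹ a b * (1 / 2 * cov B.g (ricci B.g) x [α (p', b'), a, b]
          - cov B.g (ricci B.g) x [a, α (p', b'), b]) = 0 := by
        simp only [mul_sub, mul_left_comm _ (1 / 2 : ℝ), Finset.sum_sub_distrib, ← Finset.mul_sum]
        rw [h1]
        ring
      refine Eq.trans (Finset.sum_congr rfl fun a _ => Finset.sum_congr rfl fun b _ => ?_) h4
      have h5 := hcov (α (p', b')) a b
      simp only [one_div] at h5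
      simp [flipEnd, hF, Function.update_of_ne, hpp, h5]

/-- If the free index is not on the differentiated factor, the derivative yields
`Riccify` of the corresponding term of `Xdiv`. -/
theorem IsAdmissible.combination_derivRiccify_sub (h : C.IsAdmissible τ q a) {i₀ : C.ι}
    (hi₀ : i₀ ∈ C.nonUps) {p : ℕ} {c : C.P × Bool} {l : List (C.P × Bool)}
    (hl : C.lbl i₀ = c :: l) (hp : C.ord i₀ = p + 1) (hc : ¬ C.IsUps (flipEnd c))
    (hom : C.kind i₀ = .omega → C.upsList i₀ = [] → 2 ≤ p) :
    Combination n (IsRemainder τ q a) fun B x => C.derivRiccify i₀ p c l B x - C.riccify B x := by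
  have hu : ∀ z ∈ C.upsList i₀, flipEnd z ∈ l := by
    intro z hz
    obtain ⟨h1, h2⟩ := C.mem_upsList.1 hz
    rw [hl, List.mem_cons] at h1
    refine h1.resolve_left fun h3 => hc ?_
    rwa [← h3, flipEnd_involutive z]
  have hlen : l.length = (C.kind i₀).rank + p := by
    have := C.len i₀
    rw [hl, hp, List.length_cons] at this
    omega
  by_cases hlow : C.kind i₀ = .omega ∧ p < 2
  · obtain ⟨hk, hlt⟩ := hlow
    have hnil : C.upsList i₀ ≠ [] := fun hnil => absurd (hom hk hnil) (by omega)
    obtain ⟨z, hz⟩ := List.exists_mem_of_ne_nil _ hnil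
    have hl0 := List.length_pos_of_mem (hu z hz)
    rw [hk] at hlen
    obtain rfl : p = 1 := by
      simp only [Kind.rank] at hlen
      omega
    obtain ⟨e, rfl⟩ := List.length_eq_one_iff.1 (show l.length = 1 from hlen)
    have hue : C.upsList i₀ = [flipEnd e] := by
      have h1 : ∀ z ∈ C.upsList i₀, z = flipEnd e := fun z hz => by
        rw [← List.mem_singleton.1 (hu z hz), flipEnd_involutive z]
      have hnd := C.nodup_upsList i₀
      match C.upsList i₀, hnil, h1, hnd with
      | [z], _, h1, _ => rw [h1 z (by simp)]
      | z :: w :: t, _, h1, hnd =>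
        rw [h1 z (by simp), h1 w (by simp)] at hnd
        simp at hnd
    refine ⟨0, Fin.elim0, Fin.elim0, fun k => k.elim0, fun B x hx => ?_⟩
    beta_reduce
    rw [derivRiccify_eq_riccify h hi₀ hk hl hp hue B hx, sub_self, Fin.sum_univ_zero]
  · have hp2 : C.kind i₀ = .omega → 2 ≤ p := fun hk => by
      by_contra hlt
      exact hlow ⟨hk, by omega⟩
    have hS : Enum (C.upsList i₀ ++ C.lbl i₀).toFinset (c :: (C.upsList i₀ ++ l)) := by
      have := IsBalanced.enum_append hi₀
      rw [hl] at this ⊢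
      exact this.perm List.perm_middle
    have hV := cls_long_le_good flipEnd _ _ (if C.kind i₀ = .omega then 1 else 0)
      (2 * (C.upsList i₀).length + 2 * if C.kind i₀ = .omega then 1 else 0) 1
      (riccFac_cons_sub_mem (n := n) hS hlen (h.no_ric i₀) (C.mem_nonUps.1 hi₀) hp2)
    refine cast ?_ (h.combination_replace hi₀ (fun i _ => h.no_internal i) hV le_rfl (Or.inl rfl))
    congr 1
    funext B x
    rw [C.riccify_eq_mul hi₀, derivRiccify, contractPairs_sub]
    congr 1
    funext α
    rw [cov_riccTens_eq_riccFac B x (C.mem_nonUps.1 hi₀) hp2, hl, hp, ← mul_sub]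
    rfl

end Scheme

end Derivative

/-! ### The divergence of the Riccification of a vector field -/

section Divergence

variable {n s : ℕ}

namespace Contraction

variable (X : Contraction s 1) {τ q a : ℕ}

/-- The factors other than `∇υ`. -/
def nonUps : Finset X.ι := Finset.univ.filter fun i => X.kind i ≠ .ups

theorem mem_nonUps {i : X.ι} : i ∈ X.nonUps ↔ X.kind i ≠ .ups := by
  simp [nonUps]

/-- The indices of the factor that `Riccify` makes of the factor `i`. -/
def riccSlots (i : X.ι) : List (Fin 1 ⊕ Fin X.pairs × Bool) :=
  (X.upsSlots i ++ X.slots i).map Sum.swap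

theorem map_riccSlots (lab : (Fin X.pairs × Bool) ⊕ Fin 1 → Fin n) (i : X.ι) :
    (X.riccSlots i).map (lab ∘ Sum.swap) = X.upsLabels lab i ++ X.labels lab i := by
  rw [riccSlots, List.map_map, upsLabels_eq, labels_eq, ← List.map_append]
  refine List.map_congr_left fun z _ => ?_
  simp

theorem kind_of_mem_upsSlots {i : X.ι} {z : (Fin X.pairs × Bool) ⊕ Fin 1} (hz : z ∈ X.upsSlots i) :
    X.kind (X.slot z).1 = .ups := by
  obtain ⟨j, b, rfl, hk, -⟩ := X.mem_upsSlots.1 hz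
  exact hk

theorem nodup_riccSlots {i : X.ι} (hi : i ∈ X.nonUps) : (X.riccSlots i).Nodup := by
  refine List.Nodup.map (Sum.swap_leftInverse.injective) (List.nodup_append.2
    ⟨X.nodup_upsSlots i, X.nodup_slots i, fun z hz w hw hzw => ?_⟩)
  subst hzw
  have := X.kind_of_mem_upsSlots hz
  rw [X.mem_slots.1 hw] at this
  exact X.mem_nonUps.1 hi this

theorem mem_riccSlots {i : X.ι} {z : Fin 1 ⊕ Fin X.pairs × Bool} :
    z ∈ X.riccSlots i ↔ z.swap ∈ X.upsSlots i ∨ (X.slot z.swap).1 = i := by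
  rw [riccSlots, List.mem_map, ← X.mem_slots, ← List.mem_append]
  constructor
  · rintro ⟨w, hw, rfl⟩
    rwa [Sum.swap_swap]
  · intro h
    exact ⟨_, h, Sum.swap_swap z⟩

theorem eq_of_mem_riccSlots {i j : X.ι} (hi : i ∈ X.nonUps) (hj : j ∈ X.nonUps)
    {z : Fin 1 ⊕ Fin X.pairs × Bool} (h : z ∈ X.riccSlots i) (h' : z ∈ X.riccSlots j) : i = j := by
  rw [mem_riccSlots] at h h'
  rcases h with h | h <;> rcases h' with h' | h'
  · obtain ⟨k, b, hz, -, hk⟩ := X.mem_upsSlots.1 h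
    obtain ⟨k', b', hz', -, hk'⟩ := X.mem_upsSlots.1 h'
    rw [hz] at hz'
    simp only [Sum.inl.injEq, Prod.mk.injEq] at hz'
    rw [← hk, ← hk', hz'.1, hz'.2]
  · exact absurd (h' ▸ X.kind_of_mem_upsSlots h) (X.mem_nonUps.1 hj)
  · exact absurd (h ▸ X.kind_of_mem_upsSlots h') (X.mem_nonUps.1 hi)
  · exact h.symm.trans h'

variable {X}

theorem IsAdmissible.exists_mem_riccSlots (hX : X.IsAdmissible τ q a)
    (z : Fin 1 ⊕ Fin X.pairs × Bool) : ∃ i ∈ X.nonUps, z ∈ X.riccSlots i := by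
  by_cases hk : X.kind (X.slot z.swap).1 = .ups
  · rcases z with k | ⟨j, b⟩
    · exact absurd hk (hX.ups_not_free k)
    · refine ⟨X.owner j !b, X.mem_nonUps.2 fun h => hX.ups_not_ups j ?_, ?_⟩
      · rcases b with _ | _
        · exact ⟨hk, h⟩
        · exact ⟨h, hk⟩
      · exact X.mem_riccSlots.2 (Or.inl (X.mem_upsSlots.2 ⟨j, b, rfl, hk, rfl⟩))
  · exact ⟨_, X.mem_nonUps.2 hk, X.mem_riccSlots.2 (Or.inr rfl)⟩

variable (X) in
theorem riccify_eq (B : Background n s) (x : Fin n → ℝ) (lab : Fin 1 → Fin n) :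
    X.riccify B x lab = ∑ α : Fin X.pairs × Bool → Fin n,
      (∏ j, (B.g x)⁻¹ (α (j, false)) (α (j, true))) * ∏ i ∈ X.nonUps,
        B.riccTens (X.kind i) (X.ord i) (X.upsSlots i).length x
          ((X.riccSlots i).map (Sum.elim lab α)) := by
  refine Finset.sum_congr rfl fun α _ => ?_
  congr 1
  rw [← Finset.prod_subset (Finset.subset_univ X.nonUps)]
  · refine Finset.prod_congr rfl fun i _ => ?_
    have h1 : (Sum.elim lab α : Fin 1 ⊕ Fin X.pairs × Bool → Fin n) = Sum.elim α lab ∘ Sum.swap := by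
      funext z
      rcases z with z | z <;> rfl
    beta_reduce
    rw [h1, map_riccSlots, riccFactor_eq, upsLabels_eq, List.length_map]
  · intro i _ hi
    have : X.kind i = .ups := by simpa [nonUps] using hi
    beta_reduce
    rw [this]
    rfl

theorem IsAdmissible.labelCov_riccify (hX : X.IsAdmissible τ q a) (B : Background n s)
    {x : Fin n → ℝ} (hx : x ∈ B.U) (β : Fin n) (lab : Fin 1 → Fin n) :
    labelCov B.g Finset.univ β (fun y => X.riccify B y) x lab = ∑ i₀ ∈ X.nonUps,
      ∑ α : Fin X.pairs × Bool → Fin n, (∏ j, (B.g x)⁻¹ (α (j, false)) (α (j, true))) *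
        ((∏ i ∈ X.nonUps.erase i₀, B.riccTens (X.kind i) (X.ord i) (X.upsSlots i).length x
          ((X.riccSlots i).map (Sum.elim lab α))) *
        cov B.g (B.riccTens (X.kind i₀) (X.ord i₀) (X.upsSlots i₀).length) x
          (β :: (X.riccSlots i₀).map (Sum.elim lab α))) := by
  have h1 := labelCov_contract B hx Finset.univ β (P := Fin X.pairs) (W := fun y lab =>
    ∏ i ∈ X.nonUps, B.riccTens (X.kind i) (X.ord i) (X.upsSlots i).length y
      ((X.riccSlots i).map lab)) (fun lab => contDiffOn_prod fun _ _ => smooth_riccTens B _ _ _ _) lab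
  rw [labelCov_congr B hx Finset.univ β (fun y _ lab => X.riccify_eq B y lab) lab, h1,
    Finset.sum_comm]
  refine Finset.sum_congr rfl fun α _ => ?_
  rw [← Finset.mul_sum]
  congr 1
  have hU : X.nonUps.biUnion (fun i => (X.riccSlots i).toFinset)
      = (Finset.univ : Finset (Fin 1)).disjSum Finset.univ := by
    ext z
    obtain ⟨i, hi, hz⟩ := hX.exists_mem_riccSlots z
    simp only [Finset.mem_biUnion, List.mem_toFinset]
    refine ⟨fun _ => ?_, fun _ => ⟨i, hi, hz⟩⟩
    rcases z with z | z
    · exact Finset.inl_mem_disjSum.2 (Finset.mem_univ _)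
    · exact Finset.inr_mem_disjSum.2 (Finset.mem_univ _)
  rw [← hU, labelCov_prod B hx β X.nonUps (fun i => (X.riccSlots i).toFinset)]
  · refine Finset.sum_congr rfl fun i hi => ?_
    rw [labelCov_list B _ (X.nodup_riccSlots hi)]
  · intro i hi j hj hij
    refine Finset.disjoint_left.2 fun z hz hz' => hij ?_
    rw [List.mem_toFinset] at hz hz'
    exact X.eq_of_mem_riccSlots hi hj hz hz'
  · exact fun i lab => smooth_riccTens B _ _ _ _
  · intro i y lab e he j
    rw [map_update_of_notMem fun h => he (List.mem_toFinset.2 h)]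

theorem divergence_eq_labelCov (g : (Fin n → ℝ) → Matrix (Fin n) (Fin n) ℝ)
    (F : (Fin n → ℝ) → (Fin 1 → Fin n) → ℝ) (x : Fin n → ℝ) :
    divergence g (fun y γ => F y fun _ => γ) x
      = ∑ β, ∑ γ, (g x)⁻¹ β γ * labelCov g Finset.univ β F x fun _ => γ := by
  refine Finset.sum_congr rfl fun β _ => Finset.sum_congr rfl fun γ _ => ?_
  congr 1
  rw [labelCov, Fintype.sum_unique (ι := Fin 1)]
  congr 1
  refine Finset.sum_congr rfl fun k _ => ?_
  refine congrArg₂ (· * ·) rfl (congrArg (F x) (funext fun i => ?_))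
  rw [Subsingleton.elim i default, Function.update_self]

/-- The divergence of a Riccification is the sum of the terms in which one factor is
differentiated. -/
theorem IsAdmissible.divergence_riccify (hX : X.IsAdmissible τ q a) (B : Background n s)
    {x : Fin n → ℝ} (hx : x ∈ B.U) :
    divergence B.g (fun y γ => X.riccify B y fun _ => γ) x
      = ∑ i₀ : {i // X.kind i ≠ .ups}, (X.divCompletion i₀.1 i₀.2).toScheme.derivRiccify i₀.1
        (X.ord i₀.1) (none, false) ((X.slots i₀.1).map (X.divCompletion i₀.1 i₀.2).φ) B x := by
  rw [divergence_eq_labelCov]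
  simp only [hX.labelCov_riccify B hx, Finset.mul_sum X.nonUps]
  rw [Finset.sum_congr rfl fun β _ => Finset.sum_comm, Finset.sum_comm,
    Finset.sum_subtype X.nonUps (fun i => X.mem_nonUps) _]
  refine Finset.sum_congr rfl fun i₀ _ => ?_
  rw [Scheme.derivRiccify, contractPairs_option (V := fun β γ α =>
    (∏ i ∈ X.nonUps.erase i₀, B.riccTens (X.kind i) (X.ord i) (X.upsSlots i).length x
      ((X.riccSlots i).map (Sum.elim (fun _ => γ) α))) *
    cov B.g (B.riccTens (X.kind i₀) (X.ord i₀) (X.upsSlots i₀).length) x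
      (β :: (X.riccSlots i₀).map (Sum.elim (fun _ => γ) α)))]
  · rfl
  · intro α
    have hups := (X.divCompletion i₀.1 i₀.2).upsList_toScheme hX.ups_not_free
    have h1 : ∀ i, (X.riccSlots i).map
        (Sum.elim (fun _ => α (none, true)) fun z => α (some z.1, z.2))
        = ((X.upsSlots i).map (X.divCompletion i₀.1 i₀.2).φ).map α
          ++ ((X.slots i).map (X.divCompletion i₀.1 i₀.2).φ).map α := by
      intro i
      rw [riccSlots, ← List.map_append, ← List.map_append, List.map_map, List.map_map]
      refine List.map_congr_left fun z _ => ?_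
      rcases z with z | z <;> rfl
    simp only [h1]
    refine congrArg₂ (· * ·) (Finset.prod_congr rfl fun i hi => ?_) ?_
    · have hne : i ≠ i₀.1 := (Finset.mem_erase.1 hi).1
      rw [hups, riccFactor_eq, List.length_map, List.length_map]
      simp [hne]
    · rw [hups, List.length_map, List.map_append]

/-- Up to remainders, the divergence of `Riccify[X]` is the sum of the Riccifications of the terms
of `Xdiv X`. -/
theorem IsAdmissible.combination_divergence (hX : X.IsAdmissible τ q a) :
    Combination n (IsRemainder τ q a) fun B x =>
      divergence B.g (fun y γ => X.riccify B y fun _ => γ) x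
        - ∑ i₀ : {i : X.ι // i ≠ (X.slot (.inr 0)).1 ∧ X.kind i ≠ .ups},
          (X.divCompletion i₀.1 i₀.2.2).toScheme.riccify B x := by
  have hlbl : ∀ i₀ : {i // X.kind i ≠ .ups}, (X.divCompletion i₀.1 i₀.2).toScheme.lbl i₀.1
      = (none, false) :: (X.slots i₀.1).map (X.divCompletion i₀.1 i₀.2).φ := fun i₀ => by simp
  have hord : ∀ i₀ : {i // X.kind i ≠ .ups},
      (X.divCompletion i₀.1 i₀.2).toScheme.ord i₀.1 = X.ord i₀.1 + 1 := fun i₀ => by simp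
  have hom : ∀ i₀ : {i // X.kind i ≠ .ups}, X.kind i₀.1 = .omega →
      (X.divCompletion i₀.1 i₀.2).toScheme.upsList i₀.1 = [] → 2 ≤ X.ord i₀.1 := by
    intro i₀ hk hu
    rw [Completion.upsList_toScheme _ hX.ups_not_free, List.map_eq_nil_iff] at hu
    refine hX.omega_ord i₀.1 hk ?_
    rintro ⟨j, b, hj, hk'⟩
    have : .inl (j, !b) ∈ X.upsSlots i₀.1 := X.mem_upsSlots.2 ⟨j, !b, rfl, hk', by rwa [Bool.not_not]⟩
    rw [hu] at this
    exact List.not_mem_nil this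
  refine Combination.sum (T := {i // X.kind i ≠ .ups}) (F := fun i₀ B x =>
    (X.divCompletion i₀.1 i₀.2).toScheme.derivRiccify i₀.1 (X.ord i₀.1) (none, false)
      ((X.slots i₀.1).map (X.divCompletion i₀.1 i₀.2).φ) B x
    - if i₀.1 = (X.slot (.inr 0)).1 then 0 else (X.divCompletion i₀.1 i₀.2).toScheme.riccify B x)
    (fun i₀ => ?_) (fun _ => 1) fun B x hx => ?_
  · by_cases hi : i₀.1 = (X.slot (.inr 0)).1
    · simp only [if_pos hi, sub_zero]
      refine Scheme.IsBalanced.combination_derivRiccify (Completion.isBalanced_toScheme _ hX)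
        ((Scheme.mem_nonUps _).2 i₀.2) ?_ (hlbl i₀) (hord i₀) ?_ ?_ (hom i₀)
      · intro i hne
        refine Completion.not_internal _ hX fun z hz => ?_
        simp [hne] at hz
      · exact List.mem_map.2 ⟨.inr 0, X.mem_slots.2 hi.symm, rfl⟩
      · intro z hz hz'
        obtain ⟨w, hw, rfl⟩ := List.mem_map.1 hz
        obtain ⟨w', hw', h⟩ := List.mem_map.1 hz'
        rw [X.mem_slots] at hw hw'
        rcases w with ⟨j, b⟩ | k
        · obtain rfl : w' = .inl (j, !b) := (X.divCompletion i₀.1 i₀.2).injective h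
          refine hX.no_internal j ?_
          rcases b with _ | _
          · exact hw.trans hw'.symm
          · exact hw'.trans hw.symm
        · rcases w' with ⟨j, b⟩ | w' <;> simp [flipEnd] at h
    · simp only [if_neg hi]
      refine Scheme.IsAdmissible.combination_derivRiccify_sub (X.isAdmissible_divCompletion i₀.2 hi hX)
        ((Scheme.mem_nonUps _).2 i₀.2) (hlbl i₀) (hord i₀) ?_ (hom i₀)
      exact fun h => hX.ups_not_free 0 ((Completion.isUps_toScheme _ (.inr 0)).1 h)
  · simp only [one_mul, Finset.sum_sub_distrib]
    rw [hX.divergence_riccify B hx]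
    congr 1
    have h1 : ∀ i₀ : {i : X.ι // i ≠ (X.slot (.inr 0)).1 ∧ X.kind i ≠ .ups},
        (X.divCompletion i₀.1 i₀.2.2).toScheme.riccify B x = if i₀.1 = (X.slot (.inr 0)).1 then 0
          else (X.divCompletion i₀.1 i₀.2.2).toScheme.riccify B x := fun i₀ => by rw [if_neg i₀.2.1]
    rw [Finset.sum_congr rfl fun i₀ _ => h1 i₀]
    refine Fintype.sum_of_injective (fun i₀ => ⟨i₀.1, i₀.2.2⟩) (fun i j h => ?_) _ _ (fun i hi => ?_)
      fun _ => rfl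
    · exact Subtype.ext (congrArg (fun z => z.1) h)
    · refine if_pos ?_
      by_contra h
      exact hi ⟨⟨i.1, h, i.2⟩, rfl⟩

end Contraction

end Divergence

/-! ### The identity among Riccifications -/

section Conclusion

variable {n s τ q a : ℕ}

theorem Combination.exists_split {p₁ p₂ p₃ : Contraction s 0 → Prop}
    {F : Background n s → (Fin n → ℝ) → ℝ}
    (h : Combination n (fun C => p₁ C ∨ p₂ C ∨ p₃ C) F) :
    ∃ (K₁ K₂ K₃ : ℕ) (d₁ : Fin K₁ → ℝ) (d₂ : Fin K₂ → ℝ) (d₃ : Fin K₃ → ℝ)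
      (D₁ : Fin K₁ → Contraction s 0) (D₂ : Fin K₂ → Contraction s 0)
      (D₃ : Fin K₃ → Contraction s 0), (∀ k, p₁ (D₁ k)) ∧ (∀ k, p₂ (D₂ k)) ∧ (∀ k, p₃ (D₃ k)) ∧
      ∀ B, ∀ x ∈ B.U, F B x = ∑ k, d₁ k * (D₁ k).value B x Fin.elim0
        + ∑ k, d₂ k * (D₂ k).value B x Fin.elim0 + ∑ k, d₃ k * (D₃ k).value B x Fin.elim0 := by
  obtain ⟨K, c, C, hC, hF⟩ := h
  replace hF := hF
  induction K generalizing F with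
  | zero =>
    refine ⟨0, 0, 0, Fin.elim0, Fin.elim0, Fin.elim0, Fin.elim0, Fin.elim0, Fin.elim0,
      fun k => k.elim0, fun k => k.elim0, fun k => k.elim0, fun B x hx => ?_⟩
    simp [hF B x hx]
  | succ K ih =>
    obtain ⟨K₁, K₂, K₃, d₁, d₂, d₃, D₁, D₂, D₃, h₁, h₂, h₃, hG⟩ :=
      ih (F := fun B x => ∑ k : Fin K, c k.succ * (C k.succ).value B x Fin.elim0)
        (fun k => c k.succ) (fun k => C k.succ) (fun k => hC k.succ) fun _ _ _ => rfl
    rcases hC 0 with h | h | h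
    · refine ⟨K₁ + 1, K₂, K₃, Fin.cons (c 0) d₁, d₂, d₃, Fin.cons (C 0) D₁, D₂, D₃,
        Fin.cases h h₁, h₂, h₃, fun B x hx => ?_⟩
      rw [hF B x hx, Fin.sum_univ_succ, Fin.sum_univ_succ]
      have := hG B x hx
      beta_reduce at this
      rw [this]
      simp only [Fin.cons_zero, Fin.cons_succ]
      ring
    · refine ⟨K₁, K₂ + 1, K₃, d₁, Fin.cons (c 0) d₂, d₃, D₁, Fin.cons (C 0) D₂, D₃,
        h₁, Fin.cases h h₂, h₃, fun B x hx => ?_⟩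
      rw [hF B x hx, Fin.sum_univ_succ, Fin.sum_univ_succ (n := K₂)]
      have := hG B x hx
      beta_reduce at this
      rw [this]
      simp only [Fin.cons_zero, Fin.cons_succ]
      ring
    · refine ⟨K₁, K₂, K₃ + 1, d₁, d₂, Fin.cons (c 0) d₃, D₁, D₂, Fin.cons (C 0) D₃,
        h₁, h₂, Fin.cases h h₃, fun B x hx => ?_⟩
      rw [hF B x hx, Fin.sum_univ_succ, Fin.sum_univ_succ (n := K₃)]
      have := hG B x hx
      beta_reduce at this
      rw [this]
      simp only [Fin.cons_zero, Fin.cons_succ]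
      ring

theorem divergence_sum {R : Type} [Fintype R] (B : Background n s) {x : Fin n → ℝ} (hx : x ∈ B.U)
    (b : R → ℝ) (F : R → (Fin n → ℝ) → Fin n → ℝ)
    (hF : ∀ r γ, ContDiffOn ℝ ∞ (fun y => F r y γ) B.U) :
    divergence B.g (fun y γ => ∑ r, b r * F r y γ) x = ∑ r, b r * divergence B.g (F r) x := by
  unfold divergence
  have hd := fun r γ => differentiableAt_of_smooth B.isOpen (hF r γ) hx
  simp only [Finset.mul_sum]
  rw [Finset.sum_comm (t := Finset.univ (α := Fin n)) (s := Finset.univ (α := R))]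
  refine Finset.sum_congr rfl fun i _ => ?_
  rw [Finset.sum_comm (t := Finset.univ (α := Fin n)) (s := Finset.univ (α := R))]
  refine Finset.sum_congr rfl fun j _ => ?_
  rw [pd_sum i Finset.univ fun r _ => (hd r j).const_mul (b r),
    Finset.sum_congr rfl fun r _ => pd_const_mul i (b r) (hd r j), Finset.sum_comm,
    ← Finset.sum_sub_distrib, Finset.mul_sum]
  refine Finset.sum_congr rfl fun r _ => ?_
  rw [mul_sub, mul_sub, mul_sub, Finset.mul_sum, Finset.mul_sum, Finset.mul_sum]
  congr 1
  · ring
  · exact Finset.sum_congr rfl fun k _ => by ring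

theorem Contraction.smooth_riccify (X : Contraction s 1) (B : Background n s) (β : Fin 1 → Fin n) :
    ContDiffOn ℝ ∞ (fun y => X.riccify B y β) B.U := by
  simp only [X.riccify_eq]
  exact ContDiffOn.sum fun _ _ => (contDiffOn_prod fun _ _ => B.smooth_ginv _ _).mul
    (contDiffOn_prod fun _ _ => smooth_riccTens B _ _ _ _)

end Conclusion

section Conclusion

variable {n s τ q a : ℕ}

theorem Combination.add {p : Contraction s 0 → Prop} {F G H : Background n s → (Fin n → ℝ) → ℝ}
    (hF : Combination n p F) (hG : Combination n p G) (hH : ∀ B, ∀ x ∈ B.U, H B x = F B x + G B x) :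
    Combination n p H := by
  refine Combination.sum (T := Bool) (F := fun t => cond t F G) ?_ (fun _ => 1) fun B x hx => ?_
  · rintro (_ | _)
    exacts [hG, hF]
  · simpa using hH B x hx

/-- The Riccification of the identity is a combination of remainders. -/
theorem combination_riccify {L R : Type} [Fintype L] [Fintype R] (c : L → ℝ)
    (C : L → Contraction s 0) (b : R → ℝ) (X : R → Contraction s 1)
    (hC : ∀ l, (C l).IsAdmissible τ q a) (hX : ∀ r, (X r).IsAdmissible τ q a)
    (hCw : ∀ l, (C l).weight ≤ n) (hXw : ∀ r, (X r).weight + 1 ≤ n)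
    (h : VanishesMod n s q a (τ + a + 1) fun B x =>
      ∑ l, c l * (C l).value B x Fin.elim0 - ∑ r, b r * (X r).xdiv B x) :
    Combination n (IsRemainder τ q a) fun B x => ∑ l, c l * (C l).riccify B x Fin.elim0
      - divergence B.g (fun y γ => ∑ r, b r * (X r).riccify B y fun _ => γ) x := by
  obtain ⟨K, e, D, hD, hv⟩ := h
  -- the terms of the identity: the `C l`, and for each `X r` the terms of `Xdiv`
  let T := L ⊕ Σ r, {i : (X r).ι // i ≠ ((X r).slot (.inr 0)).1 ∧ (X r).kind i ≠ .ups}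
  let f : T → ℝ := Sum.elim c fun z => -b z.1
  let S : T → Scheme s := Sum.elim (fun l => (C l).completion.toScheme)
    fun z => ((X z.1).divCompletion z.2.1 z.2.2.2).toScheme
  have h1 : Combination n (IsRemainder τ q a) fun B x => ∑ t, f t * (S t).riccify B x := by
    refine combination_sum_riccify f S ?_ ?_ e (fun k => (D k).completion.toScheme)
      (fun k h => (Contraction.Completion.count_toScheme _ _).trans ((hD k).1.psi h))
      (fun k => (Contraction.Completion.count_toScheme _ _).trans (hD k).1.omega)
      (fun k => (Contraction.Completion.count_toScheme _ _).trans (hD k).1.ups)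
      (fun k => (hD k).2) ?_
    · rintro (l | ⟨r, i₀, h₁, h₀⟩)
      · exact Contraction.Completion.isAdmissible_toScheme _ (hC l) fun _ _ hz =>
          absurd hz List.not_mem_nil
      · exact (X r).isAdmissible_divCompletion h₀ h₁ (hX r)
    · rintro (l | ⟨r, i₀, h₁, h₀⟩)
      · refine (Fintype.card_fin _).trans_le ?_
        have := (C l).two_mul_pairs_le
        have := hCw l
        omega
      · refine (Fintype.card_option.trans (congrArg (· + 1) (Fintype.card_fin _))).trans_le ?_
        have := (X r).two_mul_pairs_le
        have := hXw r
        change (X r).pairs + 1 ≤ n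
        omega
    · intro B x hx
      have h2 := hv B x hx
      simp only [Contraction.value_eq_val, Contraction.xdiv_eq_sum_val] at h2
      rw [← h2, Fintype.sum_sum_type, Fintype.sum_sigma]
      simp only [f, S, Sum.elim_inl, Sum.elim_inr, neg_mul, Finset.sum_neg_distrib, Finset.mul_sum]
      rfl
  have h2 : Combination n (IsRemainder τ q a) fun B x => ∑ r, (-b r) *
      (divergence B.g (fun y γ => (X r).riccify B y fun _ => γ) x
        - ∑ i₀ : {i : (X r).ι // i ≠ ((X r).slot (.inr 0)).1 ∧ (X r).kind i ≠ .ups},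
          ((X r).divCompletion i₀.1 i₀.2.2).toScheme.riccify B x) :=
    Combination.sum (fun r => (hX r).combination_divergence) (fun r => -b r) fun _ _ _ => rfl
  refine h1.add h2 fun B x hx => ?_
  rw [divergence_sum B hx b (fun r y γ => (X r).riccify B y fun _ => γ)
    fun r γ => (X r).smooth_riccify B _]
  rw [Fintype.sum_sum_type, Fintype.sum_sigma]
  simp only [f, S, Sum.elim_inl, Sum.elim_inr, neg_mul, Finset.sum_neg_distrib, mul_sub,
    Finset.sum_sub_distrib, Finset.mul_sum, Contraction.riccify_eq_riccify]
  simp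
  ring

end Conclusion
end RicciInvariants

open RicciInvariants
theorem lemma4p2 (n s τ q a : ℕ) {L R : Type} [Fintype L] [Fintype R]
    (c : L → ℝ) (C : L → Contraction s 0) (b : R → ℝ) (X : R → Contraction s 1)
    (hC : ∀ l, (C l).IsAdmissible τ q a) (hX : ∀ r, (X r).IsAdmissible τ q a)
    (hCw : ∀ l, (C l).weight ≤ n) (hXw : ∀ r, (X r).weight + 1 ≤ n)
    (h : VanishesMod n s q a (τ + a + 1) fun B x =>
      ∑ l, c l * (C l).value B x Fin.elim0 - ∑ r, b r * (X r).xdiv B x) :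
    ∃ (K₁ K₂ : ℕ) (d₁ : Fin K₁ → ℝ) (d₂ : Fin K₂ → ℝ)
      (D₁ : Fin K₁ → Contraction s 0) (D₂ : Fin K₂ → Contraction s 0),
      (∀ k, (D₁ k).IsNormal τ ∧ (D₁ k).count .ric < q ∧ a + q ≤ (D₁ k).delta) ∧
      (∀ k, (D₂ k).IsNormal τ ∧ (D₂ k).count .ric = q ∧ a + q + 1 ≤ (D₂ k).delta) ∧
      VanishesMod n s 0 0 (τ + 1) fun B x =>
        ∑ l, c l * (C l).riccify B x Fin.elim0
          - divergence B.g (fun y γ => ∑ r, b r * (X r).riccify B y fun _ => γ) x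
          - (∑ k, d₁ k * (D₁ k).value B x Fin.elim0 + ∑ k, d₂ k * (D₂ k).value B x Fin.elim0) := by
  obtain ⟨K, e, E, hE, hv⟩ := combination_riccify c C b X hC hX hCw hXw h
  obtain ⟨K₁, K₂, K₃, d₁, d₂, d₃, D₁, D₂, D₃, h₁, h₂, h₃, hF⟩ := Combination.exists_split
    (p₁ := fun D : Contraction s 0 => D.IsNormal τ ∧ D.count .ric < q ∧ a + q ≤ D.delta)
    (p₂ := fun D => D.IsNormal τ ∧ D.count .ric = q ∧ a + q + 1 ≤ D.delta)
    (p₃ := fun D => D.HasCounts 0 0 ∧ τ + 1 ≤ D.length)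
    ⟨K, e, E, fun k => by
      obtain ⟨hc, hl | ⟨hn, hd | hd⟩⟩ := hE k
      · exact Or.inr (Or.inr ⟨hc, hl⟩)
      · exact Or.inl ⟨hn, hd⟩
      · exact Or.inr (Or.inl ⟨hn, hd⟩), hv⟩
  refine ⟨K₁, K₂, d₁, d₂, D₁, D₂, h₁, h₂, K₃, d₃, D₃, h₃, fun B x hx => ?_⟩
  beta_reduce
  rw [hF B x hx, add_sub_cancel_left]
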